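/- **Setting.** Let $h,\psi:\mathbb R^2\to\mathbb R$ with $h\in H^{6}$, $\Lambda\psi\in H^{6}$ (where $\Lambda=\sqrt{|\nabla|\tanh|\nabla|}$ and $\psi$ is the inverse Fourier transform of an $L^1$ function) and $|h(x)|<1$ for all $x$. The velocity potential $\varphi=\varphi[h,\psi]$ on the strip $\mathbb R^2\times[-1,0]$ is the $C^2$ solution, with $\nabla_{x,z}\varphi\in L^\infty_z([-1,0];H^{5})$, of $$\Big[\Delta_x+\tfrac{1+(z+1)^2|\nabla h|^2}{(1+h)^2}\partial_z^2-\tfrac{2(z+1)\nabla h}{1+h}\cdot\nabla\partial_z+\Big(\tfrac{-(z+1)\Delta h}{1+h}+\tfrac{2(z+1)|\nabla h|^2}{(1+h)^2}\Big)\partial_z\Big]\varphi=0,\quad \varphi|_{z=0}=\psi,\quad \partial_z\varphi|_{z=-1}=0 ,$$ that is, $\varphi(x,z)=\phi(x,h+(1+h)z)$, where $\phi$ is harmonic in $\{-1<y<h(x)\}$, $\phi=\psi$ on $\{y=h\}$ and $\partial_y\phi=0$ on $\{y=-1\}$. Put $\varphi_\tau=\varphi[\tau h,\tau\psi]$ for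 $|\tau|\le1$, so that $\varphi=\varphi_1$. Let $\Lambda_p[\nabla_{x,z}\varphi]=\frac1{p!}\partial_\tau^p|_{\tau=0}\nabla_{x,z}\varphi_\tau$ be the term of order $p$ of the Taylor expansion in $(h,\psi)$, and let $\Lambda_{\ge3}[\nabla_{x,z}\varphi]=\nabla_{x,z}\varphi-\sum_{p\le2}\Lambda_p[\nabla_{x,z}\varphi]$ be the cubic and higher order part. Finally, let $$\tilde h_1=\frac{2h+h^2}{(1+h)^2},\qquad \tilde h_2=\frac{|\nabla h|^2}{(1+h)^2},\qquad \tilde h_3=\frac{\nabla h}{1+h}\ \ (\text{a vector}).$$ **Symbols.** With $\mathcal F f(\xi)=\int e^{-ix\cdot\xi}f(x)\,dx$, a bilinear operator $Q$ with symbol $q$ and a trilinear operator $C$ with symbol $c$ are given by $$\mathcal F[Q(f,g)](\xi)=\tfrac1{4\pi^2}\int\hat f(\xi-\eta)\hat g(\eta)\,q(\xi-\eta,\eta)\,d\eta,$$ $$\mathcal F[C(f,g,k)](\xi)=\tfrac1{16\pi^4}\iint\hat f(\xi-\eta)\hat g(\eta-\sigma)\hat k(\sigma)\,c(\xi-\eta,\eta-\sigma,\sigma)\,d\eta\,d\sigma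 .$$ Fix a smooth even $\chi:\mathbb R\to[0,1]$ supported in $[-\frac32,\frac32]$ and equal to $1$ on $[-\frac54,\frac54]$, and let $\psi_k(\xi)=\chi(|\xi|/2^k)-\chi(|\xi|/2^{k-1})$. The norm $\|q\|_{\mathcal S^\infty_{k,k_1,k_2}}$ is the $L^1$ norm of the inverse Fourier transform of $q(\xi_1,\xi_2)\psi_k(\xi_1+\xi_2)\psi_{k_1}(\xi_1)\psi_{k_2}(\xi_2)$, and $\|c\|_{\mathcal S^\infty_{k,k_1,k_2,k_3}}$ that of $c(\xi_1,\xi_2,\xi_3)\psi_k(\xi_1+\xi_2+\xi_3)\psi_{k_1}(\xi_1)\psi_{k_2}(\xi_2)\psi_{k_3}(\xi_3)$; the localized symbols are required to be continuous. **Statement.** For every $z\in[-1,0]$ there are trilinear operators $C_z^0$, $C_z^i$, $\tilde C_z^i$ and bilinear operators $T_z^i$ ($i=1,2,3$), which do not depend on $h,\psi$ and act between vector-valued functions of the appropriate dimensions, such that for all $h,\psi$ as above $\tau\mapsto\nabla_{x,z}\varphi_\tau(x,z)$ is $C^2$ near $\tau=0$ for all $(x,z)\in\mathbb R^2\times[-1,0]$,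 and $$\Lambda_{\ge3}[\nabla_{x,z}\varphi](z)=C_z^0(h,\psi,h)+\sum_{i=1}^3\Big(C_z^i(h,\psi,\tilde h_i)+\tilde C_z^i(h,\psi,h\,\tilde h_i)+T_z^i\big(\tilde h_i,\Lambda_{\ge3}[\nabla_{x,z}\varphi]\big)\Big)$$ on $\mathbb R^2$. Here $T_z^i$ takes a function on $\mathbb R^2$ and a function on the strip: $$T_z^i(f,u)=T_{z}^{i,0}(f,u(z))+\int_{-1}^0T_{z,s}^{i}(f,u(s))\,ds,$$ where $T_z^{i,0}$ and $T_{z,s}^i$ are bilinear operators with symbols $t_z^{i,0}$ and $t_{z,s}^i$ (for fixed $z$, $t^i_{z,s}(\xi_1,\xi_2)$ is jointly measurable in $(s,\xi_1,\xi_2)$). With a constant that depends only on $\chi$, for all integers $k,k_1,k_2,k_3$, the symbols $c^0_z,c_z^i,\tilde c_z^i$ of $C_z^0,C_z^i,\tilde C_z^i$ satisfy $$\sup_{z\in[-1,0]}\Big(\|c_z^0\|_{\mathcal S^\infty_{k,k_1,k_2,k_3}}+\sum_{i=1}^3\big(\|c_z^i\|_{\mathcal S^\infty_{k,k_1,k_2,k_3}}+\|\tilde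 c_z^i\|_{\mathcal S^\infty_{k,k_1,k_2,k_3}}\big)\Big)\lesssim2^{3\max\{k_1,k_2,k_3\}_+},$$ $$\sup_{z,s\in[-1,0]}\sum_{i=1}^3\big(\|t_z^{i,0}\|_{\mathcal S^\infty_{k,k_1,k_2}}+\|t_{z,s}^i\|_{\mathcal S^\infty_{k,k_1,k_2}}\big)\lesssim2^{3\max\{k_1,k_2\}_+},$$ where $m_+=\max\{m,0\}$. -/

import Mathlib

open MeasureTheory Set
open scoped ENNReal ContDiff

namespace WaterWaves

/-- The horizontal plane, with its Euclidean structure. -/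
abbrev E := EuclideanSpace ℝ (Fin 2)

noncomputable section

/-! ### Fourier transform, Sobolev norms -/

/-- The character `exp(i x·ξ)`. -/
def chr (x ξ : E) : ℂ := Complex.exp (Complex.I * ((inner ℝ x ξ : ℝ) : ℂ))

/-- `F` is the Fourier transform of `f`, for the convention `F(ξ) = ∫ exp(-i x·ξ) f(x) dx`, stated
through the inversion formula, so that `f` need not be integrable. `F` is unique up to null sets. -/
def HasFT (f F : E → ℂ) : Prop :=
  Integrable F ∧ ∀ x, f x = ((2 * Real.pi : ℝ) : ℂ)⁻¹ ^ 2 * ∫ ξ, chr x ξ * F ξ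

open Classical in
/-- The Fourier transform of a function that is the inverse Fourier transform of an `L¹` function
(every function of `H^s(ℝ²)`, `s > 1`, is one). -/
def ft (f : E → ℂ) : E → ℂ :=
  if h : ∃ F, HasFT f F then h.choose else 0

/-- Real functions, seen as complex ones. -/
def toC (f : E → ℝ) : E → ℂ := fun x => (f x : ℂ)

/-- The norm of `H^s(ℝ²)`, up to a constant factor. -/
def sobolevNorm (s : ℝ) (f : E → ℝ) : ℝ≥0∞ :=
  eLpNorm (fun ξ : E => (((1 + ‖ξ‖ ^ 2) ^ (s / 2) : ℝ) : ℂ) * ft (toC f) ξ) 2 volume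

/-- Membership in `H^s(ℝ²)`, for `s > 1`. -/
def MemH (s : ℝ) (f : E → ℝ) : Prop :=
  (∃ F, HasFT (toC f) F) ∧ sobolevNorm s f < ⊤

/-- `Λ f ∈ H^s(ℝ²)`, where `Λ = (|∇| tanh |∇|)^{1/2}`, for `s > 1`. -/
def LambdaMemH (s : ℝ) (f : E → ℝ) : Prop :=
  (∃ F, HasFT (toC f) F) ∧
    eLpNorm (fun ξ : E => (((1 + ‖ξ‖ ^ 2) ^ (s / 2) * √(‖ξ‖ * Real.tanh ‖ξ‖) : ℝ) : ℂ)
      * ft (toC f) ξ) 2 volume < ⊤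

/-! ### Derivatives in the plane and in the strip `ℝ² × [-1,0]` -/

/-- The partial derivative `∂_{x_i}` in the plane. -/
def dx (i : Fin 2) (f : E → ℝ) (x : E) : ℝ := fderiv ℝ f x (EuclideanSpace.single i 1)

/-- The Laplacian in the plane. -/
def lap (f : E → ℝ) (x : E) : ℝ := ∑ i, dx i (dx i f) x

/-- `|∇ f|²`. -/
def gradSq (f : E → ℝ) (x : E) : ℝ := ∑ i, dx i f x ^ 2

/-- `∂_{x_i}` in the strip. -/
def px (i : Fin 2) (φ : E → ℝ → ℝ) (x : E) (z : ℝ) : ℝ := dx i (fun y => φ y z) x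

/-- `∂_z` in the strip, one-sided at the bottom and at the top. -/
def pz (φ : E → ℝ → ℝ) (x : E) (z : ℝ) : ℝ := derivWithin (φ x) (Icc (-1) 0) z

/-- `∇_{x,z} φ = (∂_{x_1} φ, ∂_{x_2} φ, ∂_z φ)`. -/
def gradXZ (φ : E → ℝ → ℝ) : Fin 3 → E → ℝ → ℝ := ![px 0 φ, px 1 φ, pz φ]

/-! ### The velocity potential in the flattened domain -/

def coefA (h : E → ℝ) (x : E) (z : ℝ) : ℝ :=
  (1 + (z + 1) ^ 2 * gradSq h x) / (1 + h x) ^ 2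

def coefB (h : E → ℝ) (i : Fin 2) (x : E) (z : ℝ) : ℝ :=
  -2 * (z + 1) * dx i h x / (1 + h x)

def coefC (h : E → ℝ) (x : E) (z : ℝ) : ℝ :=
  -(z + 1) * lap h x / (1 + h x) + 2 * (z + 1) * gradSq h x / (1 + h x) ^ 2

/-- `φ` is the velocity potential `φ(x,z) = ϕ(x, h + (h+1) z)` in the strip `ℝ² × [-1,0]`, where `ϕ`
is harmonic in `{-1 < y < h(x)}`, equals `ψ` on `{y = h(x)}` and satisfies `∂_y ϕ = 0` on `{y = -1}`:
the flattened Laplace equation, its boundary conditions, and `∇_{x,z} φ ∈ L^∞_z H^5`. -/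
structure IsPotential (h ψ : E → ℝ) (φ : E → ℝ → ℝ) : Prop where
  contDiffOn : ContDiffOn ℝ 2 (fun p : E × ℝ => φ p.1 p.2) (univ ×ˢ Icc (-1) 0)
  equation : ∀ x, ∀ z ∈ Ioo (-1 : ℝ) 0,
    (∑ i, px i (px i φ) x z) + coefA h x z * pz (pz φ) x z
      + (∑ i, coefB h i x z * px i (pz φ) x z) + coefC h x z * pz φ x z = 0
  top : ∀ x, φ x 0 = ψ x
  bottom : ∀ x, pz φ x (-1) = 0
  bounded : ∃ M : ℝ, ∀ z ∈ Icc (-1 : ℝ) 0, ∀ a : Fin 3,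
    MemH 5 (fun x => gradXZ φ a x z) ∧
      sobolevNorm 5 (fun x => gradXZ φ a x z) ≤ ENNReal.ofReal M

/-- The components of `h̃₁ = (2h+h²)/(1+h)²`, `h̃₂ = |∇h|²/(1+h)²`, `h̃₃ = ∇h/(1+h)`;
the last two entries are the two components of the vector `h̃₃`. -/
def hTilde (h : E → ℝ) : Fin 4 → E → ℝ :=
  ![fun x => (2 * h x + h x ^ 2) / (1 + h x) ^ 2,
    fun x => gradSq h x / (1 + h x) ^ 2,
    fun x => dx 0 h x / (1 + h x),
    fun x => dx 1 h x / (1 + h x)]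

/-- The Taylor expansion in `(h,ψ)`, for a family `Φ t` of objects that belong to `(t h, t ψ)`:
`Λ_p[∇_{x,z} φ]` is the coefficient of `t^p` at `t = 0`. -/
def gradTerm (Φ : ℝ → E → ℝ → ℝ) (p : ℕ) (a : Fin 3) (x : E) (z : ℝ) : ℝ :=
  iteratedDeriv p (fun t => gradXZ (Φ t) a x z) 0 / (p.factorial : ℝ)

/-- `Λ_{≥ 3}[∇_{x,z} φ]`: what the terms of order at most two leave of `∇_{x,z} φ`. -/
def gradGeThree (Φ : ℝ → E → ℝ → ℝ) (a : Fin 3) (x : E) (z : ℝ) : ℝ :=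
  gradXZ (Φ 1) a x z - ∑ p ∈ Finset.range 3, gradTerm Φ p a x z

/-! ### Multilinear operators and their symbols -/

/-- The bilinear operator `Q(f,g)` with symbol `q`:
`F[Q(f,g)](ξ) = (2π)⁻² ∫ f̂(ξ-η) ĝ(η) q(ξ-η,η) dη`. -/
def bilin (q : E → E → ℂ) (f g : E → ℝ) (x : E) : ℂ :=
  ((2 * Real.pi : ℝ) : ℂ)⁻¹ ^ 4 *
    ∫ p : E × E, chr x (p.1 + p.2) * q p.1 p.2 * ft (toC f) p.1 * ft (toC g) p.2

/-- The trilinear operator `C(f,g,k)` with symbol `c`: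
`F[C(f,g,k)](ξ) = (2π)⁻⁴ ∫∫ f̂(ξ-η) ĝ(η-σ) k̂(σ) c(ξ-η,η-σ,σ) dη dσ`. -/
def trilin (c : E → E → E → ℂ) (f g k : E → ℝ) (x : E) : ℂ :=
  ((2 * Real.pi : ℝ) : ℂ)⁻¹ ^ 6 *
    ∫ p : E × E × E, chr x (p.1 + p.2.1 + p.2.2) * c p.1 p.2.1 p.2.2 *
      ft (toC f) p.1 * ft (toC g) p.2.1 * ft (toC k) p.2.2

/-- The cutoff functions that generate the dyadic decomposition. -/
structure IsCutoff (χ : ℝ → ℝ) : Prop where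
  smooth : ContDiff ℝ ∞ χ
  even : ∀ r, χ (-r) = χ r
  mem_Icc : ∀ r, χ r ∈ Icc (0 : ℝ) 1
  support : Function.support χ ⊆ Icc (-(3 / 2)) (3 / 2)
  eq_one : ∀ r ∈ Icc (-(5 / 4) : ℝ) (5 / 4), χ r = 1

/-- `ψ_k(ξ) = χ(|ξ|/2^k) - χ(|ξ|/2^{k-1})`. -/
def dyadic (χ : ℝ → ℝ) (k : ℤ) (ξ : E) : ℝ :=
  χ (‖ξ‖ / 2 ^ k) - χ (‖ξ‖ / 2 ^ (k - 1))

/-- The symbol `q(ξ₁,ξ₂)` localized at `|ξ₁+ξ₂| ~ 2^k`, `|ξ_i| ~ 2^{k_i}`. -/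
def loc2 (χ : ℝ → ℝ) (k k₁ k₂ : ℤ) (q : E → E → ℂ) (p : E × E) : ℂ :=
  q p.1 p.2 * ((dyadic χ k (p.1 + p.2) * dyadic χ k₁ p.1 * dyadic χ k₂ p.2 : ℝ) : ℂ)

/-- The symbol `c(ξ₁,ξ₂,ξ₃)` localized at `|ξ₁+ξ₂+ξ₃| ~ 2^k`, `|ξ_i| ~ 2^{k_i}`. -/
def loc3 (χ : ℝ → ℝ) (k k₁ k₂ k₃ : ℤ) (c : E → E → E → ℂ) (p : E × E × E) : ℂ :=
  c p.1 p.2.1 p.2.2 * ((dyadic χ k (p.1 + p.2.1 + p.2.2) * dyadic χ k₁ p.1 *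
    dyadic χ k₂ p.2.1 * dyadic χ k₃ p.2.2 : ℝ) : ℂ)

open Classical in
/-- `‖q‖_{S^∞_{k,k₁,k₂}}`: the `L¹` norm of the inverse Fourier transform of the localized symbol,
which has to be continuous. The change of variables `(ξ₁,ξ₂) = (ξ-η,η)` does not alter this norm. -/
def sNorm2 (χ : ℝ → ℝ) (k k₁ k₂ : ℤ) (q : E → E → ℂ) : ℝ≥0∞ :=
  if Continuous (loc2 χ k k₁ k₂ q) then
    ∫⁻ x : E × E, ‖((2 * Real.pi : ℝ) : ℂ)⁻¹ ^ 4 *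
      ∫ p : E × E, chr x.1 p.1 * chr x.2 p.2 * loc2 χ k k₁ k₂ q p‖ₑ
  else ⊤

open Classical in
/-- `‖c‖_{S^∞_{k,k₁,k₂,k₃}}`, as for bilinear symbols; here `(ξ₁,ξ₂,ξ₃) = (ξ-η,η-σ,σ)`. -/
def sNorm3 (χ : ℝ → ℝ) (k k₁ k₂ k₃ : ℤ) (c : E → E → E → ℂ) : ℝ≥0∞ :=
  if Continuous (loc3 χ k k₁ k₂ k₃ c) then
    ∫⁻ x : E × E × E, ‖((2 * Real.pi : ℝ) : ℂ)⁻¹ ^ 6 *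
      ∫ p : E × E × E, chr x.1 p.1 * chr x.2.1 p.2.1 * chr x.2.2 p.2.2 *
        loc3 χ k k₁ k₂ k₃ c p‖ₑ
  else ⊤

/-- A bilinear operator that takes a function `f` on the plane and a function `u` on the strip to a
function on the plane. Its symbol is the measure `q₀ δ_{s=z} + q s ds` in the variable `s` of `u`. -/
def stripBilin (q₀ : E → E → ℂ) (q : ℝ → E → E → ℂ) (f : E → ℝ) (u : E → ℝ → ℝ)
    (z : ℝ) (x : E) : ℂ :=
  bilin q₀ f (fun y => u y z) x + ∫ s in (-1 : ℝ)..0, bilin (q s) f (fun y => u y s) x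

end

end WaterWaves

namespace WaterWaves
open Filter Topology FourierTransform
noncomputable section

/-! ### The inverse Fourier transform of integrable functions -/

/-- The constant `(2π)⁻²`. -/
def c0 : ℂ := ((2 * Real.pi : ℝ) : ℂ)⁻¹ ^ 2

lemma norm_c0 : ‖c0‖ = (2 * Real.pi)⁻¹ ^ 2 := by
  rw [c0, norm_pow, norm_inv, Complex.norm_real, Real.norm_of_nonneg (by positivity)]

lemma norm_c0_le : ‖c0‖ ≤ 1 := by
  rw [norm_c0]
  have : (2 * Real.pi)⁻¹ ≤ 1 := inv_le_one_of_one_le₀ (by linarith [Real.pi_gt_three])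
  exact pow_le_one₀ (by positivity) this

lemma c0_ne_zero : c0 ≠ 0 := by
  rw [← norm_ne_zero_iff, norm_c0]; positivity

lemma chr_continuous2 : Continuous fun p : E × E => chr p.1 p.2 := by
  unfold chr
  fun_prop

lemma chr_continuous (x : E) : Continuous (chr x) := by
  unfold chr
  fun_prop

lemma chr_continuous_left (ξ : E) : Continuous fun x => chr x ξ := by
  unfold chr
  fun_prop

@[simp] lemma norm_chr (x ξ : E) : ‖chr x ξ‖ = 1 := by
  rw [chr, mul_comm, Complex.norm_exp_ofReal_mul_I]

lemma chr_add (x ξ η : E) : chr x (ξ + η) = chr x ξ * chr x η := by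
  rw [chr, chr, chr, ← Complex.exp_add, inner_add_right]
  push_cast
  ring_nf

lemma chr_integrable {F : E → ℂ} (hF : Integrable F) (x : E) :
    Integrable fun ξ => chr x ξ * F ξ := by
  refine hF.bdd_mul (c := 1) (chr_continuous x).aestronglyMeasurable ?_
  exact Eventually.of_forall fun ξ => (norm_chr x ξ).le

lemma fourier_eq_chr (F : E → ℂ) (w : E) :
    𝓕 F w = ∫ ξ, chr ((-(2 * Real.pi)) • w) ξ * F ξ := by
  rw [Real.fourier_eq]
  refine integral_congr_ae (Eventually.of_forall fun ξ => ?_)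
  simp only [Real.fourierChar_apply, Circle.smul_def, smul_eq_mul, chr]
  congr 2
  rw [real_inner_smul_left, real_inner_comm]
  push_cast
  ring

lemma HasFT.fourier_eq {f F : E → ℂ} (h : HasFT f F) (w : E) :
    c0 * 𝓕 F w = f ((-(2 * Real.pi)) • w) := by
  rw [fourier_eq_chr, h.2]
  rfl

lemma HasFT.integrable {f F : E → ℂ} (h : HasFT f F) : Integrable F := h.1

lemma HasFT.eq {f F : E → ℂ} (h : HasFT f F) (x : E) : f x = c0 * ∫ ξ, chr x ξ * F ξ := h.2 x

lemma HasFT.mk' {f F : E → ℂ} (h : Integrable F) (h' : ∀ x, f x = c0 * ∫ ξ, chr x ξ * F ξ) :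
    HasFT f F := ⟨h, h'⟩

/-- Parseval's identity for a function with integrable Fourier transform and a Schwartz function. -/
lemma HasFT.integral_mul_schwartz {f F : E → ℂ} (h : HasFT f F) (θ : SchwartzMap E ℂ) :
    c0 * ∫ ξ, F ξ * 𝓕 θ ξ = ∫ w, f ((-(2 * Real.pi)) • w) * θ w := by
  have key := VectorFourier.integral_fourierIntegral_smul_eq_flip (μ := (volume : Measure E))
    (ν := (volume : Measure E)) (e := Real.fourierChar) (L := innerₗ E) (f := F) (g := θ)
    Real.continuous_fourierChar (by simp only [innerₗ_apply_apply]; fun_prop) h.1 θ.integrable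
  have e1 : ∀ w, VectorFourier.fourierIntegral Real.fourierChar volume (innerₗ E) F w = 𝓕 F w :=
    fun w => rfl
  have e2 : ∀ w, VectorFourier.fourierIntegral Real.fourierChar volume (innerₗ E).flip θ w
      = 𝓕 θ w := by
    intro w
    rw [flip_innerₗ, SchwartzMap.fourier_coe]
    rfl
  simp only [e1, e2, smul_eq_mul] at key
  rw [← key, ← integral_const_mul]
  refine integral_congr_ae (Eventually.of_forall fun w => ?_)
  simp only [← h.fourier_eq]
  ring

lemma ae_eq_zero_of_integral_schwartz {G : E → ℂ} (hG : Integrable G)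
    (h : ∀ θ : SchwartzMap E ℂ, ∫ ξ, G ξ * 𝓕 θ ξ = 0) : G =ᵐ[volume] 0 := by
  refine ae_eq_zero_of_integral_contDiff_smul_eq_zero hG.locallyIntegrable fun g hg hc => ?_
  have hg' : ContDiff ℝ ∞ (fun x => (g x : ℂ)) := Complex.ofRealCLM.contDiff.comp hg
  have hc' : HasCompactSupport (fun x => (g x : ℂ)) := hc.comp_left (g := Complex.ofReal) rfl
  let S : SchwartzMap E ℂ := hc'.toSchwartzMap hg'
  have := h (𝓕⁻ S)
  rw [FourierTransform.fourier_fourierInv_eq] at this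
  rw [← this]
  refine integral_congr_ae (Eventually.of_forall fun w => ?_)
  change (g w) • G w = G w * (g w : ℂ)
  rw [Complex.real_smul, mul_comm]

theorem HasFT.unique {f F G : E → ℂ} (hF : HasFT f F) (hG : HasFT f G) : F =ᵐ[volume] G := by
  have : F - G =ᵐ[volume] 0 := by
    refine ae_eq_zero_of_integral_schwartz (hF.1.sub hG.1) fun θ => ?_
    have hb : ∀ {H : E → ℂ}, Integrable H → Integrable fun ξ => H ξ * 𝓕 θ ξ := by
      intro H hH
      refine (hH.bdd_mul (f := fun ξ => 𝓕 θ ξ) (c := ‖(𝓕 θ).toBoundedContinuousFunction‖)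
        (𝓕 θ).continuous.aestronglyMeasurable ?_).congr
        (Eventually.of_forall fun ξ => mul_comm _ _)
      exact Eventually.of_forall fun ξ => (𝓕 θ).toBoundedContinuousFunction.norm_coe_le_norm ξ
    have e1 := hF.integral_mul_schwartz θ
    rw [← hG.integral_mul_schwartz θ] at e1
    have e2 := mul_left_cancel₀ c0_ne_zero e1
    simp only [Pi.sub_apply, sub_mul]
    rw [integral_sub (hb hF.1) (hb hG.1), e2, sub_self]
  filter_upwards [this] with ξ hξ
  simpa [sub_eq_zero] using hξ

lemma hasFT_ft {f : E → ℂ} (h : ∃ F, HasFT f F) : HasFT f (ft f) := by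
  rw [ft, dif_pos h]
  exact h.choose_spec

lemma HasFT.ft_ae {f F : E → ℂ} (h : HasFT f F) : ft f =ᵐ[volume] F :=
  (hasFT_ft ⟨F, h⟩).unique h

lemma HasFT.congr_ae {f F G : E → ℂ} (h : HasFT f F) (hG : F =ᵐ[volume] G) : HasFT f G := by
  refine ⟨h.1.congr hG, fun x => ?_⟩
  rw [h.2]
  congr 1
  refine integral_congr_ae ?_
  filter_upwards [hG] with ξ hξ
  rw [hξ]

lemma HasFT.congr_fun {f g F : E → ℂ} (h : HasFT f F) (hg : ∀ x, g x = f x) : HasFT g F :=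
  ⟨h.1, fun x => by rw [hg, h.2]⟩

lemma HasFT.add {f F g G : E → ℂ} (hf : HasFT f F) (hg : HasFT g G) :
    HasFT (fun x => f x + g x) (fun ξ => F ξ + G ξ) := by
  refine ⟨hf.1.add hg.1, fun x => ?_⟩
  simp only [mul_add]
  rw [integral_add (chr_integrable hf.1 x) (chr_integrable hg.1 x), hf.2, hg.2, mul_add]

lemma HasFT.smul {f F : E → ℂ} (hf : HasFT f F) (a : ℂ) :
    HasFT (fun x => a * f x) (fun ξ => a * F ξ) := by
  refine ⟨hf.1.const_mul a, fun x => ?_⟩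
  simp only [mul_left_comm _ a]
  rw [integral_const_mul, hf.2]
  ring

lemma hasFT_zero : HasFT (fun _ => 0) (fun _ => 0) := ⟨integrable_zero _ _ _, fun x => by simp⟩

lemma HasFT.norm_le {f F : E → ℂ} (hf : HasFT f F) (x : E) : ‖f x‖ ≤ ∫ ξ, ‖F ξ‖ := by
  rw [hf.eq, norm_mul]
  have h1 : ‖∫ ξ, chr x ξ * F ξ‖ ≤ ∫ ξ, ‖F ξ‖ := by
    refine (norm_integral_le_integral_norm _).trans (le_of_eq ?_)
    simp
  calc _ ≤ 1 * ∫ ξ, ‖F ξ‖ := mul_le_mul norm_c0_le h1 (norm_nonneg _) zero_le_one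
    _ = _ := one_mul _

lemma HasFT.continuous {f F : E → ℂ} (hf : HasFT f F) : Continuous f := by
  have : f = fun x => c0 * ∫ ξ, chr x ξ * F ξ := funext hf.eq
  rw [this]
  refine continuous_const.mul ?_
  refine continuous_of_dominated (bound := fun ξ => ‖F ξ‖)
    (fun x => (chr_integrable hf.1 x).aestronglyMeasurable)
    (fun x => Eventually.of_forall fun ξ => by simp) hf.1.norm
    (Eventually.of_forall fun ξ => (chr_continuous_left ξ).mul continuous_const)

/-! ### Convolutions and weights -/

/-- The convolution that gives the Fourier transform of a product. -/
def cv (F G : E → ℂ) (ξ : E) : ℂ := c0 * ∫ η, F η * G (ξ - η)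

lemma cv_eq (F G : E → ℂ) :
    cv F G = fun ξ => c0 * convolution F G (ContinuousLinearMap.mul ℝ ℂ) volume ξ := rfl

lemma cv_integrable {F G : E → ℂ} (hF : Integrable F) (hG : Integrable G) :
    Integrable (cv F G) := by
  rw [cv_eq]
  exact (hF.integrable_convolution (ContinuousLinearMap.mul ℝ ℂ) hG).const_mul _

lemma cv_ae_congr {F F' G G' : E → ℂ} (hF : F =ᵐ[volume] F') (hG : G =ᵐ[volume] G') :
    cv F G = cv F' G' := by
  funext ξ
  rw [cv, cv]
  congr 1
  refine integral_congr_ae ?_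
  have h2 : ∀ᵐ η, G (ξ - η) = G' (ξ - η) :=
    (quasiMeasurePreserving_sub_left_of_right_invariant volume ξ).ae hG
  filter_upwards [hF, h2] with η h1 h2
  rw [h1, h2]

lemma HasFT.mul {f F g G : E → ℂ} (hf : HasFT f F) (hg : HasFT g G) :
    HasFT (fun x => f x * g x) (cv F G) := by
  refine HasFT.mk' (cv_integrable hf.1 hg.1) fun x => ?_
  have h1 := integral_convolution (L := ContinuousLinearMap.mul ℝ ℂ) (μ := (volume : Measure E))
    (ν := (volume : Measure E)) (chr_integrable hf.1 x) (chr_integrable hg.1 x)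
  rw [hf.eq, hg.eq]
  have h2 : ∀ ξ, convolution (fun ξ => chr x ξ * F ξ) (fun ξ => chr x ξ * G ξ)
      (ContinuousLinearMap.mul ℝ ℂ) volume ξ
      = chr x ξ * convolution F G (ContinuousLinearMap.mul ℝ ℂ) volume ξ := by
    intro ξ
    rw [convolution_def, convolution_def, ← integral_const_mul]
    refine integral_congr_ae (Eventually.of_forall fun η => ?_)
    simp only [ContinuousLinearMap.mul_apply']
    have : chr x ξ = chr x η * chr x (ξ - η) := by rw [← chr_add]; congr 1; abel
    rw [this]
    ring
  simp only [h2, ContinuousLinearMap.mul_apply'] at h1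
  simp only [cv_eq, mul_left_comm _ c0]
  rw [integral_const_mul, h1]
  ring

lemma weight_pos (ξ : E) : 0 < 1 + ‖ξ‖ := by positivity

lemma weight_mul (ξ η : E) : 1 + ‖ξ‖ ≤ (1 + ‖η‖) * (1 + ‖ξ - η‖) := by
  have : ‖ξ‖ ≤ ‖η‖ + ‖ξ - η‖ := by
    calc ‖ξ‖ = ‖η + (ξ - η)‖ := by congr 1; abel
      _ ≤ _ := norm_add_le _ _
  nlinarith [norm_nonneg η, norm_nonneg (ξ - η), mul_nonneg (norm_nonneg η) (norm_nonneg (ξ - η))]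

lemma weight_pow_mul (k : ℕ) (ξ η : E) :
    (1 + ‖ξ‖) ^ k ≤ (1 + ‖η‖) ^ k * (1 + ‖ξ - η‖) ^ k := by
  rw [← mul_pow]
  exact pow_le_pow_left₀ (weight_pos ξ).le (weight_mul ξ η) k

/-- Integrability with the weight `(1+|ξ|)^k`. -/
def WI (k : ℕ) (F : E → ℂ) : Prop := Integrable fun ξ => (1 + ‖ξ‖) ^ k * ‖F ξ‖

/-- The weighted `L¹` norm. -/
def wn (k : ℕ) (F : E → ℂ) : ℝ := ∫ ξ, (1 + ‖ξ‖) ^ k * ‖F ξ‖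

lemma wn_nonneg (k : ℕ) (F : E → ℂ) : 0 ≤ wn k F :=
  integral_nonneg fun ξ => by positivity

lemma WI.mono {k l : ℕ} (hkl : k ≤ l) {F : E → ℂ} (hm : AEStronglyMeasurable F)
    (h : WI l F) : WI k F := by
  refine Integrable.mono' h (by fun_prop) (Eventually.of_forall fun ξ => ?_)
  rw [Real.norm_of_nonneg (by positivity)]
  have : (1 + ‖ξ‖) ^ k ≤ (1 + ‖ξ‖) ^ l := pow_le_pow_right₀ (by simp) hkl
  gcongr

lemma wn_mono {k l : ℕ} (hkl : k ≤ l) {F : E → ℂ} (hm : AEStronglyMeasurable F)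
    (h : WI l F) : wn k F ≤ wn l F := by
  refine integral_mono (h.mono hkl hm) h fun ξ => ?_
  have : (1 + ‖ξ‖) ^ k ≤ (1 + ‖ξ‖) ^ l := pow_le_pow_right₀ (by simp) hkl
  dsimp only
  gcongr

lemma WI.integrable {k : ℕ} {F : E → ℂ} (hm : AEStronglyMeasurable F) (h : WI k F) :
    Integrable F := by
  have := h.mono (Nat.zero_le k) hm
  simp only [WI, pow_zero, one_mul] at this
  exact (integrable_norm_iff hm).1 this

lemma wn_zero (F : E → ℂ) : wn 0 F = ∫ ξ, ‖F ξ‖ := by simp [wn]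

lemma WI.congr_ae {k : ℕ} {F G : E → ℂ} (h : WI k F) (hG : F =ᵐ[volume] G) : WI k G := by
  refine Integrable.congr h ?_
  filter_upwards [hG] with ξ hξ
  rw [hξ]

lemma wn_congr_ae {k : ℕ} {F G : E → ℂ} (hG : F =ᵐ[volume] G) : wn k F = wn k G := by
  refine integral_congr_ae ?_
  filter_upwards [hG] with ξ hξ
  rw [hξ]

lemma WI.add {k : ℕ} {F G : E → ℂ} (hF : AEStronglyMeasurable F) (hG : AEStronglyMeasurable G)
    (h : WI k F) (h' : WI k G) : WI k (fun ξ => F ξ + G ξ) := by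
  refine Integrable.mono' (Integrable.add h h') (by fun_prop) (Eventually.of_forall fun ξ => ?_)
  rw [Real.norm_of_nonneg (by positivity), Pi.add_apply, ← mul_add]
  gcongr
  exact norm_add_le _ _

lemma WI.smul {k : ℕ} {F : E → ℂ} (h : WI k F) (a : ℂ) : WI k (fun ξ => a * F ξ) := by
  have := Integrable.const_mul h ‖a‖
  refine this.congr (Eventually.of_forall fun ξ => ?_)
  simp only [norm_mul]
  ring

lemma WI.cv {k : ℕ} {F G : E → ℂ} (hF : AEStronglyMeasurable F) (hG : AEStronglyMeasurable G)
    (h : WI k F) (h' : WI k G) : WI k (cv F G) ∧ wn k (WaterWaves.cv F G) ≤ wn k F * wn k G := by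
  have hc := Integrable.integrable_convolution (ContinuousLinearMap.mul ℝ ℝ) h h'
  have hi := integral_convolution (L := ContinuousLinearMap.mul ℝ ℝ) (μ := (volume : Measure E))
    (ν := (volume : Measure E)) h h'
  have hae := Integrable.ae_convolution_exists (ContinuousLinearMap.mul ℝ ℝ) h h'
  have hcv : Integrable (WaterWaves.cv F G) := cv_integrable (h.integrable hF) (h'.integrable hG)
  have hb : ∀ᵐ ξ : E, (1 + ‖ξ‖) ^ k * ‖WaterWaves.cv F G ξ‖ ≤
      convolution (fun ξ => (1 + ‖ξ‖) ^ k * ‖F ξ‖) (fun ξ => (1 + ‖ξ‖) ^ k * ‖G ξ‖)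
        (ContinuousLinearMap.mul ℝ ℝ) volume ξ := by
    filter_upwards [hae] with ξ hξ
    rw [convolution_def]
    calc (1 + ‖ξ‖) ^ k * ‖WaterWaves.cv F G ξ‖
        ≤ (1 + ‖ξ‖) ^ k * ∫ η, ‖F η * G (ξ - η)‖ := by
          gcongr
          rw [WaterWaves.cv, norm_mul]
          refine (mul_le_of_le_one_left (norm_nonneg _) norm_c0_le).trans ?_
          exact norm_integral_le_integral_norm _
      _ = ∫ η, (1 + ‖ξ‖) ^ k * ‖F η * G (ξ - η)‖ := (integral_const_mul _ _).symm
      _ ≤ _ := by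
          refine integral_mono_of_nonneg (Eventually.of_forall fun η => by positivity) hξ
            (Eventually.of_forall fun η => ?_)
          simp only [ContinuousLinearMap.mul_apply', norm_mul]
          calc _ ≤ ((1 + ‖η‖) ^ k * (1 + ‖ξ - η‖) ^ k) * (‖F η‖ * ‖G (ξ - η)‖) := by
                gcongr
                exact weight_pow_mul k ξ η
            _ = _ := by ring
  have hint : WI k (WaterWaves.cv F G) := by
    refine Integrable.mono' hc ?_ ?_
    · have := hcv.aestronglyMeasurable
      fun_prop
    · filter_upwards [hb] with ξ hξ
      rwa [Real.norm_of_nonneg (by positivity)]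
  refine ⟨hint, ?_⟩
  calc wn k (WaterWaves.cv F G) ≤ _ := integral_mono_ae hint hc hb
    _ = _ := hi

/-- `F` is the Fourier transform of `f` and is integrable with the weight `(1+|ξ|)^k`. -/
structure FTW (k : ℕ) (f F : E → ℂ) : Prop where
  hasFT : HasFT f F
  wi : WI k F

lemma FTW.aesm {k : ℕ} {f F : E → ℂ} (h : FTW k f F) : AEStronglyMeasurable F :=
  h.hasFT.1.aestronglyMeasurable

lemma FTW.mono {k l : ℕ} (hkl : k ≤ l) {f F : E → ℂ} (h : FTW l f F) : FTW k f F :=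
  ⟨h.hasFT, h.wi.mono hkl h.aesm⟩

lemma FTW.add {k : ℕ} {f F g G : E → ℂ} (hf : FTW k f F) (hg : FTW k g G) :
    FTW k (fun x => f x + g x) (fun ξ => F ξ + G ξ) :=
  ⟨hf.hasFT.add hg.hasFT, hf.wi.add hf.aesm hg.aesm hg.wi⟩

lemma FTW.smul {k : ℕ} {f F : E → ℂ} (hf : FTW k f F) (a : ℂ) :
    FTW k (fun x => a * f x) (fun ξ => a * F ξ) :=
  ⟨hf.hasFT.smul a, hf.wi.smul a⟩

lemma FTW.sub {k : ℕ} {f F g G : E → ℂ} (hf : FTW k f F) (hg : FTW k g G) :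
    FTW k (fun x => f x - g x) (fun ξ => F ξ - G ξ) := by
  simpa [sub_eq_add_neg] using hf.add (hg.smul (-1))

lemma FTW.mul {k : ℕ} {f F g G : E → ℂ} (hf : FTW k f F) (hg : FTW k g G) :
    FTW k (fun x => f x * g x) (cv F G) :=
  ⟨hf.hasFT.mul hg.hasFT, (hf.wi.cv hf.aesm hg.aesm hg.wi).1⟩

lemma FTW.congr_fun {k : ℕ} {f g F : E → ℂ} (h : FTW k f F) (hg : ∀ x, g x = f x) : FTW k g F :=
  ⟨h.hasFT.congr_fun hg, h.wi⟩

lemma ftw_zero (k : ℕ) : FTW k (fun _ => 0) (fun _ => 0) := ⟨hasFT_zero, by simp [WI]⟩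

end
end WaterWaves

namespace WaterWaves
open Filter Topology FourierTransform
noncomputable section

/-! ### Derivatives -/

lemma toC_apply (f : E → ℝ) (x : E) : toC f x = (f x : ℂ) := rfl

lemma FTW.hasFDerivAt {f F : E → ℂ} (h : FTW 1 f F) (x : E) :
    HasFDerivAt f (c0 • ∫ ξ, (Complex.I * (chr x ξ * F ξ)) •
      (Complex.ofRealCLM.comp (innerSL ℝ ξ : E →L[ℝ] ℝ))) x := by
  have e : f = fun x => c0 * ∫ ξ, chr x ξ * F ξ := funext h.hasFT.eq
  rw [e]
  refine HasFDerivAt.const_mul ?_ c0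
  have hL : Continuous fun ξ : E => (Complex.ofRealCLM.comp (innerSL ℝ ξ : E →L[ℝ] ℝ)) :=
    continuous_const.clm_comp (innerSL ℝ).continuous
  have hLn : ∀ ξ : E, ‖(Complex.ofRealCLM.comp (innerSL ℝ ξ : E →L[ℝ] ℝ))‖ ≤ ‖ξ‖ := fun ξ => by
    refine (ContinuousLinearMap.opNorm_comp_le _ _).trans ?_
    rw [Complex.ofRealCLM_norm, one_mul, innerSL_apply_norm]
  refine hasFDerivAt_integral_of_dominated_of_fderiv_le (F := fun x ξ => chr x ξ * F ξ)
    (F' := fun x ξ => (Complex.I * (chr x ξ * F ξ)) •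
      (Complex.ofRealCLM.comp (innerSL ℝ ξ : E →L[ℝ] ℝ)))
    (bound := fun ξ => (1 + ‖ξ‖) ^ 1 * ‖F ξ‖) (s := univ) univ_mem
    (Eventually.of_forall fun x => (chr_integrable h.hasFT.1 x).aestronglyMeasurable)
    (chr_integrable h.hasFT.1 x) ?_ ?_ h.wi ?_
  · exact ((chr_integrable h.hasFT.1 x).aestronglyMeasurable.const_mul _).smul
      hL.aestronglyMeasurable
  · refine Eventually.of_forall fun ξ x _ => ?_
    rw [norm_smul, norm_mul, norm_mul, Complex.norm_I, norm_chr, one_mul, one_mul, pow_one, mul_comm]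
    gcongr
    linarith [hLn ξ]
  · refine Eventually.of_forall fun ξ x _ => ?_
    have h1 : HasFDerivAt (fun x : E => Complex.I * ((inner ℝ x ξ : ℝ) : ℂ))
        (Complex.I • Complex.ofRealCLM.comp (innerSL ℝ ξ : E →L[ℝ] ℝ)) x := by
      have h2 : HasFDerivAt (fun x : E => ((inner ℝ ξ x : ℝ) : ℂ))
        (Complex.ofRealCLM.comp (innerSL ℝ ξ : E →L[ℝ] ℝ)) x :=
        (Complex.ofRealCLM.comp (innerSL ℝ ξ : E →L[ℝ] ℝ)).hasFDerivAt
      simp only [real_inner_comm] at h2 ⊢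
      exact h2.const_mul Complex.I
    have h3 := (h1.cexp).mul_const (F ξ)
    refine h3.congr_fderiv ?_
    ext v
    simp [chr]
    ring

lemma hasFDerivAt_of_toC {f : E → ℝ} {D : E →L[ℝ] ℂ} {x : E} (h : HasFDerivAt (toC f) D x) :
    HasFDerivAt f (Complex.reCLM.comp D) x := by
  have := Complex.reCLM.hasFDerivAt.comp x h
  exact this.congr_of_eventuallyEq (Eventually.of_forall fun y => by simp [toC])

lemma toC_dx {f : E → ℝ} {D : E →L[ℝ] ℂ} {x : E} (h : HasFDerivAt (toC f) D x) (i : Fin 2) :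
    toC (dx i f) x = D (EuclideanSpace.single i 1) := by
  have h1 := hasFDerivAt_of_toC h
  have h2 := Complex.ofRealCLM.hasFDerivAt.comp x h1
  have h3 : HasFDerivAt (toC f) (Complex.ofRealCLM.comp (Complex.reCLM.comp D)) x := h2
  have h4 := h3.unique h
  rw [toC_apply, dx, h1.fderiv]
  conv_rhs => rw [← h4]
  rfl

lemma FTW.differentiable {f : E → ℝ} {F : E → ℂ} (h : FTW 1 (toC f) F) : Differentiable ℝ f :=
  fun x => (hasFDerivAt_of_toC (h.hasFDerivAt x)).differentiableAt

lemma norm_coord_le (ξ : E) (i : Fin 2) : |ξ i| ≤ ‖ξ‖ := by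
  simpa using PiLp.norm_apply_le ξ i

lemma WI.coord {k : ℕ} {F : E → ℂ} (hm : AEStronglyMeasurable F) (h : WI (k + 1) F) (i : Fin 2) :
    WI k (fun ξ => Complex.I * (ξ i : ℂ) * F ξ) ∧
      wn k (fun ξ => Complex.I * (ξ i : ℂ) * F ξ) ≤ wn (k + 1) F := by
  have hb : ∀ ξ : E, (1 + ‖ξ‖) ^ k * ‖Complex.I * (ξ i : ℂ) * F ξ‖ ≤
      (1 + ‖ξ‖) ^ (k + 1) * ‖F ξ‖ := by
    intro ξ
    rw [norm_mul, norm_mul, Complex.norm_I, one_mul, Complex.norm_real, Real.norm_eq_abs, pow_succ,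
      ← mul_assoc]
    gcongr
    linarith [norm_coord_le ξ i]
  have hi : WI k (fun ξ => Complex.I * (ξ i : ℂ) * F ξ) := by
    refine Integrable.mono' h (by fun_prop) (Eventually.of_forall fun ξ => ?_)
    rw [Real.norm_of_nonneg (by positivity)]
    exact hb ξ
  exact ⟨hi, integral_mono hi h hb⟩

/-- The Fourier transform of a derivative. -/
theorem FTW.dx {k : ℕ} {f : E → ℝ} {F : E → ℂ} (h : FTW (k + 1) (toC f) F) (i : Fin 2) :
    FTW k (toC (dx i f)) (fun ξ => Complex.I * (ξ i : ℂ) * F ξ) := by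
  have h1 : FTW 1 (toC f) F := h.mono (by omega)
  have hw := (h.wi.coord h.aesm i).1
  have hw1 := (h1.wi.coord h.aesm i).1
  refine ⟨HasFT.mk' (hw.integrable (by have := h.aesm; fun_prop)) fun x => ?_, hw⟩
  rw [toC_dx (h1.hasFDerivAt x) i]
  rw [_root_.smul_apply, smul_eq_mul, ContinuousLinearMap.integral_apply]
  · congr 1
    refine integral_congr_ae (Eventually.of_forall fun ξ => ?_)
    simp only [_root_.smul_apply, smul_eq_mul, ContinuousLinearMap.comp_apply,
      innerSL_apply_apply, Complex.ofRealCLM_apply, EuclideanSpace.inner_single_right]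
    simp
    ring
  · have hL : Continuous fun ξ : E => (Complex.ofRealCLM.comp (innerSL ℝ ξ : E →L[ℝ] ℝ)) :=
      continuous_const.clm_comp (innerSL ℝ).continuous
    refine Integrable.mono' h1.wi (((chr_integrable h.hasFT.1 x).aestronglyMeasurable.const_mul
      _).smul hL.aestronglyMeasurable) (Eventually.of_forall fun ξ => ?_)
    rw [norm_smul, norm_mul, norm_mul, Complex.norm_I, norm_chr, one_mul, one_mul, pow_one, mul_comm]
    gcongr
    refine (ContinuousLinearMap.opNorm_comp_le _ _).trans ?_
    rw [Complex.ofRealCLM_norm, one_mul, innerSL_apply_norm]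
    linarith

/-! ### Sobolev spaces and weights -/

lemma weight_le (k : ℕ) (s : ℝ) (hs : (k : ℝ) + 2 ≤ s) (ξ : E) :
    (1 + ‖ξ‖) ^ k ≤ 2 ^ k * (1 + ‖ξ‖ ^ 2) ^ (-(2 : ℝ) / 2 - 0) * (1 + ‖ξ‖ ^ 2) ^ (s / 2) := by
  have h0 : (1 : ℝ) ≤ 1 + ‖ξ‖ ^ 2 := by nlinarith [sq_nonneg ‖ξ‖]
  have hp : (0 : ℝ) < 1 + ‖ξ‖ ^ 2 := by linarith
  rw [mul_assoc, ← Real.rpow_add hp]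
  have h1 : (1 + ‖ξ‖) ≤ 2 * (1 + ‖ξ‖ ^ 2) ^ ((1 : ℝ) / 2) := by
    rw [← Real.sqrt_eq_rpow]
    refine le_of_sq_le_sq ?_ (by positivity)
    rw [mul_pow, Real.sq_sqrt hp.le]
    nlinarith [sq_nonneg (‖ξ‖ - 1), sq_nonneg ‖ξ‖]
  calc (1 + ‖ξ‖) ^ k ≤ (2 * (1 + ‖ξ‖ ^ 2) ^ ((1 : ℝ) / 2)) ^ k :=
        pow_le_pow_left₀ (weight_pos ξ).le h1 k
    _ = 2 ^ k * (1 + ‖ξ‖ ^ 2) ^ ((1 : ℝ) / 2 * k) := by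
        rw [mul_pow, Real.rpow_mul hp.le, Real.rpow_natCast]
    _ ≤ _ := by
        gcongr 2 ^ k * ?_
        exact Real.rpow_le_rpow_of_exponent_le h0 (by linarith)

lemma memLp_inv_weight : MemLp (fun ξ : E => ((1 + ‖ξ‖ ^ 2) ^ (-(2 : ℝ) / 2 - 0) : ℝ)) 2 := by
  have hc : Continuous fun ξ : E => ((1 + ‖ξ‖ ^ 2) ^ (-(2 : ℝ) / 2 - 0) : ℝ) := by
    refine Continuous.rpow_const (by fun_prop) fun ξ => Or.inl ?_
    positivity
  rw [memLp_two_iff_integrable_sq hc.aestronglyMeasurable]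
  have h1 : Integrable (fun x : E => ((1 : ℝ) + ‖x‖ ^ 2) ^ (-(4 : ℝ) / 2)) := by
    refine integrable_rpow_neg_one_add_norm_sq ?_
    rw [finrank_euclideanSpace]
    norm_num
  refine h1.congr (Eventually.of_forall fun ξ => ?_)
  dsimp only
  rw [show (-(4 : ℝ) / 2) = (-(2 : ℝ) / 2 - 0) * (2 : ℕ) by norm_num, Real.rpow_mul (by positivity),
    Real.rpow_natCast]

/-- The constant in the embedding of weighted `L²` in weighted `L¹`. -/
def wConst (k : ℕ) : ℝ :=
  2 ^ k * (eLpNorm (fun ξ : E => ((1 + ‖ξ‖ ^ 2) ^ (-(2 : ℝ) / 2 - 0) : ℝ)) 2 volume).toReal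

lemma wi_of_eLpNorm {k : ℕ} {s : ℝ} (hs : (k : ℝ) + 2 ≤ s) {G : E → ℂ}
    (hm : AEStronglyMeasurable G)
    (h : eLpNorm (fun ξ : E => (((1 + ‖ξ‖ ^ 2) ^ (s / 2) : ℝ) : ℂ) * G ξ) 2 volume < ⊤) :
    WI k G ∧ wn k G ≤ wConst k *
      (eLpNorm (fun ξ : E => (((1 + ‖ξ‖ ^ 2) ^ (s / 2) : ℝ) : ℂ) * G ξ) 2 volume).toReal := by
  set A : E → ℝ := fun ξ => ((1 + ‖ξ‖ ^ 2) ^ (-(2 : ℝ) / 2 - 0) : ℝ)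
  set g : E → ℂ := fun ξ : E => (((1 + ‖ξ‖ ^ 2) ^ (s / 2) : ℝ) : ℂ) * G ξ
  have hc : Continuous fun ξ : E => ((1 + ‖ξ‖ ^ 2) ^ (s / 2) : ℝ) := by
    refine Continuous.rpow_const (by fun_prop) fun ξ => Or.inl ?_
    positivity
  have hgm : AEStronglyMeasurable g := by
    have := hc.aestronglyMeasurable (μ := (volume : Measure E))
    fun_prop
  have hg : MemLp g 2 := ⟨hgm, h⟩
  have hA : MemLp A 2 := memLp_inv_weight
  have hAg : Integrable (A • g) := memLp_one_iff_integrable.1 (hg.smul hA)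
  have hb : ∀ ξ, (1 + ‖ξ‖) ^ k * ‖G ξ‖ ≤ 2 ^ k * ‖(A • g) ξ‖ := by
    intro ξ
    have h1 := weight_le k s hs ξ
    have h2 : ‖(A • g) ξ‖ = (1 + ‖ξ‖ ^ 2) ^ (-(2 : ℝ) / 2 - 0) * ((1 + ‖ξ‖ ^ 2) ^ (s / 2) * ‖G ξ‖) := by
      rw [Pi.smul_apply', norm_smul, norm_mul, Complex.norm_real, Real.norm_of_nonneg,
        Real.norm_of_nonneg] <;> positivity
    rw [h2]
    calc _ ≤ (2 ^ k * (1 + ‖ξ‖ ^ 2) ^ (-(2 : ℝ) / 2 - 0) * (1 + ‖ξ‖ ^ 2) ^ (s / 2)) * ‖G ξ‖ := by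
          gcongr
      _ = _ := by ring
  have hwi : WI k G := by
    refine Integrable.mono' (hAg.norm.const_mul (2 ^ k)) (by fun_prop)
      (Eventually.of_forall fun ξ => ?_)
    rw [Real.norm_of_nonneg (by positivity)]
    exact hb ξ
  refine ⟨hwi, (integral_mono hwi (hAg.norm.const_mul (2 ^ k)) hb).trans ?_⟩
  rw [integral_const_mul, wConst, mul_assoc, integral_norm_eq_lintegral_enorm
    hAg.aestronglyMeasurable, ← eLpNorm_one_eq_lintegral_enorm]
  gcongr
  rw [← ENNReal.toReal_mul]
  refine ENNReal.toReal_mono (ENNReal.mul_ne_top hA.2.ne h.ne) ?_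
  exact eLpNorm_smul_le_mul_eLpNorm hgm hA.1

lemma MemH.ftw {k : ℕ} {s : ℝ} (hs : (k : ℝ) + 2 ≤ s) {f : E → ℝ} (h : MemH s f) :
    FTW k (toC f) (ft (toC f)) ∧ wn k (ft (toC f)) ≤ wConst k * (sobolevNorm s f).toReal := by
  have h1 := hasFT_ft h.1
  have h2 := wi_of_eLpNorm hs h1.1.aestronglyMeasurable h.2
  exact ⟨⟨h1, h2.1⟩, h2.2⟩

lemma half_le_tanh {r : ℝ} (hr : 1 ≤ r) : 1 / 2 ≤ Real.tanh r := by
  rw [Real.tanh_eq_sinh_div_cosh, le_div_iff₀ (Real.cosh_pos r), Real.sinh_eq, Real.cosh_eq]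
  have h1 : Real.exp (-r) ≤ 1 / 2 := by
    rw [Real.exp_neg, inv_le_comm₀ (Real.exp_pos r) (by norm_num)]
    linarith [Real.add_one_le_exp r]
  have h2 : 2 ≤ Real.exp r := by linarith [Real.add_one_le_exp r]
  linarith

lemma LambdaMemH.ftw {f : E → ℝ} (h : LambdaMemH 6 f) : FTW 4 (toC f) (ft (toC f)) := by
  have h1 := hasFT_ft h.1
  have hm := h1.1.aestronglyMeasurable
  set L : E → ℝ := fun ξ => √(‖ξ‖ * Real.tanh ‖ξ‖) with hL
  have hLc : Continuous L := by
    have : Continuous Real.tanh := by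
      have : Real.tanh = fun x => Real.sinh x / Real.cosh x :=
        funext Real.tanh_eq_sinh_div_cosh
      rw [this]
      exact Real.continuous_sinh.div Real.continuous_cosh fun x => (Real.cosh_pos x).ne'
    rw [hL]
    fun_prop
  have h2 := (wi_of_eLpNorm (k := 4) (s := 6) (by norm_num) (G := fun ξ => (L ξ : ℂ) * ft (toC f) ξ)
    (by have := hLc.aestronglyMeasurable (μ := (volume : Measure E)); fun_prop) (by
      refine lt_of_eq_of_lt ?_ h.2
      congr 1
      funext ξ
      simp only [hL]
      push_cast
      ring)).1
  refine ⟨h1, ?_⟩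
  refine Integrable.mono' ((h1.1.norm.const_mul 16).add (Integrable.const_mul h2 2)) (by fun_prop)
    (Eventually.of_forall fun ξ => ?_)
  rw [Real.norm_of_nonneg (by positivity), Pi.add_apply, norm_mul, Complex.norm_real,
    Real.norm_of_nonneg (Real.sqrt_nonneg _)]
  rcases le_total ‖ξ‖ 1 with hξ | hξ
  · have : (1 + ‖ξ‖) ^ 4 ≤ 2 ^ 4 := pow_le_pow_left₀ (weight_pos ξ).le (by linarith) 4
    have h3 : (1 + ‖ξ‖) ^ 4 * ‖ft (toC f) ξ‖ ≤ 16 * ‖ft (toC f) ξ‖ := by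
      gcongr
      linarith
    have h4 : 0 ≤ 2 * ((1 + ‖ξ‖) ^ 4 * (L ξ * ‖ft (toC f) ξ‖)) := by positivity
    linarith
  · have h5 : 1 / 2 ≤ L ξ := by
      refine Real.le_sqrt_of_sq_le ?_
      have := half_le_tanh hξ
      nlinarith
    have h3 : 0 ≤ 16 * ‖ft (toC f) ξ‖ := by positivity
    have h4 : (1 + ‖ξ‖) ^ 4 * ‖ft (toC f) ξ‖ ≤ 2 * ((1 + ‖ξ‖) ^ 4 * (L ξ * ‖ft (toC f) ξ‖)) := by
      have : ‖ft (toC f) ξ‖ ≤ 2 * (L ξ * ‖ft (toC f) ξ‖) := by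
        nlinarith [norm_nonneg (ft (toC f) ξ)]
      calc _ ≤ (1 + ‖ξ‖) ^ 4 * (2 * (L ξ * ‖ft (toC f) ξ‖)) := by gcongr
        _ = _ := by ring
    linarith

/-! ### Decay at infinity -/

lemma HasFT.tendsto_zero {f F : E → ℂ} (h : HasFT f F) : Tendsto f (cocompact E) (𝓝 0) := by
  have h1 := tendsto_integral_exp_inner_smul_cocompact (V := E) F
  have h2 : Tendsto (fun x : E => (-(2 * Real.pi))⁻¹ • x) (cocompact E) (cocompact E) :=
    (Homeomorph.smulOfNeZero ((-(2 * Real.pi))⁻¹) (by simp [Real.pi_ne_zero])).isClosedEmbedding.tendsto_cocompact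
  have h3 := (h1.comp h2).const_mul c0
  rw [mul_zero] at h3
  refine h3.congr fun x => ?_
  have h4 := h.fourier_eq ((-(2 * Real.pi))⁻¹ • x)
  rw [smul_smul, mul_inv_cancel₀ (by simp [Real.pi_ne_zero]), one_smul] at h4
  rw [← h4, Real.fourier_eq]
  rfl

lemma exists_sup_lt_one {h : E → ℝ} {H : E → ℂ} (hH : HasFT (toC h) H) (h1 : ∀ x, |h x| < 1) :
    ∃ ρ, 0 ≤ ρ ∧ ρ < 1 ∧ ∀ x, |h x| ≤ ρ := by
  have hc : Continuous fun x => |h x| := by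
    have := Complex.continuous_re.comp hH.continuous
    exact continuous_abs.comp this
  have ht := hH.tendsto_zero.norm
  rw [norm_zero] at ht
  have h2 : ∀ᶠ x in cocompact E, |h x| < 1 / 2 := by
    filter_upwards [ht.eventually_lt_const (show (0 : ℝ) < 1 / 2 by norm_num)] with x hx
    simpa [toC] using hx
  obtain ⟨K, hK, hK'⟩ := mem_cocompact.1 h2
  rcases K.eq_empty_or_nonempty with rfl | hne
  · refine ⟨1 / 2, by norm_num, by norm_num, fun x => ?_⟩
    exact (hK' (by simp)).le
  · obtain ⟨x0, -, hx0⟩ := hK.exists_isMaxOn hne hc.continuousOn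
    refine ⟨max (1 / 2) |h x0|, by positivity, max_lt (by norm_num) (h1 x0), fun x => ?_⟩
    by_cases hx : x ∈ K
    · exact (hx0 hx).trans (le_max_right _ _)
    · exact (hK' hx).le.trans (le_max_left _ _)

/-! ### Approximation of Fourier transforms -/

/-- Shrinking bump functions. -/
def bmp (n : ℕ) : ContDiffBump (0 : E) where
  rIn := 1 / (n + 1)
  rOut := 2 / (n + 1)
  rIn_pos := by positivity
  rIn_lt_rOut := by gcongr; norm_num

/-- The convolution of the Fourier transform of `f` with a bump function, in terms of `f`. -/
def ftApprox (n : ℕ) (f : E → ℂ) (ξ : E) : ℂ :=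
  c0⁻¹ * ∫ w, f ((-(2 * Real.pi)) • w) *
    (chr ((2 * Real.pi) • w) ξ * 𝓕 (fun x => (((bmp n).normed volume x : ℝ) : ℂ)) w)

lemma HasFT.convolution_bmp {f F : E → ℂ} (h : HasFT f F) (n : ℕ) (ξ : E) :
    convolution ((bmp n).normed volume) F (ContinuousLinearMap.lsmul ℝ ℝ) volume ξ
      = ftApprox n f ξ := by
  set ρ : E → ℂ := fun x => (((bmp n).normed volume x : ℝ) : ℂ) with hρ
  have hρ1 : ContDiff ℝ ∞ ρ := Complex.ofRealCLM.contDiff.comp ((bmp n).contDiff_normed)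
  have hρ2 : HasCompactSupport ρ :=
    (bmp n).hasCompactSupport_normed.comp_left (g := Complex.ofReal) rfl
  have hS1 : ContDiff ℝ ∞ (fun η => ρ (ξ - η)) := hρ1.comp (contDiff_const.sub contDiff_id)
  have hS2 : HasCompactSupport (fun η => ρ (ξ - η)) :=
    hρ2.comp_homeomorph (Homeomorph.subLeft ξ)
  let S : SchwartzMap E ℂ := hS2.toSchwartzMap hS1
  have hSa : ∀ η, S η = ρ (ξ - η) := fun η => rfl
  have key := h.integral_mul_schwartz (𝓕⁻ S)
  rw [FourierTransform.fourier_fourierInv_eq] at key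
  have e1 : convolution ((bmp n).normed volume) F (ContinuousLinearMap.lsmul ℝ ℝ) volume ξ
      = ∫ η, F η * S η := by
    rw [convolution_eq_swap]
    refine integral_congr_ae (Eventually.of_forall fun η => ?_)
    simp [hSa, hρ, mul_comm]
  rw [e1, ftApprox, eq_inv_mul_iff_mul_eq₀ c0_ne_zero, key]
  refine integral_congr_ae (Eventually.of_forall fun w => ?_)
  dsimp only
  congr 1
  rw [SchwartzMap.fourierInv_coe, Real.fourierInv_eq, Real.fourier_eq, ← integral_const_mul,
    ← integral_sub_left_eq_self _ volume ξ]
  refine integral_congr_ae (Eventually.of_forall fun v => ?_)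
  simp only [hSa, Real.fourierChar_apply, Circle.smul_def, smul_eq_mul, chr, sub_sub_cancel]
  rw [← mul_assoc, ← Complex.exp_add]
  congr 2
  rw [inner_sub_left, real_inner_smul_left, real_inner_comm w ξ]
  push_cast
  ring

lemma bmp_rOut_tendsto : Tendsto (fun n => (bmp n).rOut) atTop (𝓝 0) := by
  have := (tendsto_one_div_add_atTop_nhds_zero_nat (𝕜 := ℝ)).const_mul 2
  simp only [mul_zero] at this
  refine this.congr fun n => ?_
  simp only [bmp]
  ring

lemma HasFT.ftApprox_tendsto {f F : E → ℂ} (h : HasFT f F) :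
    ∀ᵐ ξ, Tendsto (fun n => ftApprox n f ξ) atTop (𝓝 (F ξ)) := by
  have := ContDiffBump.ae_convolution_tendsto_right_of_locallyIntegrable (μ := (volume : Measure E))
    (φ := bmp) (K := 2) bmp_rOut_tendsto (Eventually.of_forall fun n => by
      simp only [bmp]
      apply le_of_eq
      ring) h.1.locallyIntegrable
  filter_upwards [this] with ξ hξ
  exact hξ.congr fun n => h.convolution_bmp n ξ

lemma norm_fourier_bmp_le (n : ℕ) (w : E) :
    ‖𝓕 (fun x => (((bmp n).normed volume x : ℝ) : ℂ)) w‖ ≤ 1 := by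
  rw [Real.fourier_eq]
  refine (norm_integral_le_integral_norm _).trans ?_
  have : ∀ v : E, ‖(Real.fourierChar (-inner ℝ v w)) • (((bmp n).normed volume v : ℝ) : ℂ)‖ =
      (bmp n).normed volume v := by
    intro v
    rw [Circle.norm_smul, Complex.norm_real, Real.norm_of_nonneg ((bmp n).nonneg_normed v)]
  simp only [this]
  exact ((bmp n).integral_normed (μ := volume)).le

/-- The Fourier transform is bounded by the `L¹` norm. -/
lemma HasFT.norm_le_integral {f F : E → ℂ} (h : HasFT f F) (hf : Integrable f) :
    ∀ᵐ ξ, ‖F ξ‖ ≤ ∫ x, ‖f x‖ := by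
  filter_upwards [h.ftApprox_tendsto] with ξ hξ
  refine le_of_tendsto hξ.norm (Eventually.of_forall fun n => ?_)
  rw [ftApprox, norm_mul, norm_inv, norm_c0]
  have h0 : ∀ w, ‖f ((-(2 * Real.pi)) • w) * (chr ((2 * Real.pi) • w) ξ *
      𝓕 (fun x => (((bmp n).normed volume x : ℝ) : ℂ)) w)‖ ≤ ‖f ((-(2 * Real.pi)) • w)‖ := by
    intro w
    rw [norm_mul, norm_mul, norm_chr, one_mul]
    exact mul_le_of_le_one_right (norm_nonneg _) (norm_fourier_bmp_le n w)
  have hint : Integrable fun w => ‖f ((-(2 * Real.pi)) • w)‖ :=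
    (hf.comp_smul (by simp [Real.pi_ne_zero])).norm
  have h1 : ‖∫ w, f ((-(2 * Real.pi)) • w) * (chr ((2 * Real.pi) • w) ξ *
      𝓕 (fun x => (((bmp n).normed volume x : ℝ) : ℂ)) w)‖ ≤ ∫ w, ‖f ((-(2 * Real.pi)) • w)‖ :=
    norm_integral_le_of_norm_le hint (Eventually.of_forall h0)
  have h2 := Measure.integral_comp_smul (volume : Measure E) (fun x => ‖f x‖) (-(2 * Real.pi))
  rw [finrank_euclideanSpace, Fintype.card_fin, smul_eq_mul] at h2
  rw [h2] at h1
  have hpi := Real.pi_pos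
  have h3 : |((-(2 * Real.pi)) ^ 2)⁻¹| = (2 * Real.pi)⁻¹ ^ 2 := by
    rw [neg_sq, abs_of_nonneg (by positivity), inv_pow]
  rw [h3] at h1
  calc _ ≤ ((2 * Real.pi)⁻¹ ^ 2)⁻¹ * ((2 * Real.pi)⁻¹ ^ 2 * ∫ x, ‖f x‖) := by gcongr
    _ = _ := inv_mul_cancel_left₀ (by positivity) _

/-- Functions on the strip, with slices that have a Fourier transform, have jointly measurable
Fourier transforms. -/
theorem exists_measurable_ft {f : ℝ → E → ℂ} (hf : Continuous fun p : ℝ × E => f p.1 p.2)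
    (h : ∀ s, ∃ F, HasFT (f s) F) :
    ∃ U : ℝ → E → ℂ, StronglyMeasurable (fun p : ℝ × E => U p.1 p.2) ∧ ∀ s, HasFT (f s) (U s) := by
  have hm : ∀ n, StronglyMeasurable fun p : ℝ × E => ftApprox n (f p.1) p.2 := by
    intro n
    simp only [ftApprox]
    refine StronglyMeasurable.const_mul ?_ _
    have hF : Continuous (𝓕 (fun x => (((bmp n).normed volume x : ℝ) : ℂ))) := by
      refine VectorFourier.fourierIntegral_continuous Real.continuous_fourierChar
        (by simp only [innerₗ_apply_apply]; fun_prop) ?_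
      exact ((bmp n).integrable_normed).ofReal
    refine StronglyMeasurable.integral_prod_right (f := fun (p : ℝ × E) (w : E) =>
      f p.1 ((-(2 * Real.pi)) • w) * (chr ((2 * Real.pi) • w) p.2 *
      𝓕 (fun x => (((bmp n).normed volume x : ℝ) : ℂ)) w)) ?_
    apply Continuous.stronglyMeasurable
    have h1 : Continuous fun q : (ℝ × E) × E => f q.1.1 ((-(2 * Real.pi)) • q.2) :=
      hf.comp (by fun_prop : Continuous fun q : (ℝ × E) × E => (q.1.1, (-(2 * Real.pi)) • q.2))
    have h2 : Continuous fun q : (ℝ × E) × E => chr ((2 * Real.pi) • q.2) q.1.2 :=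
      chr_continuous2.comp
        (by fun_prop : Continuous fun q : (ℝ × E) × E => ((2 * Real.pi) • q.2, q.1.2))
    exact h1.mul (h2.mul (hF.comp continuous_snd))
  refine ⟨fun s ξ => limUnder atTop fun n => ftApprox n (f s) ξ, ?_, fun s => ?_⟩
  · exact StronglyMeasurable.limUnder hm
  · obtain ⟨F, hF⟩ := h s
    refine hF.congr_ae ?_
    filter_upwards [hF.ftApprox_tendsto] with ξ hξ
    exact hξ.limUnder_eq.symm

end
end WaterWaves

namespace WaterWaves
open Filter Topology FourierTransform
noncomputable section

/-! ### Inverses in the weighted Wiener algebra -/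

lemma HasFT.memLp_two {f F : E → ℂ} (h : HasFT f F) (hF : MemLp F 2) : MemLp f 2 := by
  set g : Lp ℂ 2 (volume : Measure E) := 𝓕 (hF.toLp F) with hg
  have hne : (-(2 * Real.pi)) ≠ 0 := by simp [Real.pi_ne_zero]
  have hfc : Continuous fun w => f ((-(2 * Real.pi)) • w) := h.continuous.comp (by fun_prop)
  have hgl : LocallyIntegrable (fun w => c0 * g w) volume :=
    ((Lp.memLp g).const_mul c0).locallyIntegrable (by norm_num)
  have key : ∀ᵐ w, f ((-(2 * Real.pi)) • w) = c0 * g w := by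
    refine ae_eq_of_integral_contDiff_smul_eq hfc.locallyIntegrable hgl fun φ hφ hc => ?_
    have hφ' : ContDiff ℝ ∞ (fun x => (φ x : ℂ)) := Complex.ofRealCLM.contDiff.comp hφ
    have hc' : HasCompactSupport (fun x => (φ x : ℂ)) := hc.comp_left (g := Complex.ofReal) rfl
    let S : SchwartzMap E ℂ := hc'.toSchwartzMap hφ'
    have e1 := h.integral_mul_schwartz S
    have e2 := congrArg (fun T => T S) (Lp.fourier_toTemperedDistribution_eq (hF.toLp F))
    simp only [TemperedDistribution.fourier_apply, Lp.toTemperedDistribution_apply] at e2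
    rw [← hg] at e2
    have e3 : ∫ x, (𝓕 S) x • (hF.toLp F) x = ∫ ξ, F ξ * 𝓕 S ξ := by
      refine integral_congr_ae ?_
      filter_upwards [hF.coeFn_toLp] with x hx
      rw [hx, smul_eq_mul, mul_comm]
    rw [e3] at e2
    rw [e2] at e1
    calc ∫ x, φ x • f ((-(2 * Real.pi)) • x) = ∫ x, f ((-(2 * Real.pi)) • x) * S x := by
          refine integral_congr_ae (Eventually.of_forall fun x => ?_)
          change φ x • f _ = f _ * (φ x : ℂ)
          rw [Complex.real_smul, mul_comm]
      _ = c0 * ∫ x, S x • g x := e1.symm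
      _ = _ := by
          rw [← integral_const_mul]
          refine integral_congr_ae (Eventually.of_forall fun x => ?_)
          change c0 * ((φ x : ℂ) * g x) = φ x • (c0 * g x)
          rw [Complex.real_smul]
          ring
  have h1 : MemLp (fun w => f ((-(2 * Real.pi)) • w)) 2 := by
    refine ((Lp.memLp g).const_mul c0).ae_eq ?_
    filter_upwards [key] with w hw
    exact hw.symm
  rw [memLp_two_iff_integrable_sq_norm h.continuous.aestronglyMeasurable]
  rw [memLp_two_iff_integrable_sq_norm hfc.aestronglyMeasurable] at h1
  exact (integrable_comp_smul_iff volume (fun w => ‖f w‖ ^ 2) hne).1 h1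

/-- Membership in the weighted Wiener algebra, with a bound of the norm. -/
def WB (f : E → ℂ) (B : ℝ) : Prop := ∃ F, FTW 1 f F ∧ wn 1 F ≤ B

lemma WB.mono {f : E → ℂ} {B C : ℝ} (h : WB f B) (hBC : B ≤ C) : WB f C := by
  obtain ⟨F, h1, h2⟩ := h
  exact ⟨F, h1, h2.trans hBC⟩

lemma WB.nonneg {f : E → ℂ} {B : ℝ} (h : WB f B) : 0 ≤ B := by
  obtain ⟨F, h1, h2⟩ := h
  exact (wn_nonneg 1 F).trans h2

lemma WB.congr_fun {f g : E → ℂ} {B : ℝ} (h : WB f B) (hg : ∀ x, g x = f x) : WB g B := by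
  obtain ⟨F, h1, h2⟩ := h
  exact ⟨F, h1.congr_fun hg, h2⟩

lemma wb_zero : WB (fun _ => 0) 0 := ⟨_, ftw_zero 1, by simp [wn]⟩

lemma WB.add {f g : E → ℂ} {B C : ℝ} (hf : WB f B) (hg : WB g C) :
    WB (fun x => f x + g x) (B + C) := by
  obtain ⟨F, h1, h2⟩ := hf
  obtain ⟨G, h3, h4⟩ := hg
  refine ⟨_, h1.add h3, ?_⟩
  refine le_trans ?_ (add_le_add h2 h4)
  rw [wn, wn, wn, ← integral_add h1.wi h3.wi]
  refine integral_mono (h1.add h3).wi (Integrable.add h1.wi h3.wi) fun ξ => ?_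
  dsimp only
  rw [← mul_add]
  gcongr
  exact norm_add_le _ _

lemma WB.smul {f : E → ℂ} {B : ℝ} (hf : WB f B) (a : ℂ) : WB (fun x => a * f x) (‖a‖ * B) := by
  obtain ⟨F, h1, h2⟩ := hf
  refine ⟨_, h1.smul a, le_trans (le_of_eq ?_) (mul_le_mul_of_nonneg_left h2 (norm_nonneg a))⟩
  rw [wn, wn, ← integral_const_mul]
  congr 1
  funext ξ
  rw [norm_mul]
  ring

lemma WB.mul {f g : E → ℂ} {B C : ℝ} (hf : WB f B) (hg : WB g C) :
    WB (fun x => f x * g x) (B * C) := by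
  have hB := hf.nonneg
  obtain ⟨F, h1, h2⟩ := hf
  obtain ⟨G, h3, h4⟩ := hg
  refine ⟨_, h1.mul h3, ((h1.wi.cv h1.aesm h3.aesm h3.wi).2).trans ?_⟩
  exact mul_le_mul h2 h4 (wn_nonneg _ _) hB

lemma wb_sum {ι : Type*} (s : Finset ι) {f : ι → E → ℂ} {B : ι → ℝ} (h : ∀ i ∈ s, WB (f i) (B i)) :
    WB (fun x => ∑ i ∈ s, f i x) (∑ i ∈ s, B i) := by
  classical
  induction s using Finset.induction_on with
  | empty => simpa using wb_zero
  | insert i s hi ih =>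
    simp only [Finset.sum_insert hi]
    exact (h i (by simp)).add (ih fun j hj => h j (by simp [hj]))

lemma WB.norm_le {f : E → ℂ} {B : ℝ} (h : WB f B) (x : E) : ‖f x‖ ≤ B := by
  obtain ⟨F, h1, h2⟩ := h
  refine (h1.hasFT.norm_le x).trans (le_trans ?_ h2)
  rw [← wn_zero]
  exact wn_mono (Nat.zero_le 1) h1.aesm h1.wi

lemma wb_tsum {f : ℕ → E → ℂ} {B : ℕ → ℝ} (h : ∀ n, WB (f n) (B n)) (hB : Summable B) :
    WB (fun x => ∑' n, f n x) (∑' n, B n) := by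
  choose F hF hFB using h
  have hm : ∀ n, AEStronglyMeasurable (F n) volume := fun n => (hF n).aesm
  have hlin : ∫⁻ ξ, ∑' n, ‖(1 + ‖ξ‖) ^ 1 * ‖F n ξ‖‖ₑ = ∑' n, ENNReal.ofReal (wn 1 (F n)) := by
    rw [lintegral_tsum fun n => by have := hm n; fun_prop]
    congr 1
    funext n
    rw [wn, ofReal_integral_eq_lintegral_ofReal (hF n).wi
      (Eventually.of_forall fun ξ => by positivity)]
    refine lintegral_congr fun ξ => ?_
    rw [Real.enorm_of_nonneg (by positivity)]
  have hle : ∑' n, ENNReal.ofReal (wn 1 (F n)) ≤ ENNReal.ofReal (∑' n, B n) := by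
    rw [ENNReal.ofReal_tsum_of_nonneg (fun n => (wn_nonneg 1 (F n)).trans (hFB n)) hB]
    exact ENNReal.tsum_le_tsum fun n => ENNReal.ofReal_le_ofReal (hFB n)
  have hfin : ∀ᵐ ξ, ∑' n, ‖(1 + ‖ξ‖) ^ 1 * ‖F n ξ‖‖ₑ < ⊤ := by
    refine ae_lt_top' ?_ ?_
    · refine AEMeasurable.tsum fun n => ?_
      have := hm n
      fun_prop
    · rw [hlin]
      exact (hle.trans_lt ENNReal.ofReal_lt_top).ne
  have hsum : ∀ᵐ ξ, Summable fun n => ‖F n ξ‖ := by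
    filter_upwards [hfin] with ξ hξ
    have h1 : Summable fun n => (1 + ‖ξ‖) ^ 1 * ‖F n ξ‖ := by
      have := ENNReal.summable_toReal hξ.ne
      refine this.congr fun n => ?_
      rw [toReal_enorm, Real.norm_of_nonneg (by positivity)]
    refine Summable.of_nonneg_of_le (fun n => norm_nonneg _) (fun n => ?_) h1
    refine le_mul_of_one_le_left (norm_nonneg _) ?_
    simp
  have hS : AEStronglyMeasurable (fun ξ => ∑' n, F n ξ) volume := by
    refine aestronglyMeasurable_of_tendsto_ae (u := atTop)
      (f := fun n ξ => ∑ i ∈ Finset.range n, F i ξ) (fun n => ?_) ?_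
    · exact Finset.aestronglyMeasurable_fun_sum _ fun i _ => hm i
    · filter_upwards [hsum] with ξ hξ
      exact hξ.of_norm.hasSum.tendsto_sum_nat
  have hle2 : ∫⁻ ξ, ‖(1 + ‖ξ‖) ^ 1 * ‖∑' n, F n ξ‖‖ₑ ≤ ENNReal.ofReal (∑' n, B n) := by
    refine le_trans ?_ (hlin.trans_le hle)
    refine lintegral_mono fun ξ => ?_
    simp only [enorm_mul, enorm_norm]
    rw [ENNReal.tsum_mul_left]
    gcongr
    exact enorm_tsum_le_tsum_enorm
  have hwi : WI 1 (fun ξ => ∑' n, F n ξ) :=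
    ⟨by fun_prop, hle2.trans_lt ENNReal.ofReal_lt_top⟩
  refine ⟨fun ξ => ∑' n, F n ξ, ⟨HasFT.mk' (hwi.integrable hS) fun x => ?_, hwi⟩, ?_⟩
  · have h1 := hasSum_integral_of_summable_integral_norm (F := fun n ξ => chr x ξ * F n ξ)
      (μ := volume) (fun n => chr_integrable (hF n).hasFT.1 x) (by
        refine Summable.of_nonneg_of_le (fun n => integral_nonneg fun ξ => norm_nonneg _)
          (fun n => ?_) hB
        simp only [norm_mul, norm_chr, one_mul]
        rw [← wn_zero]
        exact (wn_mono (Nat.zero_le 1) (hm n) (hF n).wi).trans (hFB n))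
    simp only [tsum_mul_left] at h1
    rw [← (h1.mul_left c0).tsum_eq]
    congr 1
    funext n
    exact (hF n).hasFT.eq x
  · rw [wn, integral_eq_lintegral_of_nonneg_ae (Eventually.of_forall fun ξ => by positivity)
      hwi.aestronglyMeasurable]
    have hB0 : 0 ≤ ∑' n, B n := tsum_nonneg fun n => (wn_nonneg 1 (F n)).trans (hFB n)
    refine ENNReal.toReal_le_of_le_ofReal hB0 (le_trans (le_of_eq ?_) hle2)
    refine lintegral_congr fun ξ => ?_
    rw [Real.enorm_of_nonneg (by positivity)]

lemma cv_support {F G : E → ℂ} {R S : ℝ} (hF : ∀ ξ, R < ‖ξ‖ → F ξ = 0)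
    (hG : ∀ ξ, S < ‖ξ‖ → G ξ = 0) : ∀ ξ, R + S < ‖ξ‖ → cv F G ξ = 0 := by
  intro ξ hξ
  rw [cv]
  have : ∀ η, F η * G (ξ - η) = 0 := by
    intro η
    by_cases h1 : R < ‖η‖
    · rw [hF η h1, zero_mul]
    · have : S < ‖ξ - η‖ := by
        have : ‖ξ‖ ≤ ‖η‖ + ‖ξ - η‖ := by
          calc ‖ξ‖ = ‖η + (ξ - η)‖ := by congr 1; abel
            _ ≤ _ := norm_add_le _ _
        linarith
      rw [hG _ this, mul_zero]
  simp [this]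

/-- Powers of band-limited functions. -/
lemma hasFT_pow_bandlimited {a A : E → ℂ} (h : HasFT a A) {R : ℝ} (hA : ∀ ξ, R < ‖ξ‖ → A ξ = 0)
    (n : ℕ) : ∃ F, HasFT (fun x => a x ^ (n + 1)) F ∧ ∀ ξ, (n + 1) * R < ‖ξ‖ → F ξ = 0 := by
  induction n with
  | zero => exact ⟨A, by simpa using h, by simpa using hA⟩
  | succ n ih =>
    obtain ⟨F, h1, h2⟩ := ih
    refine ⟨cv F A, (h1.mul h).congr_fun fun x => pow_succ _ _, fun ξ hξ => ?_⟩
    refine cv_support h2 hA ξ (lt_of_eq_of_lt ?_ hξ)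
    push_cast
    ring

lemma ball_volume_real (r : ℝ) (hr : 0 ≤ r) :
    (volume (Metric.closedBall (0 : E) r)).toReal
      = r ^ 2 * (volume (Metric.ball (0 : E) 1)).toReal := by
  rw [Measure.addHaar_closedBall volume (0 : E) hr, finrank_euclideanSpace, Fintype.card_fin,
    ENNReal.toReal_mul, ENNReal.toReal_ofReal (by positivity)]

lemma wb_pow_bandlimited {a A : E → ℂ} (h : HasFT a A) {R σ : ℝ} (hR : 0 ≤ R)
    (hA : ∀ ξ, R < ‖ξ‖ → A ξ = 0) (h2 : MemLp a 2) (hσ : 0 < σ) (hs : ∀ x, ‖a x‖ ≤ σ) :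
    ∃ D, 0 ≤ D ∧ ∀ m : ℕ, WB (fun x => a x ^ (m + 2)) (D * ((m : ℝ) + 2) ^ 3 * σ ^ m) := by
  have hi : Integrable fun x => ‖a x‖ ^ 2 :=
    (memLp_two_iff_integrable_sq_norm h.continuous.aestronglyMeasurable).1 h2
  set N := ∫ x, ‖a x‖ ^ 2 with hN
  have hN0 : 0 ≤ N := integral_nonneg fun x => by positivity
  set v := (volume (Metric.ball (0 : E) 1)).toReal
  refine ⟨(1 + R) * R ^ 2 * v * N, by positivity, fun m => ?_⟩
  obtain ⟨F, hF, hFs⟩ := hasFT_pow_bandlimited h hA (m + 1)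
  push_cast at hFs
  have hle : ∀ x, ‖a x ^ (m + 2)‖ ≤ σ ^ m * ‖a x‖ ^ 2 := by
    intro x
    rw [norm_pow, pow_add]
    gcongr
    exact hs x
  have hint : Integrable fun x => a x ^ (m + 2) :=
    Integrable.mono' (hi.const_mul (σ ^ m)) (h.continuous.pow _).aestronglyMeasurable
      (Eventually.of_forall hle)
  have hL1 : ∫ x, ‖a x ^ (m + 2)‖ ≤ σ ^ m * N := by
    rw [hN, ← integral_const_mul]
    exact integral_mono hint.norm (hi.const_mul _) hle
  set r := ((m : ℝ) + 2) * R with hr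
  have hr0 : 0 ≤ r := by positivity
  have hb : ∀ᵐ ξ, (1 + ‖ξ‖) ^ 1 * ‖F ξ‖ ≤
      (Metric.closedBall (0 : E) r).indicator (fun _ => (1 + r) * (σ ^ m * N)) ξ := by
    filter_upwards [hF.norm_le_integral hint] with ξ hξ
    by_cases h3 : ξ ∈ Metric.closedBall (0 : E) r
    · rw [indicator_of_mem h3, pow_one]
      rw [mem_closedBall_zero_iff] at h3
      have := hξ.trans hL1
      gcongr
    · rw [indicator_of_notMem h3]
      rw [mem_closedBall_zero_iff, not_le] at h3
      rw [hFs ξ (by rw [hr] at h3; convert! h3 using 2; ring), norm_zero, mul_zero]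
  have hbi : Integrable ((Metric.closedBall (0 : E) r).indicator
      (fun _ => (1 + r) * (σ ^ m * N))) volume := by
    rw [integrable_indicator_iff Metric.isClosed_closedBall.measurableSet]
    exact integrableOn_const (measure_closedBall_lt_top).ne
  have hwi : WI 1 F := by
    refine Integrable.mono' hbi (by have := hF.1.aestronglyMeasurable; fun_prop) ?_
    filter_upwards [hb] with ξ hξ
    rwa [Real.norm_of_nonneg (by positivity)]
  refine ⟨F, ⟨hF, hwi⟩, (integral_mono_ae hwi hbi hb).trans ?_⟩
  rw [integral_indicator Metric.isClosed_closedBall.measurableSet, setIntegral_const, smul_eq_mul,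
    Measure.real, ball_volume_real r hr0]
  have h5 : 1 + r ≤ (1 + R) * (m + 2) := by
    rw [hr]
    nlinarith [Nat.cast_nonneg (α := ℝ) m]
  calc r ^ 2 * v * ((1 + r) * (σ ^ m * N))
      ≤ r ^ 2 * v * (((1 + R) * (m + 2)) * (σ ^ m * N)) := by gcongr
    _ = _ := by rw [hr]; ring

lemma tendsto_wn_compl {F : E → ℂ} (h : WI 1 F) :
    Tendsto (fun n : ℕ => wn 1 ((Metric.closedBall (0 : E) n)ᶜ.indicator F)) atTop (𝓝 0) := by
  have h1 := tendsto_setIntegral_of_antitone (μ := (volume : Measure E))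
    (s := fun n : ℕ => (Metric.closedBall (0 : E) n)ᶜ)
    (f := fun ξ => (1 + ‖ξ‖) ^ 1 * ‖F ξ‖)
    (fun n => Metric.isClosed_closedBall.measurableSet.compl)
    (fun m n hmn => compl_subset_compl.2 (Metric.closedBall_subset_closedBall (by exact_mod_cast hmn)))
    ⟨0, Integrable.integrableOn h⟩
  have h2 : ⋂ n : ℕ, (Metric.closedBall (0 : E) n)ᶜ = ∅ := by
    rw [← compl_iUnion, Metric.iUnion_closedBall_nat, compl_univ]
  rw [h2, setIntegral_empty] at h1
  refine h1.congr fun n => ?_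
  rw [← integral_indicator Metric.isClosed_closedBall.measurableSet.compl, wn]
  congr 1
  funext ξ
  by_cases h3 : ξ ∈ (Metric.closedBall (0 : E) n)ᶜ
  · simp only [indicator_of_mem h3]
  · simp only [indicator_of_notMem h3, norm_zero, mul_zero]

lemma wb_pow {f : E → ℂ} {B : ℝ} (h : WB f B) (n : ℕ) :
    WB (fun x => f x ^ (n + 1)) (B ^ (n + 1)) := by
  induction n with
  | zero => simpa using h
  | succ n ih => simpa only [pow_succ] using ih.mul h

/-- Beurling's spectral radius formula, as a bound for powers. -/
lemma wb_pow_of_sup {h H : E → ℂ} (hH : FTW 1 h H) (hH2 : MemLp H 2) {ρ : ℝ} (hρ0 : 0 ≤ ρ)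
    (hρ : ρ < 1) (hb : ∀ x, ‖h x‖ ≤ ρ) :
    ∃ B : ℕ → ℝ, Summable B ∧ ∀ n, WB (fun x => h x ^ (n + 1)) (B n) := by
  set ε := (1 - ρ) / 4 with hε
  have hε0 : 0 < ε := by rw [hε]; linarith
  obtain ⟨R, hR⟩ := ((tendsto_wn_compl hH.wi).eventually_le_const hε0).exists
  set A : E → ℂ := (Metric.closedBall (0 : E) R).indicator H with hA
  set Bc : E → ℂ := (Metric.closedBall (0 : E) R)ᶜ.indicator H with hBc
  have hms : MeasurableSet (Metric.closedBall (0 : E) (R : ℝ)) :=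
    Metric.isClosed_closedBall.measurableSet
  have hAi : Integrable A := hH.hasFT.1.indicator hms
  have hBi : Integrable Bc := hH.hasFT.1.indicator hms.compl
  have hAB : ∀ ξ, H ξ = A ξ + Bc ξ := fun ξ =>
    (congrFun (indicator_self_add_compl (Metric.closedBall (0 : E) (R : ℝ)) H) ξ).symm
  set a : E → ℂ := fun x => c0 * ∫ ξ, chr x ξ * A ξ with ha
  set b : E → ℂ := fun x => c0 * ∫ ξ, chr x ξ * Bc ξ with hbdef
  have hha : HasFT a A := HasFT.mk' hAi fun x => rfl
  have hhb : HasFT b Bc := HasFT.mk' hBi fun x => rfl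
  have hBw : WI 1 Bc := by
    have := Integrable.indicator hH.wi hms.compl
    refine this.congr (Eventually.of_forall fun ξ => ?_)
    by_cases h3 : ξ ∈ (Metric.closedBall (0 : E) (R : ℝ))ᶜ
    · simp only [hBc, indicator_of_mem h3]
    · simp only [hBc, indicator_of_notMem h3, norm_zero, mul_zero]
  have hAw : WI 1 A := by
    have := Integrable.indicator hH.wi hms
    refine this.congr (Eventually.of_forall fun ξ => ?_)
    by_cases h3 : ξ ∈ (Metric.closedBall (0 : E) (R : ℝ))
    · simp only [hA, indicator_of_mem h3]
    · simp only [hA, indicator_of_notMem h3, norm_zero, mul_zero]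
  have hbB : WB b ε := ⟨Bc, ⟨hhb, hBw⟩, hR⟩
  have hab : ∀ x, h x = a x + b x := by
    intro x
    rw [((hha.add hhb).congr_ae (Eventually.of_forall fun ξ => (hAB ξ).symm)).eq x, hH.hasFT.eq x]
  set σ := ρ + ε with hσ
  have hσ0 : 0 < σ := by rw [hσ]; linarith
  have has : ∀ x, ‖a x‖ ≤ σ := by
    intro x
    have : a x = h x - b x := by rw [hab x]; ring
    rw [this]
    exact (norm_sub_le _ _).trans (add_le_add (hb x) (hbB.norm_le x))
  have haL : MemLp a 2 := hha.memLp_two (hH2.indicator hms)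
  obtain ⟨D, hD0, hD⟩ := wb_pow_bandlimited hha (R := R) (by positivity) (fun ξ hξ => by
    rw [hA, indicator_of_notMem]
    simpa using hξ) haL hσ0 has
  have haW : WB a (wn 1 A) := ⟨A, ⟨hha, hAw⟩, le_rfl⟩
  -- a common bound for all powers of `a`
  set D' := 1 + D / σ ^ 2 + wn 1 A / σ with hD'
  have hD'1 : 1 ≤ D' := by
    have := wn_nonneg 1 A
    have h1 : 0 ≤ D / σ ^ 2 := by positivity
    have h2 : 0 ≤ wn 1 A / σ := by positivity
    linarith
  have hpa : ∀ m : ℕ, WB (fun x => a x ^ (m + 1)) (D' * ((m : ℝ) + 2) ^ 3 * σ ^ (m + 1)) := by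
    intro m
    have hwA := wn_nonneg 1 A
    have h1 : 0 ≤ D / σ ^ 2 := by positivity
    have h2 : 0 ≤ wn 1 A / σ := by positivity
    rcases m with _ | m
    · simp only [zero_add, pow_one]
      refine haW.mono ?_
      have h3 : wn 1 A = wn 1 A / σ * σ := by field_simp
      calc wn 1 A = wn 1 A / σ * 1 * σ := by rw [mul_one]; exact h3
        _ ≤ _ := by
          gcongr
          · rw [hD']; linarith
          · norm_num
    · refine (hD m).mono ?_
      have h3 : D * σ ^ m = D / σ ^ 2 * σ ^ (m + 1 + 1) := by field_simp; ring
      calc D * ((m : ℝ) + 2) ^ 3 * σ ^ m = D / σ ^ 2 * ((m : ℝ) + 2) ^ 3 * σ ^ (m + 1 + 1) := by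
            rw [mul_right_comm, h3]; ring
        _ ≤ _ := by
          gcongr
          · rw [hD']; linarith
          · simp
  have hpab : ∀ m k : ℕ, 1 ≤ m + k →
      WB (fun x => a x ^ m * b x ^ k) (D' * ((m : ℝ) + 2) ^ 3 * (σ ^ m * ε ^ k)) := by
    intro m k hmk
    rcases m with _ | m
    · rcases k with _ | k
      · omega
      · simp only [pow_zero, one_mul]
        refine (wb_pow hbB k).mono ?_
        refine le_mul_of_one_le_left (by positivity) ?_
        have : (1 : ℝ) ≤ (((0 : ℕ) : ℝ) + 2) ^ 3 := by norm_num
        nlinarith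
    · rcases k with _ | k
      · simp only [pow_zero, mul_one]
        refine (hpa m).mono ?_
        gcongr
        simp
      · refine ((hpa m).mul (wb_pow hbB k)).mono ?_
        rw [mul_assoc]
        gcongr
        simp
  refine ⟨fun n => D' * (((n + 1 : ℕ) : ℝ) + 2) ^ 3 * (σ + ε) ^ (n + 1), ?_, fun n => ?_⟩
  · have hr : ‖σ + ε‖ < 1 := by
      rw [Real.norm_of_nonneg (by positivity)]
      rw [hσ, hε]
      linarith
    have hsum : ∀ k : ℕ, Summable fun n : ℕ => ((n : ℝ)) ^ k * (σ + ε) ^ n :=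
      fun k => summable_pow_mul_geometric_of_norm_lt_one k hr
    have h1 : Summable fun n : ℕ => D' * (((n : ℕ) : ℝ) + 2) ^ 3 * (σ + ε) ^ n := by
      have := ((((hsum 3).add ((hsum 2).mul_left 6)).add ((hsum 1).mul_left 12)).add
        ((hsum 0).mul_left 8)).mul_left D'
      refine this.congr fun n => ?_
      ring
    exact (summable_nat_add_iff 1).2 h1
  · have e1 : ∀ x, h x ^ (n + 1) = ∑ m ∈ Finset.range (n + 1 + 1),
        (((n + 1).choose m : ℕ) : ℂ) * (a x ^ m * b x ^ (n + 1 - m)) := by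
      intro x
      rw [hab x, add_pow]
      refine Finset.sum_congr rfl fun m _ => ?_
      ring
    refine WB.congr_fun ?_ e1
    refine (wb_sum (Finset.range (n + 1 + 1)) fun m hm =>
      (hpab m (n + 1 - m) (by omega)).smul (((n + 1).choose m : ℕ) : ℂ)).mono ?_
    dsimp only
    rw [add_pow σ ε, Finset.mul_sum]
    refine Finset.sum_le_sum fun m hm => ?_
    have hm' : m ≤ n + 1 := by
      have := Finset.mem_range.1 hm
      omega
    rw [Complex.norm_natCast]
    calc _ ≤ ((n + 1).choose m : ℝ) * (D' * (((n + 1 : ℕ) : ℝ) + 2) ^ 3 *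
          (σ ^ m * ε ^ (n + 1 - m))) := by
          gcongr
      _ = _ := by ring

/-- The Wiener lemma for `1/(1+h)`, `|h| < 1`. -/
theorem exists_ftw_inv {h H : E → ℂ} (hH : FTW 1 h H) (hH2 : MemLp H 2) {ρ : ℝ} (hρ0 : 0 ≤ ρ)
    (hρ : ρ < 1) (hb : ∀ x, ‖h x‖ ≤ ρ) : ∃ G, FTW 1 (fun x => (1 + h x)⁻¹ - 1) G := by
  obtain ⟨B, hB, hp⟩ := wb_pow_of_sup hH hH2 hρ0 hρ hb
  have h1 := wb_tsum (fun n => (hp n).smul ((-1) ^ (n + 1))) (by simpa using hB)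
  obtain ⟨G, hG, -⟩ := h1
  refine ⟨G, hG.congr_fun fun x => ?_⟩
  have hx : ‖-h x‖ < 1 := by
    rw [norm_neg]
    exact (hb x).trans_lt hρ
  have h2 := (hasSum_geometric_of_norm_lt_one hx)
  have h3 := (hasSum_nat_add_iff' 1).2 h2
  simp only [Finset.range_one, Finset.sum_singleton, pow_zero, sub_neg_eq_add] at h3
  rw [← h3.tsum_eq]
  congr 1
  funext n
  rw [neg_pow]

end
end WaterWaves

namespace WaterWaves
open Filter Topology FourierTransform
open scoped NNReal
noncomputable section

/-! ### Fourier multipliers that are bounded on the space of functions with integrable inverse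
Fourier transform -/

section Mult

set_option linter.unusedSectionVars false

variable {V : Type*} [NormedAddCommGroup V] [NormedSpace ℝ V] [FiniteDimensional ℝ V]
  [SecondCountableTopology V] [MeasureSpace V] [BorelSpace V] [(volume : Measure V).IsAddHaarMeasure]
  (P : V →L[ℝ] V →L[ℝ] ℝ)

/-- The character `exp(i P(x,p))`. -/
def ich (x p : V) : ℂ := Complex.exp (Complex.I * ((P x p : ℝ) : ℂ))

/-- The `L¹` norm of the inverse Fourier transform, up to a constant factor. -/
def lnorm (f : V → ℂ) : ℝ≥0∞ := ∫⁻ x, ‖∫ p, ich P x p * f p‖ₑ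

/-- Multiplication by `g` is bounded by `B` in the norm `lnorm`. -/
structure Mult (g : V → ℂ) (B : ℝ≥0) : Prop where
  cont : Continuous g
  bdd : ∀ ξ, ‖g ξ‖ ≤ B
  bound : ∀ f : V → ℂ, Continuous f → HasCompactSupport f →
    lnorm P (fun p => g p * f p) ≤ B * lnorm P f

/-- `Lt` is the adjoint of `L`. -/
structure Adj (L : V →L[ℝ] E) (Lt : E →L[ℝ] V) : Prop where
  eq : ∀ y ξ, P (Lt y) ξ = inner ℝ y (L ξ)

variable {P}

@[simp] lemma norm_ich (x p : V) : ‖ich P x p‖ = 1 := by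
  rw [ich, mul_comm, Complex.norm_exp_ofReal_mul_I]

lemma ich_continuous2 : Continuous fun q : V × V => ich P q.1 q.2 := by
  have h : Continuous fun q : V × V => P q.1 q.2 :=
    P.isBoundedBilinearMap.continuous
  unfold ich
  fun_prop

lemma ich_continuous (x : V) : Continuous (ich P x) :=
  ich_continuous2.comp (Continuous.prodMk_right x)

lemma ich_add_left (x y p : V) : ich P (x + y) p = ich P x p * ich P y p := by
  rw [ich, ich, ich, ← Complex.exp_add, map_add]
  congr 1
  rw [_root_.add_apply]
  push_cast
  ring

lemma Adj.smul {L : V →L[ℝ] E} {Lt : E →L[ℝ] V} (h : Adj P L Lt) (c : ℝ) :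
    Adj P (c • L) (c • Lt) := by
  refine ⟨fun y ξ => ?_⟩
  simp only [_root_.smul_apply, map_smul, h.eq, real_inner_smul_right, smul_eq_mul]

lemma Mult.mono {g : V → ℂ} {B C : ℝ≥0} (h : Mult P g B) (hBC : B ≤ C) : Mult P g C where
  cont := h.cont
  bdd ξ := (h.bdd ξ).trans (by exact_mod_cast hBC)
  bound f hf hc := (h.bound f hf hc).trans (by gcongr)

lemma Mult.congr {g g' : V → ℂ} {B : ℝ≥0} (h : Mult P g B) (hg : ∀ ξ, g' ξ = g ξ) :
    Mult P g' B := by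
  have : g' = g := funext hg
  rwa [this]

lemma mult_const (a : ℂ) : Mult P (fun _ => a) ‖a‖₊ where
  cont := continuous_const
  bdd ξ := by simp
  bound f hf hc := by
    apply le_of_eq
    rw [lnorm, lnorm, ← lintegral_const_mul' _ _ ENNReal.coe_ne_top]
    refine lintegral_congr fun x => ?_
    simp only [mul_left_comm _ a]
    rw [integral_const_mul, enorm_mul]
    rfl

lemma Mult.mul {g g' : V → ℂ} {B C : ℝ≥0} (h : Mult P g B) (h' : Mult P g' C) :
    Mult P (fun ξ => g ξ * g' ξ) (B * C) where
  cont := h.cont.mul h'.cont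
  bdd ξ := by
    rw [norm_mul, NNReal.coe_mul]
    exact mul_le_mul (h.bdd ξ) (h'.bdd ξ) (norm_nonneg _) B.2
  bound f hf hc := by
    have hk : HasCompactSupport fun p => g' p * f p := hc.mul_left
    calc lnorm P (fun p => g p * g' p * f p) = lnorm P (fun p => g p * (g' p * f p)) := by
          congr 1
          funext p
          exact mul_assoc _ _ _
      _ ≤ B * lnorm P (fun p => g' p * f p) :=
          h.bound (fun p => g' p * f p) (h'.cont.mul hf) hk
      _ ≤ B * (C * lnorm P f) := mul_le_mul_right (h'.bound f hf hc) _
      _ = ((B * C : ℝ≥0) : ℝ≥0∞) * lnorm P f := by rw [ENNReal.coe_mul, mul_assoc]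

lemma Mult.smul {g : V → ℂ} {B : ℝ≥0} (h : Mult P g B) (a : ℂ) :
    Mult P (fun ξ => a * g ξ) (‖a‖₊ * B) := (mult_const a).mul h

lemma ich_mul_integrable {f : V → ℂ} (hf : Continuous f) (hc : HasCompactSupport f) (x : V) :
    Integrable fun p => ich P x p * f p :=
  ((ich_continuous x).mul hf).integrable_of_hasCompactSupport hc.mul_left

lemma lnorm_stronglyMeasurable {Y : Type*} [MeasurableSpace Y] {g : Y → V → ℂ}
    (hg : StronglyMeasurable (Function.uncurry g)) :
    StronglyMeasurable fun q : V × Y => ∫ p, ich P q.1 p * g q.2 p := by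
  refine StronglyMeasurable.integral_prod_right (f := fun (q : V × Y) p => ich P q.1 p * g q.2 p) ?_
  have h0 : StronglyMeasurable fun q : V × V => ich P q.1 q.2 := ich_continuous2.stronglyMeasurable
  have h1 : StronglyMeasurable fun q : (V × Y) × V => ich P q.1.1 q.2 :=
    h0.comp_measurable (g := fun q : (V × Y) × V => (q.1.1, q.2)) (by fun_prop)
  have h2 : StronglyMeasurable fun q : (V × Y) × V => g q.1.2 q.2 :=
    hg.comp_measurable (by fun_prop : Measurable fun q : (V × Y) × V => (q.1.2, q.2))
  exact h1.mul h2

lemma measurable_lnorm_integrand {f : V → ℂ} (hf : Continuous f) :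
    Measurable fun x => ‖∫ p, ich P x p * f p‖ₑ := by
  have h := lnorm_stronglyMeasurable (P := P) (Y := Unit) (g := fun _ p => f p)
    (hf.stronglyMeasurable.comp_measurable measurable_snd)
  exact (h.comp_measurable (by fun_prop : Measurable fun x : V => (x, ()))).enorm

lemma Mult.add {g g' : V → ℂ} {B C : ℝ≥0} (h : Mult P g B) (h' : Mult P g' C) :
    Mult P (fun ξ => g ξ + g' ξ) (B + C) where
  cont := h.cont.add h'.cont
  bdd ξ := by
    rw [NNReal.coe_add]
    exact (norm_add_le _ _).trans (add_le_add (h.bdd ξ) (h'.bdd ξ))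
  bound f hf hc := by
    rw [ENNReal.coe_add, add_mul]
    refine le_trans ?_ (add_le_add (h.bound f hf hc) (h'.bound f hf hc))
    rw [lnorm, lnorm, lnorm, ← lintegral_add_left
      (measurable_lnorm_integrand (f := fun p => g p * f p) (h.cont.mul hf))]
    refine lintegral_mono fun x => ?_
    simp only [add_mul, mul_add]
    rw [integral_add (ich_mul_integrable (f := fun p => g p * f p) (h.cont.mul hf) hc.mul_left x)
      (ich_mul_integrable (f := fun p => g' p * f p) (h'.cont.mul hf) hc.mul_left x)]
    exact enorm_add_le _ _

lemma Mult.sub {g g' : V → ℂ} {B C : ℝ≥0} (h : Mult P g B) (h' : Mult P g' C) :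
    Mult P (fun ξ => g ξ - g' ξ) (B + C) := by
  have := h.add (h'.smul (-1))
  simpa [sub_eq_add_neg] using this

lemma mult_sum {ι : Type*} (s : Finset ι) {g : ι → V → ℂ} {B : ι → ℝ≥0}
    (h : ∀ i ∈ s, Mult P (g i) (B i)) : Mult P (fun ξ => ∑ i ∈ s, g i ξ) (∑ i ∈ s, B i) := by
  classical
  induction s using Finset.induction_on with
  | empty => simpa using mult_const (P := P) 0
  | insert i s hi ih =>
    simp only [Finset.sum_insert hi]
    exact (h i (by simp)).add (ih fun j hj => h j (by simp [hj]))

lemma mult_prod_one {ι : Type*} (s : Finset ι) {g : ι → V → ℂ} (h : ∀ i ∈ s, Mult P (g i) 1) :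
    Mult P (fun ξ => ∏ i ∈ s, g i ξ) 1 := by
  classical
  induction s using Finset.induction_on with
  | empty => simpa using mult_const (P := P) 1
  | insert i s hi ih =>
    simp only [Finset.prod_insert hi]
    simpa using (h i (by simp)).mul (ih fun j hj => h j (by simp [hj]))

lemma mult_ich (v : V) : Mult P (fun ξ => ich P v ξ) 1 where
  cont := ich_continuous v
  bdd ξ := by simp
  bound f hf hc := by
    rw [ENNReal.coe_one, one_mul]
    apply le_of_eq
    rw [lnorm, lnorm, ← lintegral_add_right_eq_self (fun x => ‖∫ p, ich P x p * f p‖ₑ) v]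
    refine lintegral_congr fun x => ?_
    simp only [ich_add_left, mul_assoc]

lemma mult_integral {Y : Type*} [MeasurableSpace Y] {ν : Measure Y} [SFinite ν] {g : Y → V → ℂ}
    (hm : StronglyMeasurable (Function.uncurry g)) {B : Y → ℝ≥0} (hBm : Measurable B)
    (hg : ∀ᵐ y ∂ν, Mult P (g y) (B y)) {B' : ℝ≥0} (hB : ∫⁻ y, B y ∂ν ≤ B') :
    Mult P (fun ξ => ∫ y, g y ξ ∂ν) B' := by
  have hBi : Integrable (fun y => (B y : ℝ)) ν := by
    refine ⟨by fun_prop, ?_⟩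
    rw [HasFiniteIntegral]
    refine lt_of_le_of_lt ?_ (hB.trans_lt ENNReal.coe_lt_top)
    refine lintegral_mono fun y => ?_
    simp
  have hsl : ∀ ξ, StronglyMeasurable fun y => g y ξ := fun ξ =>
    hm.comp_measurable (by fun_prop : Measurable fun y : Y => (y, ξ))
  refine ⟨?_, fun ξ => ?_, fun f hf hc => ?_⟩
  · refine continuous_of_dominated (F := fun ξ y => g y ξ) (bound := fun y => (B y : ℝ))
      (fun ξ => (hsl ξ).aestronglyMeasurable) (fun ξ => ?_) hBi ?_
    · filter_upwards [hg] with y hy using hy.bdd ξ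
    · filter_upwards [hg] with y hy using hy.cont
  · have h1 : ‖∫ y, g y ξ ∂ν‖ₑ ≤ B' := by
      refine (enorm_integral_le_lintegral_enorm _).trans (le_trans (lintegral_mono_ae ?_) hB)
      filter_upwards [hg] with y hy
      have := hy.bdd ξ
      rw [enorm_le_coe]
      exact_mod_cast this
    rw [enorm_le_coe] at h1
    exact_mod_cast h1
  · have hfi : Integrable f := hf.integrable_of_hasCompactSupport hc
    have hswap : ∀ x, ∫ p, ich P x p * ((∫ y, g y p ∂ν) * f p) =
        ∫ y, ∫ p, ich P x p * (g y p * f p) ∂volume ∂ν := by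
      intro x
      rw [← integral_integral_swap]
      · refine integral_congr_ae (Eventually.of_forall fun p => ?_)
        dsimp only
        rw [← integral_mul_const, ← integral_const_mul]
      · have hi : Integrable (fun q : V × Y => ‖f q.1‖ * (B q.2 : ℝ)) (volume.prod ν) :=
          hfi.norm.mul_prod hBi
        refine hi.mono' ?_ ?_
        · have h1 : StronglyMeasurable fun q : V × Y => ich P x q.1 :=
            (ich_continuous x).stronglyMeasurable.comp_measurable measurable_fst
          have h2 : StronglyMeasurable fun q : V × Y => g q.2 q.1 :=
            hm.comp_measurable measurable_swap
          have h3 : StronglyMeasurable fun q : V × Y => f q.1 :=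
            hf.stronglyMeasurable.comp_measurable measurable_fst
          exact (h1.mul (h2.mul h3)).aestronglyMeasurable
        · have : ∀ᵐ q ∂((volume : Measure V).prod ν), Mult P (g q.2) (B q.2) :=
            Measure.quasiMeasurePreserving_snd.ae hg
          filter_upwards [this] with q hq
          change ‖ich P x q.1 * (g q.2 q.1 * f q.1)‖ ≤ _
          rw [norm_mul, norm_ich, one_mul, norm_mul, mul_comm]
          gcongr
          exact hq.bdd _
    have hm' : StronglyMeasurable (Function.uncurry fun y p => g y p * f p) :=
      hm.mul (hf.stronglyMeasurable.comp_measurable measurable_snd)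
    calc lnorm P (fun p => (∫ y, g y p ∂ν) * f p)
        ≤ ∫⁻ x, ∫⁻ y, ‖∫ p, ich P x p * (g y p * f p)‖ₑ ∂ν := by
          refine lintegral_mono fun x => ?_
          rw [hswap]
          exact enorm_integral_le_lintegral_enorm _
      _ = ∫⁻ y, ∫⁻ x, ‖∫ p, ich P x p * (g y p * f p)‖ₑ ∂volume ∂ν := by
          refine lintegral_lintegral_swap ?_
          exact (lnorm_stronglyMeasurable hm').enorm.aemeasurable
      _ ≤ ∫⁻ y, B y * lnorm P f ∂ν := by
          refine lintegral_mono_ae ?_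
          filter_upwards [hg] with y hy using hy.bound f hf hc
      _ = (∫⁻ y, B y ∂ν) * lnorm P f := lintegral_mul_const _ (by fun_prop)
      _ ≤ _ := by gcongr

lemma mult_lim {g : ℕ → V → ℂ} {g' : V → ℂ} {B : ℝ≥0} (h : ∀ n, Mult P (g n) B)
    (hc : Continuous g') (hl : ∀ ξ, Tendsto (fun n => g n ξ) atTop (𝓝 (g' ξ))) :
    Mult P g' B where
  cont := hc
  bdd ξ := le_of_tendsto (hl ξ).norm (Eventually.of_forall fun n => (h n).bdd ξ)
  bound f hf hcs := by
    have hfi : Integrable f := hf.integrable_of_hasCompactSupport hcs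
    have h1 : ∀ x, Tendsto (fun n => ‖∫ p, ich P x p * (g n p * f p)‖ₑ) atTop
        (𝓝 ‖∫ p, ich P x p * (g' p * f p)‖ₑ) := by
      intro x
      refine Tendsto.enorm ?_
      refine tendsto_integral_of_dominated_convergence (fun p => B * ‖f p‖)
        (fun n => (ich_mul_integrable ((h n).cont.mul hf) hcs.mul_left x).aestronglyMeasurable)
        (hfi.norm.const_mul _) (fun n => Eventually.of_forall fun p => ?_)
        (Eventually.of_forall fun p => ?_)
      · rw [norm_mul, norm_ich, one_mul, norm_mul]
        gcongr
        exact (h n).bdd p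
      · exact ((hl p).mul_const _).const_mul _
    calc lnorm P (fun p => g' p * f p)
        = ∫⁻ x, liminf (fun n => ‖∫ p, ich P x p * (g n p * f p)‖ₑ) atTop := by
          refine lintegral_congr fun x => ?_
          rw [(h1 x).liminf_eq]
      _ ≤ liminf (fun n => lnorm P (fun p => g n p * f p)) atTop :=
          lintegral_liminf_le fun n => measurable_lnorm_integrand ((h n).cont.mul hf)
      _ ≤ liminf (fun _ : ℕ => B * lnorm P f) atTop :=
          liminf_le_liminf (Eventually.of_forall fun n => (h n).bound f hf hcs)
      _ = _ := liminf_const _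

lemma mult_hasSum {g : ℕ → V → ℂ} {g' : V → ℂ} {B : ℕ → ℝ≥0} {B' : ℝ≥0}
    (h : ∀ n, Mult P (g n) (B n)) (hB : HasSum B B') (hs : ∀ ξ, HasSum (fun n => g n ξ) (g' ξ)) :
    Mult P g' B' := by
  refine mult_lim (g := fun n ξ => ∑ i ∈ Finset.range n, g i ξ) (fun n => ?_) ?_
    fun ξ => (hs ξ).tendsto_sum_nat
  · exact (mult_sum _ fun i _ => h i).mono (sum_le_hasSum _ (fun _ _ => bot_le) hB)
  · have e : g' = fun ξ => ∑' n, g n ξ := funext fun ξ => (hs ξ).tsum_eq.symm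
    rw [e]
    refine continuous_tsum (u := fun n => (B n : ℝ)) (fun n => (h n).cont) ?_ fun n ξ => (h n).bdd ξ
    exact_mod_cast hB.summable

/-! #### Radial multipliers -/

variable {L : V →L[ℝ] E} {Lt : E →L[ℝ] V}

lemma Adj.ich_eq (h : Adj P L Lt) (y : E) (ξ : V) : ich P (Lt y) ξ = chr y (L ξ) := by
  rw [ich, h.eq, chr]

lemma mult_fourier (h : Adj P L Lt) {ρ : E → ℂ} (hρ : Continuous ρ) (hi : Integrable ρ) {B : ℝ≥0}
    (hB : ∫ y, ‖ρ y‖ ≤ B) : Mult P (fun ξ => ∫ y, ρ y * chr y (L ξ)) B := by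
  refine mult_integral (g := fun y ξ => ρ y * chr y (L ξ)) (B := fun y => ‖ρ y‖₊) ?_
    (by fun_prop) (Eventually.of_forall fun y => ?_) ?_
  · refine Continuous.stronglyMeasurable ?_
    exact (hρ.comp continuous_fst).mul (chr_continuous2.comp
      (by fun_prop : Continuous fun q : E × V => (q.1, L q.2)))
  · simp only [← h.ich_eq]
    simpa using (mult_ich (P := P) (Lt y)).smul (ρ y)
  · change ∫⁻ y, ‖ρ y‖ₑ ≤ _
    rw [← ofReal_integral_norm_eq_lintegral_enorm hi]
    refine ENNReal.ofReal_le_of_le_toReal ?_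
    simpa using hB

/-- The `L¹` norm of the Fourier transform of a test function. -/
def ftMass (φ : E → ℂ) : ℝ≥0 := (∫ w, ‖𝓕 φ w‖).toNNReal

lemma mult_test (h : Adj P L Lt) {φ : E → ℂ} (hφ : ContDiff ℝ ∞ φ) (hc : HasCompactSupport φ) :
    Mult P (fun ξ => φ (L ξ)) (ftMass φ) := by
  let S : SchwartzMap E ℂ := hc.toSchwartzMap hφ
  have hS : (S : E → ℂ) = φ := rfl
  have hF : 𝓕 φ = (𝓕 S : SchwartzMap E ℂ) := by rw [SchwartzMap.fourier_coe, hS]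
  have h1 := mult_fourier (h.smul (2 * Real.pi)) (ρ := 𝓕 φ) (B := ftMass φ)
    (by rw [hF]; exact (𝓕 S).continuous) (by rw [hF]; exact (𝓕 S).integrable) (Real.le_coe_toNNReal _)
  refine h1.congr fun ξ => ?_
  have h2 : φ (L ξ) = (𝓕⁻ (𝓕 S) : SchwartzMap E ℂ) (L ξ) := by
    rw [FourierTransform.fourierInv_fourier_eq]
    rfl
  rw [h2, SchwartzMap.fourierInv_coe, Real.fourierInv_eq, ← hF]
  refine integral_congr_ae (Eventually.of_forall fun y => ?_)
  simp only [Real.fourierChar_apply, Circle.smul_def, smul_eq_mul, chr, _root_.smul_apply,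
    real_inner_smul_right]
  rw [mul_comm]
  congr 2
  push_cast
  ring

lemma mult_gauss_one (h : Adj P L Lt) :
    Mult P (fun ξ => ((Real.exp (-‖L ξ‖ ^ 2) : ℝ) : ℂ)) 1 := by
  set ρ : E → ℂ := fun y => (4 * Real.pi : ℂ)⁻¹ * Complex.exp (-(1 / 4 : ℂ) * ‖y‖ ^ 2) with hρ
  have hb : 0 < (1 / 4 : ℂ).re := by norm_num
  have hpi : (Real.pi : ℂ) ≠ 0 := by exact_mod_cast Real.pi_ne_zero
  have key : ∀ (c : ℂ) (ζ : E), ∫ y, ρ y * Complex.exp (c * (inner ℝ ζ y : ℝ)) =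
      Complex.exp (c ^ 2 * ‖ζ‖ ^ 2) := by
    intro c ζ
    have := GaussianFourier.integral_cexp_neg_mul_sq_norm_add hb c ζ
    rw [finrank_euclideanSpace, Fintype.card_fin] at this
    simp only [hρ, mul_assoc]
    rw [integral_const_mul]
    simp only [← Complex.exp_add]
    rw [this]
    norm_num
    field_simp
  have hn : ∀ y, ‖ρ y‖ = (4 * Real.pi)⁻¹ * Real.exp (-(1 / 4) * ‖y‖ ^ 2) := by
    intro y
    rw [hρ]
    simp only [norm_mul, norm_inv, Complex.norm_exp]
    congr 1
    · simp [abs_of_pos Real.pi_pos]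
    · congr 1
      rw [← Complex.ofReal_pow, Complex.re_mul_ofReal]
      norm_num
  have hρn : ∀ y, ρ y = ((‖ρ y‖ : ℝ) : ℂ) := by
    intro y
    rw [hn, hρ]
    push_cast
    rfl
  have hint : Integrable ρ := by
    have := GaussianFourier.integrable_cexp_neg_mul_sq_norm_add hb 0 (0 : E)
    simp only [zero_mul, add_zero] at this
    exact this.const_mul _
  have hone : ∫ y, ‖ρ y‖ = 1 := by
    have h0 := key 0 0
    simp only [zero_mul, Complex.exp_zero, mul_one, ne_eq, OfNat.ofNat_ne_zero, not_false_eq_true,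
      zero_pow] at h0
    have h1 : ((∫ y, ‖ρ y‖ : ℝ) : ℂ) = 1 := by
      rw [← integral_complex_ofReal, ← h0]
      exact integral_congr_ae (Eventually.of_forall fun y => (hρn y).symm)
    exact_mod_cast h1
  have h1 := mult_fourier h (ρ := ρ) (B := 1) (by rw [hρ]; fun_prop) hint (by rw [hone]; simp)
  refine h1.congr fun ξ => ?_
  have h2 := key Complex.I (L ξ)
  rw [Complex.I_sq] at h2
  push_cast
  rw [show -((‖L ξ‖ : ℝ) : ℂ) ^ 2 = -1 * ((‖L ξ‖ : ℝ) : ℂ) ^ 2 by ring, ← h2]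
  refine integral_congr_ae (Eventually.of_forall fun y => ?_)
  simp only [chr]
  rw [real_inner_comm]

lemma mult_gauss (h : Adj P L Lt) {u : ℝ} (hu : 0 ≤ u) :
    Mult P (fun ξ => ((Real.exp (-(u * ‖L ξ‖ ^ 2)) : ℝ) : ℂ)) 1 := by
  refine (mult_gauss_one (h.smul √u)).congr fun ξ => ?_
  rw [_root_.smul_apply, norm_smul, mul_pow, Real.norm_of_nonneg (Real.sqrt_nonneg u),
    Real.sq_sqrt hu]

lemma mult_resolvent (h : Adj P L Lt) {c : ℝ} (hc : 0 ≤ c) :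
    Mult P (fun ξ => ((1 / (1 + c * ‖L ξ‖ ^ 2) : ℝ) : ℂ)) 1 := by
  have h1 := mult_integral (P := P) (ν := volume.restrict (Ioi (0 : ℝ)))
    (g := fun (t : ℝ) ξ => ((Real.exp (-t) : ℝ) : ℂ) * ((Real.exp (-((t * c) * ‖L ξ‖ ^ 2)) : ℝ) : ℂ))
    (B := fun t => ‖((Real.exp (-t) : ℝ) : ℂ)‖₊ * 1) (B' := 1) ?_ (by fun_prop) ?_ ?_
  · refine h1.congr fun ξ => ?_
    have hp : 0 < 1 + c * ‖L ξ‖ ^ 2 := by positivity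
    have h2 := integral_exp_mul_Ioi (a := -(1 + c * ‖L ξ‖ ^ 2)) (by linarith) 0
    rw [mul_zero, Real.exp_zero] at h2
    have h3 : (1 / (1 + c * ‖L ξ‖ ^ 2) : ℝ) = -1 / -(1 + c * ‖L ξ‖ ^ 2) := by rw [neg_div_neg_eq]
    rw [h3, ← h2, ← integral_complex_ofReal]
    refine integral_congr_ae (Eventually.of_forall fun t => ?_)
    dsimp only
    rw [← Complex.ofReal_mul, ← Real.exp_add]
    congr 2
    ring
  · refine Continuous.stronglyMeasurable ?_
    simp only [Function.uncurry_def]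
    fun_prop
  · refine (ae_restrict_iff' measurableSet_Ioi).2 (Eventually.of_forall fun t ht => ?_)
    exact (mult_gauss h (u := t * c) (mul_nonneg (le_of_lt ht) hc)).smul ((Real.exp (-t) : ℝ) : ℂ)
  · simp only [mul_one]
    have h2 : ∫⁻ t in Ioi (0 : ℝ), ENNReal.ofReal (Real.exp (-t)) = 1 := by
      rw [← ofReal_integral_eq_lintegral_ofReal (integrableOn_exp_neg_Ioi 0)
        (Eventually.of_forall fun t => (Real.exp_pos _).le), integral_exp_neg_Ioi_zero,
        ENNReal.ofReal_one]
    rw [ENNReal.coe_one, ← h2]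
    refine lintegral_mono fun t => ?_
    change ‖((Real.exp (-t) : ℝ) : ℂ)‖ₑ ≤ _
    rw [← ofReal_norm, Complex.norm_real, Real.norm_of_nonneg (Real.exp_pos _).le]

lemma mult_ratio (h : Adj P L Lt) {c a : ℝ} (hc : 0 ≤ c) (ha0 : 0 ≤ a) (ha : a ≤ 1) :
    Mult P (fun ξ => (((1 + a ^ 2 * c * ‖L ξ‖ ^ 2) / (1 + c * ‖L ξ‖ ^ 2) : ℝ) : ℂ)) 1 := by
  have ha2 : a ^ 2 ≤ 1 := pow_le_one₀ ha0 ha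
  have h1 := (mult_const (P := P) ((a ^ 2 : ℝ) : ℂ)).add
    ((mult_resolvent h hc).smul ((1 - a ^ 2 : ℝ) : ℂ))
  have e : ‖((a ^ 2 : ℝ) : ℂ)‖₊ + ‖((1 - a ^ 2 : ℝ) : ℂ)‖₊ * 1 = 1 := by
    ext
    simp only [NNReal.coe_add, NNReal.coe_mul, coe_nnnorm, Complex.norm_real]
    rw [Real.norm_of_nonneg (by positivity), Real.norm_of_nonneg (by linarith)]
    simp
  rw [e] at h1
  refine h1.congr fun ξ => ?_
  have hp : 1 + c * ‖L ξ‖ ^ 2 ≠ 0 := by positivity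
  rw [← Complex.ofReal_mul, ← Complex.ofReal_add]
  congr 1
  field_simp
  ring

end Mult
end
end WaterWaves

namespace WaterWaves
open Filter Topology FourierTransform
open scoped NNReal
noncomputable section

/-! ### Hyperbolic multipliers -/

lemma tendsto_sinh_prod (x : ℝ) :
    Tendsto (fun n : ℕ => Real.pi * x * ∏ j ∈ Finset.range n, (1 + x ^ 2 / ((j : ℝ) + 1) ^ 2)) atTop
      (𝓝 (Real.sinh (Real.pi * x))) := by
  have h := (Complex.tendsto_euler_sin_prod (x * Complex.I)).const_mul (-Complex.I)
  have h1 := (Complex.continuous_re.tendsto _).comp h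
  have e1 : (-Complex.I * Complex.sin (Real.pi * (x * Complex.I))).re = Real.sinh (Real.pi * x) := by
    rw [← mul_assoc, Complex.sin_mul_I, mul_left_comm, ← mul_assoc]
    rw [show Complex.sinh (Real.pi * x) * -Complex.I * Complex.I = Complex.sinh (Real.pi * x) by
      rw [mul_assoc, neg_mul, Complex.I_mul_I]; ring]
    rw [← Complex.ofReal_mul, ← Complex.ofReal_sinh, Complex.ofReal_re]
  rw [e1] at h1
  refine h1.congr fun n => ?_
  simp only [Function.comp_apply]
  have e2 : ∀ j : ℕ, (1 - (x * Complex.I : ℂ) ^ 2 / ((j : ℂ) + 1) ^ 2) =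
      ((1 + x ^ 2 / ((j : ℝ) + 1) ^ 2 : ℝ) : ℂ) := by
    intro j
    rw [mul_pow, Complex.I_sq]
    push_cast
    ring
  simp only [e2]
  rw [← Complex.ofReal_prod]
  rw [show ∀ y : ℝ, -Complex.I * ((Real.pi : ℂ) * (x * Complex.I) * (y : ℂ)) =
    ((Real.pi * x * y : ℝ) : ℂ) from fun y => by
      push_cast
      linear_combination (-(Real.pi : ℂ) * x * y) * Complex.I_mul_I]
  rw [Complex.ofReal_re]

lemma tendsto_sinh_ratio {b R : ℝ} (hR : 0 < R) :
    Tendsto (fun n : ℕ => b * ∏ j ∈ Finset.range n,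
      ((1 + b ^ 2 * (1 / (Real.pi * ((j : ℝ) + 1)) ^ 2) * R ^ 2) /
        (1 + 1 / (Real.pi * ((j : ℝ) + 1)) ^ 2 * R ^ 2))) atTop
      (𝓝 (Real.sinh (b * R) / Real.sinh R)) := by
  have hpi := Real.pi_pos
  have h1 := tendsto_sinh_prod (b * (R / Real.pi))
  have h2 := tendsto_sinh_prod (R / Real.pi)
  have e1 : Real.pi * (b * (R / Real.pi)) = b * R := by field_simp
  have e2 : Real.pi * (R / Real.pi) = R := by field_simp
  rw [e1] at h1
  rw [e2] at h2
  have hs : Real.sinh R ≠ 0 := (Real.sinh_pos_iff.2 hR).ne'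
  refine (h1.div h2 hs).congr fun n => ?_
  rw [Finset.prod_div_distrib, Pi.div_apply]
  have hp : (∏ j ∈ Finset.range n, (1 + (R / Real.pi) ^ 2 / ((j : ℝ) + 1) ^ 2)) ≠ 0 :=
    Finset.prod_ne_zero_iff.2 fun j _ => by positivity
  have e3 : ∀ j : ℕ, (1 + b ^ 2 * (1 / (Real.pi * ((j : ℝ) + 1)) ^ 2) * R ^ 2) =
      (1 + (b * (R / Real.pi)) ^ 2 / ((j : ℝ) + 1) ^ 2) := fun j => by
    field_simp
  have e4 : ∀ j : ℕ, (1 + 1 / (Real.pi * ((j : ℝ) + 1)) ^ 2 * R ^ 2) =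
      (1 + (R / Real.pi) ^ 2 / ((j : ℝ) + 1) ^ 2) := fun j => by
    field_simp
  simp only [e3, e4]
  field_simp

/-- `π t coth(π t)`, by its partial fraction expansion. -/
def kco (t : ℝ) : ℝ := 1 + ∑' n : ℕ, 2 * t ^ 2 / (t ^ 2 + ((n : ℝ) + 1) ^ 2)

lemma summable_kco (t : ℝ) : Summable fun n : ℕ => 2 * t ^ 2 / (t ^ 2 + ((n : ℝ) + 1) ^ 2) := by
  have h1 : Summable fun n : ℕ => 1 / ((n : ℝ) + 1) ^ 2 := by
    have := (summable_nat_add_iff 1).2 (Real.summable_one_div_nat_pow.2 (show 1 < 2 by norm_num))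
    exact_mod_cast this
  refine Summable.of_nonneg_of_le (fun n => by positivity) (fun n => ?_) (h1.mul_left (2 * t ^ 2))
  rw [mul_one_div]
  gcongr
  nlinarith [sq_nonneg t]

lemma kco_eq {t : ℝ} (ht : 0 < t) :
    kco t = Real.pi * t * (Real.cosh (Real.pi * t) / Real.sinh (Real.pi * t)) := by
  have hx : (t * Complex.I : ℂ) ∈ Complex.integerComplement := by
    rintro ⟨n, hn⟩
    have := congrArg Complex.im hn
    simp at this
    exact ht.ne' this.symm
  have h := cot_series_rep' hx
  have hs : Real.sinh (Real.pi * t) ≠ 0 := (Real.sinh_pos_iff.2 (by positivity)).ne'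
  have hsC : Complex.sinh (Real.pi * t) ≠ 0 := by
    rw [← Complex.ofReal_mul, ← Complex.ofReal_sinh]
    exact_mod_cast hs
  have htC : (t : ℂ) ≠ 0 := by exact_mod_cast ht.ne'
  have e1 : (Real.pi * (t * Complex.I : ℂ)).cot =
      -Complex.I * (Complex.cosh (Real.pi * t) / Complex.sinh (Real.pi * t)) := by
    rw [← mul_assoc, Complex.cot, Complex.cos_mul_I, Complex.sin_mul_I]
    field_simp
    rw [Complex.I_sq]
    ring
  have e2 : ∀ n : ℕ, (1 / ((t * Complex.I : ℂ) - ((n : ℂ) + 1)) + 1 / (t * Complex.I + ((n : ℂ) + 1)))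
      = (-Complex.I / t) * ((2 * t ^ 2 / (t ^ 2 + ((n : ℝ) + 1) ^ 2) : ℝ) : ℂ) := by
    intro n
    have h1 : (t * Complex.I : ℂ) - ((n : ℂ) + 1) ≠ 0 := fun h0 => by
      have := congrArg Complex.im h0
      simp at this
      exact ht.ne' this
    have h2 : (t * Complex.I : ℂ) + ((n : ℂ) + 1) ≠ 0 := fun h0 => by
      have := congrArg Complex.im h0
      simp at this
      exact ht.ne' this
    have h3 : ((t : ℂ) ^ 2 + ((n : ℂ) + 1) ^ 2) ≠ 0 := by
      have : (0 : ℝ) < t ^ 2 + ((n : ℝ) + 1) ^ 2 := by positivity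
      exact_mod_cast this.ne'
    push_cast
    field_simp
    linear_combination ((2 : ℂ) * t ^ 3 * Complex.I) * Complex.I_sq
  simp only [e2, e1] at h
  rw [tsum_mul_left, ← Complex.ofReal_tsum] at h
  have h4 : ((kco t : ℝ) : ℂ) =
      ((Real.pi * t * (Real.cosh (Real.pi * t) / Real.sinh (Real.pi * t)) : ℝ) : ℂ) := by
    rw [kco]
    push_cast at h ⊢
    have h5 := congrArg (fun w => w * (t * Complex.I)) h
    have h6 : ∀ w : ℂ, -Complex.I / t * w * (t * Complex.I) = w := by
      intro w
      field_simp
      rw [Complex.I_sq]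
      ring
    rw [h6] at h5
    rw [← h5]
    field_simp
    linear_combination (-(Real.pi : ℂ) * t * Complex.cosh (Real.pi * t)) * Complex.I_sq
  exact_mod_cast h4

lemma kco_sub_one_le {X : ℝ} (hX : 0 < X) :
    ∑' n : ℕ, 2 * X ^ 2 / (X ^ 2 + ((n : ℝ) + 1) ^ 2) ≤ Real.pi * X := by
  have h := kco_eq hX
  rw [kco] at h
  set y := Real.pi * X with hy
  have hy0 : 0 < y := by positivity
  have hs : 0 < Real.sinh y := Real.sinh_pos_iff.2 hy0
  have h1 : y * (Real.cosh y / Real.sinh y) ≤ 1 + y := by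
    rw [mul_div_assoc', div_le_iff₀ hs]
    have h2 : Real.cosh y = Real.sinh y + Real.exp (-y) := by
      rw [Real.cosh_eq, Real.sinh_eq]; ring
    have h3 : Real.exp (-y) ≤ 1 := Real.exp_le_one_iff.2 (by linarith)
    have h4 : y ≤ Real.sinh y := Real.self_le_sinh_iff.2 hy0.le
    rw [h2]
    nlinarith
  linarith

lemma r_sinh_eq {a r : ℝ} (hr : 0 ≤ r) :
    r * Real.sinh (a * r) / Real.cosh r = 1 / 2 * kco (2 / Real.pi * r) *
      (Real.cosh ((1 + a) / 2 * (2 * r)) / Real.cosh (2 * r)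
        - Real.cosh ((1 - a) / 2 * (2 * r)) / Real.cosh (2 * r)) := by
  rcases hr.eq_or_lt with rfl | hr
  · simp
  · have hpi := Real.pi_pos
    rw [kco_eq (by positivity)]
    have e1 : Real.pi * (2 / Real.pi * r) = 2 * r := by field_simp
    rw [e1]
    have hs : Real.sinh r ≠ 0 := (Real.sinh_pos_iff.2 hr).ne'
    have hc : Real.cosh r ≠ 0 := (Real.cosh_pos r).ne'
    have hc2 : Real.cosh (2 * r) ≠ 0 := (Real.cosh_pos _).ne'
    have hs2 : Real.sinh (2 * r) = 2 * Real.sinh r * Real.cosh r := Real.sinh_two_mul r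
    have e2 : Real.cosh ((1 + a) / 2 * (2 * r)) =
        Real.cosh r * Real.cosh (a * r) + Real.sinh r * Real.sinh (a * r) := by
      rw [← Real.cosh_add]; congr 1; ring
    have e3 : Real.cosh ((1 - a) / 2 * (2 * r)) =
        Real.cosh r * Real.cosh (a * r) - Real.sinh r * Real.sinh (a * r) := by
      rw [← Real.cosh_sub]; congr 1; ring
    rw [e2, e3, hs2]
    field_simp
    ring

section Mult

set_option linter.unusedSectionVars false

variable {V : Type*} [NormedAddCommGroup V] [NormedSpace ℝ V] [FiniteDimensional ℝ V]
  [SecondCountableTopology V] [MeasureSpace V] [BorelSpace V] [(volume : Measure V).IsAddHaarMeasure]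
  {P : V →L[ℝ] V →L[ℝ] ℝ} {L : V →L[ℝ] E} {Lt : E →L[ℝ] V}

lemma mult_cosh (h : Adj P L Lt) {a : ℝ} (ha : |a| ≤ 1) :
    Mult P (fun ξ => ((Real.cosh (a * ‖L ξ‖) / Real.cosh ‖L ξ‖ : ℝ) : ℂ)) 1 := by
  wlog ha0 : 0 ≤ a generalizing a
  · have := this (a := -a) (by rwa [abs_neg]) (by linarith)
    simpa only [neg_mul, Real.cosh_neg] using this
  rw [abs_of_nonneg ha0] at ha
  have hpi := Real.pi_pos
  -- finite products
  have hfac : ∀ (b : ℝ), 0 ≤ b → b ≤ 1 → ∀ n : ℕ, Mult P (fun ξ => (b : ℂ) *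
      ∏ j ∈ Finset.range n, ((((1 + b ^ 2 * (1 / (Real.pi * ((j : ℝ) + 1)) ^ 2) * ‖((2 : ℝ) • L) ξ‖ ^ 2) /
        (1 + 1 / (Real.pi * ((j : ℝ) + 1)) ^ 2 * ‖((2 : ℝ) • L) ξ‖ ^ 2)) : ℝ) : ℂ)) (‖(b : ℂ)‖₊ * 1) := by
    intro b hb0 hb n
    exact (mult_prod_one _ fun j _ => mult_ratio (h.smul 2) (by positivity) hb0 hb).smul b
  refine mult_lim (B := 1) (g := fun n ξ => ((((1 + a) / 2 : ℝ) : ℂ) *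
      ∏ j ∈ Finset.range n, ((((1 + ((1 + a) / 2) ^ 2 * (1 / (Real.pi * ((j : ℝ) + 1)) ^ 2) *
        ‖((2 : ℝ) • L) ξ‖ ^ 2) /
        (1 + 1 / (Real.pi * ((j : ℝ) + 1)) ^ 2 * ‖((2 : ℝ) • L) ξ‖ ^ 2)) : ℝ) : ℂ)) +
      ((((1 - a) / 2 : ℝ) : ℂ) *
      ∏ j ∈ Finset.range n, ((((1 + ((1 - a) / 2) ^ 2 * (1 / (Real.pi * ((j : ℝ) + 1)) ^ 2) *
        ‖((2 : ℝ) • L) ξ‖ ^ 2) /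
        (1 + 1 / (Real.pi * ((j : ℝ) + 1)) ^ 2 * ‖((2 : ℝ) • L) ξ‖ ^ 2)) : ℝ) : ℂ)))
      (fun n => ?_) ?_ fun ξ => ?_
  · refine ((hfac ((1 + a) / 2) (by linarith) (by linarith) n).add
      (hfac ((1 - a) / 2) (by linarith) (by linarith) n)).mono (le_of_eq ?_)
    ext
    simp only [NNReal.coe_add, NNReal.coe_mul, coe_nnnorm, Complex.norm_real]
    rw [Real.norm_of_nonneg (by linarith), Real.norm_of_nonneg (by linarith)]
    ring
  · refine Complex.continuous_ofReal.comp ?_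
    exact (Real.continuous_cosh.comp (by fun_prop)).div (Real.continuous_cosh.comp (by fun_prop))
      fun ξ => (Real.cosh_pos _).ne'
  · rcases (norm_nonneg (L ξ)).eq_or_lt with h0 | h0
    · have h1 : ‖((2 : ℝ) • L) ξ‖ = 0 := by
        rw [_root_.smul_apply, norm_smul, ← h0, mul_zero]
      rw [← h0]
      simp only [h1]
      simp only [ne_eq, OfNat.ofNat_ne_zero, not_false_eq_true, zero_pow, mul_zero, add_zero,
        div_one, Complex.ofReal_one, Finset.prod_const_one, mul_one, Real.cosh_zero]
      rw [← Complex.ofReal_add, show (1 + a) / 2 + (1 - a) / 2 = 1 by ring]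
      exact tendsto_const_nhds
    · have h1 : ‖((2 : ℝ) • L) ξ‖ = 2 * ‖L ξ‖ := by
        rw [_root_.smul_apply, norm_smul, Real.norm_of_nonneg (by norm_num)]
      simp only [h1]
      set r := ‖L ξ‖
      have t1 := tendsto_sinh_ratio (b := (1 + a) / 2) (R := 2 * r) (by positivity)
      have t2 := tendsto_sinh_ratio (b := (1 - a) / 2) (R := 2 * r) (by positivity)
      have t3 := (Complex.continuous_ofReal.tendsto _).comp (t1.add t2)
      have hs : Real.sinh r ≠ 0 := (Real.sinh_pos_iff.2 h0).ne'
      have hc : Real.cosh r ≠ 0 := (Real.cosh_pos r).ne'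
      have e0 : Real.sinh ((1 + a) / 2 * (2 * r)) / Real.sinh (2 * r) +
          Real.sinh ((1 - a) / 2 * (2 * r)) / Real.sinh (2 * r) =
          Real.cosh (a * r) / Real.cosh r := by
        rw [show (1 + a) / 2 * (2 * r) = r + a * r by ring,
          show (1 - a) / 2 * (2 * r) = r - a * r by ring, Real.sinh_two_mul, Real.sinh_add,
          Real.sinh_sub]
        field_simp
        ring
      rw [e0] at t3
      refine t3.congr fun n => ?_
      simp only [Function.comp_apply]
      rw [Complex.ofReal_add, Complex.ofReal_mul, Complex.ofReal_mul, Complex.ofReal_prod,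
        Complex.ofReal_prod]

/-! #### Cutoffs -/

variable {χ : ℝ → ℝ}

/-- The cutoff to `|ζ| ≲ 1`. -/
def phi0 (χ : ℝ → ℝ) (ζ : E) : ℂ := ((χ ‖ζ‖ : ℝ) : ℂ)

/-- The cutoff to `|ζ| ≲ 1`, times a coordinate. -/
def phi1 (χ : ℝ → ℝ) (i : Fin 2) (ζ : E) : ℂ := ((ζ i * χ ‖ζ‖ : ℝ) : ℂ)

/-- The cutoff to `|ζ| ≲ 1`, times `|ζ|²`. -/
def phi2 (χ : ℝ → ℝ) (ζ : E) : ℂ := ((‖ζ‖ ^ 2 * χ ‖ζ‖ : ℝ) : ℂ)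

/-- The cutoff to `|ζ| ~ 1`. -/
def phi3 (χ : ℝ → ℝ) (ζ : E) : ℂ := ((χ ‖ζ‖ - χ (2 * ‖ζ‖) : ℝ) : ℂ)

/-- The cutoff to `|ζ| ~ 1`, times a homogeneous function of degree `0`. -/
def phi4 (χ : ℝ → ℝ) (i j : Fin 2) (ζ : E) : ℂ :=
  (((χ ‖ζ‖ - χ (2 * ‖ζ‖)) * (ζ i * ζ j / ‖ζ‖ ^ 2) : ℝ) : ℂ)

lemma IsCutoff.contDiff_comp_norm (hχ : IsCutoff χ) {c : ℝ} :
    ContDiff ℝ ∞ fun ζ : E => χ (c * ‖ζ‖) := by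
  rw [contDiff_iff_contDiffAt]
  intro ζ
  by_cases h0 : ζ = 0
  · have : (fun ζ : E => χ (c * ‖ζ‖)) =ᶠ[𝓝 ζ] fun _ => 1 := by
      have hc : Continuous fun ζ : E => |c * ‖ζ‖| := by fun_prop
      have := (hc.tendsto ζ).eventually_lt_const (show |c * ‖ζ‖| < 5 / 4 by rw [h0]; norm_num)
      filter_upwards [this] with η hη
      exact hχ.eq_one _ ⟨by linarith [(abs_lt.1 hη).1], (abs_lt.1 hη).2.le⟩
    exact contDiffAt_const.congr_of_eventuallyEq this
  · exact hχ.smooth.contDiffAt.comp ζ (contDiffAt_const.mul (contDiffAt_norm ℝ h0))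

lemma IsCutoff.eq_zero (hχ : IsCutoff χ) {r : ℝ} (hr : 3 / 2 < r) : χ r = 0 := by
  by_contra h
  have := hχ.support h
  linarith [this.2]

lemma IsCutoff.compact (hχ : IsCutoff χ) {f : E → ℂ} (hf : ∀ ζ : E, 3 / 2 < ‖ζ‖ → f ζ = 0) :
    HasCompactSupport f := by
  refine HasCompactSupport.intro (isCompact_closedBall (0 : E) (3 / 2)) fun ζ hζ => hf ζ ?_
  simpa using hζ

lemma contDiff_coord (i : Fin 2) : ContDiff ℝ ∞ fun ζ : E => ζ i := by fun_prop

lemma IsCutoff.phi0 (hχ : IsCutoff χ) : ContDiff ℝ ∞ (phi0 χ) ∧ HasCompactSupport (phi0 χ) := by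
  have h1 := hχ.contDiff_comp_norm (c := 1)
  simp only [one_mul] at h1
  refine ⟨Complex.ofRealCLM.contDiff.comp h1, hχ.compact fun ζ hζ => ?_⟩
  simp [WaterWaves.phi0, hχ.eq_zero hζ]

lemma IsCutoff.phi1 (hχ : IsCutoff χ) (i : Fin 2) :
    ContDiff ℝ ∞ (phi1 χ i) ∧ HasCompactSupport (phi1 χ i) := by
  have h1 := hχ.contDiff_comp_norm (c := 1)
  simp only [one_mul] at h1
  refine ⟨Complex.ofRealCLM.contDiff.comp ((contDiff_coord i).mul h1), hχ.compact fun ζ hζ => ?_⟩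
  simp [WaterWaves.phi1, hχ.eq_zero hζ]

lemma IsCutoff.phi2 (hχ : IsCutoff χ) : ContDiff ℝ ∞ (phi2 χ) ∧ HasCompactSupport (phi2 χ) := by
  have h1 := hχ.contDiff_comp_norm (c := 1)
  simp only [one_mul] at h1
  refine ⟨Complex.ofRealCLM.contDiff.comp ((contDiff_norm_sq ℝ).mul h1), hχ.compact fun ζ hζ => ?_⟩
  simp [WaterWaves.phi2, hχ.eq_zero hζ]

lemma IsCutoff.phi3 (hχ : IsCutoff χ) : ContDiff ℝ ∞ (phi3 χ) ∧ HasCompactSupport (phi3 χ) := by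
  have h1 := hχ.contDiff_comp_norm (c := 1)
  simp only [one_mul] at h1
  refine ⟨Complex.ofRealCLM.contDiff.comp (h1.sub hχ.contDiff_comp_norm),
    hχ.compact fun ζ hζ => ?_⟩
  simp [WaterWaves.phi3, hχ.eq_zero hζ, hχ.eq_zero (r := 2 * ‖ζ‖) (by linarith)]

lemma IsCutoff.phi4 (hχ : IsCutoff χ) (i j : Fin 2) :
    ContDiff ℝ ∞ (phi4 χ i j) ∧ HasCompactSupport (phi4 χ i j) := by
  have h1 := hχ.contDiff_comp_norm (c := 1)
  simp only [one_mul] at h1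
  refine ⟨Complex.ofRealCLM.contDiff.comp ?_, hχ.compact fun ζ hζ => ?_⟩
  · rw [contDiff_iff_contDiffAt]
    intro ζ
    by_cases h0 : ζ = 0
    · have : (fun ζ : E => (χ ‖ζ‖ - χ (2 * ‖ζ‖)) * (ζ i * ζ j / ‖ζ‖ ^ 2)) =ᶠ[𝓝 ζ] fun _ => 0 := by
        have := (continuous_norm.tendsto ζ).eventually_lt_const
          (show ‖ζ‖ < 5 / 8 by rw [h0]; norm_num)
        filter_upwards [this] with η hη
        have hn := norm_nonneg η
        rw [hχ.eq_one _ ⟨by linarith, by linarith⟩, hχ.eq_one _ ⟨by linarith, by linarith⟩]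
        simp
      exact contDiffAt_const.congr_of_eventuallyEq this
    · refine ((h1.sub hχ.contDiff_comp_norm).contDiffAt).mul
        ((((contDiff_coord i).mul (contDiff_coord j)).contDiffAt).div
          (contDiff_norm_sq ℝ).contDiffAt ?_)
      simpa using h0
  · simp [WaterWaves.phi4, hχ.eq_zero hζ, hχ.eq_zero (r := 2 * ‖ζ‖) (by linarith)]

/-- A constant that depends only on the cutoff function. -/
def cst (χ : ℝ → ℝ) : ℝ≥0 :=
  1 + ftMass (phi0 χ) + ∑ i, ftMass (phi1 χ i) + ftMass (phi2 χ) + ∑ i, ∑ j, ftMass (phi4 χ i j)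

lemma cst_0 : ftMass (phi0 χ) ≤ cst χ := by
  rw [cst]
  exact le_add_right (le_add_right (le_add_right le_add_self))

lemma cst_1 (i : Fin 2) : ftMass (phi1 χ i) ≤ cst χ := by
  rw [cst]
  refine le_add_right (le_add_right (le_add_left ?_))
  exact Finset.single_le_sum (f := fun i => ftMass (phi1 χ i)) (fun _ _ => bot_le) (Finset.mem_univ i)

lemma cst_2 : ftMass (phi2 χ) ≤ cst χ := by
  rw [cst]
  exact le_add_right le_add_self

lemma cst_4 (i j : Fin 2) : ftMass (phi4 χ i j) ≤ cst χ := by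
  rw [cst]
  refine le_add_left ?_
  exact (Finset.single_le_sum (f := fun j => ftMass (phi4 χ i j)) (fun _ _ => bot_le)
    (Finset.mem_univ j)).trans (Finset.single_le_sum (f := fun i => ∑ j, ftMass (phi4 χ i j))
    (fun _ _ => bot_le) (Finset.mem_univ i))

/-- The cutoff to frequencies of size at most about `2^N`. -/
def cut (χ : ℝ → ℝ) (N : ℤ) (ζ : E) : ℝ := χ (‖ζ‖ / 2 ^ N)

lemma norm_smul_two_zpow (N : ℤ) (ζ : E) : ‖((2 : ℝ) ^ (-N)) • ζ‖ = ‖ζ‖ / 2 ^ N := by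
  rw [norm_smul, Real.norm_of_nonneg (by positivity), zpow_neg]
  field_simp

lemma mult_cut (hχ : IsCutoff χ) (h : Adj P L Lt) (N : ℤ) :
    Mult P (fun ξ => ((cut χ N (L ξ) : ℝ) : ℂ)) (cst χ) := by
  refine ((mult_test (h.smul ((2 : ℝ) ^ (-N))) hχ.phi0.1 hχ.phi0.2).mono cst_0).congr fun ξ => ?_
  rw [phi0, _root_.smul_apply, norm_smul_two_zpow, cut]

lemma mult_coord (hχ : IsCutoff χ) (h : Adj P L Lt) (N : ℤ) (i : Fin 2) :
    Mult P (fun ξ => (((L ξ) i * cut χ N (L ξ) : ℝ) : ℂ)) (2 ^ N * cst χ) := by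
  refine (((mult_test (h.smul ((2 : ℝ) ^ (-N))) (hχ.phi1 i).1 (hχ.phi1 i).2).mono (cst_1 i)).smul
    (((2 : ℝ) ^ N : ℝ) : ℂ)).mono (le_of_eq ?_) |>.congr fun ξ => ?_
  · congr 1
    ext
    rw [coe_nnnorm, Complex.norm_real, Real.norm_of_nonneg (by positivity)]
    simp
  · rw [phi1, _root_.smul_apply, norm_smul_two_zpow, cut, ← Complex.ofReal_mul]
    congr 1
    rw [PiLp.smul_apply, smul_eq_mul, zpow_neg]
    have : (2 : ℝ) ^ N ≠ 0 := by positivity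
    field_simp

lemma mult_normsq (hχ : IsCutoff χ) (h : Adj P L Lt) (N : ℤ) :
    Mult P (fun ξ => ((‖L ξ‖ ^ 2 * cut χ N (L ξ) : ℝ) : ℂ)) ((2 ^ N) ^ 2 * cst χ) := by
  refine (((mult_test (h.smul ((2 : ℝ) ^ (-N))) hχ.phi2.1 hχ.phi2.2).mono cst_2).smul
    ((((2 : ℝ) ^ N) ^ 2 : ℝ) : ℂ)).mono (le_of_eq ?_) |>.congr fun ξ => ?_
  · congr 1
    ext
    rw [coe_nnnorm, Complex.norm_real, Real.norm_of_nonneg (by positivity)]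
    simp
  · rw [phi2, _root_.smul_apply, norm_smul_two_zpow, cut, ← Complex.ofReal_mul]
    congr 1
    have : (2 : ℝ) ^ N ≠ 0 := by positivity
    field_simp

lemma dyadic_eq (χ : ℝ → ℝ) (k : ℤ) (ζ : E) : dyadic χ k ζ = χ (‖((2 : ℝ) ^ (-k)) • ζ‖) -
    χ (2 * ‖((2 : ℝ) ^ (-k)) • ζ‖) := by
  rw [dyadic, norm_smul_two_zpow]
  congr 2
  rw [zpow_sub_one₀ (by norm_num)]
  field_simp

lemma mult_riesz (hχ : IsCutoff χ) (h : Adj P L Lt) (k : ℤ) (i j : Fin 2) :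
    Mult P (fun ξ => ((dyadic χ k (L ξ) * ((L ξ) i * (L ξ) j / ‖L ξ‖ ^ 2) : ℝ) : ℂ)) (cst χ) := by
  refine ((mult_test (h.smul ((2 : ℝ) ^ (-k))) (hχ.phi4 i j).1 (hχ.phi4 i j).2).mono
    (cst_4 i j)).congr fun ξ => ?_
  rw [phi4, _root_.smul_apply, dyadic_eq]
  congr 2
  have : (2 : ℝ) ^ (-k) ≠ 0 := by positivity
  rw [norm_smul, Real.norm_of_nonneg (by positivity), PiLp.smul_apply, PiLp.smul_apply, smul_eq_mul,
    smul_eq_mul]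
  field_simp

lemma mult_kco (hχ : IsCutoff χ) (h : Adj P L Lt) (N : ℤ) :
    Mult P (fun ξ => ((cut χ N (L ξ) * kco (2 / Real.pi * ‖L ξ‖) : ℝ) : ℂ))
      (17 * cst χ * (1 + 2 ^ N)) := by
  have hpi := Real.pi_pos
  have hpi3 := Real.pi_gt_three
  have hpi4 := Real.pi_le_four
  set X : ℝ := 2 ^ N with hX
  have hX0 : 0 < X := by positivity
  set B : ℕ → ℝ≥0 := fun n => (4 * cst χ) * (2 * X ^ 2 / (X ^ 2 + ((n : ℝ) + 1) ^ 2)).toNNReal with hB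
  have hterm : ∀ n : ℕ, Mult P (fun ξ => ((cut χ N (L ξ) * (2 * (2 / Real.pi * ‖L ξ‖) ^ 2 /
      ((2 / Real.pi * ‖L ξ‖) ^ 2 + ((n : ℝ) + 1) ^ 2)) : ℝ) : ℂ)) (B n) := by
    intro n
    set m : ℝ := (n : ℝ) + 1 with hm
    have hm0 : 0 < m := by positivity
    set c : ℝ := (2 / Real.pi) ^ 2 / m ^ 2 with hc
    have hres := mult_resolvent h (c := c) (by positivity)
    have hcle : c ≤ 1 / m ^ 2 := by
      rw [hc]
      gcongr
      rw [div_pow, div_le_one (by positivity)]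
      nlinarith
    rcases le_total (m ^ 2) (X ^ 2) with hmX | hmX
    · have h1 := ((mult_cut hχ h N).mul ((mult_const (P := P) 1).sub hres)).smul 2
      refine (h1.mono ?_).congr fun ξ => ?_
      · rw [hB]
        have : (1 : ℝ) ≤ 2 * X ^ 2 / (X ^ 2 + m ^ 2) := by
          rw [le_div_iff₀ (by positivity)]
          linarith
        have h2 : (1 : ℝ≥0) ≤ (2 * X ^ 2 / (X ^ 2 + m ^ 2)).toNNReal := by
          rw [← Real.toNNReal_one]
          exact Real.toNNReal_le_toNNReal this
        calc ‖(2 : ℂ)‖₊ * (cst χ * (‖(1 : ℂ)‖₊ + 1)) = 4 * cst χ * 1 := by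
              ext
              simp
              ring
          _ ≤ _ := by dsimp only; gcongr
      · push_cast
        rw [hc]
        have h3 : (m : ℂ) ≠ 0 := by exact_mod_cast hm0.ne'
        have h4 : (Real.pi : ℂ) ≠ 0 := by exact_mod_cast hpi.ne'
        have h5 : ((2 / Real.pi * ‖L ξ‖ : ℝ) ^ 2 + m ^ 2 : ℂ) ≠ 0 := by
          have : 0 < (2 / Real.pi * ‖L ξ‖) ^ 2 + m ^ 2 := by positivity
          exact_mod_cast this.ne'
        have h6 : (1 + (2 / Real.pi) ^ 2 / m ^ 2 * ‖L ξ‖ ^ 2 : ℂ) ≠ 0 := by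
          have : 0 < (1 + (2 / Real.pi) ^ 2 / m ^ 2 * ‖L ξ‖ ^ 2) := by positivity
          exact_mod_cast this.ne'
        push_cast at h5 ⊢
        have e : ∀ q : ℝ, (q : ℂ) = ((q : ℝ) : ℂ) := fun _ => rfl
        have key : (2 * (2 / Real.pi * ‖L ξ‖) ^ 2 / ((2 / Real.pi * ‖L ξ‖) ^ 2 + m ^ 2) : ℝ) =
            2 * (1 - 1 / (1 + (2 / Real.pi) ^ 2 / m ^ 2 * ‖L ξ‖ ^ 2)) := by
          have : (2 / Real.pi * ‖L ξ‖) ^ 2 + m ^ 2 ≠ 0 := by positivity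
          have h6' : (1 + (2 / Real.pi) ^ 2 / m ^ 2 * ‖L ξ‖ ^ 2) ≠ 0 := by positivity
          rw [eq_comm]
          field_simp
          ring
        have key' := congrArg (fun q : ℝ => (q : ℂ)) key
        push_cast at key'
        rw [key']
        ring
    · have h1 := (((mult_normsq hχ h N).mul hres).smul ((2 * c : ℝ) : ℂ))
      refine (h1.mono ?_).congr fun ξ => ?_
      · rw [hB]
        have hX2 : ((2 : ℝ≥0) ^ N) ^ 2 = (X ^ 2).toNNReal := by
          ext
          rw [Real.coe_toNNReal _ (by positivity)]
          simp [hX]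
        rw [← NNReal.coe_le_coe]
        simp only [NNReal.coe_mul, coe_nnnorm, Complex.norm_real, hX2, mul_one]
        rw [Real.coe_toNNReal _ (by positivity), Real.coe_toNNReal _ (by positivity),
          Real.norm_of_nonneg (by positivity)]
        have h2 : X ^ 2 / m ^ 2 ≤ 2 * X ^ 2 / (X ^ 2 + m ^ 2) := by
          rw [div_le_div_iff₀ (by positivity) (by positivity)]
          nlinarith [sq_nonneg X]
        have h3 : c * X ^ 2 ≤ X ^ 2 / m ^ 2 := by
          calc c * X ^ 2 ≤ 1 / m ^ 2 * X ^ 2 := by gcongr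
            _ = _ := by ring
        have hcs : 0 ≤ (cst χ : ℝ) := (cst χ).2
        calc 2 * c * (X ^ 2 * (cst χ : ℝ)) = 2 * (cst χ : ℝ) * (c * X ^ 2) := by ring
          _ ≤ 2 * (cst χ : ℝ) * (2 * X ^ 2 / (X ^ 2 + m ^ 2)) := by
              gcongr
              exact h3.trans h2
          _ ≤ _ := by
              gcongr
              push_cast
              norm_num
      · rw [← Complex.ofReal_mul, ← Complex.ofReal_mul]
        congr 1
        rw [hc]
        have : (2 / Real.pi * ‖L ξ‖) ^ 2 + m ^ 2 ≠ 0 := by positivity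
        have h6' : (1 + (2 / Real.pi) ^ 2 / m ^ 2 * ‖L ξ‖ ^ 2) ≠ 0 := by positivity
        field_simp
        ring
  have hS : HasSum B ((4 * cst χ) * (∑' n : ℕ, 2 * X ^ 2 / (X ^ 2 + ((n : ℝ) + 1) ^ 2)).toNNReal) := by
    refine HasSum.mul_left _ ?_
    rw [← NNReal.hasSum_coe, Real.coe_toNNReal _ (tsum_nonneg fun n => by positivity)]
    have := (summable_kco X).hasSum
    refine this.congr_fun ?_ |> fun h => h
    intro n
    rw [Real.coe_toNNReal _ (by positivity)]
  have h2 := mult_hasSum hterm hS (g' := fun ξ => ((cut χ N (L ξ) * ∑' n : ℕ,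
    (2 * (2 / Real.pi * ‖L ξ‖) ^ 2 / ((2 / Real.pi * ‖L ξ‖) ^ 2 + ((n : ℝ) + 1) ^ 2)) : ℝ) : ℂ))
    fun ξ => Complex.hasSum_ofReal.2 ((summable_kco _).hasSum.mul_left _)
  refine (((mult_cut hχ h N).add h2).mono ?_).congr fun ξ => ?_
  · have hle : (∑' n : ℕ, 2 * X ^ 2 / (X ^ 2 + ((n : ℝ) + 1) ^ 2)).toNNReal ≤ 4 * 2 ^ N := by
      rw [Real.toNNReal_le_iff_le_coe]
      refine (kco_sub_one_le hX0).trans ?_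
      push_cast
      rw [hX]
      gcongr
    calc cst χ + 4 * cst χ * _ ≤ cst χ + 4 * cst χ * (4 * 2 ^ N) := by gcongr
      _ ≤ 17 * cst χ * (1 + 2 ^ N) := by
        rw [← NNReal.coe_le_coe]
        push_cast
        have := (cst χ).2
        have h3 : (0 : ℝ) < 2 ^ N := by positivity
        nlinarith [mul_nonneg this h3.le]
  · rw [kco, ← Complex.ofReal_add]
    congr 1
    ring

lemma mult_r_sinh (hχ : IsCutoff χ) (h : Adj P L Lt) (N : ℤ) {a : ℝ} (ha : |a| ≤ 1) :
    Mult P (fun ξ => ((cut χ N (L ξ) * (‖L ξ‖ * Real.sinh (a * ‖L ξ‖) / Real.cosh ‖L ξ‖) : ℝ) : ℂ))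
      (17 * cst χ * (1 + 2 ^ N)) := by
  have ha' := abs_le.1 ha
  have h1 := mult_cosh (h.smul 2) (a := (1 + a) / 2) (abs_le.2 ⟨by linarith, by linarith⟩)
  have h2 := mult_cosh (h.smul 2) (a := (1 - a) / 2) (abs_le.2 ⟨by linarith, by linarith⟩)
  refine (((mult_kco hχ h N).mul (h1.sub h2)).smul (1 / 2)).mono (le_of_eq ?_) |>.congr fun ξ => ?_
  · ext
    push_cast
    norm_num
    ring
  · rw [r_sinh_eq (norm_nonneg _), _root_.smul_apply, norm_smul, Real.norm_of_nonneg (by norm_num)]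
    push_cast
    ring

end Mult
end
end WaterWaves

namespace WaterWaves
open Filter Topology FourierTransform
open scoped NNReal
noncomputable section

/-! ### Symbols that are multipliers on frequency regions -/

section SymbolBound

set_option linter.unusedSectionVars false

variable {V : Type*} [NormedAddCommGroup V] [NormedSpace ℝ V] [FiniteDimensional ℝ V]
  [SecondCountableTopology V] [MeasureSpace V] [BorelSpace V] [(volume : Measure V).IsAddHaarMeasure]
  {P : V →L[ℝ] V →L[ℝ] ℝ} {L : V →L[ℝ] E} {Lt : E →L[ℝ] V}
  {κ ι : Type*} {D : κ → Set V} {Y : κ → ℝ≥0} {p : ι → Prop}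

/-- On every region `D k`, the symbols `g i` agree with multipliers of size `Y k ^ d`. -/
def SB (P : V →L[ℝ] V →L[ℝ] ℝ) (D : κ → Set V) (Y : κ → ℝ≥0) (p : ι → Prop) (d : ℕ)
    (g : ι → V → ℂ) : Prop :=
  ∃ C : ℝ≥0, ∀ i, p i → ∀ k, ∃ m, Mult P m (C * Y k ^ d) ∧ ∀ ξ ∈ D k, g i ξ = m ξ

/-- The linear map `L` has size at most `Y k` on `D k`. -/
structure Frq (P : V →L[ℝ] V →L[ℝ] ℝ) (D : κ → Set V) (Y : κ → ℝ≥0) (L : V →L[ℝ] E) : Prop where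
  adj : ∃ Lt, Adj P L Lt
  one_le : ∀ k, 1 ≤ Y k
  bd : ∀ k, ∃ N : ℤ, (2 : ℝ≥0) ^ N ≤ 8 * Y k ∧ ∀ ξ ∈ D k, ‖L ξ‖ ≤ 5 / 4 * 2 ^ N

/-- The linear map `L` has size about `2 ^ n` on `D k`, for some `n`. -/
def Tot (D : κ → Set V) (L : V →L[ℝ] E) : Prop :=
  ∀ k, ∃ n : ℤ, ∀ ξ ∈ D k, 5 / 16 * 2 ^ n < ‖L ξ‖ ∧ ‖L ξ‖ ≤ 3 * 2 ^ n

lemma SB.congr {d : ℕ} {g g' : ι → V → ℂ} (h : SB P D Y p d g)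
    (hg : ∀ i, p i → ∀ k, ∀ ξ ∈ D k, g' i ξ = g i ξ) : SB P D Y p d g' := by
  obtain ⟨C, hC⟩ := h
  refine ⟨C, fun i hi k => ?_⟩
  obtain ⟨m, hm, he⟩ := hC i hi k
  exact ⟨m, hm, fun ξ hξ => (hg i hi k ξ hξ).trans (he ξ hξ)⟩

lemma SB.mono {d d' : ℕ} {g : ι → V → ℂ} (h : SB P D Y p d g) (hY : ∀ k, 1 ≤ Y k) (hd : d ≤ d') :
    SB P D Y p d' g := by
  obtain ⟨C, hC⟩ := h
  refine ⟨C, fun i hi k => ?_⟩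
  obtain ⟨m, hm, he⟩ := hC i hi k
  exact ⟨m, hm.mono (by gcongr; exact hY k), he⟩

lemma SB.add {d : ℕ} {g g' : ι → V → ℂ} (h : SB P D Y p d g) (h' : SB P D Y p d g') :
    SB P D Y p d fun i ξ => g i ξ + g' i ξ := by
  obtain ⟨C, hC⟩ := h
  obtain ⟨C', hC'⟩ := h'
  refine ⟨C + C', fun i hi k => ?_⟩
  obtain ⟨m, hm, he⟩ := hC i hi k
  obtain ⟨m', hm', he'⟩ := hC' i hi k
  refine ⟨_, (hm.add hm').mono (by rw [add_mul]), fun ξ hξ => ?_⟩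
  dsimp only
  rw [he ξ hξ, he' ξ hξ]

lemma SB.mul {d d' : ℕ} {g g' : ι → V → ℂ} (h : SB P D Y p d g) (h' : SB P D Y p d' g') :
    SB P D Y p (d + d') fun i ξ => g i ξ * g' i ξ := by
  obtain ⟨C, hC⟩ := h
  obtain ⟨C', hC'⟩ := h'
  refine ⟨C * C', fun i hi k => ?_⟩
  obtain ⟨m, hm, he⟩ := hC i hi k
  obtain ⟨m', hm', he'⟩ := hC' i hi k
  refine ⟨_, (hm.mul hm').mono (le_of_eq ?_), fun ξ hξ => ?_⟩
  · rw [pow_add]; ring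
  · dsimp only
    rw [he ξ hξ, he' ξ hξ]

lemma sb_const {c : ι → ℂ} (M : ℝ≥0) (hc : ∀ i, p i → ‖c i‖₊ ≤ M) :
    SB P D Y p 0 fun i _ => c i :=
  ⟨M, fun i hi _ => ⟨_, (mult_const (c i)).mono (by simpa using hc i hi), fun _ _ => rfl⟩⟩

lemma SB.smul {d : ℕ} {g : ι → V → ℂ} (h : SB P D Y p d g) {c : ι → ℂ} (M : ℝ≥0)
    (hc : ∀ i, p i → ‖c i‖₊ ≤ M) : SB P D Y p d fun i ξ => c i * g i ξ := by
  simpa using (sb_const (P := P) (D := D) (Y := Y) M hc).mul h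

lemma SB.neg {d : ℕ} {g : ι → V → ℂ} (h : SB P D Y p d g) : SB P D Y p d fun i ξ => -g i ξ := by
  simpa using h.smul (c := fun _ => -1) 1 (by simp)

lemma SB.sub {d : ℕ} {g g' : ι → V → ℂ} (h : SB P D Y p d g) (h' : SB P D Y p d g') :
    SB P D Y p d fun i ξ => g i ξ - g' i ξ := by
  simpa [sub_eq_add_neg] using h.add h'.neg

lemma sb_zero {d : ℕ} : SB P D Y p d fun (_ : ι) _ => 0 :=
  ⟨0, fun _ _ _ => ⟨_, (mult_const 0).mono (by simp), fun _ _ => rfl⟩⟩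

lemma sb_sum {α : Type*} (s : Finset α) {d : ℕ} {g : α → ι → V → ℂ}
    (h : ∀ a ∈ s, SB P D Y p d (g a)) : SB P D Y p d fun i ξ => ∑ a ∈ s, g a i ξ := by
  classical
  induction s using Finset.induction_on with
  | empty => simpa using sb_zero
  | insert a s ha ih =>
    simp only [Finset.sum_insert ha]
    exact (h a (by simp)).add (ih fun b hb => h b (by simp [hb]))

lemma sb_cosh (hL : Frq P D Y L) {a : ι → ℝ} (ha : ∀ i, p i → |a i| ≤ 1) :
    SB P D Y p 0 fun i ξ => ((Real.cosh (a i * ‖L ξ‖) / Real.cosh ‖L ξ‖ : ℝ) : ℂ) := by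
  obtain ⟨Lt, hLt⟩ := hL.adj
  exact ⟨1, fun i hi _ => ⟨_, (mult_cosh hLt (ha i hi)).mono (by simp), fun _ _ => rfl⟩⟩

variable {χ : ℝ → ℝ}

lemma cut_eq_one (hχ : IsCutoff χ) {N : ℤ} {ζ : E} (h : ‖ζ‖ ≤ 5 / 4 * 2 ^ N) : cut χ N ζ = 1 := by
  have h2 : (0 : ℝ) < 2 ^ N := by positivity
  refine hχ.eq_one _ ⟨?_, (div_le_iff₀ h2).2 h⟩
  have : 0 ≤ ‖ζ‖ / 2 ^ N := by positivity
  linarith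

lemma cut_eq_zero (hχ : IsCutoff χ) {N : ℤ} {ζ : E} (h : 3 / 2 * 2 ^ N < ‖ζ‖) : cut χ N ζ = 0 := by
  have h2 : (0 : ℝ) < 2 ^ N := by positivity
  exact hχ.eq_zero ((lt_div_iff₀ h2).2 h)

lemma sb_rsinh (hχ : IsCutoff χ) (hL : Frq P D Y L) {a : ι → ℝ} (ha : ∀ i, p i → |a i| ≤ 1) :
    SB P D Y p 1 fun i ξ => ((‖L ξ‖ * Real.sinh (a i * ‖L ξ‖) / Real.cosh ‖L ξ‖ : ℝ) : ℂ) := by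
  obtain ⟨Lt, hLt⟩ := hL.adj
  refine ⟨17 * cst χ * 9, fun i hi k => ?_⟩
  obtain ⟨N, hN, hD⟩ := hL.bd k
  refine ⟨_, (mult_r_sinh hχ hLt N (ha i hi)).mono ?_, fun ξ hξ => ?_⟩
  · rw [mul_assoc _ _ (Y k ^ 1), pow_one]
    gcongr
    calc 1 + 2 ^ N ≤ Y k + 8 * Y k := add_le_add (hL.one_le k) hN
      _ = 9 * Y k := by ring
  · rw [cut_eq_one hχ (hD ξ hξ), one_mul]

lemma sb_coord (hχ : IsCutoff χ) (hL : Frq P D Y L) (j : Fin 2) :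
    SB P D Y p 1 fun (_ : ι) ξ => (((L ξ) j : ℝ) : ℂ) := by
  obtain ⟨Lt, hLt⟩ := hL.adj
  refine ⟨8 * cst χ, fun i hi k => ?_⟩
  obtain ⟨N, hN, hD⟩ := hL.bd k
  refine ⟨_, (mult_coord hχ hLt N j).mono ?_, fun ξ hξ => ?_⟩
  · calc 2 ^ N * cst χ ≤ 8 * Y k * cst χ := by gcongr
      _ = _ := by ring
  · rw [cut_eq_one hχ (hD ξ hξ), mul_one]

lemma sb_normsq (hχ : IsCutoff χ) (hL : Frq P D Y L) :
    SB P D Y p 2 fun (_ : ι) ξ => ((‖L ξ‖ ^ 2 : ℝ) : ℂ) := by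
  refine (sb_sum Finset.univ (g := fun (j : Fin 2) (_ : ι) ξ => (((L ξ) j : ℝ) : ℂ) * (((L ξ) j : ℝ) : ℂ))
    fun j _ => (sb_coord hχ hL j).mul (sb_coord hχ hL j)).congr fun i _ k ξ _ => ?_
  rw [EuclideanSpace.real_norm_sq_eq]
  push_cast
  simp only [sq]

lemma Tot.ne_zero (hT : Tot D L) {k : κ} {ξ : V} (hξ : ξ ∈ D k) : 0 < ‖L ξ‖ := by
  obtain ⟨n, hn⟩ := hT k
  exact lt_trans (by positivity) (hn ξ hξ).1

lemma sum_dyadic (χ : ℝ → ℝ) (n : ℤ) (ζ : E) :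
    ∑ j ∈ Finset.range 5, dyadic χ (n - 2 + (j : ℤ)) ζ = cut χ (n + 2) ζ - cut χ (n - 3) ζ := by
  simp only [Finset.sum_range_succ, Finset.sum_range_zero, dyadic, cut]
  push_cast
  rw [show n - 2 + 0 - 1 = n - 3 by ring, show n - 2 + 1 - 1 = n - 2 + 0 by ring,
    show n - 2 + 2 - 1 = n - 2 + 1 by ring, show n - 2 + 3 - 1 = n - 2 + 2 by ring,
    show n - 2 + 4 - 1 = n - 2 + 3 by ring, show n - 2 + 4 = n + 2 by ring]
  ring

lemma sb_riesz (hχ : IsCutoff χ) (hL : Frq P D Y L) (hT : Tot D L) (j l : Fin 2) :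
    SB P D Y p 0 fun (_ : ι) ξ => (((L ξ) j * (L ξ) l / ‖L ξ‖ ^ 2 : ℝ) : ℂ) := by
  obtain ⟨Lt, hLt⟩ := hL.adj
  refine ⟨∑ _i ∈ Finset.range 5, cst χ, fun i hi k => ?_⟩
  obtain ⟨n, hn⟩ := hT k
  refine ⟨_, (mult_sum (Finset.range 5) fun i _ => mult_riesz hχ hLt (n - 2 + (i : ℤ)) j l).mono
    (by rw [pow_zero, mul_one]), fun ξ hξ => ?_⟩
  rw [← Complex.ofReal_sum, ← Finset.sum_mul, sum_dyadic]
  have h2 : (0 : ℝ) < 2 ^ n := by positivity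
  rw [cut_eq_one hχ, cut_eq_zero hχ, sub_zero, one_mul]
  · rw [zpow_sub₀ (by norm_num)]
    norm_num
    linarith [(hn ξ hξ).1]
  · rw [zpow_add₀ (by norm_num)]
    norm_num
    linarith [(hn ξ hξ).2]

lemma mult_sinh_div (h : Adj P L Lt) {a : ℝ} (ha : a ≤ 1) :
    Mult P (fun ξ => ∫ b in Ioc 0 a, ((Real.cosh (b * ‖L ξ‖) / Real.cosh ‖L ξ‖ : ℝ) : ℂ)) 1 := by
  refine mult_integral (g := fun (b : ℝ) ξ => ((Real.cosh (b * ‖L ξ‖) / Real.cosh ‖L ξ‖ : ℝ) : ℂ))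
    (B := fun _ => 1) ?_ (by fun_prop) ?_ ?_
  · refine Continuous.stronglyMeasurable ?_
    refine Complex.continuous_ofReal.comp ?_
    exact (Real.continuous_cosh.comp (by fun_prop)).div (Real.continuous_cosh.comp (by fun_prop))
      fun ξ => (Real.cosh_pos _).ne'
  · refine (ae_restrict_iff' measurableSet_Ioc).2 (Eventually.of_forall fun b hb => ?_)
    exact mult_cosh h (abs_le.2 ⟨by linarith [hb.1], by linarith [hb.2]⟩)
  · simp only [ENNReal.coe_one, lintegral_const, one_mul, Measure.restrict_apply MeasurableSet.univ,
      univ_inter, Real.volume_Ioc, sub_zero]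
    exact ENNReal.ofReal_le_one.2 ha

lemma integral_cosh_mul {a r : ℝ} (ha0 : 0 ≤ a) (hr : 0 < r) :
    ∫ b in Ioc 0 a, ((Real.cosh (b * r) / Real.cosh r : ℝ) : ℂ) =
      ((Real.sinh (a * r) / (r * Real.cosh r) : ℝ) : ℂ) := by
  rw [integral_complex_ofReal, ← intervalIntegral.integral_of_le ha0]
  congr 1
  have hd : ∀ b ∈ uIcc 0 a, HasDerivAt (fun b => Real.sinh (b * r) / (r * Real.cosh r))
      (Real.cosh (b * r) / Real.cosh r) b := by
    intro b _
    have h1 : HasDerivAt (fun b : ℝ => b * r) r b := by simpa using (hasDerivAt_id b).mul_const r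
    have h2 := (h1.sinh).div_const (r * Real.cosh r)
    have h3 := (Real.cosh_pos r).ne'
    have h4 : Real.cosh (b * r) * r / (r * Real.cosh r) = Real.cosh (b * r) / Real.cosh r := by
      field_simp
    rwa [h4] at h2
  rw [intervalIntegral.integral_eq_sub_of_hasDerivAt hd]
  · simp
  · refine Continuous.intervalIntegrable ?_ _ _
    fun_prop

lemma sb_sinh_div (hL : Frq P D Y L) (hT : Tot D L) {a : ι → ℝ} (ha : ∀ i, p i → |a i| ≤ 1) :
    SB P D Y p 0 fun i ξ => ((Real.sinh (a i * ‖L ξ‖) / (‖L ξ‖ * Real.cosh ‖L ξ‖) : ℝ) : ℂ) := by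
  obtain ⟨Lt, hLt⟩ := hL.adj
  refine ⟨1, fun i hi k => ?_⟩
  rw [pow_zero, mul_one]
  have hai := abs_le.1 (ha i hi)
  rcases le_total 0 (a i) with h0 | h0
  · refine ⟨_, mult_sinh_div hLt hai.2, fun ξ hξ => ?_⟩
    rw [integral_cosh_mul h0 (hT.ne_zero hξ)]
  · refine ⟨_, ((mult_sinh_div hLt (a := -a i) (by linarith)).smul (-1)).mono
      (by simp), fun ξ hξ => ?_⟩
    rw [integral_cosh_mul (by linarith) (hT.ne_zero hξ), neg_mul (a i), Real.sinh_neg]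
    push_cast
    ring

end SymbolBound

end
end WaterWaves

namespace WaterWaves
open Filter Topology FourierTransform
open scoped NNReal
noncomputable section

/-! ### The kernels of the flattened Neumann problem -/

def kPA (z s r : ℝ) : ℝ :=
  if s < z then -(Real.sinh (r * z) * Real.sinh (r * (s + 1)) / Real.cosh r)
  else -(Real.cosh (r * (z + 1)) * Real.cosh (r * s) / Real.cosh r)

def kPR (z s r : ℝ) : ℝ :=
  if s < z then Real.sinh (r * z) * Real.cosh (r * (s + 1)) / (r * Real.cosh r)
  else Real.cosh (r * (z + 1)) * Real.sinh (r * s) / (r * Real.cosh r)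

def kVA (z s r : ℝ) : ℝ :=
  if s < z then -(r * Real.cosh (r * z) * Real.sinh (r * (s + 1)) / Real.cosh r)
  else -(r * Real.sinh (r * (z + 1)) * Real.cosh (r * s) / Real.cosh r)

def kVR (z s r : ℝ) : ℝ :=
  if s < z then Real.cosh (r * z) * Real.cosh (r * (s + 1)) / Real.cosh r
  else Real.sinh (r * (z + 1)) * Real.sinh (r * s) / Real.cosh r

/-- The first argument of the kernels written as sums of hyperbolic functions. -/
def argP (q : ℝ × ℝ) : ℝ := q.1 + q.2 + 1

/-- The second argument of the kernels written as sums of hyperbolic functions. -/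
def argM (q : ℝ × ℝ) : ℝ := if q.2 < q.1 then q.1 - q.2 - 1 else q.1 + 1 - q.2

def sgnM (q : ℝ × ℝ) : ℝ := if q.2 < q.1 then 1 / 2 else -(1 / 2)

/-- The square `[-1,0]²`. -/
def InSq (q : ℝ × ℝ) : Prop := q.1 ∈ Icc (-1 : ℝ) 0 ∧ q.2 ∈ Icc (-1 : ℝ) 0

lemma abs_argP {q : ℝ × ℝ} (hq : InSq q) : |argP q| ≤ 1 := by
  obtain ⟨⟨h1, h2⟩, h3, h4⟩ := hq
  rw [argP, abs_le]
  constructor <;> linarith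

lemma abs_argM {q : ℝ × ℝ} (hq : InSq q) : |argM q| ≤ 1 := by
  obtain ⟨⟨h1, h2⟩, h3, h4⟩ := hq
  rw [argM, abs_le]
  split_ifs with h <;> constructor <;> linarith

lemma kPA_eq (q : ℝ × ℝ) (r : ℝ) : kPA q.1 q.2 r =
    -(1 / 2) * (Real.cosh (argP q * r) / Real.cosh r)
      + sgnM q * (Real.cosh (argM q * r) / Real.cosh r) := by
  rw [kPA, argP, argM, sgnM]
  split_ifs with h
  · rw [show (q.1 + q.2 + 1) * r = r * q.1 + r * (q.2 + 1) by ring,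
      show (q.1 - q.2 - 1) * r = r * q.1 - r * (q.2 + 1) by ring, Real.cosh_add, Real.cosh_sub]
    ring
  · rw [show (q.1 + q.2 + 1) * r = r * (q.1 + 1) + r * q.2 by ring,
      show (q.1 + 1 - q.2) * r = r * (q.1 + 1) - r * q.2 by ring, Real.cosh_add, Real.cosh_sub]
    ring

lemma kPR_eq (q : ℝ × ℝ) (r : ℝ) : kPR q.1 q.2 r =
    1 / 2 * (Real.sinh (argP q * r) / (r * Real.cosh r))
      + sgnM q * (Real.sinh (argM q * r) / (r * Real.cosh r)) := by
  rw [kPR, argP, argM, sgnM]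
  split_ifs with h
  · rw [show (q.1 + q.2 + 1) * r = r * q.1 + r * (q.2 + 1) by ring,
      show (q.1 - q.2 - 1) * r = r * q.1 - r * (q.2 + 1) by ring, Real.sinh_add, Real.sinh_sub]
    ring
  · rw [show (q.1 + q.2 + 1) * r = r * (q.1 + 1) + r * q.2 by ring,
      show (q.1 + 1 - q.2) * r = r * (q.1 + 1) - r * q.2 by ring, Real.sinh_add, Real.sinh_sub]
    ring

lemma sq_mul_kPR_eq (q : ℝ × ℝ) {r : ℝ} (hr : 0 < r) : r ^ 2 * kPR q.1 q.2 r =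
    1 / 2 * (r * Real.sinh (argP q * r) / Real.cosh r)
      + sgnM q * (r * Real.sinh (argM q * r) / Real.cosh r) := by
  rw [kPR_eq]
  have := (Real.cosh_pos r).ne'
  field_simp

lemma kVA_eq (q : ℝ × ℝ) (r : ℝ) : kVA q.1 q.2 r =
    -(1 / 2) * (r * Real.sinh (argP q * r) / Real.cosh r)
      + sgnM q * (r * Real.sinh (argM q * r) / Real.cosh r) := by
  rw [kVA, argP, argM, sgnM]
  split_ifs with h
  · rw [show (q.1 + q.2 + 1) * r = r * q.1 + r * (q.2 + 1) by ring,
      show (q.1 - q.2 - 1) * r = r * q.1 - r * (q.2 + 1) by ring, Real.sinh_add, Real.sinh_sub]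
    ring
  · rw [show (q.1 + q.2 + 1) * r = r * (q.1 + 1) + r * q.2 by ring,
      show (q.1 + 1 - q.2) * r = r * (q.1 + 1) - r * q.2 by ring, Real.sinh_add, Real.sinh_sub]
    ring

lemma kVR_eq (q : ℝ × ℝ) (r : ℝ) : kVR q.1 q.2 r =
    1 / 2 * (Real.cosh (argP q * r) / Real.cosh r)
      + sgnM q * (Real.cosh (argM q * r) / Real.cosh r) := by
  rw [kVR, argP, argM, sgnM]
  split_ifs with h
  · rw [show (q.1 + q.2 + 1) * r = r * q.1 + r * (q.2 + 1) by ring,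
      show (q.1 - q.2 - 1) * r = r * q.1 - r * (q.2 + 1) by ring, Real.cosh_add, Real.cosh_sub]
    ring
  · rw [show (q.1 + q.2 + 1) * r = r * (q.1 + 1) + r * q.2 by ring,
      show (q.1 + 1 - q.2) * r = r * (q.1 + 1) - r * q.2 by ring, Real.cosh_add, Real.cosh_sub]
    ring

section Measurable

lemma measurable_kPA : Measurable fun q : ℝ × ℝ × ℝ => kPA q.1 q.2.1 q.2.2 := by
  unfold kPA
  refine Measurable.ite (measurableSet_lt (by fun_prop) (by fun_prop)) ?_ ?_ <;> fun_prop

lemma measurable_kPR : Measurable fun q : ℝ × ℝ × ℝ => kPR q.1 q.2.1 q.2.2 := by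
  unfold kPR
  refine Measurable.ite (measurableSet_lt (by fun_prop) (by fun_prop)) ?_ ?_ <;> fun_prop

lemma measurable_kVA : Measurable fun q : ℝ × ℝ × ℝ => kVA q.1 q.2.1 q.2.2 := by
  unfold kVA
  refine Measurable.ite (measurableSet_lt (by fun_prop) (by fun_prop)) ?_ ?_ <;> fun_prop

lemma measurable_kVR : Measurable fun q : ℝ × ℝ × ℝ => kVR q.1 q.2.1 q.2.2 := by
  unfold kVR
  refine Measurable.ite (measurableSet_lt (by fun_prop) (by fun_prop)) ?_ ?_ <;> fun_prop

end Measurable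

/-! ### The symbols -/

/-- The factor of `h̃_j ∂_b φ` in the first order terms `Q^a`. -/
def alp (j : Fin 4) (b : Fin 3) (s : ℝ) : ℝ :=
  (![![0, 0, 1], ![0, 0, -(s + 1) ^ 2], ![s + 1, 0, 0], ![0, s + 1, 0]] : Fin 4 → Fin 3 → ℝ) j b

/-- The symbol of the factor of `h̃_j ∂_b φ` in the terms in divergence form and of order zero. -/
def bet (j : Fin 4) (b : Fin 3) (s : ℝ) (ξ : E) : ℂ :=
  (![![0, 0, 0], ![0, 0, s + 1], ![-1, 0, Complex.I * ξ 0 * (s + 1)],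
    ![0, -1, Complex.I * ξ 1 * (s + 1)]] : Fin 4 → Fin 3 → ℂ) j b

/-- The symbols `t_{z,s}`, as functions of the output frequency. -/
def tsym (z : ℝ) (a : Fin 3) (j : Fin 4) (b : Fin 3) (s : ℝ) (ξ : E) : ℂ :=
  (![Complex.I * ξ 0 * (kPA z s ‖ξ‖ * alp j b s + kPR z s ‖ξ‖ * bet j b s ξ),
    Complex.I * ξ 1 * (kPA z s ‖ξ‖ * alp j b s + kPR z s ‖ξ‖ * bet j b s ξ),
    kVA z s ‖ξ‖ * alp j b s + kVR z s ‖ξ‖ * bet j b s ξ] : Fin 3 → ℂ) a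

/-- The symbols `t_z⁰`. -/
def tsym0 (z : ℝ) (a : Fin 3) (j : Fin 4) (b : Fin 3) : ℂ :=
  (![0, 0, (alp j b z : ℂ)] : Fin 3 → ℂ) a

def mA (s r : ℝ) : ℝ := Real.cosh ((s + 1) * r) / Real.cosh r

def mB (s r : ℝ) : ℝ := r * Real.sinh ((s + 1) * r) / Real.cosh r

/-- The symbols of the linear terms. -/
def symA (b : Fin 3) (s : ℝ) (ζ : E) : ℂ :=
  (![Complex.I * ζ 0 * mA s ‖ζ‖, Complex.I * ζ 1 * mA s ‖ζ‖, (mB s ‖ζ‖ : ℂ)] : Fin 3 → ℂ) b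

/-- The symbols of the quadratic terms. -/
def symB (b : Fin 3) (s : ℝ) (ξ η : E) : ℂ :=
  (![Complex.I * (ξ + η) 0 * ((1 + s) * mB s ‖η‖ - mA s ‖ξ + η‖ * mB 0 ‖η‖),
    Complex.I * (ξ + η) 1 * ((1 + s) * mB s ‖η‖ - mA s ‖ξ + η‖ * mB 0 ‖η‖),
    (mB s ‖η‖ + (1 + s) * (‖η‖ ^ 2 * mA s ‖η‖) - mB s ‖ξ + η‖ * mB 0 ‖η‖ : ℂ)] : Fin 3 → ℂ) b

lemma measurable_tsym_prod (a : Fin 3) (j : Fin 4) (b : Fin 3) :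
    Measurable fun q : ℝ × ℝ × E => tsym q.1 a j b q.2.1 q.2.2 := by
  have hn : Measurable fun q : ℝ × ℝ × E => (q.1, q.2.1, ‖q.2.2‖) := by fun_prop
  have h1 : Measurable fun q : ℝ × ℝ × E => kPA q.1 q.2.1 ‖q.2.2‖ := measurable_kPA.comp hn
  have h2 : Measurable fun q : ℝ × ℝ × E => kPR q.1 q.2.1 ‖q.2.2‖ := measurable_kPR.comp hn
  have h3 : Measurable fun q : ℝ × ℝ × E => kVA q.1 q.2.1 ‖q.2.2‖ := measurable_kVA.comp hn
  have h4 : Measurable fun q : ℝ × ℝ × E => kVR q.1 q.2.1 ‖q.2.2‖ := measurable_kVR.comp hn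
  have h5 : Measurable fun q : ℝ × ℝ × E => alp j b q.2.1 := by
    fin_cases j <;> fin_cases b <;> simp [alp] <;> fun_prop
  have hc : ∀ i : Fin 2, Measurable fun q : ℝ × ℝ × E => ((q.2.2 i : ℝ) : ℂ) := fun i => by fun_prop
  have h6 : Measurable fun q : ℝ × ℝ × E => bet j b q.2.1 q.2.2 := by
    have e1 := ((hc 0).const_mul Complex.I).mul
      (by fun_prop : Measurable fun q : ℝ × ℝ × E => ((q.2.1 : ℂ) + 1))
    have e2 := ((hc 1).const_mul Complex.I).mul
      (by fun_prop : Measurable fun q : ℝ × ℝ × E => ((q.2.1 : ℂ) + 1))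
    fin_cases j <;> fin_cases b <;> simp [bet] <;> first | exact e1 | exact e2 | fun_prop
  have h7 : Measurable fun q : ℝ × ℝ × E => ((kPA q.1 q.2.1 ‖q.2.2‖ : ℂ) * alp j b q.2.1
      + kPR q.1 q.2.1 ‖q.2.2‖ * bet j b q.2.1 q.2.2) := by fun_prop
  have h8 : Measurable fun q : ℝ × ℝ × E => ((kVA q.1 q.2.1 ‖q.2.2‖ : ℂ) * alp j b q.2.1
      + kVR q.1 q.2.1 ‖q.2.2‖ * bet j b q.2.1 q.2.2) := by fun_prop
  fin_cases a
  · exact ((hc 0).const_mul Complex.I).mul h7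
  · exact ((hc 1).const_mul Complex.I).mul h7
  · exact h8

lemma measurable_tsym (z : ℝ) (a : Fin 3) (j : Fin 4) (b : Fin 3) :
    Measurable fun q : ℝ × E => tsym z a j b q.1 q.2 :=
  Measurable.comp (g := fun q : ℝ × ℝ × E => tsym q.1 a j b q.2.1 q.2.2)
    (f := fun q : ℝ × E => (z, q.1, q.2)) (measurable_tsym_prod a j b) (by fun_prop)

lemma continuous_mA : Continuous fun q : ℝ × ℝ => mA q.1 q.2 := by
  unfold mA
  exact (Real.continuous_cosh.comp (by fun_prop)).div (Real.continuous_cosh.comp (by fun_prop))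
    fun ξ => (Real.cosh_pos _).ne'

lemma continuous_mB : Continuous fun q : ℝ × ℝ => mB q.1 q.2 := by
  unfold mB
  exact (continuous_snd.mul (Real.continuous_sinh.comp (by fun_prop))).div
    (Real.continuous_cosh.comp (by fun_prop)) fun ξ => (Real.cosh_pos _).ne'

lemma continuous_symA (b : Fin 3) : Continuous fun q : ℝ × E => symA b q.1 q.2 := by
  have h1 : Continuous fun q : ℝ × E => mA q.1 ‖q.2‖ :=
    continuous_mA.comp (by fun_prop : Continuous fun q : ℝ × E => (q.1, ‖q.2‖))
  have h2 : Continuous fun q : ℝ × E => mB q.1 ‖q.2‖ :=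
    continuous_mB.comp (by fun_prop : Continuous fun q : ℝ × E => (q.1, ‖q.2‖))
  fin_cases b <;> simp [symA] <;> fun_prop

lemma continuous_symB (b : Fin 3) : Continuous fun q : ℝ × E × E => symB b q.1 q.2.1 q.2.2 := by
  have h1 : Continuous fun q : ℝ × E × E => mA q.1 ‖q.2.2‖ :=
    continuous_mA.comp (by fun_prop : Continuous fun q : ℝ × E × E => (q.1, ‖q.2.2‖))
  have h2 : Continuous fun q : ℝ × E × E => mB q.1 ‖q.2.2‖ :=
    continuous_mB.comp (by fun_prop : Continuous fun q : ℝ × E × E => (q.1, ‖q.2.2‖))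
  have h3 : Continuous fun q : ℝ × E × E => mA q.1 ‖q.2.1 + q.2.2‖ :=
    continuous_mA.comp (by fun_prop : Continuous fun q : ℝ × E × E => (q.1, ‖q.2.1 + q.2.2‖))
  have h4 : Continuous fun q : ℝ × E × E => mB q.1 ‖q.2.1 + q.2.2‖ :=
    continuous_mB.comp (by fun_prop : Continuous fun q : ℝ × E × E => (q.1, ‖q.2.1 + q.2.2‖))
  have h5 : Continuous fun q : ℝ × E × E => mB 0 ‖q.2.2‖ :=
    continuous_mB.comp (by fun_prop : Continuous fun q : ℝ × E × E => ((0 : ℝ), ‖q.2.2‖))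
  have hc : ∀ i : Fin 2, Continuous fun q : ℝ × E × E => (((q.2.1 + q.2.2) i : ℝ) : ℂ) :=
    fun i => by fun_prop
  fin_cases b
  · exact ((hc 0).const_mul Complex.I).mul (by fun_prop)
  · exact ((hc 1).const_mul Complex.I).mul (by fun_prop)
  · show Continuous fun q : ℝ × E × E => (mB q.1 ‖q.2.2‖ + (1 + q.1) * (‖q.2.2‖ ^ 2 * mA q.1 ‖q.2.2‖)
      - mB q.1 ‖q.2.1 + q.2.2‖ * mB 0 ‖q.2.2‖ : ℂ)
    fun_prop

section Bounds

set_option linter.unusedSectionVars false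

variable {V : Type*} [NormedAddCommGroup V] [NormedSpace ℝ V] [FiniteDimensional ℝ V]
  [SecondCountableTopology V] [MeasureSpace V] [BorelSpace V] [(volume : Measure V).IsAddHaarMeasure]
  {P : V →L[ℝ] V →L[ℝ] ℝ} {L L' : V →L[ℝ] E}
  {κ : Type*} {D : κ → Set V} {Y : κ → ℝ≥0} {χ : ℝ → ℝ}

lemma nnnorm_sgnM (q : ℝ × ℝ) : ‖((sgnM q : ℝ) : ℂ)‖₊ ≤ 1 := by
  rw [← NNReal.coe_le_coe, coe_nnnorm, Complex.norm_real, sgnM]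
  split_ifs <;> norm_num

lemma sb_comb {F : ℝ → V → ℝ} {d : ℕ} (h : ∀ a : ℝ × ℝ → ℝ, (∀ q, InSq q → |a q| ≤ 1) →
    SB P D Y InSq d fun q ξ => ((F (a q) ξ : ℝ) : ℂ)) {c : ℝ} :
    SB P D Y InSq d fun q ξ => ((c * F (argP q) ξ + sgnM q * F (argM q) ξ : ℝ) : ℂ) := by
  refine (((h argP fun q hq => abs_argP hq).smul (c := fun _ => (c : ℂ)) _ fun _ _ => le_rfl).add
    ((h argM fun q hq => abs_argM hq).smul (c := fun q => (sgnM q : ℂ)) 1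
      fun q _ => nnnorm_sgnM q)).congr fun q _ k ξ _ => ?_
  push_cast
  ring

lemma sb_kPA (hL : Frq P D Y L) :
    SB P D Y InSq 0 fun q ξ => ((kPA q.1 q.2 ‖L ξ‖ : ℝ) : ℂ) := by
  simp only [kPA_eq]
  exact sb_comb (F := fun a ξ => Real.cosh (a * ‖L ξ‖) / Real.cosh ‖L ξ‖) fun a ha => sb_cosh hL ha

lemma sb_kVR (hL : Frq P D Y L) :
    SB P D Y InSq 0 fun q ξ => ((kVR q.1 q.2 ‖L ξ‖ : ℝ) : ℂ) := by
  simp only [kVR_eq]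
  exact sb_comb (F := fun a ξ => Real.cosh (a * ‖L ξ‖) / Real.cosh ‖L ξ‖) fun a ha => sb_cosh hL ha

lemma sb_kVA (hχ : IsCutoff χ) (hL : Frq P D Y L) :
    SB P D Y InSq 1 fun q ξ => ((kVA q.1 q.2 ‖L ξ‖ : ℝ) : ℂ) := by
  simp only [kVA_eq]
  exact sb_comb (F := fun a ξ => ‖L ξ‖ * Real.sinh (a * ‖L ξ‖) / Real.cosh ‖L ξ‖)
    fun a ha => sb_rsinh hχ hL ha

lemma sb_kPR (hL : Frq P D Y L) (hT : Tot D L) :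
    SB P D Y InSq 0 fun q ξ => ((kPR q.1 q.2 ‖L ξ‖ : ℝ) : ℂ) := by
  simp only [kPR_eq]
  exact sb_comb (F := fun a ξ => Real.sinh (a * ‖L ξ‖) / (‖L ξ‖ * Real.cosh ‖L ξ‖))
    fun a ha => sb_sinh_div hL hT ha

lemma sb_sq_kPR (hχ : IsCutoff χ) (hL : Frq P D Y L) (hT : Tot D L) :
    SB P D Y InSq 1 fun q ξ => ((‖L ξ‖ ^ 2 * kPR q.1 q.2 ‖L ξ‖ : ℝ) : ℂ) := by
  refine (sb_comb (F := fun a ξ => ‖L ξ‖ * Real.sinh (a * ‖L ξ‖) / Real.cosh ‖L ξ‖)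
    (c := 1 / 2) fun a ha => sb_rsinh hχ hL ha).congr fun q _ k ξ hξ => ?_
  rw [sq_mul_kPR_eq q (hT.ne_zero hξ)]

lemma abs_alp {j : Fin 4} {b : Fin 3} {s : ℝ} (hs : s ∈ Icc (-1 : ℝ) 0) : |alp j b s| ≤ 1 := by
  obtain ⟨h1, h2⟩ := hs
  have e0 : |(0 : ℝ)| ≤ 1 := by norm_num
  have e1 : |(1 : ℝ)| ≤ 1 := by norm_num
  have e2 : |(s + 1)| ≤ 1 := abs_le.2 ⟨by linarith, by linarith⟩
  have e3 : |-(s + 1) ^ 2| ≤ 1 := by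
    rw [abs_neg, abs_pow]
    exact pow_le_one₀ (abs_nonneg _) e2
  fin_cases j <;> fin_cases b <;> first | exact e0 | exact e1 | exact e2 | exact e3

lemma nnnorm_alp {j : Fin 4} {b : Fin 3} {s : ℝ} (hs : s ∈ Icc (-1 : ℝ) 0) :
    ‖((alp j b s : ℝ) : ℂ)‖₊ ≤ 1 := by
  rw [← NNReal.coe_le_coe, coe_nnnorm, Complex.norm_real]
  exact abs_alp hs

lemma nnnorm_add_one {s : ℝ} (hs : s ∈ Icc (-1 : ℝ) 0) : ‖((s : ℂ) + 1)‖₊ ≤ 1 := by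
  rw [← NNReal.coe_le_coe, coe_nnnorm, show (s : ℂ) + 1 = ((s + 1 : ℝ) : ℂ) by push_cast; rfl,
    Complex.norm_real, Real.norm_eq_abs, NNReal.coe_one, abs_le]
  constructor <;> linarith [hs.1, hs.2]

lemma sb_I_coord (hχ : IsCutoff χ) (hL : Frq P D Y L) {ι : Type*} {p : ι → Prop} (i : Fin 2) :
    SB P D Y p 1 fun (_ : ι) ξ => Complex.I * ((L ξ) i : ℝ) :=
  (sb_coord hχ hL i).smul (c := fun _ => Complex.I) 1 fun _ _ => by simp

/-- The kernel of an operator of order zero, applied to the terms `bet`. -/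
lemma sb_mul_bet (hL : Frq P D Y L) {g : ℝ × ℝ → V → ℂ}
    (hg : SB P D Y InSq 0 g) (hg' : ∀ i : Fin 2, SB P D Y InSq 1 fun q ξ => g q ξ * ((L ξ) i : ℝ))
    (j : Fin 4) (b : Fin 3) : SB P D Y InSq 1 fun q ξ => g q ξ * bet j b q.2 (L ξ) := by
  obtain ⟨C, hC⟩ : Frq P D Y L := hL
  have h0 := hg.mono hC (show 0 ≤ 1 by norm_num)
  have h1 := h0.smul (c := fun q => (q.2 : ℂ) + 1) 1 fun q hq => nnnorm_add_one hq.2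
  have h2 : ∀ i : Fin 2, SB P D Y InSq 1 fun q ξ => g q ξ * (Complex.I * ((L ξ) i : ℝ) * (q.2 + 1)) :=
    fun i => ((hg' i).smul (c := fun q => Complex.I * ((q.2 : ℂ) + 1)) 1 fun q hq => by
      simpa using nnnorm_add_one hq.2).congr fun q _ k ξ _ => by ring
  have h3 := h0.neg
  have hz : SB P D Y InSq 1 fun (_ : ℝ × ℝ) _ => 0 := sb_zero
  fin_cases j <;> fin_cases b <;> simp [bet]
  all_goals first
    | exact hz
    | exact h3
    | exact h2 0
    | exact h2 1
    | exact h1.congr fun q _ k ξ _ => mul_comm _ _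

lemma sb_tsym (hχ : IsCutoff χ) (hL : Frq P D Y L) (hT : Tot D L) (a : Fin 3) (j : Fin 4)
    (b : Fin 3) : SB P D Y InSq 1 fun q ξ => tsym q.1 a j b q.2 (L ξ) := by
  have hV : SB P D Y InSq 1 fun q ξ =>
      (kVA q.1 q.2 ‖L ξ‖ * alp j b q.2 + kVR q.1 q.2 ‖L ξ‖ * bet j b q.2 (L ξ) : ℂ) := by
    refine SB.add ?_ (sb_mul_bet hL (sb_kVR hL) (fun i => ?_) j b)
    · exact ((sb_kVA hχ hL).smul (c := fun q => (alp j b q.2 : ℂ)) 1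
        fun q hq => nnnorm_alp hq.2).congr fun q _ k ξ _ => mul_comm _ _
    · simpa using (sb_kVR hL).mul (sb_coord hχ hL i)
  have hP : ∀ l : Fin 2, SB P D Y InSq 1 fun q ξ => Complex.I * ((L ξ) l : ℝ) *
      (kPA q.1 q.2 ‖L ξ‖ * alp j b q.2 + kPR q.1 q.2 ‖L ξ‖ * bet j b q.2 (L ξ) : ℂ) := by
    intro l
    have h1 : SB P D Y InSq 1 fun q ξ => Complex.I * ((L ξ) l : ℝ) *
        (kPA q.1 q.2 ‖L ξ‖ * alp j b q.2 : ℂ) := by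
      refine ((sb_I_coord hχ hL l).mul ((sb_kPA hL).smul (c := fun q => (alp j b q.2 : ℂ)) 1
        fun q hq => nnnorm_alp hq.2)).congr fun q _ k ξ _ => ?_
      ring
    have hr : ∀ i : Fin 2, SB P D Y InSq 1 fun q ξ =>
        Complex.I * ((L ξ) l : ℝ) * (kPR q.1 q.2 ‖L ξ‖ : ℝ) * ((L ξ) i : ℝ) := by
      intro i
      refine (((sb_riesz hχ hL hT l i).mul (sb_sq_kPR hχ hL hT)).smul (c := fun _ => Complex.I) 1
        fun _ _ => by simp).congr fun q _ k ξ hξ => ?_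
      have : ((‖L ξ‖ : ℝ) : ℂ) ≠ 0 := by exact_mod_cast (hT.ne_zero hξ).ne'
      push_cast
      field_simp
    have hk : SB P D Y InSq 1 fun q ξ => Complex.I * ((L ξ) l : ℝ) * (kPR q.1 q.2 ‖L ξ‖ : ℝ) := by
      simpa using (sb_I_coord hχ hL l).mul (sb_kPR hL hT)
    have h1' := hk.smul (c := fun q => (q.2 : ℂ) + 1) 1 fun q hq => nnnorm_add_one hq.2
    have h2 : ∀ i : Fin 2, SB P D Y InSq 1 fun q ξ => Complex.I * ((L ξ) l : ℝ) *
        ((kPR q.1 q.2 ‖L ξ‖ : ℝ) * (Complex.I * ((L ξ) i : ℝ) * (q.2 + 1))) :=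
      fun i => ((hr i).smul (c := fun q => Complex.I * ((q.2 : ℂ) + 1)) 1 fun q hq => by
        simpa using nnnorm_add_one hq.2).congr fun q _ k ξ _ => by ring
    have h3 := hk.neg
    have h4 : SB P D Y InSq 1 fun q ξ => Complex.I * ((L ξ) l : ℝ) *
        ((kPR q.1 q.2 ‖L ξ‖ : ℝ) * bet j b q.2 (L ξ)) := by
      have hz : SB P D Y InSq 1 fun (_ : ℝ × ℝ) _ => 0 := sb_zero
      fin_cases j <;> fin_cases b <;> simp only [bet] <;> simp
      all_goals first
        | exact hz
        | exact h3
        | exact h2 0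
        | exact h2 1
        | exact h1'.congr fun q _ k ξ _ => by ring
    refine (h1.add h4).congr fun q _ k ξ _ => ?_
    ring
  fin_cases a
  · exact hP 0
  · exact hP 1
  · exact hV

/-- The interval `[-1,0]`. -/
def InI (s : ℝ) : Prop := s ∈ Icc (-1 : ℝ) 0

lemma abs_add_one_le {s : ℝ} (hs : InI s) : |s + 1| ≤ 1 := by
  rw [abs_le]
  constructor <;> linarith [hs.1, hs.2]

lemma sb_mA (hL : Frq P D Y L) : SB P D Y InI 0 fun s ξ => ((mA s ‖L ξ‖ : ℝ) : ℂ) :=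
  sb_cosh hL fun _ hs => abs_add_one_le hs

lemma sb_mB (hχ : IsCutoff χ) (hL : Frq P D Y L) :
    SB P D Y InI 1 fun s ξ => ((mB s ‖L ξ‖ : ℝ) : ℂ) :=
  sb_rsinh hχ hL fun _ hs => abs_add_one_le hs

lemma sb_mB_zero (hχ : IsCutoff χ) (hL : Frq P D Y L) :
    SB P D Y InI 1 fun _ ξ => ((mB 0 ‖L ξ‖ : ℝ) : ℂ) :=
  sb_rsinh hχ hL fun _ _ => by norm_num

lemma sb_symA (hχ : IsCutoff χ) (hL : Frq P D Y L) (b : Fin 3) :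
    SB P D Y InI 1 fun s ξ => symA b s (L ξ) := by
  fin_cases b
  · exact (sb_I_coord hχ hL 0).mul (sb_mA hL)
  · exact (sb_I_coord hχ hL 1).mul (sb_mA hL)
  · exact sb_mB hχ hL

lemma sb_symB (hχ : IsCutoff χ) (hL : Frq P D Y L) (hL' : Frq P D Y L') (hS : Frq P D Y (L + L'))
    (b : Fin 3) : SB P D Y InI 2 fun s ξ => symB b s (L ξ) (L' ξ) := by
  have hs : ∀ s, InI s → ‖(1 + s : ℂ)‖₊ ≤ 1 := fun s hs => by
    rw [add_comm]
    exact nnnorm_add_one hs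
  have h1 : SB P D Y InI 1 fun s ξ =>
      ((1 + s) * mB s ‖L' ξ‖ - mA s ‖L ξ + L' ξ‖ * mB 0 ‖L' ξ‖ : ℂ) := by
    refine ((sb_mB hχ hL').smul (c := fun s => (1 + s : ℂ)) 1 hs).sub ?_
    simpa using (sb_mA hS).mul (sb_mB_zero hχ hL')
  have h2 := (sb_mB hχ hL').mono hL.one_le (show 1 ≤ 2 by norm_num)
  have h3 : SB P D Y InI 2 fun s ξ => ((1 + s : ℂ) * ((‖L' ξ‖ ^ 2 : ℝ) * (mA s ‖L' ξ‖ : ℝ))) :=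
    ((sb_normsq hχ hL').mul (sb_mA hL')).smul (c := fun s => (1 + s : ℂ)) 1 hs
  have h4 : SB P D Y InI 2 fun s ξ => (((mB s ‖L ξ + L' ξ‖ : ℝ) : ℂ) * (mB 0 ‖L' ξ‖ : ℝ)) :=
    (sb_mB hχ hS).mul (sb_mB_zero hχ hL')
  fin_cases b
  · exact (sb_I_coord hχ hS 0).mul h1
  · exact (sb_I_coord hχ hS 1).mul h1
  · refine ((h2.add h3).sub h4).congr fun s _ k ξ _ => ?_
    simp [symB]

end Bounds

end
end WaterWaves

namespace WaterWaves
open Filter Topology FourierTransform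
open scoped NNReal
noncomputable section

/-! ### Bounds for localized symbols -/

section Weighted

set_option linter.unusedSectionVars false

variable {V : Type*} [NormedAddCommGroup V] [NormedSpace ℝ V] [FiniteDimensional ℝ V]
  [SecondCountableTopology V] [MeasureSpace V] [BorelSpace V] [(volume : Measure V).IsAddHaarMeasure]
  {P : V →L[ℝ] V →L[ℝ] ℝ}
  {κ ι : Type*} {w : κ → V → ℂ} {Y : κ → ℝ≥0} {p : ι → Prop}

/-- The symbols `g i`, localized by `w k`, are multipliers of size `Y k ^ d`. -/
def SW (P : V →L[ℝ] V →L[ℝ] ℝ) (w : κ → V → ℂ) (Y : κ → ℝ≥0) (p : ι → Prop) (d : ℕ)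
    (g : ι → V → ℂ) : Prop :=
  ∃ C : ℝ≥0, ∀ i, p i → ∀ k, Mult P (fun ξ => w k ξ * g i ξ) (C * Y k ^ d)

lemma SB.sw {d : ℕ} {g : ι → V → ℂ} (h : SB P (fun k => {ξ | w k ξ ≠ 0}) Y p d g)
    (hw : ∃ C, ∀ k, Mult P (w k) C) : SW P w Y p d g := by
  obtain ⟨C, hC⟩ := h
  obtain ⟨Cw, hCw⟩ := hw
  refine ⟨Cw * C, fun i hi k => ?_⟩
  obtain ⟨m, hm, he⟩ := hC i hi k
  refine (((hCw k).mul hm).mono (by rw [mul_assoc])).congr fun ξ => ?_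
  by_cases h0 : w k ξ = 0
  · rw [h0, zero_mul, zero_mul]
  · rw [he ξ h0]

lemma SW.add {d : ℕ} {g g' : ι → V → ℂ} (h : SW P w Y p d g) (h' : SW P w Y p d g') :
    SW P w Y p d fun i ξ => g i ξ + g' i ξ := by
  obtain ⟨C, hC⟩ := h
  obtain ⟨C', hC'⟩ := h'
  exact ⟨C + C', fun i hi k => (((hC i hi k).add (hC' i hi k)).mono (by rw [add_mul])).congr
    fun ξ => mul_add _ _ _⟩

lemma SW.neg {d : ℕ} {g : ι → V → ℂ} (h : SW P w Y p d g) :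
    SW P w Y p d fun i ξ => -g i ξ := by
  obtain ⟨C, hC⟩ := h
  exact ⟨C, fun i hi k => (((hC i hi k).smul (-1)).mono (by simp)).congr fun ξ => by ring⟩

lemma sw_zero {d : ℕ} : SW P w Y p d fun _ _ => 0 :=
  ⟨0, fun _ _ _ => ((mult_const 0).mono (by simp)).congr fun ξ => mul_zero _⟩

lemma sw_sum {α : Type*} (s : Finset α) {d : ℕ} {g : α → ι → V → ℂ}
    (h : ∀ a ∈ s, SW P w Y p d (g a)) : SW P w Y p d fun i ξ => ∑ a ∈ s, g a i ξ := by
  classical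
  induction s using Finset.induction_on with
  | empty => simpa using sw_zero
  | insert a s ha ih =>
    simp only [Finset.sum_insert ha]
    exact (h a (by simp)).add (ih fun b hb => h b (by simp [hb]))

lemma sw_integral {d : ℕ} {g : ℝ × ℝ → V → ℂ} (hwc : ∀ k, Continuous (w k)) (h : SW P w Y InSq d g)
    (hm : ∀ z, StronglyMeasurable fun q : ℝ × V => g (z, q.1) q.2) :
    SW P w Y InI d fun z ξ => ∫ s in Icc (-1 : ℝ) 0, g (z, s) ξ := by
  obtain ⟨C, hC⟩ := h
  refine ⟨C, fun z hz k => ?_⟩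
  have hw : StronglyMeasurable fun q : ℝ × V => w k q.2 * g (z, q.1) q.2 :=
    ((hwc k).comp continuous_snd).stronglyMeasurable.mul (hm z)
  refine (mult_integral (g := fun s ξ => w k ξ * g (z, s) ξ) (ν := volume.restrict (Icc (-1 : ℝ) 0))
    (B := fun _ => C * Y k ^ d) hw (by fun_prop) ?_ ?_).congr fun ξ => ?_
  · exact (ae_restrict_iff' measurableSet_Icc).2 (Eventually.of_forall fun s hs => hC (z, s) ⟨hz, hs⟩ k)
  · simp
  · rw [integral_const_mul]

end Weighted

/-! #### The pairings -/

instance : (volume : Measure (E × E)).IsAddHaarMeasure := Measure.prod.instIsAddHaarMeasure _ _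

instance : (volume : Measure (E × E × E)).IsAddHaarMeasure := Measure.prod.instIsAddHaarMeasure _ _

def inE : E →L[ℝ] E →L[ℝ] ℝ := innerSL ℝ

/-- The pairing of `E × W`, for a pairing of `W`. -/
def prodP {W : Type*} [NormedAddCommGroup W] [NormedSpace ℝ W] (Q : W →L[ℝ] W →L[ℝ] ℝ) :
    (E × W) →L[ℝ] (E × W) →L[ℝ] ℝ :=
  inE.bilinearComp (ContinuousLinearMap.fst ℝ E W) (ContinuousLinearMap.fst ℝ E W) +
    Q.bilinearComp (ContinuousLinearMap.snd ℝ E W) (ContinuousLinearMap.snd ℝ E W)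

def pair2 : (E × E) →L[ℝ] (E × E) →L[ℝ] ℝ := prodP inE

def pair3 : (E × E × E) →L[ℝ] (E × E × E) →L[ℝ] ℝ := prodP pair2

section

variable {W : Type*} [NormedAddCommGroup W] [NormedSpace ℝ W] {Q : W →L[ℝ] W →L[ℝ] ℝ}

lemma prodP_apply (x p : E × W) : prodP Q x p = inner ℝ x.1 p.1 + Q x.2 p.2 := rfl

lemma adj_id : Adj inE (ContinuousLinearMap.id ℝ E) (ContinuousLinearMap.id ℝ E) := ⟨fun _ _ => rfl⟩

lemma adj_fst : Adj (prodP Q) (ContinuousLinearMap.fst ℝ E W) (ContinuousLinearMap.inl ℝ E W) :=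
  ⟨fun y ξ => by simp [prodP_apply]⟩

lemma Adj.comp_snd {L : W →L[ℝ] E} {Lt : E →L[ℝ] W} (h : Adj Q L Lt) :
    Adj (prodP Q) (L.comp (ContinuousLinearMap.snd ℝ E W))
      ((ContinuousLinearMap.inr ℝ E W).comp Lt) :=
  ⟨fun y ξ => by simp [prodP_apply, h.eq]⟩

lemma Adj.add {L L' : W →L[ℝ] E} {Lt Lt' : E →L[ℝ] W} (h : Adj Q L Lt) (h' : Adj Q L' Lt') :
    Adj Q (L + L') (Lt + Lt') :=
  ⟨fun y ξ => by simp [h.eq, h'.eq, inner_add_right]⟩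

lemma ich_prodP (x p : E × W) : ich (prodP Q) x p = chr x.1 p.1 * ich Q x.2 p.2 := by
  rw [ich, prodP_apply, chr, ich, ← Complex.exp_add]
  push_cast
  ring_nf

lemma ich_inE (x p : E) : ich inE x p = chr x p := rfl

end

/-! #### The localized base symbols -/

variable {χ : ℝ → ℝ}

/-- The norm of the symbol of a dyadic localization. -/
def dyMass (χ : ℝ → ℝ) : ℝ≥0 := (∫ x, ‖∫ p, chr x p * phi3 χ p‖).toNNReal

lemma dyadic_cont (hχ : IsCutoff χ) (k : ℤ) : Continuous (dyadic χ k) := by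
  have := hχ.smooth.continuous
  unfold dyadic
  fun_prop

lemma phi3_smul (k : ℤ) (ζ : E) : phi3 χ (((2 : ℝ) ^ (-k)) • ζ) = dyadic χ k ζ := by
  rw [dyadic_eq, phi3]

lemma phi3_integrable (hχ : IsCutoff χ) : Integrable fun x => ∫ p, chr x p * phi3 χ p := by
  let S : SchwartzMap E ℂ := hχ.phi3.2.toSchwartzMap hχ.phi3.1
  have h1 : Integrable (𝓕 (phi3 χ)) := by
    have hF : 𝓕 (phi3 χ) = (𝓕 S : SchwartzMap E ℂ) := by
      rw [SchwartzMap.fourier_coe]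
      rfl
    rw [hF]
    exact (𝓕 S).integrable
  have hc : (-(2 * Real.pi))⁻¹ ≠ 0 := inv_ne_zero (neg_ne_zero.2 (by positivity))
  refine (h1.comp_smul hc).congr (Eventually.of_forall fun x => ?_)
  simp only
  rw [fourier_eq_chr, smul_smul, mul_inv_cancel₀ (neg_ne_zero.2 (by positivity)), one_smul]

lemma dyadic_fourier (k : ℤ) (x : E) : ∫ p, chr x p * (dyadic χ k p : ℂ) =
    (((2 : ℝ) ^ k) ^ 2 : ℝ) • ∫ p, chr (((2 : ℝ) ^ k) • x) p * phi3 χ p := by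
  have h := Measure.integral_comp_smul (volume : Measure E)
    (fun p => chr (((2 : ℝ) ^ k) • x) p * phi3 χ p) ((2 : ℝ) ^ (-k))
  rw [show Module.finrank ℝ E = 2 by simp] at h
  have h2 : |(((2 : ℝ) ^ (-k)) ^ 2)⁻¹| = ((2 : ℝ) ^ k) ^ 2 := by
    rw [zpow_neg, inv_pow, inv_inv, abs_of_nonneg (by positivity)]
  rw [h2] at h
  rw [← h]
  refine integral_congr_ae (Eventually.of_forall fun p => ?_)
  simp only
  rw [phi3_smul]
  congr 1
  rw [chr, chr, real_inner_smul_left, real_inner_smul_right, ← mul_assoc, zpow_neg,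
    mul_inv_cancel₀ (by positivity), one_mul]

lemma dyadic_mass (hχ : IsCutoff χ) (k : ℤ) :
    AEMeasurable (fun x => ‖∫ p, chr x p * (dyadic χ k p : ℂ)‖ₑ) ∧
      ∫⁻ x, ‖∫ p, chr x p * (dyadic χ k p : ℂ)‖ₑ = dyMass χ := by
  simp only [dyadic_fourier]
  have h1 := ((phi3_integrable hχ).comp_smul (R := (2 : ℝ) ^ k) (by positivity)).smul
    (((2 : ℝ) ^ k) ^ 2 : ℝ)
  refine ⟨h1.aestronglyMeasurable.enorm, ?_⟩
  have h2 := ofReal_integral_norm_eq_lintegral_enorm h1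
  simp only [Pi.smul_apply] at h2
  rw [← h2]
  simp only [norm_smul]
  rw [integral_const_mul, Measure.integral_comp_smul volume
    (fun x : E => ‖∫ p, chr x p * phi3 χ p‖) ((2 : ℝ) ^ k), show Module.finrank ℝ E = 2 by simp,
    abs_of_nonneg (by positivity), Real.norm_of_nonneg (by positivity), smul_eq_mul, ← mul_assoc,
    mul_inv_cancel₀ (by positivity), one_mul]
  rfl

/-- The norms of base symbols are multiplicative. -/
lemma lnorm_tensor {W : Type*} [NormedAddCommGroup W] [NormedSpace ℝ W] [MeasureSpace W]
    [SFinite (volume : Measure W)] {Q : W →L[ℝ] W →L[ℝ] ℝ} {f : E → ℂ} {g : W → ℂ}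
    (hf : AEMeasurable fun x => ‖∫ p, chr x p * f p‖ₑ)
    (hg : AEMeasurable fun x => ‖∫ p, ich Q x p * g p‖ₑ) :
    AEMeasurable (fun x => ‖∫ p, ich (prodP Q) x p * (f p.1 * g p.2)‖ₑ) ∧
    lnorm (prodP Q) (fun p => f p.1 * g p.2) = lnorm inE f * lnorm Q g := by
  have h : (fun x : E × W => ‖∫ p, ich (prodP Q) x p * (f p.1 * g p.2)‖ₑ) =
      fun x => ‖∫ p, chr x.1 p * f p‖ₑ * ‖∫ p, ich Q x.2 p * g p‖ₑ := by
    funext x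
    rw [← enorm_mul, ← integral_prod_mul]
    congr 1
    refine integral_congr_ae (Eventually.of_forall fun p => ?_)
    simp only [ich_prodP]
    ring
  constructor
  · rw [h]
    exact (hf.comp_quasiMeasurePreserving Measure.quasiMeasurePreserving_fst).mul
      (hg.comp_quasiMeasurePreserving Measure.quasiMeasurePreserving_snd)
  · rw [lnorm, h]
    exact lintegral_prod_mul hf hg

/-- The localization at `|ξ₁| ~ 2 ^ k₁`, `|ξ₂| ~ 2 ^ k₂`. -/
def base2 (χ : ℝ → ℝ) (k₁ k₂ : ℤ) (p : E × E) : ℂ := (dyadic χ k₁ p.1 : ℂ) * (dyadic χ k₂ p.2 : ℂ)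

def base3 (χ : ℝ → ℝ) (k₁ k₂ k₃ : ℤ) (p : E × E × E) : ℂ :=
  (dyadic χ k₁ p.1 : ℂ) * base2 χ k₂ k₃ p.2

lemma lnorm_base2 (hχ : IsCutoff χ) (k₁ k₂ : ℤ) :
    AEMeasurable (fun x => ‖∫ p, ich pair2 x p * base2 χ k₁ k₂ p‖ₑ) ∧
    lnorm pair2 (base2 χ k₁ k₂) = dyMass χ ^ 2 := by
  have h := lnorm_tensor (Q := inE) (dyadic_mass hχ k₁).1 (dyadic_mass hχ k₂).1
  refine ⟨h.1, h.2.trans ?_⟩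
  rw [lnorm, lnorm]
  simp only [ich_inE]
  rw [(dyadic_mass hχ k₁).2, (dyadic_mass hχ k₂).2, sq]

lemma lnorm_base3 (hχ : IsCutoff χ) (k₁ k₂ k₃ : ℤ) :
    lnorm pair3 (base3 χ k₁ k₂ k₃) = dyMass χ ^ 3 := by
  have h := lnorm_tensor (Q := pair2) (dyadic_mass hχ k₁).1 (lnorm_base2 hχ k₂ k₃).1
  refine h.2.trans ?_
  rw [(lnorm_base2 hχ k₂ k₃).2, lnorm]
  simp only [ich_inE]
  rw [(dyadic_mass hχ k₁).2]
  ring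

lemma compact_dyadic (hχ : IsCutoff χ) (k : ℤ) :
    dyadic χ k = fun ζ => if ‖ζ‖ ≤ 3 / 2 * 2 ^ k then dyadic χ k ζ else 0 := by
  funext ζ
  split_ifs with h
  · rfl
  · have h2 : (0 : ℝ) < 2 ^ k := by positivity
    push Not at h
    rw [dyadic, hχ.eq_zero ((lt_div_iff₀ h2).2 h), hχ.eq_zero, sub_zero]
    rw [lt_div_iff₀ (by positivity), zpow_sub_one₀ (by norm_num)]
    linarith

lemma dyadic_eq_zero (hχ : IsCutoff χ) {k : ℤ} {ζ : E} (h : 3 / 2 * 2 ^ k < ‖ζ‖) :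
    dyadic χ k ζ = 0 := by
  rw [compact_dyadic hχ k]
  exact if_neg (not_le.2 h)

lemma base2_compact (hχ : IsCutoff χ) (k₁ k₂ : ℤ) : HasCompactSupport (base2 χ k₁ k₂) := by
  refine HasCompactSupport.intro ((isCompact_closedBall (0 : E) (3 / 2 * 2 ^ k₁)).prod
    (isCompact_closedBall (0 : E) (3 / 2 * 2 ^ k₂))) fun p hp => ?_
  rw [mem_prod, not_and_or] at hp
  rw [base2]
  rcases hp with hp | hp <;> rw [mem_closedBall_zero_iff, not_le] at hp <;>
    rw [dyadic_eq_zero hχ hp] <;> simp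

lemma base3_compact (hχ : IsCutoff χ) (k₁ k₂ k₃ : ℤ) : HasCompactSupport (base3 χ k₁ k₂ k₃) := by
  refine HasCompactSupport.intro ((isCompact_closedBall (0 : E) (3 / 2 * 2 ^ k₁)).prod
    ((isCompact_closedBall (0 : E) (3 / 2 * 2 ^ k₂)).prod
      (isCompact_closedBall (0 : E) (3 / 2 * 2 ^ k₃)))) fun p hp => ?_
  rw [mem_prod, mem_prod, not_and_or, not_and_or] at hp
  rw [base3, base2]
  rcases hp with hp | hp | hp <;> rw [mem_closedBall_zero_iff, not_le] at hp <;>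
    rw [dyadic_eq_zero hχ hp] <;> simp

lemma base2_cont (hχ : IsCutoff χ) (k₁ k₂ : ℤ) : Continuous (base2 χ k₁ k₂) := by
  have h1 := dyadic_cont hχ k₁
  have h2 := dyadic_cont hχ k₂
  unfold base2
  fun_prop

lemma base3_cont (hχ : IsCutoff χ) (k₁ k₂ k₃ : ℤ) : Continuous (base3 χ k₁ k₂ k₃) := by
  have h1 := dyadic_cont hχ k₁
  have h2 := base2_cont hχ k₂ k₃
  unfold base3
  fun_prop

/-! #### The weights -/

/-- A wider dyadic cutoff. -/
def fat (χ : ℝ → ℝ) (k : ℤ) (ζ : E) : ℝ := cut χ (k + 1) ζ - cut χ (k - 2) ζ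

lemma fat_ne_zero (hχ : IsCutoff χ) {k : ℤ} {ζ : E} (h : fat χ k ζ ≠ 0) :
    5 / 16 * 2 ^ k < ‖ζ‖ ∧ ‖ζ‖ ≤ 3 * 2 ^ k := by
  have h2 : (0 : ℝ) < 2 ^ k := by positivity
  have e1 : (2 : ℝ) ^ (k + 1) = 2 ^ k * 2 := zpow_add_one₀ (by norm_num) k
  have e2 : (2 : ℝ) ^ (k - 2) = 2 ^ k / 4 := by rw [zpow_sub₀ (by norm_num)]; norm_num
  constructor
  · by_contra h0
    push Not at h0
    refine h ?_
    rw [fat, cut_eq_one hχ (by rw [e1]; linarith), cut_eq_one hχ (by rw [e2]; linarith), sub_self]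
  · by_contra h0
    push Not at h0
    refine h ?_
    rw [fat, cut_eq_zero hχ (by rw [e1]; linarith), cut_eq_zero hχ (by rw [e2]; linarith), sub_self]

lemma fat_mul_dyadic (hχ : IsCutoff χ) (k : ℤ) (ζ : E) :
    fat χ k ζ * dyadic χ k ζ = dyadic χ k ζ := by
  by_cases h : dyadic χ k ζ = 0
  · rw [h, mul_zero]
  · have h2 : (0 : ℝ) < 2 ^ k := by positivity
    have e0 : (2 : ℝ) ^ (k - 1) = 2 ^ k / 2 := by rw [zpow_sub₀ (by norm_num)]; norm_num
    have e1 : (2 : ℝ) ^ (k + 1) = 2 ^ k * 2 := zpow_add_one₀ (by norm_num) k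
    have e2 : (2 : ℝ) ^ (k - 2) = 2 ^ k / 4 := by rw [zpow_sub₀ (by norm_num)]; norm_num
    have h3 : ‖ζ‖ ≤ 3 / 2 * 2 ^ k := by
      by_contra h0
      exact h (dyadic_eq_zero hχ (not_le.1 h0))
    have h4 : 5 / 8 * 2 ^ k < ‖ζ‖ := by
      by_contra h0
      push Not at h0
      refine h ?_
      have := cut_eq_one hχ (N := k) (ζ := ζ) (by linarith)
      have h5 := cut_eq_one hχ (N := k - 1) (ζ := ζ) (by rw [e0]; linarith)
      rw [cut] at this h5
      rw [dyadic, this, h5, sub_self]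
    rw [fat, cut_eq_one hχ (by rw [e1]; linarith), cut_eq_zero hχ (by rw [e2]; linarith), sub_zero,
      one_mul]

/-- The size of the frequencies, from below by `1`. -/
def Ysz (m : ℤ) : ℝ≥0 := 2 ^ max m 0

lemma one_le_Ysz (m : ℤ) : 1 ≤ Ysz m := one_le_zpow₀ (by norm_num) (le_max_right _ _)

lemma two_zpow_le_Ysz {j m : ℤ} (h : j ≤ m) : (2 : ℝ) ^ j ≤ 2 ^ m :=
  zpow_le_zpow_right₀ (by norm_num) h

section Weight

set_option linter.unusedSectionVars false

variable {V : Type*} [NormedAddCommGroup V] [NormedSpace ℝ V] [FiniteDimensional ℝ V]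
  [SecondCountableTopology V] [MeasureSpace V] [BorelSpace V] [(volume : Measure V).IsAddHaarMeasure]
  {P : V →L[ℝ] V →L[ℝ] ℝ} {L : V →L[ℝ] E} {Lt : E →L[ℝ] V}

lemma mult_fat (hχ : IsCutoff χ) (h : Adj P L Lt) (k : ℤ) :
    Mult P (fun ξ => ((fat χ k (L ξ) : ℝ) : ℂ)) (2 * cst χ) :=
  (((mult_cut hχ h (k + 1)).sub (mult_cut hχ h (k - 2))).mono (by rw [two_mul])).congr fun ξ => by
    rw [fat]
    push_cast
    rfl

lemma mult_dyadic (hχ : IsCutoff χ) (h : Adj P L Lt) (k : ℤ) :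
    Mult P (fun ξ => ((dyadic χ k (L ξ) : ℝ) : ℂ)) (2 * cst χ) :=
  (((mult_cut hχ h k).sub (mult_cut hχ h (k - 1))).mono (by rw [two_mul])).congr fun ξ => by
    rw [dyadic, cut, cut]
    push_cast
    rfl

/-- A linear map that is bounded by `9 · 2 ^ m` on `D` is of size `2 ^ max m 0`. -/
lemma frq_of_le {κ : Type*} {D : κ → Set V} {m : κ → ℤ} (h : Adj P L Lt)
    (hD : ∀ k, ∀ ξ ∈ D k, ‖L ξ‖ ≤ 9 * 2 ^ m k) : Frq P D (fun k => Ysz (m k)) L where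
  adj := ⟨Lt, h⟩
  one_le k := one_le_Ysz _
  bd k := by
    refine ⟨m k + 3, ?_, fun ξ hξ => (hD k ξ hξ).trans ?_⟩
    · rw [zpow_add₀ (by norm_num), mul_comm, Ysz]
      norm_num
    · rw [zpow_add₀ (by norm_num)]
      have : (0 : ℝ) < 2 ^ m k := by positivity
      norm_num
      linarith

end Weight

end
end WaterWaves

namespace WaterWaves
open Filter Topology FourierTransform
open scoped NNReal
noncomputable section

/-! ### The bounds for the bilinear and the trilinear symbols -/

variable {χ : ℝ → ℝ}

def prE1 : (E × E) →L[ℝ] E := ContinuousLinearMap.fst ℝ E E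

def prE2 : (E × E) →L[ℝ] E :=
  (ContinuousLinearMap.id ℝ E).comp (ContinuousLinearMap.snd ℝ E E)

def prS : (E × E) →L[ℝ] E := prE1 + prE2

def prT1 : (E × E × E) →L[ℝ] E := ContinuousLinearMap.fst ℝ E (E × E)

def prT2 : (E × E × E) →L[ℝ] E := prE1.comp (ContinuousLinearMap.snd ℝ E (E × E))

def prT3 : (E × E × E) →L[ℝ] E := prE2.comp (ContinuousLinearMap.snd ℝ E (E × E))

def prT : (E × E × E) →L[ℝ] E := prT1 + prT2 + prT3

lemma prS_apply (p : E × E) : prS p = p.1 + p.2 := rfl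

lemma prT_apply (p : E × E × E) : prT p = p.1 + p.2.1 + p.2.2 := rfl

lemma adj_prE1 : ∃ Lt, Adj pair2 prE1 Lt := ⟨_, adj_fst⟩

lemma adj_prE2 : ∃ Lt, Adj pair2 prE2 Lt := ⟨_, adj_id.comp_snd⟩

lemma adj_prS : ∃ Lt, Adj pair2 prS Lt :=
  let ⟨_, h1⟩ := adj_prE1
  let ⟨_, h2⟩ := adj_prE2
  ⟨_, h1.add h2⟩

lemma adj_prT1 : ∃ Lt, Adj pair3 prT1 Lt := ⟨_, adj_fst⟩

lemma adj_prT2 : ∃ Lt, Adj pair3 prT2 Lt :=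
  let ⟨_, h1⟩ := adj_prE1
  ⟨_, h1.comp_snd⟩

lemma adj_prT3 : ∃ Lt, Adj pair3 prT3 Lt :=
  let ⟨_, h1⟩ := adj_prE2
  ⟨_, h1.comp_snd⟩

lemma adj_prT12 : ∃ Lt, Adj pair3 (prT1 + prT2) Lt :=
  let ⟨_, h1⟩ := adj_prT1
  let ⟨_, h2⟩ := adj_prT2
  ⟨_, h1.add h2⟩

lemma adj_prT : ∃ Lt, Adj pair3 prT Lt :=
  let ⟨_, h1⟩ := adj_prT12
  let ⟨_, h2⟩ := adj_prT3
  ⟨_, h1.add h2⟩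

/-- The weight for bilinear symbols at the frequencies `k = (k, k₁, k₂)`. -/
def wt2 (χ : ℝ → ℝ) (k : ℤ × ℤ × ℤ) (p : E × E) : ℂ :=
  (fat χ k.1 (prS p) : ℂ) * (fat χ k.2.1 (prE1 p) * fat χ k.2.2 (prE2 p))

/-- The weight for trilinear symbols at the frequencies `k = (k, k₁, k₂, k₃)`. -/
def wt3 (χ : ℝ → ℝ) (k : ℤ × ℤ × ℤ × ℤ) (p : E × E × E) : ℂ :=
  (fat χ k.1 (prT p) : ℂ) *
    (fat χ k.2.1 (prT1 p) * (fat χ k.2.2.1 (prT2 p) * fat χ k.2.2.2 (prT3 p)))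

def max2 (k : ℤ × ℤ × ℤ) : ℤ := max k.2.1 k.2.2

def max3 (k : ℤ × ℤ × ℤ × ℤ) : ℤ := max k.2.1 (max k.2.2.1 k.2.2.2)

lemma mult_wt2 (hχ : IsCutoff χ) : ∃ C, ∀ k, Mult pair2 (wt2 χ k) C := by
  obtain ⟨_, h0⟩ := adj_prS
  obtain ⟨_, h1⟩ := adj_prE1
  obtain ⟨_, h2⟩ := adj_prE2
  exact ⟨_, fun k => (mult_fat hχ h0 k.1).mul ((mult_fat hχ h1 k.2.1).mul (mult_fat hχ h2 k.2.2))⟩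

lemma mult_wt3 (hχ : IsCutoff χ) : ∃ C, ∀ k, Mult pair3 (wt3 χ k) C := by
  obtain ⟨_, h0⟩ := adj_prT
  obtain ⟨_, h1⟩ := adj_prT1
  obtain ⟨_, h2⟩ := adj_prT2
  obtain ⟨_, h3⟩ := adj_prT3
  exact ⟨_, fun k => (mult_fat hχ h0 k.1).mul ((mult_fat hχ h1 k.2.1).mul
    ((mult_fat hχ h2 k.2.2.1).mul (mult_fat hχ h3 k.2.2.2)))⟩

/-- The region of the frequencies `k`. -/
def reg2 (χ : ℝ → ℝ) (k : ℤ × ℤ × ℤ) : Set (E × E) := {p | wt2 χ k p ≠ 0}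

def reg3 (χ : ℝ → ℝ) (k : ℤ × ℤ × ℤ × ℤ) : Set (E × E × E) := {p | wt3 χ k p ≠ 0}

lemma mem_reg2 (hχ : IsCutoff χ) {k : ℤ × ℤ × ℤ} {p : E × E} (h : p ∈ reg2 χ k) :
    (5 / 16 * 2 ^ k.1 < ‖prS p‖ ∧ ‖prS p‖ ≤ 3 * 2 ^ k.1) ∧
      ‖prE1 p‖ ≤ 3 * 2 ^ max2 k ∧ ‖prE2 p‖ ≤ 3 * 2 ^ max2 k := by
  rw [reg2, mem_ofPred_eq, wt2, mul_ne_zero_iff, mul_ne_zero_iff, Complex.ofReal_ne_zero,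
    Complex.ofReal_ne_zero, Complex.ofReal_ne_zero] at h
  refine ⟨fat_ne_zero hχ h.1, (fat_ne_zero hχ h.2.1).2.trans ?_, (fat_ne_zero hχ h.2.2).2.trans ?_⟩
  · exact mul_le_mul_of_nonneg_left (two_zpow_le_Ysz (le_max_left _ _)) (by norm_num)
  · exact mul_le_mul_of_nonneg_left (two_zpow_le_Ysz (le_max_right _ _)) (by norm_num)

lemma mem_reg3 (hχ : IsCutoff χ) {k : ℤ × ℤ × ℤ × ℤ} {p : E × E × E} (h : p ∈ reg3 χ k) :
    (5 / 16 * 2 ^ k.1 < ‖prT p‖ ∧ ‖prT p‖ ≤ 3 * 2 ^ k.1) ∧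
      ‖prT1 p‖ ≤ 3 * 2 ^ max3 k ∧ ‖prT2 p‖ ≤ 3 * 2 ^ max3 k ∧ ‖prT3 p‖ ≤ 3 * 2 ^ max3 k := by
  rw [reg3, mem_ofPred_eq, wt3, mul_ne_zero_iff, mul_ne_zero_iff, mul_ne_zero_iff,
    Complex.ofReal_ne_zero, Complex.ofReal_ne_zero, Complex.ofReal_ne_zero,
    Complex.ofReal_ne_zero] at h
  refine ⟨fat_ne_zero hχ h.1, (fat_ne_zero hχ h.2.1).2.trans ?_,
    (fat_ne_zero hχ h.2.2.1).2.trans ?_, (fat_ne_zero hχ h.2.2.2).2.trans ?_⟩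
  · exact mul_le_mul_of_nonneg_left (two_zpow_le_Ysz (le_max_left _ _)) (by norm_num)
  · exact mul_le_mul_of_nonneg_left
      (two_zpow_le_Ysz ((le_max_left _ _).trans (le_max_right _ _))) (by norm_num)
  · exact mul_le_mul_of_nonneg_left
      (two_zpow_le_Ysz ((le_max_right _ _).trans (le_max_right _ _))) (by norm_num)

lemma tot_prS (hχ : IsCutoff χ) : Tot (reg2 χ) prS := fun k => ⟨k.1, fun _ h => (mem_reg2 hχ h).1⟩

lemma tot_prT (hχ : IsCutoff χ) : Tot (reg3 χ) prT := fun k => ⟨k.1, fun _ h => (mem_reg3 hχ h).1⟩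

lemma frq_prS (hχ : IsCutoff χ) : Frq pair2 (reg2 χ) (fun k => Ysz (max2 k)) prS := by
  obtain ⟨_, h0⟩ := adj_prS
  refine frq_of_le h0 fun k ξ hξ => ?_
  obtain ⟨-, h1, h2⟩ := mem_reg2 hχ hξ
  have : (0 : ℝ) < 2 ^ max2 k := by positivity
  have h3 := norm_add_le (prE1 ξ) (prE2 ξ)
  have e : prS ξ = prE1 ξ + prE2 ξ := rfl
  rw [e]
  linarith

lemma frq_prT (hχ : IsCutoff χ) : Frq pair3 (reg3 χ) (fun k => Ysz (max3 k)) prT := by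
  obtain ⟨_, h0⟩ := adj_prT
  refine frq_of_le h0 fun k ξ hξ => ?_
  obtain ⟨-, h1, h2, h3⟩ := mem_reg3 hχ hξ
  have h4 := norm_add₃_le (a := prT1 ξ) (b := prT2 ξ) (c := prT3 ξ)
  have e : prT ξ = prT1 ξ + prT2 ξ + prT3 ξ := rfl
  rw [e]
  linarith

lemma frq_prT12 (hχ : IsCutoff χ) :
    Frq pair3 (reg3 χ) (fun k => Ysz (max3 k)) (prT1 + prT2) := by
  obtain ⟨_, h0⟩ := adj_prT12
  refine frq_of_le h0 fun k ξ hξ => ?_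
  obtain ⟨-, h1, h2, h3⟩ := mem_reg3 hχ hξ
  have : (0 : ℝ) < 2 ^ max3 k := by positivity
  have h4 := norm_add_le (prT1 ξ) (prT2 ξ)
  have e : (prT1 + prT2) ξ = prT1 ξ + prT2 ξ := rfl
  rw [e]
  linarith

lemma frq_prT1 (hχ : IsCutoff χ) : Frq pair3 (reg3 χ) (fun k => Ysz (max3 k)) prT1 := by
  obtain ⟨_, h0⟩ := adj_prT1
  refine frq_of_le h0 fun k ξ hξ => ?_
  obtain ⟨-, h1, h2, h3⟩ := mem_reg3 hχ hξ
  have : (0 : ℝ) < 2 ^ max3 k := by positivity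
  linarith

lemma frq_prT2 (hχ : IsCutoff χ) : Frq pair3 (reg3 χ) (fun k => Ysz (max3 k)) prT2 := by
  obtain ⟨_, h0⟩ := adj_prT2
  refine frq_of_le h0 fun k ξ hξ => ?_
  obtain ⟨-, h1, h2, h3⟩ := mem_reg3 hχ hξ
  have : (0 : ℝ) < 2 ^ max3 k := by positivity
  linarith

/-- Multiplier bounds for weighted symbols imply bounds for the norms of their localizations. -/
lemma SW.sNorm2_le (hχ : IsCutoff χ) {ι : Type*} {p : ι → Prop} {d : ℕ} {q : ι → E → E → ℂ}
    (h : SW pair2 (wt2 χ) (fun k => Ysz (max2 k)) p d fun i ξ => q i ξ.1 ξ.2) :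
    ∃ K : ℝ≥0, ∀ i, p i → ∀ k k₁ k₂, sNorm2 χ k k₁ k₂ (q i) ≤
      ((K * Ysz (max k₁ k₂) ^ d : ℝ≥0) : ℝ≥0∞) := by
  obtain ⟨C, hC⟩ := h
  refine ⟨C * (2 * cst χ) * dyMass χ ^ 2, fun i hi k k₁ k₂ => ?_⟩
  obtain ⟨_, hS⟩ := adj_prS
  have hm := (hC i hi (k, k₁, k₂)).mul (mult_dyadic hχ hS k)
  have e : loc2 χ k k₁ k₂ (q i) = fun ξ => wt2 χ (k, k₁, k₂) ξ * q i ξ.1 ξ.2 *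
      ((dyadic χ k (prS ξ) : ℝ) : ℂ) * base2 χ k₁ k₂ ξ := by
    funext ξ
    rw [loc2, base2, wt2]
    simp only [prS_apply]
    have e1 : prE1 ξ = ξ.1 := rfl
    have e2 : prE2 ξ = ξ.2 := rfl
    have f1 := fat_mul_dyadic hχ k (ξ.1 + ξ.2)
    have f2 := fat_mul_dyadic hχ k₁ ξ.1
    have f3 := fat_mul_dyadic hχ k₂ ξ.2
    rw [e1, e2]
    conv_lhs => rw [← f1, ← f2, ← f3]
    push_cast
    ring
  have hcont : Continuous (loc2 χ k k₁ k₂ (q i)) := by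
    rw [e]
    exact hm.cont.mul (base2_cont hχ k₁ k₂)
  rw [sNorm2, if_pos hcont]
  have hb := hm.bound (base2 χ k₁ k₂) (base2_cont hχ k₁ k₂) (base2_compact hχ k₁ k₂)
  rw [(lnorm_base2 hχ k₁ k₂).2, ← e] at hb
  refine le_trans (lintegral_mono fun x => ?_) (hb.trans (le_of_eq ?_))
  · rw [enorm_mul]
    refine (mul_le_of_le_one_left (zero_le) ?_).trans (le_of_eq ?_)
    · rw [enorm_pow]
      refine pow_le_one₀ (zero_le) ?_
      rw [← ofReal_norm, norm_inv, Complex.norm_real, Real.norm_of_nonneg (by positivity)]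
      refine ENNReal.ofReal_le_one.2 (inv_le_one_of_one_le₀ ?_)
      linarith [Real.pi_gt_three]
    · congr 2
      funext ξ
      rw [pair2, ich_prodP, ich_inE]
  · simp only [max2]
    push_cast
    ring

lemma SW.sNorm3_le (hχ : IsCutoff χ) {ι : Type*} {p : ι → Prop} {d : ℕ} {c : ι → E → E → E → ℂ}
    (h : SW pair3 (wt3 χ) (fun k => Ysz (max3 k)) p d fun i ξ => c i ξ.1 ξ.2.1 ξ.2.2) :
    ∃ K : ℝ≥0, ∀ i, p i → ∀ k k₁ k₂ k₃, sNorm3 χ k k₁ k₂ k₃ (c i) ≤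
      ((K * Ysz (max k₁ (max k₂ k₃)) ^ d : ℝ≥0) : ℝ≥0∞) := by
  obtain ⟨C, hC⟩ := h
  refine ⟨C * (2 * cst χ) * dyMass χ ^ 3, fun i hi k k₁ k₂ k₃ => ?_⟩
  obtain ⟨_, hS⟩ := adj_prT
  have hm := (hC i hi (k, k₁, k₂, k₃)).mul (mult_dyadic hχ hS k)
  have e : loc3 χ k k₁ k₂ k₃ (c i) = fun ξ => wt3 χ (k, k₁, k₂, k₃) ξ * c i ξ.1 ξ.2.1 ξ.2.2 *
      ((dyadic χ k (prT ξ) : ℝ) : ℂ) * base3 χ k₁ k₂ k₃ ξ := by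
    funext ξ
    rw [loc3, base3, base2, wt3]
    simp only [prT_apply]
    have e1 : prT1 ξ = ξ.1 := rfl
    have e2 : prT2 ξ = ξ.2.1 := rfl
    have e3 : prT3 ξ = ξ.2.2 := rfl
    have f1 := fat_mul_dyadic hχ k (ξ.1 + ξ.2.1 + ξ.2.2)
    have f2 := fat_mul_dyadic hχ k₁ ξ.1
    have f3 := fat_mul_dyadic hχ k₂ ξ.2.1
    have f4 := fat_mul_dyadic hχ k₃ ξ.2.2
    rw [e1, e2, e3]
    conv_lhs => rw [← f1, ← f2, ← f3, ← f4]
    push_cast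
    ring
  have hcont : Continuous (loc3 χ k k₁ k₂ k₃ (c i)) := by
    rw [e]
    exact hm.cont.mul (base3_cont hχ k₁ k₂ k₃)
  rw [sNorm3, if_pos hcont]
  have hb := hm.bound (base3 χ k₁ k₂ k₃) (base3_cont hχ k₁ k₂ k₃) (base3_compact hχ k₁ k₂ k₃)
  rw [lnorm_base3 hχ k₁ k₂ k₃, ← e] at hb
  refine le_trans (lintegral_mono fun x => ?_) (hb.trans (le_of_eq ?_))
  · rw [enorm_mul]
    refine (mul_le_of_le_one_left (zero_le) ?_).trans (le_of_eq ?_)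
    · rw [enorm_pow]
      refine pow_le_one₀ (zero_le) ?_
      rw [← ofReal_norm, norm_inv, Complex.norm_real, Real.norm_of_nonneg (by positivity)]
      refine ENNReal.ofReal_le_one.2 (inv_le_one_of_one_le₀ ?_)
      linarith [Real.pi_gt_three]
    · congr 2
      funext ξ
      rw [pair3, ich_prodP, pair2, ich_prodP, ich_inE]
      ring
  · simp only [max3]
    push_cast
    ring

/-- The symbol of the composition of `T_z` with an operator with symbols `S`. -/
def csymC (z : ℝ) (a : Fin 3) (j : Fin 4) (S : Fin 3 → ℝ → E → E → E → ℂ) (ξ₁ ξ₂ ξ₃ : E) : ℂ :=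
  ∑ b, (tsym0 z a j b * S b z ξ₁ ξ₂ ξ₃ +
    ∫ s in Icc (-1 : ℝ) 0, tsym z a j b s (ξ₁ + ξ₂ + ξ₃) * S b s ξ₁ ξ₂ ξ₃)

lemma sw_csymC (hχ : IsCutoff χ) (a : Fin 3) (j : Fin 4) {S : Fin 3 → ℝ → E → E → E → ℂ}
    (hS : ∀ b, Continuous fun q : ℝ × E × E × E => S b q.1 q.2.1 q.2.2.1 q.2.2.2)
    (hS' : ∀ b, SB pair3 (reg3 χ) (fun k => Ysz (max3 k)) InI 2
      fun s ξ => S b s ξ.1 ξ.2.1 ξ.2.2) :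
    SW pair3 (wt3 χ) (fun k => Ysz (max3 k)) InI 3 fun z ξ => csymC z a j S ξ.1 ξ.2.1 ξ.2.2 := by
  refine sw_sum Finset.univ fun b _ => SW.add ?_ ?_
  · refine SB.sw ?_ (mult_wt3 hχ)
    refine ((hS' b).mono (fun k => one_le_Ysz _) (show 2 ≤ 3 by norm_num)).smul
      (c := fun z => tsym0 z a j b) 1 fun z hz => ?_
    fin_cases a
    · simp [tsym0]
    · simp [tsym0]
    · exact nnnorm_alp hz
  · refine sw_integral (g := fun q ξ => tsym q.1 a j b q.2 (prT ξ) * S b q.2 ξ.1 ξ.2.1 ξ.2.2)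
      ?_ ?_ fun z => ?_
    · obtain ⟨C, hC⟩ := mult_wt3 hχ
      exact fun k => (hC k).cont
    · refine SB.sw ?_ (mult_wt3 hχ)
      refine SB.mul (d := 1) (d' := 2) (sb_tsym hχ (frq_prT hχ) (tot_prT hχ) a j b) ?_
      obtain ⟨C, hC⟩ := hS' b
      exact ⟨C, fun q hq => hC q.2 hq.2⟩
    · refine StronglyMeasurable.mul ?_ (hS b).stronglyMeasurable
      exact ((measurable_tsym z a j b).comp
        (by fun_prop : Measurable fun q : ℝ × E × E × E => (q.1, prT q.2))).stronglyMeasurable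

/-- The symbols `symB - m • symA`. -/
def symD (m : ℂ) (b : Fin 3) (s : ℝ) (ξ₁ ξ₂ _ξ₃ : E) : ℂ := symB b s ξ₁ ξ₂ - m * symA b s ξ₂

/-- The symbols `symA`, as trilinear symbols. -/
def symA3 (b : Fin 3) (s : ℝ) (_ξ₁ ξ₂ _ξ₃ : E) : ℂ := symA b s ξ₂

/-- The symbols `symA`, with a derivative of the first function. -/
def symDA (l : Fin 2) (b : Fin 3) (s : ℝ) (ξ₁ ξ₂ _ξ₃ : E) : ℂ := Complex.I * ξ₁ l * symA b s ξ₂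

/-- The symbols `c_z⁰`. -/
def csym0 (z : ℝ) (a : Fin 3) : E → E → E → ℂ := csymC z a 0 symA3

/-- The symbols `c_z`. -/
def csym (z : ℝ) (a : Fin 3) : Fin 4 → E → E → E → ℂ :=
  ![csymC z a 0 (symD 2), csymC z a 1 (symD 1),
    fun ξ₁ ξ₂ ξ₃ => csymC z a 2 (symD 1) ξ₁ ξ₂ ξ₃ + csymC z a 1 (symDA 0) ξ₁ ξ₂ ξ₃,
    fun ξ₁ ξ₂ ξ₃ => csymC z a 3 (symD 1) ξ₁ ξ₂ ξ₃ + csymC z a 1 (symDA 1) ξ₁ ξ₂ ξ₃]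

/-- The symbols `c̃_z`. -/
def csym' (z : ℝ) (a : Fin 3) : Fin 4 → E → E → E → ℂ :=
  ![fun ξ₁ ξ₂ ξ₃ => -csymC z a 0 symA3 ξ₁ ξ₂ ξ₃, fun _ _ _ => 0, fun _ _ _ => 0, fun _ _ _ => 0]

lemma continuous_symA_snd (b : Fin 3) :
    Continuous fun q : ℝ × E × E × E => symA b q.1 q.2.2.1 :=
  (continuous_symA b).comp (by fun_prop : Continuous fun q : ℝ × E × E × E => (q.1, q.2.2.1))

lemma continuous_symD (m : ℂ) (b : Fin 3) :
    Continuous fun q : ℝ × E × E × E => symD m b q.1 q.2.1 q.2.2.1 q.2.2.2 :=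
  ((continuous_symB b).comp
    (by fun_prop : Continuous fun q : ℝ × E × E × E => (q.1, q.2.1, q.2.2.1))).sub
    ((continuous_symA_snd b).const_mul m)

lemma continuous_symDA (l : Fin 2) (b : Fin 3) :
    Continuous fun q : ℝ × E × E × E => symDA l b q.1 q.2.1 q.2.2.1 q.2.2.2 :=
  Continuous.mul (by fun_prop : Continuous fun q : ℝ × E × E × E =>
    Complex.I * ((q.2.1 l : ℝ) : ℂ)) (continuous_symA_snd b)

lemma sb_symA3 (hχ : IsCutoff χ) (b : Fin 3) : SB pair3 (reg3 χ) (fun k => Ysz (max3 k)) InI 1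
    fun s ξ => symA b s ξ.2.1 := sb_symA hχ (frq_prT2 hχ) b

lemma sb_symD (hχ : IsCutoff χ) (m : ℂ) (b : Fin 3) :
    SB pair3 (reg3 χ) (fun k => Ysz (max3 k)) InI 2 fun s ξ => symD m b s ξ.1 ξ.2.1 ξ.2.2 :=
  (sb_symB hχ (frq_prT1 hχ) (frq_prT2 hχ) (frq_prT12 hχ) b).sub
    (((sb_symA3 hχ b).smul (c := fun _ => m) ‖m‖₊ fun _ _ => le_rfl).mono
      (fun k => one_le_Ysz _) (by norm_num))

lemma sb_symDA (hχ : IsCutoff χ) (l : Fin 2) (b : Fin 3) :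
    SB pair3 (reg3 χ) (fun k => Ysz (max3 k)) InI 2 fun s ξ => symDA l b s ξ.1 ξ.2.1 ξ.2.2 :=
  (sb_I_coord hχ (frq_prT1 hχ) l).mul (sb_symA3 hχ b)

lemma sw_csym0 (hχ : IsCutoff χ) (a : Fin 3) :
    SW pair3 (wt3 χ) (fun k => Ysz (max3 k)) InI 3 fun z ξ => csym0 z a ξ.1 ξ.2.1 ξ.2.2 :=
  sw_csymC hχ a 0 continuous_symA_snd
    fun b => (sb_symA3 hχ b).mono (fun k => one_le_Ysz _) (by norm_num)

lemma sw_csym (hχ : IsCutoff χ) (a : Fin 3) (j : Fin 4) :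
    SW pair3 (wt3 χ) (fun k => Ysz (max3 k)) InI 3 fun z ξ => csym z a j ξ.1 ξ.2.1 ξ.2.2 := by
  fin_cases j
  · exact sw_csymC hχ a 0 (continuous_symD 2) (sb_symD hχ 2)
  · exact sw_csymC hχ a 1 (continuous_symD 1) (sb_symD hχ 1)
  · exact (sw_csymC hχ a 2 (continuous_symD 1) (sb_symD hχ 1)).add
      (sw_csymC hχ a 1 (continuous_symDA 0) (sb_symDA hχ 0))
  · exact (sw_csymC hχ a 3 (continuous_symD 1) (sb_symD hχ 1)).add
      (sw_csymC hχ a 1 (continuous_symDA 1) (sb_symDA hχ 1))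

lemma sw_csym' (hχ : IsCutoff χ) (a : Fin 3) (j : Fin 4) :
    SW pair3 (wt3 χ) (fun k => Ysz (max3 k)) InI 3 fun z ξ => csym' z a j ξ.1 ξ.2.1 ξ.2.2 := by
  fin_cases j
  · exact (sw_csym0 hχ a).neg
  · exact sw_zero
  · exact sw_zero
  · exact sw_zero

lemma sw_tsym (hχ : IsCutoff χ) (a : Fin 3) (j : Fin 4) (b : Fin 3) :
    SW pair2 (wt2 χ) (fun k => Ysz (max2 k)) InSq 3
      fun q ξ => tsym q.1 a j b q.2 (ξ.1 + ξ.2) :=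
  SB.sw ((sb_tsym hχ (frq_prS hχ) (tot_prS hχ) a j b).mono (fun k => one_le_Ysz _) (by norm_num))
    (mult_wt2 hχ)

lemma sw_tsym0 (hχ : IsCutoff χ) (a : Fin 3) (j : Fin 4) (b : Fin 3) :
    SW pair2 (wt2 χ) (fun k => Ysz (max2 k)) InI 3 fun z (_ : E × E) => tsym0 z a j b := by
  refine SB.sw (SB.mono (d := 0) (sb_const 1 fun z hz => ?_) (fun k => one_le_Ysz _)
    (by norm_num)) (mult_wt2 hχ)
  fin_cases a
  · simp [tsym0]
  · simp [tsym0]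
  · exact nnnorm_alp hz

lemma coe_Ysz_pow (K : ℝ≥0) (m : ℤ) : ((K * Ysz m ^ 3 : ℝ≥0) : ℝ≥0∞) =
    ENNReal.ofReal ((K : ℝ) * 2 ^ (3 * max m 0)) := by
  rw [← ENNReal.ofReal_coe_nnreal]
  congr 1
  rw [Ysz]
  push_cast
  rw [mul_comm 3, zpow_mul]
  norm_cast

theorem symbol_bounds3 (hχ : IsCutoff χ) : ∃ K : ℝ≥0, ∀ z ∈ Icc (-1 : ℝ) 0,
    ∀ (a : Fin 3) (k k₁ k₂ k₃ : ℤ),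
      sNorm3 χ k k₁ k₂ k₃ (csym0 z a)
        + ∑ j, (sNorm3 χ k k₁ k₂ k₃ (csym z a j) + sNorm3 χ k k₁ k₂ k₃ (csym' z a j))
        ≤ ((K * Ysz (max k₁ (max k₂ k₃)) ^ 3 : ℝ≥0) : ℝ≥0∞) := by
  choose A hA using fun a => (sw_csym0 hχ a).sNorm3_le hχ
  choose B hB using fun a j => (sw_csym hχ a j).sNorm3_le hχ
  choose C hC using fun a j => (sw_csym' hχ a j).sNorm3_le hχ
  refine ⟨∑ a, (A a + ∑ j, (B a j + C a j)), fun z hz a k k₁ k₂ k₃ => ?_⟩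
  refine (add_le_add (hA a z hz k k₁ k₂ k₃) (Finset.sum_le_sum fun j _ =>
    add_le_add (hB a j z hz k k₁ k₂ k₃) (hC a j z hz k k₁ k₂ k₃))).trans ?_
  norm_cast
  simp only [← add_mul, ← Finset.sum_mul]
  gcongr
  exact Finset.single_le_sum (f := fun a => A a + ∑ j, (B a j + C a j)) (fun _ _ => bot_le)
    (Finset.mem_univ a)

theorem symbol_bounds2 (hχ : IsCutoff χ) : ∃ K : ℝ≥0, ∀ z ∈ Icc (-1 : ℝ) 0, ∀ s ∈ Icc (-1 : ℝ) 0,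
    ∀ (a : Fin 3) (k k₁ k₂ : ℤ),
      ∑ j, ∑ b, (sNorm2 χ k k₁ k₂ (fun _ _ => tsym0 z a j b)
        + sNorm2 χ k k₁ k₂ (fun ξ₁ ξ₂ => tsym z a j b s (ξ₁ + ξ₂)))
        ≤ ((K * Ysz (max k₁ k₂) ^ 3 : ℝ≥0) : ℝ≥0∞) := by
  choose A hA using fun a j b => (sw_tsym0 hχ a j b).sNorm2_le hχ
    (q := fun z _ _ => tsym0 z a j b)
  choose B hB using fun a j b => (sw_tsym hχ a j b).sNorm2_le hχ
    (q := fun (q : ℝ × ℝ) ξ₁ ξ₂ => tsym q.1 a j b q.2 (ξ₁ + ξ₂))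
  refine ⟨∑ a, ∑ j, ∑ b, (A a j b + B a j b), fun z hz s hs a k k₁ k₂ => ?_⟩
  refine (Finset.sum_le_sum fun j _ => Finset.sum_le_sum fun b _ =>
    add_le_add (hA a j b z hz k k₁ k₂) (hB a j b (z, s) ⟨hz, hs⟩ k k₁ k₂)).trans ?_
  norm_cast
  simp only [← add_mul, ← Finset.sum_mul]
  gcongr
  exact Finset.single_le_sum (f := fun a => ∑ j, ∑ b, (A a j b + B a j b)) (fun _ _ => bot_le)
    (Finset.mem_univ a)

end
end WaterWaves

namespace WaterWaves
open Filter Topology FourierTransform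
open scoped NNReal
noncomputable section

/-! ### Duhamel's formula -/

/-- The product rule for a primitive of an integrable function. -/
lemma integral_primitive_mul {α β : ℝ} (hαβ : α ≤ β) {f F : ℝ → ℂ} {a a' : ℝ → ℝ}
    (hf : IntegrableOn f (Ioc α β)) (hF : ∀ s ∈ Icc α β, F s = F α + ∫ t in α..s, f t)
    (ha : ∀ s, HasDerivAt a (a' s) s) (ha' : Continuous a') :
    F β * a β - F α * a α = ∫ s in α..β, (f s * a s + F s * a' s) := by
  have hac : Continuous a := continuous_iff_continuousAt.2 fun s => (ha s).continuousAt
  set μ := (volume : Measure ℝ).restrict (Ioc α β) with hμ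
  have hai : Integrable (fun s => (a' s : ℂ)) μ :=
    ((Complex.continuous_ofReal.comp ha').integrableOn_Icc).mono_set Ioc_subset_Icc_self
  have hfa : Integrable (fun s => f s * a s) μ :=
    (hf.mul_continuousOn_of_subset (Complex.continuous_ofReal.comp hac).continuousOn
      measurableSet_Ioc isCompact_Icc Ioc_subset_Icc_self)
  have hprod : Integrable (fun q : ℝ × ℝ => (a' q.1 : ℂ) * f q.2) (μ.prod μ) := hai.mul_prod hf
  have htri : MeasurableSet {q : ℝ × ℝ | q.2 ≤ q.1} := measurableSet_le measurable_snd measurable_fst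
  have hind := hprod.indicator htri
  have hFint : ∫ s in α..β, F s * a' s = F α * (a β - a α) + ∫ t, f t * (a β - a t) ∂μ := by
    rw [intervalIntegral.integral_of_le hαβ]
    have e1 : ∫ s in Ioc α β, F s * a' s = ∫ s, (F α * a' s +
        ∫ t, {q : ℝ × ℝ | q.2 ≤ q.1}.indicator (fun q : ℝ × ℝ => (a' q.1 : ℂ) * f q.2) (s, t) ∂μ) ∂μ := by
      refine setIntegral_congr_fun measurableSet_Ioc fun s hs => ?_
      rw [hF s (Ioc_subset_Icc_self hs), add_mul, intervalIntegral.integral_of_le hs.1.le]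
      congr 1
      have e2 : ∀ t, {q : ℝ × ℝ | q.2 ≤ q.1}.indicator (fun q : ℝ × ℝ => (a' q.1 : ℂ) * f q.2) (s, t)
          = a' s * (Iic s).indicator f t := by
        intro t
        simp only [indicator_apply, mem_ofPred_eq, mem_Iic]
        split_ifs <;> simp
      simp only [e2]
      rw [integral_const_mul, integral_indicator measurableSet_Iic, hμ,
        Measure.restrict_restrict measurableSet_Iic, mul_comm]
      congr 3
      ext t
      simp only [mem_Ioc, mem_inter_iff, mem_Iic]
      exact ⟨fun h => ⟨h.2, h.1, h.2.trans hs.2⟩, fun h => ⟨h.2.1, h.1⟩⟩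
    rw [e1, integral_add (hai.const_mul _) hind.integral_prod_left, integral_integral_swap (f := fun s t => {q : ℝ × ℝ | q.2 ≤ q.1}.indicator
      (fun q : ℝ × ℝ => (a' q.1 : ℂ) * f q.2) (s, t)) hind]
    congr 1
    · rw [integral_const_mul, integral_complex_ofReal, hμ, ← intervalIntegral.integral_of_le hαβ,
        intervalIntegral.integral_eq_sub_of_hasDerivAt (fun s _ => ha s) (ha'.intervalIntegrable _ _)]
      push_cast
      rfl
    · refine setIntegral_congr_fun measurableSet_Ioc fun t ht => ?_
      have e2 : ∀ s, {q : ℝ × ℝ | q.2 ≤ q.1}.indicator (fun q : ℝ × ℝ => (a' q.1 : ℂ) * f q.2) (s, t)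
          = (Ici t).indicator (fun s => (a' s : ℂ)) s * f t := by
        intro s
        simp only [indicator_apply, mem_ofPred_eq, mem_Ici]
        split_ifs <;> simp
      simp only [e2]
      rw [integral_mul_const, integral_indicator measurableSet_Ici, hμ,
        Measure.restrict_restrict measurableSet_Ici, mul_comm]
      congr 1
      have e3 : Ici t ∩ Ioc α β = Icc t β := by
        ext s
        simp only [mem_Ioc, mem_inter_iff, mem_Ici, mem_Icc]
        exact ⟨fun h => ⟨h.1, h.2.2⟩, fun h => ⟨h.1, ht.1.trans_le h.1, h.2⟩⟩
      rw [e3, integral_complex_ofReal, integral_Icc_eq_integral_Ioc,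
        ← intervalIntegral.integral_of_le ht.2,
        intervalIntegral.integral_eq_sub_of_hasDerivAt (fun s _ => ha s) (ha'.intervalIntegrable _ _)]
      push_cast
      rfl
  have hFc : ContinuousOn F (Icc α β) := by
    have h1 : ContinuousOn (fun s => F α + ∫ t in α..s, f t) (Icc α β) := by
      refine continuousOn_const.add ?_
      exact intervalIntegral.continuousOn_primitive_interval
        (by rwa [uIcc_of_le hαβ, integrableOn_Icc_iff_integrableOn_Ioc]) |>.mono
        (by rw [uIcc_of_le hαβ])
    exact h1.congr hF
  have hFa : IntervalIntegrable (fun s => F s * a' s) volume α β := by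
    refine ContinuousOn.intervalIntegrable ?_
    rw [uIcc_of_le hαβ]
    exact hFc.mul (Complex.continuous_ofReal.comp ha').continuousOn
  have hfa' : IntervalIntegrable (fun s => f s * a s) volume α β :=
    (intervalIntegrable_iff_integrableOn_Ioc_of_le hαβ).2 hfa
  rw [intervalIntegral.integral_add hfa' hFa, hFint, intervalIntegral.integral_of_le hαβ]
  have e4 : ∫ t, f t * (a β - a t) ∂μ = (∫ t, f t ∂μ) * a β - ∫ t, f t * a t ∂μ := by
    simp only [mul_sub]
    rw [integral_sub (hf.mul_const _) hfa, integral_mul_const]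
  rw [e4, hF β ⟨hαβ, le_rfl⟩, intervalIntegral.integral_of_le hαβ]
  ring

/-- The solution of the flattened Neumann problem at a fixed frequency. -/
theorem duhamel {r : ℝ} (hr : 0 < r) {P0 : ℂ} {P V Q R : ℝ → ℂ}
    (hQ : IntegrableOn Q (Icc (-1) 0)) (hR : IntegrableOn R (Icc (-1) 0))
    (hPi : IntegrableOn P (Icc (-1) 0)) (hVi : IntegrableOn V (Icc (-1) 0))
    (hP : ∀ s ∈ Icc (-1 : ℝ) 0, P s = P0 - ∫ t in s..0, (V t + Q t))
    (hV : ∀ s ∈ Icc (-1 : ℝ) 0, V s = ∫ t in (-1)..s, (r ^ 2 * P t + R t))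
    {z : ℝ} (hz : z ∈ Icc (-1 : ℝ) 0) :
    P z = mA z r * P0 + (∫ s in Icc (-1 : ℝ) 0, (kPA z s r * Q s + kPR z s r * R s)) ∧
    V z = mB z r * P0 + (∫ s in Icc (-1 : ℝ) 0, (kVA z s r * Q s + kVR z s r * R s)) := by
  obtain ⟨hz1, hz2⟩ := hz
  have hf : IntegrableOn (fun t => V t + Q t) (Icc (-1) 0) := hVi.add hQ
  have hg : IntegrableOn (fun t => r ^ 2 * P t + R t) (Icc (-1) 0) := (hPi.const_mul _).add hR
  have hii : ∀ {φ : ℝ → ℂ}, IntegrableOn φ (Icc (-1) 0) → ∀ {a b : ℝ}, a ∈ Icc (-1 : ℝ) 0 →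
      b ∈ Icc (-1 : ℝ) 0 → IntervalIntegrable φ volume a b := fun h a b ha hb => by
    rw [intervalIntegrable_iff]
    refine h.mono_set fun t ht => ?_
    rw [uIoc, mem_Ioc] at ht
    exact ⟨(le_min ha.1 hb.1).trans ht.1.le, ht.2.trans (max_le ha.2 hb.2)⟩
  have hP' : ∀ {a s : ℝ}, a ∈ Icc (-1 : ℝ) 0 → s ∈ Icc (-1 : ℝ) 0 →
      P s = P a + ∫ t in a..s, (V t + Q t) := by
    intro a s ha hs
    rw [hP s hs, hP a ha, ← intervalIntegral.integral_add_adjacent_intervals (hii hf ha hs)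
      (hii hf hs ⟨by norm_num, le_rfl⟩)]
    ring
  have hV' : ∀ {a s : ℝ}, a ∈ Icc (-1 : ℝ) 0 → s ∈ Icc (-1 : ℝ) 0 →
      V s = V a + ∫ t in a..s, (r ^ 2 * P t + R t) := by
    intro a s ha hs
    rw [hV s hs, hV a ha, intervalIntegral.integral_add_adjacent_intervals
      (hii hg ⟨le_rfl, by norm_num⟩ ha) (hii hg ha hs)]
  have hm1 : (-1 : ℝ) ∈ Icc (-1 : ℝ) 0 := ⟨le_rfl, by norm_num⟩
  have h0 : (0 : ℝ) ∈ Icc (-1 : ℝ) 0 := ⟨by norm_num, le_rfl⟩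
  have hz : z ∈ Icc (-1 : ℝ) 0 := ⟨hz1, hz2⟩
  have dS : ∀ c s : ℝ, HasDerivAt (fun s => Real.sinh (r * (s + c))) (r * Real.cosh (r * (s + c))) s :=
    fun c s => by
      have h1 : HasDerivAt (fun s : ℝ => r * (s + c)) r s := by
        simpa using ((hasDerivAt_id s).add_const c).const_mul r
      simpa [mul_comm] using h1.sinh
  have dC : ∀ c s : ℝ, HasDerivAt (fun s => Real.cosh (r * (s + c))) (r * Real.sinh (r * (s + c))) s :=
    fun c s => by
      have h1 : HasDerivAt (fun s : ℝ => r * (s + c)) r s := by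
        simpa using ((hasDerivAt_id s).add_const c).const_mul r
      simpa [mul_comm] using h1.cosh
  have key : ∀ {a b : ℝ} (c : ℝ), a ≤ b → a ∈ Icc (-1 : ℝ) 0 → b ∈ Icc (-1 : ℝ) 0 →
      (V b * Real.cosh (r * (b + c)) - P b * (r * Real.sinh (r * (b + c)) : ℝ))
        - (V a * Real.cosh (r * (a + c)) - P a * (r * Real.sinh (r * (a + c)) : ℝ)) =
      (∫ s in a..b, (R s * Real.cosh (r * (s + c)) - r * (Q s * Real.sinh (r * (s + c))))) ∧
      (V b * Real.sinh (r * (b + c)) - P b * (r * Real.cosh (r * (b + c)) : ℝ))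
        - (V a * Real.sinh (r * (a + c)) - P a * (r * Real.cosh (r * (a + c)) : ℝ)) =
      (∫ s in a..b, (R s * Real.sinh (r * (s + c)) - r * (Q s * Real.cosh (r * (s + c))))) := by
    intro a b c hab ha hb
    have hsub : Icc a b ⊆ Icc (-1 : ℝ) 0 := Icc_subset_Icc ha.1 hb.2
    have hsub' : Ioc a b ⊆ Icc (-1 : ℝ) 0 := Ioc_subset_Icc_self.trans hsub
    have cS : Continuous fun s => Real.sinh (r * (s + c)) := by fun_prop
    have cC : Continuous fun s => Real.cosh (r * (s + c)) := by fun_prop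
    have p1 := integral_primitive_mul hab (hg.mono_set hsub') (fun s hs => hV' ha (hsub hs)) (dC c)
      (cS.const_mul r)
    have p2 := integral_primitive_mul hab (hf.mono_set hsub') (fun s hs => hP' ha (hsub hs))
      (fun s => (dS c s).const_mul r) ((cC.const_mul r).const_mul r)
    have p3 := integral_primitive_mul hab (hg.mono_set hsub') (fun s hs => hV' ha (hsub hs)) (dS c)
      (cC.const_mul r)
    have p4 := integral_primitive_mul hab (hf.mono_set hsub') (fun s hs => hP' ha (hsub hs))
      (fun s => (dC c s).const_mul r) ((cS.const_mul r).const_mul r)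
    have mi : ∀ {φ : ℝ → ℂ}, IntegrableOn φ (Icc (-1) 0) → ∀ {ψ : ℝ → ℝ}, Continuous ψ →
        IntervalIntegrable (fun s => φ s * ψ s) volume a b := fun h ψ hψ =>
      (hii h ha hb).mul_continuousOn (Complex.continuous_ofReal.comp hψ).continuousOn
    constructor
    · rw [← sub_eq_zero]
      have e : ∀ A B C D : ℂ, A - B - (C - D) = (A - C) - (B - D) := fun A B C D => by ring
      rw [e, p1, p2, ← intervalIntegral.integral_sub ((mi hg cC).add (mi hVi (cS.const_mul r)))
        ((mi hf (cS.const_mul r)).add (mi hPi ((cC.const_mul r).const_mul r))), sub_eq_zero]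
      refine intervalIntegral.integral_congr fun s _ => ?_
      push_cast
      ring
    · rw [← sub_eq_zero]
      have e : ∀ A B C D : ℂ, A - B - (C - D) = (A - C) - (B - D) := fun A B C D => by ring
      rw [e, p3, p4, ← intervalIntegral.integral_sub ((mi hg cS).add (mi hVi (cC.const_mul r)))
        ((mi hf (cC.const_mul r)).add (mi hPi ((cS.const_mul r).const_mul r))), sub_eq_zero]
      refine intervalIntegral.integral_congr fun s _ => ?_
      push_cast
      ring
  have k1 := (key 1 hz1 hm1 hz).1
  have k2 := (key 0 hz2 hz h0).2
  have hV1 : V (-1) = 0 := by rw [hV _ hm1, intervalIntegral.integral_same]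
  have hP00 : P 0 = P0 := by rw [hP _ h0, intervalIntegral.integral_same, sub_zero]
  simp only [neg_add_cancel, mul_zero, Real.sinh_zero, Real.cosh_zero, hV1, hP00, add_zero,
    Complex.ofReal_zero, Complex.ofReal_one, sub_zero, mul_one] at k1 k2
  have hc : (Real.cosh r : ℂ) ≠ 0 := by exact_mod_cast (Real.cosh_pos r).ne'
  have hrC : (r : ℂ) ≠ 0 := by exact_mod_cast hr.ne'
  have id1 : (Real.cosh r : ℂ) = Real.cosh (r * z) * Real.cosh (r * (z + 1)) -
      Real.sinh (r * z) * Real.sinh (r * (z + 1)) := by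
    rw [← Complex.ofReal_mul, ← Complex.ofReal_mul, ← Complex.ofReal_sub]
    congr 1
    rw [← Real.cosh_neg r, show -r = r * z - r * (z + 1) by ring, Real.cosh_sub]
  -- the kernels on both sides of `z`
  have split : ∀ (K : ℝ → ℝ → ℝ → ℝ) (K' : ℝ → ℝ → ℝ → ℝ) (A B : ℂ),
      (∀ s, s < z → (K z s r : ℂ) = A * (-(r * Real.sinh (r * (s + 1)))) ∧
        (K' z s r : ℂ) = A * Real.cosh (r * (s + 1))) →
      (∀ s, ¬ s < z → (K z s r : ℂ) = B * (-(r * Real.cosh (r * s))) ∧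
        (K' z s r : ℂ) = B * Real.sinh (r * s)) →
      ∫ s in Icc (-1 : ℝ) 0, (K z s r * Q s + K' z s r * R s) =
        A * (∫ s in (-1)..z, (R s * Real.cosh (r * (s + 1)) - r * (Q s * Real.sinh (r * (s + 1))))) +
        B * (∫ s in z..0, (R s * Real.sinh (r * s) - r * (Q s * Real.cosh (r * s)))) := by
    intro K K' A B h1 h2
    have mi : ∀ {φ : ℝ → ℂ}, IntegrableOn φ (Icc (-1) 0) → ∀ {ψ : ℝ → ℝ}, Continuous ψ → ∀ {a b : ℝ},
        a ∈ Icc (-1 : ℝ) 0 → b ∈ Icc (-1 : ℝ) 0 →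
        IntervalIntegrable (fun s => φ s * ψ s) volume a b := fun h ψ hψ a b ha hb =>
      (hii h ha hb).mul_continuousOn (Complex.continuous_ofReal.comp hψ).continuousOn
    have i1 : IntervalIntegrable (fun s => A * (R s * Real.cosh (r * (s + 1)) -
        r * (Q s * Real.sinh (r * (s + 1))))) volume (-1) z :=
      ((mi hR (by fun_prop) hm1 hz).sub ((mi hQ (by fun_prop) hm1 hz).const_mul _)).const_mul _
    have i2 : IntervalIntegrable (fun s => B * (R s * Real.sinh (r * s) -
        r * (Q s * Real.cosh (r * s)))) volume z 0 :=
      ((mi hR (by fun_prop) hz h0).sub ((mi hQ (by fun_prop) hz h0).const_mul _)).const_mul _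
    have c1 : ∀ᵐ s, s ∈ uIoc (-1) z → A * (R s * Real.cosh (r * (s + 1)) -
        r * (Q s * Real.sinh (r * (s + 1)))) = K z s r * Q s + K' z s r * R s := by
      have hne : ∀ᵐ s : ℝ, s ≠ z := by simp [ae_iff, measure_singleton]
      filter_upwards [hne] with s hs hs'
      rw [uIoc_of_le hz1] at hs'
      obtain ⟨e1, e2⟩ := h1 s (lt_of_le_of_ne hs'.2 hs)
      rw [e1, e2]
      ring
    have c2 : ∀ᵐ s, s ∈ uIoc z 0 → B * (R s * Real.sinh (r * s) -
        r * (Q s * Real.cosh (r * s))) = K z s r * Q s + K' z s r * R s := by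
      refine Eventually.of_forall fun s hs' => ?_
      rw [uIoc_of_le hz2] at hs'
      obtain ⟨e1, e2⟩ := h2 s (not_lt.2 hs'.1.le)
      rw [e1, e2]
      ring
    have j1 := i1.congr_ae ((ae_restrict_iff' measurableSet_uIoc).2 c1)
    have j2 := i2.congr_ae ((ae_restrict_iff' measurableSet_uIoc).2 c2)
    rw [integral_Icc_eq_integral_Ioc, ← intervalIntegral.integral_of_le (by norm_num),
      ← intervalIntegral.integral_add_adjacent_intervals j1 j2,
      ← intervalIntegral.integral_congr_ae c1, ← intervalIntegral.integral_congr_ae c2,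
      intervalIntegral.integral_const_mul, intervalIntegral.integral_const_mul]
  constructor
  · rw [split kPA kPR (Real.sinh (r * z) / (r * Real.cosh r))
      (Real.cosh (r * (z + 1)) / (r * Real.cosh r)) (fun s hs => ?_) (fun s hs => ?_), ← k1, ← k2, mA,
      show (z + 1) * r = r * (z + 1) by ring]
    · push_cast at id1 hc ⊢
      field_simp
      linear_combination P z * r * id1
    · rw [kPA, kPR, if_pos hs, if_pos hs]
      push_cast at hc ⊢
      constructor <;> field_simp
    · rw [kPA, kPR, if_neg hs, if_neg hs]
      push_cast at hc ⊢
      constructor <;> field_simp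
  · rw [split kVA kVR (Real.cosh (r * z) / Real.cosh r)
      (Real.sinh (r * (z + 1)) / Real.cosh r) (fun s hs => ?_) (fun s hs => ?_), ← k1, ← k2, mB,
      show (z + 1) * r = r * (z + 1) by ring]
    · push_cast at id1 hc ⊢
      field_simp
      linear_combination V z * id1
    · rw [kVA, kVR, if_pos hs, if_pos hs]
      push_cast at hc ⊢
      constructor <;> field_simp
    · rw [kVA, kVR, if_neg hs, if_neg hs]
      push_cast at hc ⊢
      constructor <;> field_simp

end
end WaterWaves

namespace WaterWaves
open Filter Topology FourierTransform
open scoped NNReal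
noncomputable section

/-! ### Families of functions that depend on the vertical variable -/

/-- `X s` is the Fourier transform of `v s`, measurably in `s`, with uniform bounds. -/
structure Fam (k : ℕ) (v X : ℝ → E → ℂ) : Prop where
  sm : StronglyMeasurable fun q : ℝ × E => X q.1 q.2
  ftw : ∀ s ∈ Icc (-1 : ℝ) 0, FTW k (v s) (X s)
  bd : ∃ M, ∀ s ∈ Icc (-1 : ℝ) 0, wn k (X s) ≤ M

lemma wn_add_le {k : ℕ} {F G : E → ℂ} (hF : AEStronglyMeasurable F) (hG : AEStronglyMeasurable G)
    (h : WI k F) (h' : WI k G) : wn k (fun ξ => F ξ + G ξ) ≤ wn k F + wn k G := by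
  rw [wn, wn, wn, ← integral_add h h']
  refine integral_mono (h.add hF hG h') (Integrable.add h h') fun ξ => ?_
  dsimp only
  rw [← mul_add]
  gcongr
  exact norm_add_le _ _

lemma wn_smul (k : ℕ) (F : E → ℂ) (a : ℂ) : wn k (fun ξ => a * F ξ) = ‖a‖ * wn k F := by
  rw [wn, wn, ← integral_const_mul]
  refine integral_congr_ae (Eventually.of_forall fun ξ => ?_)
  simp only [norm_mul]
  ring

section Fam

variable {k : ℕ} {v X w Y : ℝ → E → ℂ}

lemma Fam.mono {l : ℕ} (h : Fam k v X) (hl : l ≤ k) : Fam l v X where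
  sm := h.sm
  ftw s hs := (h.ftw s hs).mono hl
  bd := by
    obtain ⟨M, hM⟩ := h.bd
    exact ⟨M, fun s hs => (wn_mono hl (h.ftw s hs).aesm (h.ftw s hs).wi).trans (hM s hs)⟩

lemma Fam.congr_fun (h : Fam k v X) (hw : ∀ s ∈ Icc (-1 : ℝ) 0, ∀ x, w s x = v s x) : Fam k w X :=
  ⟨h.sm, fun s hs => (h.ftw s hs).congr_fun (hw s hs), h.bd⟩

lemma Fam.add (h : Fam k v X) (h' : Fam k w Y) :
    Fam k (fun s x => v s x + w s x) (fun s ξ => X s ξ + Y s ξ) where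
  sm := h.sm.add h'.sm
  ftw s hs := (h.ftw s hs).add (h'.ftw s hs)
  bd := by
    obtain ⟨M, hM⟩ := h.bd
    obtain ⟨M', hM'⟩ := h'.bd
    exact ⟨M + M', fun s hs => (wn_add_le (h.ftw s hs).aesm (h'.ftw s hs).aesm (h.ftw s hs).wi
      (h'.ftw s hs).wi).trans (add_le_add (hM s hs) (hM' s hs))⟩

lemma Fam.smul (h : Fam k v X) {c : ℝ → ℂ} (hc : Continuous c) :
    Fam k (fun s x => c s * v s x) (fun s ξ => c s * X s ξ) where
  sm := (hc.comp continuous_fst).stronglyMeasurable.mul h.sm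
  ftw s hs := (h.ftw s hs).smul _
  bd := by
    obtain ⟨M, hM⟩ := h.bd
    obtain ⟨C, hC⟩ := (isCompact_Icc (a := (-1 : ℝ)) (b := 0)).exists_bound_of_continuousOn hc.continuousOn
    refine ⟨C * M, fun s hs => ?_⟩
    rw [wn_smul]
    exact mul_le_mul (hC s hs) (hM s hs) (wn_nonneg _ _) ((norm_nonneg _).trans (hC s hs))

lemma Fam.neg (h : Fam k v X) : Fam k (fun s x => -v s x) (fun s ξ => -X s ξ) := by
  simpa using h.smul (c := fun _ => -1) continuous_const

lemma Fam.sub (h : Fam k v X) (h' : Fam k w Y) :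
    Fam k (fun s x => v s x - w s x) (fun s ξ => X s ξ - Y s ξ) := by
  simpa [sub_eq_add_neg] using h.add h'.neg

lemma fam_zero : Fam k (fun _ _ => 0) (fun _ _ => 0) :=
  ⟨stronglyMeasurable_const, fun _ _ => ftw_zero k, ⟨0, fun _ _ => by simp [wn]⟩⟩

lemma fam_sum {ι : Type*} (S : Finset ι) {v X : ι → ℝ → E → ℂ} (h : ∀ i ∈ S, Fam k (v i) (X i)) :
    Fam k (fun s x => ∑ i ∈ S, v i s x) (fun s ξ => ∑ i ∈ S, X i s ξ) := by
  classical
  induction S using Finset.induction_on with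
  | empty => simpa using fam_zero
  | insert i S hi ih =>
    simp only [Finset.sum_insert hi]
    exact (h i (by simp)).add (ih fun j hj => h j (by simp [hj]))

lemma stronglyMeasurable_cv {G : E → ℂ} (hG : StronglyMeasurable G)
    (hX : StronglyMeasurable fun q : ℝ × E => X q.1 q.2) :
    StronglyMeasurable fun q : ℝ × E => cv G (X q.1) q.2 := by
  unfold cv
  refine StronglyMeasurable.const_mul ?_ c0
  refine StronglyMeasurable.integral_prod_right
    (f := fun (q : ℝ × E) η => G η * X q.1 (q.2 - η)) ?_
  refine (hG.comp_measurable measurable_snd).mul ?_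
  exact hX.comp_measurable (by fun_prop : Measurable fun q : (ℝ × E) × E => (q.1.1, q.1.2 - q.2))

lemma Fam.mul (h : Fam k v X) {g G : E → ℂ} (hg : FTW k g G) :
    Fam k (fun s x => g x * v s x) (fun s => cv G (X s)) where
  sm := by
    have e : ∀ s, cv G (X s) = cv (hg.aesm.mk G) (X s) := fun s =>
      cv_ae_congr hg.aesm.ae_eq_mk (ae_eq_refl _)
    simp only [e]
    exact stronglyMeasurable_cv hg.aesm.stronglyMeasurable_mk h.sm
  ftw s hs := hg.mul (h.ftw s hs)
  bd := by
    obtain ⟨M, hM⟩ := h.bd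
    exact ⟨wn k G * M, fun s hs => (hg.wi.cv hg.aesm (h.ftw s hs).aesm (h.ftw s hs).wi).2.trans
      (mul_le_mul_of_nonneg_left (hM s hs) (wn_nonneg _ _))⟩

/-- Horizontal derivatives of families. -/
lemma Fam.dx {v : ℝ → E → ℝ} (h : Fam (k + 1) (fun s => toC (v s)) X) (i : Fin 2) :
    Fam k (fun s => toC (WaterWaves.dx i (v s))) (fun s ξ => Complex.I * (ξ i : ℂ) * X s ξ) where
  sm := by
    refine StronglyMeasurable.mul ?_ h.sm
    exact Continuous.stronglyMeasurable (by fun_prop)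
  ftw s hs := (h.ftw s hs).dx i
  bd := by
    obtain ⟨M, hM⟩ := h.bd
    exact ⟨M, fun s hs => ((h.ftw s hs).wi.coord (h.ftw s hs).aesm i).2.trans (hM s hs)⟩

lemma Fam.integrable_prod (h : Fam k v X) :
    Integrable (fun q : ℝ × E => (1 + ‖q.2‖) ^ k * ‖X q.1 q.2‖)
      ((volume.restrict (Icc (-1 : ℝ) 0)).prod volume) := by
  have hm : StronglyMeasurable fun q : ℝ × E => (1 + ‖q.2‖) ^ k * ‖X q.1 q.2‖ :=
    (Continuous.stronglyMeasurable (by fun_prop)).mul h.sm.norm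
  obtain ⟨M, hM⟩ := h.bd
  rw [integrable_prod_iff hm.aestronglyMeasurable]
  constructor
  · exact (ae_restrict_iff' measurableSet_Icc).2 (Eventually.of_forall fun s hs => (h.ftw s hs).wi)
  · refine Integrable.mono' (g := fun _ => M) (by simp) ?_ ?_
    · exact hm.norm.integral_prod_right.aestronglyMeasurable
    · refine (ae_restrict_iff' measurableSet_Icc).2 (Eventually.of_forall fun s hs => ?_)
      rw [Real.norm_of_nonneg (integral_nonneg fun _ => norm_nonneg _)]
      refine le_trans (le_of_eq ?_) (hM s hs)
      refine integral_congr_ae (Eventually.of_forall fun ξ => ?_)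
      exact Real.norm_of_nonneg (by positivity)

lemma Fam.integrable_prod' (h : Fam k v X) :
    Integrable (fun q : ℝ × E => X q.1 q.2) ((volume.restrict (Icc (-1 : ℝ) 0)).prod volume) := by
  have h1 := (h.mono (Nat.zero_le k)).integrable_prod
  simp only [pow_zero, one_mul] at h1
  exact (integrable_norm_iff h.sm.aestronglyMeasurable).1 h1

/-- At almost every frequency, a family is integrable in the vertical variable. -/
lemma Fam.ae_integrableOn (h : Fam k v X) : ∀ᵐ ξ, IntegrableOn (fun s => X s ξ) (Icc (-1) 0) :=
  h.integrable_prod'.prod_left_ae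

lemma Fam.eq (h : Fam k v X) {s : ℝ} (hs : s ∈ Icc (-1 : ℝ) 0) (x : E) :
    v s x = c0 * ∫ ξ, chr x ξ * X s ξ := (h.ftw s hs).hasFT.eq x

lemma Fam.chr_integrable (h : Fam k v X) (x : E) :
    Integrable (fun q : ℝ × E => chr x q.2 * X q.1 q.2)
      ((volume.restrict (Icc (-1 : ℝ) 0)).prod volume) :=
  h.integrable_prod'.bdd_mul (c := 1)
    ((chr_continuous x).comp continuous_snd).aestronglyMeasurable
    (Eventually.of_forall fun q => (norm_chr x q.2).le)

lemma Fam.integrableOn (h : Fam k v X) (x : E) : IntegrableOn (fun s => v s x) (Icc (-1) 0) := by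
  have h1 := ((h.chr_integrable x).integral_prod_left).const_mul c0
  refine h1.congr ((ae_restrict_iff' measurableSet_Icc).2 (Eventually.of_forall fun s hs => ?_))
  exact (h.eq hs x).symm

/-- The Fourier transform of an integral in the vertical variable. -/
lemma Fam.integral (h : Fam k v X) {A : Set ℝ} (hA : A ⊆ Icc (-1 : ℝ) 0) (hAm : MeasurableSet A) :
    FTW k (fun x => ∫ s in A, v s x) (fun ξ => ∫ s in A, X s ξ) := by
  have hle : (volume.restrict A).prod (volume : Measure E) ≤
      (volume.restrict (Icc (-1 : ℝ) 0)).prod volume :=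
    Measure.prod_mono (Measure.restrict_mono_set _ hA) le_rfl
  have hi := h.integrable_prod'.mono_measure hle
  refine ⟨HasFT.mk' hi.integral_prod_right fun x => ?_, ?_⟩
  · have hc := (h.chr_integrable x).mono_measure hle
    have e1 : ∫ s in A, v s x = ∫ s in A, c0 * ∫ ξ, chr x ξ * X s ξ :=
      setIntegral_congr_fun hAm fun s hs => h.eq (hA hs) x
    rw [e1, integral_const_mul, integral_integral_swap (f := fun s ξ => chr x ξ * X s ξ) hc]
    simp only [integral_const_mul]
  · have hk := (h.integrable_prod.mono_measure hle).integral_prod_right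
    refine Integrable.mono' hk ?_ (Eventually.of_forall fun ξ => ?_)
    · refine AEStronglyMeasurable.mul (by fun_prop) ?_
      exact hi.integral_prod_right.aestronglyMeasurable.norm
    · rw [Real.norm_of_nonneg (by positivity)]
      simp only [integral_const_mul]
      gcongr
      exact norm_integral_le_integral_norm _

end Fam

/-! ### The coefficients -/

/-- Real functions with integrable Fourier transforms, with the weight `1 + |ξ|`. -/
def RW (f : E → ℝ) : Prop := ∃ F, FTW 1 (toC f) F

lemma RW.add {f g : E → ℝ} (hf : RW f) (hg : RW g) : RW fun x => f x + g x := by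
  obtain ⟨F, hF⟩ := hf
  obtain ⟨G, hG⟩ := hg
  exact ⟨_, (hF.add hG).congr_fun fun x => by simp [toC]⟩

lemma RW.mul {f g : E → ℝ} (hf : RW f) (hg : RW g) : RW fun x => f x * g x := by
  obtain ⟨F, hF⟩ := hf
  obtain ⟨G, hG⟩ := hg
  exact ⟨_, (hF.mul hG).congr_fun fun x => by simp [toC]⟩

lemma RW.smul {f : E → ℝ} (hf : RW f) (c : ℝ) : RW fun x => c * f x := by
  obtain ⟨F, hF⟩ := hf
  exact ⟨_, (hF.smul c).congr_fun fun x => by simp [toC]⟩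

lemma RW.congr {f g : E → ℝ} (hf : RW f) (h : ∀ x, g x = f x) : RW g := by
  obtain ⟨F, hF⟩ := hf
  exact ⟨F, hF.congr_fun fun x => by simp [toC, h]⟩

lemma RW.ftw {f : E → ℝ} (hf : RW f) : FTW 1 (toC f) (ft (toC f)) := by
  obtain ⟨F, hF⟩ := hf
  have h := hasFT_ft ⟨F, hF.hasFT⟩
  exact ⟨h, hF.wi.congr_ae (hF.hasFT.unique h)⟩

lemma RW.differentiable {f : E → ℝ} (hf : RW f) : Differentiable ℝ f := hf.ftw.differentiable

lemma MemH.ftw4 {h : E → ℝ} (hh : MemH 6 h) : FTW 4 (toC h) (ft (toC h)) :=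
  (MemH.ftw (k := 4) (by norm_num) hh).1

lemma MemH.rw {h : E → ℝ} (hh : MemH 6 h) : RW h := ⟨_, hh.ftw4.mono (by norm_num)⟩

lemma MemH.rw_dx {h : E → ℝ} (hh : MemH 6 h) (i : Fin 2) : RW (dx i h) :=
  ⟨_, (hh.ftw4.dx i).mono (by norm_num)⟩

lemma MemH.memLp {h : E → ℝ} (hh : MemH 6 h) : MemLp (ft (toC h)) 2 := by
  have hm := (hasFT_ft hh.1).1.aestronglyMeasurable
  refine ⟨hm, lt_of_le_of_lt (eLpNorm_mono fun ξ => ?_) hh.2⟩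
  rw [norm_mul, Complex.norm_real, Real.norm_of_nonneg (by positivity)]
  refine le_mul_of_one_le_left (norm_nonneg _) (Real.one_le_rpow ?_ (by norm_num))
  nlinarith [sq_nonneg ‖ξ‖]

lemma one_add_pos {h : E → ℝ} (h1 : ∀ x, |h x| < 1) (x : E) : 0 < 1 + h x := by
  linarith [(abs_lt.1 (h1 x)).1]

/-- Wiener's lemma for `1 / (1 + h)`. -/
lemma rw_inv {h : E → ℝ} (hh : MemH 6 h) (h1 : ∀ x, |h x| < 1) : RW fun x => (1 + h x)⁻¹ - 1 := by
  obtain ⟨ρ, hρ0, hρ, hb⟩ := exists_sup_lt_one (hasFT_ft hh.1) h1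
  obtain ⟨G, hG⟩ := exists_ftw_inv (hh.ftw4.mono (by norm_num)) hh.memLp hρ0 hρ
    fun x => by rw [toC_apply, Complex.norm_real]; exact hb x
  exact ⟨G, hG.congr_fun fun x => by simp [toC]⟩

lemma rw_hTilde {h : E → ℝ} (hh : MemH 6 h) (h1 : ∀ x, |h x| < 1) (j : Fin 4) : RW (hTilde h j) := by
  have hg := rw_inv hh h1
  have hne : ∀ x, 1 + h x ≠ 0 := fun x => (one_add_pos h1 x).ne'
  have h3 : ∀ i, RW fun x => dx i h x / (1 + h x) := fun i =>
    ((hh.rw_dx i).add ((hh.rw_dx i).mul hg)).congr fun x => by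
      have := hne x
      field_simp
      ring
  fin_cases j
  · refine ((hg.smul (-2)).add ((hg.mul hg).smul (-1))).congr fun x => ?_
    have := hne x
    simp only [hTilde, Matrix.cons_val_zero, Fin.zero_eta, Fin.isValue]
    field_simp
    ring
  · refine (((h3 0).mul (h3 0)).add ((h3 1).mul (h3 1))).congr fun x => ?_
    have := hne x
    simp only [hTilde, gradSq, Fin.sum_univ_two, Matrix.cons_val_one, Matrix.cons_val_zero,
      Fin.mk_one, Fin.isValue]
    field_simp
  · exact h3 0
  · exact h3 1

/-! ### Derivatives in the strip -/

lemma uniqueDiffOn_strip : UniqueDiffOn ℝ ((univ : Set E) ×ˢ Icc (-1 : ℝ) 0) :=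
  uniqueDiffOn_univ.prod (uniqueDiffOn_Icc (by norm_num))

section Strip

variable {φ : E → ℝ → ℝ}

/-- The derivative in the closed strip. -/
def dStrip (φ : E → ℝ → ℝ) : E × ℝ → E × ℝ →L[ℝ] ℝ :=
  fderivWithin ℝ (fun p : E × ℝ => φ p.1 p.2) (univ ×ˢ Icc (-1) 0)

lemma hasFDerivWithinAt_strip
    (hφ : ContDiffOn ℝ 2 (fun p : E × ℝ => φ p.1 p.2) (univ ×ˢ Icc (-1) 0)) (x : E) {z : ℝ}
    (hz : z ∈ Icc (-1 : ℝ) 0) :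
    HasFDerivWithinAt (fun p : E × ℝ => φ p.1 p.2) (dStrip φ (x, z)) (univ ×ˢ Icc (-1) 0) (x, z) :=
  ((hφ.differentiableOn (by norm_num)) (x, z) ⟨mem_univ x, hz⟩).hasFDerivWithinAt

lemma hasDerivWithinAt_pz
    (hφ : ContDiffOn ℝ 2 (fun p : E × ℝ => φ p.1 p.2) (univ ×ˢ Icc (-1) 0)) (x : E) {z : ℝ}
    (hz : z ∈ Icc (-1 : ℝ) 0) : HasDerivWithinAt (φ x) (pz φ x z) (Icc (-1) 0) z ∧
      pz φ x z = dStrip φ (x, z) (0, 1) := by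
  have h1 : HasDerivWithinAt (fun s : ℝ => (x, s)) ((0 : E), (1 : ℝ)) (Icc (-1) 0) z :=
    ((hasDerivAt_const z x).prodMk (hasDerivAt_id z)).hasDerivWithinAt
  have h2 : HasDerivWithinAt (φ x) (dStrip φ (x, z) (0, 1)) (Icc (-1) 0) z :=
    (hasFDerivWithinAt_strip hφ x hz).comp_hasDerivWithinAt z h1 fun s hs => ⟨mem_univ x, hs⟩
  have h3 : pz φ x z = dStrip φ (x, z) (0, 1) :=
    h2.derivWithin (uniqueDiffOn_Icc (by norm_num) z hz)
  rw [h3]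
  exact ⟨h2, rfl⟩

lemma px_eq
    (hφ : ContDiffOn ℝ 2 (fun p : E × ℝ => φ p.1 p.2) (univ ×ˢ Icc (-1) 0)) (x : E) {z : ℝ}
    (hz : z ∈ Icc (-1 : ℝ) 0) (i : Fin 2) :
    px i φ x z = dStrip φ (x, z) (EuclideanSpace.single i 1, 0) := by
  have h1 : HasFDerivWithinAt (fun y : E => (y, z)) (ContinuousLinearMap.inl ℝ E ℝ) univ x :=
    (hasFDerivAt_prodMk_left x z).hasFDerivWithinAt
  have hm : MapsTo (fun y : E => (y, z)) univ (univ ×ˢ Icc (-1) 0) := fun y _ => ⟨mem_univ y, hz⟩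
  have h3 := (hasFDerivWithinAt_univ.1 ((hasFDerivWithinAt_strip hφ x hz).comp x h1 hm)).fderiv
  have e : px i φ x z = fderiv ℝ ((fun p : E × ℝ => φ p.1 p.2) ∘ fun y => (y, z)) x
      (EuclideanSpace.single i 1) := rfl
  rw [e, h3]
  rfl

lemma continuousOn_gradXZ
    (hφ : ContDiffOn ℝ 2 (fun p : E × ℝ => φ p.1 p.2) (univ ×ˢ Icc (-1) 0)) (b : Fin 3) :
    ContinuousOn (fun p : E × ℝ => gradXZ φ b p.1 p.2) (univ ×ˢ Icc (-1) 0) := by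
  have hD : ContinuousOn (dStrip φ) (univ ×ˢ Icc (-1) 0) :=
    hφ.continuousOn_fderivWithin uniqueDiffOn_strip (by norm_num)
  have hp : ∀ i, ContinuousOn (fun p : E × ℝ => px i φ p.1 p.2) (univ ×ˢ Icc (-1) 0) := fun i =>
    (hD.clm_apply continuousOn_const).congr fun p hp => px_eq hφ p.1 hp.2 i
  fin_cases b
  · exact hp 0
  · exact hp 1
  · exact (hD.clm_apply continuousOn_const).congr fun p hp => (hasDerivWithinAt_pz hφ p.1 hp.2).2

/-- Second derivatives in the interior of the strip. -/
lemma hasDerivAt_interior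
    (hφ : ContDiffOn ℝ 2 (fun p : E × ℝ => φ p.1 p.2) (univ ×ˢ Icc (-1) 0)) (x : E) {z : ℝ}
    (hz : z ∈ Ioo (-1 : ℝ) 0) : HasDerivAt (pz φ x) (pz (pz φ) x z) z ∧
      (∀ i, HasDerivAt (px i φ x) (px i (pz φ) x z) z) := by
  set F : E × ℝ → ℝ := fun p => φ p.1 p.2 with hF
  have hn : (univ : Set E) ×ˢ Icc (-1 : ℝ) 0 ∈ 𝓝 (x, z) := prod_mem_nhds univ_mem (Icc_mem_nhds hz.1 hz.2)
  have hc : ContDiffAt ℝ 2 F (x, z) := hφ.contDiffAt hn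
  have hd : HasFDerivAt (fderiv ℝ F) (fderiv ℝ (fderiv ℝ F) (x, z)) (x, z) :=
    ((hc.fderiv_right (m := 1) (by norm_num)).differentiableAt (by norm_num)).hasFDerivAt
  have hev : ∀ᶠ p in 𝓝 (x, z), dStrip φ p = fderiv ℝ F p := by
    have : (univ : Set E) ×ˢ Ioo (-1 : ℝ) 0 ∈ 𝓝 (x, z) :=
      prod_mem_nhds univ_mem (Ioo_mem_nhds hz.1 hz.2)
    filter_upwards [this] with p hp
    exact fderivWithin_of_mem_nhds (prod_mem_nhds univ_mem (Icc_mem_nhds hp.2.1 hp.2.2))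
  have hev' : ∀ᶠ p in 𝓝 (x, z), p.2 ∈ Icc (-1 : ℝ) 0 := by
    filter_upwards [hn] with p hp using hp.2
  have hS := hc.isSymmSndFDerivAt (by simp)
  have hv : ∀ v : E × ℝ, HasFDerivAt (fun p => fderiv ℝ F p v)
      ((fderiv ℝ (fderiv ℝ F) (x, z)).flip v) (x, z) := fun v => by
    have := hd.clm_apply (hasFDerivAt_const v (x, z))
    simpa using this
  have hpz : ∀ᶠ p : E × ℝ in 𝓝 (x, z), pz φ p.1 p.2 = fderiv ℝ F p (0, 1) := by
    filter_upwards [hev, hev'] with p h1 h2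
    rw [(hasDerivWithinAt_pz hφ p.1 h2).2, ← h1]
  have hpx : ∀ i, ∀ᶠ p : E × ℝ in 𝓝 (x, z), px i φ p.1 p.2 =
      fderiv ℝ F p (EuclideanSpace.single i 1, 0) := fun i => by
    filter_upwards [hev, hev'] with p h1 h2
    rw [px_eq hφ p.1 h2 i, ← h1]
  have h1 : HasDerivAt (fun s : ℝ => (x, s)) ((0 : E), (1 : ℝ)) z :=
    (hasDerivAt_const z x).prodMk (hasDerivAt_id z)
  have d1 : HasFDerivAt (fun p : E × ℝ => pz φ p.1 p.2)
      ((fderiv ℝ (fderiv ℝ F) (x, z)).flip (0, 1)) (x, z) := (hv _).congr_of_eventuallyEq hpz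
  have d2 : ∀ i, HasFDerivAt (fun p : E × ℝ => px i φ p.1 p.2)
      ((fderiv ℝ (fderiv ℝ F) (x, z)).flip (EuclideanSpace.single i 1, 0)) (x, z) := fun i =>
    (hv _).congr_of_eventuallyEq (hpx i)
  have e1 := d1.comp_hasDerivAt z h1
  refine ⟨?_, fun i => ?_⟩
  · have e2 : pz (pz φ) x z = _ := (HasDerivAt.hasDerivWithinAt e1 (s := Icc (-1) 0)).derivWithin
      (uniqueDiffOn_Icc (by norm_num) z (Ioo_subset_Icc_self hz))
    rw [e2]
    exact e1
  · have e2 : px i (pz φ) x z =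
        (fderiv ℝ (fderiv ℝ F) (x, z)).flip (0, 1) (EuclideanSpace.single i 1, 0) := by
      have h2 : HasFDerivAt (fun y : E => (y, z)) (ContinuousLinearMap.inl ℝ E ℝ) x :=
        hasFDerivAt_prodMk_left x z
      have h3 := (d1.comp x h2).fderiv
      have e : px i (pz φ) x z = fderiv ℝ ((fun p : E × ℝ => pz φ p.1 p.2) ∘ fun y => (y, z)) x
          (EuclideanSpace.single i 1) := rfl
      rw [e, h3]
      rfl
    rw [e2, ContinuousLinearMap.flip_apply, hS]
    exact (d2 i).comp_hasDerivAt z h1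

end Strip

/-! ### The gradient of a potential on the Fourier side -/

variable {h ψ : E → ℝ} {φ : E → ℝ → ℝ}

theorem IsPotential.exists_fam (hφ : IsPotential h ψ φ) (b : Fin 3) :
    ∃ U, Fam 3 (fun s => toC fun x => gradXZ φ b x s) U := by
  obtain ⟨M, hM⟩ := hφ.bounded
  set pr : ℝ → ℝ := fun s => (projIcc (-1 : ℝ) 0 (by norm_num) s : ℝ) with hpr
  have hprm : ∀ s, pr s ∈ Icc (-1 : ℝ) 0 := fun s => (projIcc (-1 : ℝ) 0 (by norm_num) s).2
  have hc : Continuous fun p : ℝ × E => toC (fun x => gradXZ φ b x (pr p.1)) p.2 := by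
    refine Complex.continuous_ofReal.comp ?_
    refine (continuousOn_gradXZ hφ.contDiffOn b).comp_continuous
      (f := fun p : ℝ × E => (p.2, pr p.1)) ?_ fun p => ⟨mem_univ _, hprm _⟩
    have : Continuous pr := continuous_subtype_val.comp continuous_projIcc
    fun_prop
  obtain ⟨U, hU, hU'⟩ := exists_measurable_ft hc fun s => (hM (pr s) (hprm s) b).1.1
  have hk : ∀ s ∈ Icc (-1 : ℝ) 0, FTW 3 (toC fun x => gradXZ φ b x s) (U s) ∧
      wn 3 (U s) ≤ wConst 3 * (ENNReal.ofReal M).toReal := by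
    intro s hs
    have h1 := MemH.ftw (k := 3) (by norm_num) (hM s hs b).1
    have h2 := hU' s
    rw [show pr s = s from congrArg Subtype.val (projIcc_of_mem (by norm_num) hs)] at h2
    have h3 := h1.1.hasFT.unique h2
    refine ⟨⟨h2, h1.1.wi.congr_ae h3⟩, ?_⟩
    rw [← wn_congr_ae h3]
    refine h1.2.trans (mul_le_mul_of_nonneg_left ?_ ?_)
    · exact ENNReal.toReal_mono ENNReal.ofReal_ne_top (hM s hs b).2
    · rw [wConst]
      positivity
  exact ⟨U, hU, fun s hs => (hk s hs).1, ⟨_, fun s hs => (hk s hs).2⟩⟩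

/-- The horizontal derivatives, in terms of the vertical one. -/
theorem IsPotential.fourier_px (hφ : IsPotential h ψ φ) (hψ : LambdaMemH 6 ψ)
    {U : Fin 3 → ℝ → E → ℂ} (hU : ∀ b, Fam 3 (fun s => toC fun x => gradXZ φ b x s) (U b))
    {z : ℝ} (hz : z ∈ Icc (-1 : ℝ) 0) (l : Fin 2) :
    ∀ᵐ ξ, U (Fin.castSucc l) z ξ =
      Complex.I * (ξ l : ℂ) * (ft (toC ψ) ξ - ∫ s in Ioc z 0, U 2 s ξ) := by
  have hsub : Ioc z 0 ⊆ Icc (-1 : ℝ) 0 := fun s hs => ⟨hz.1.trans hs.1.le, hs.2⟩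
  have h1 : FTW 1 (toC fun x => φ x z) (fun ξ => ft (toC ψ) ξ - ∫ s in Ioc z 0, U 2 s ξ) := by
    refine ((hψ.ftw.mono (by norm_num)).sub
      (((hU 2).mono (by norm_num : 1 ≤ 3)).integral hsub measurableSet_Ioc)).congr_fun fun x => ?_
    have hc : ContinuousOn (φ x) (Icc z 0) := fun s hs =>
      (hasDerivWithinAt_pz hφ.contDiffOn x ⟨hz.1.trans hs.1, hs.2⟩).1.continuousWithinAt.mono
        (Icc_subset_Icc_left hz.1)
    have hd : ∀ s ∈ Ioo z 0, HasDerivAt (φ x) (pz φ x s) s := fun s hs =>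
      (hasDerivWithinAt_pz hφ.contDiffOn x ⟨hz.1.trans hs.1.le, hs.2.le⟩).1.hasDerivAt
        (Icc_mem_nhds (hz.1.trans_lt hs.1) hs.2)
    have hi : IntervalIntegrable (pz φ x) volume z 0 := by
      refine ContinuousOn.intervalIntegrable ?_
      rw [uIcc_of_le hz.2]
      exact (continuousOn_gradXZ hφ.contDiffOn 2).comp (f := fun s : ℝ => (x, s)) (by fun_prop)
        fun s hs => ⟨mem_univ _, hz.1.trans hs.1, hs.2⟩
    have h2 := intervalIntegral.integral_eq_sub_of_hasDerivAt_of_le hz.2 hc hd hi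
    rw [hφ.top, intervalIntegral.integral_of_le hz.2] at h2
    have e : ∫ s in Ioc z 0, toC (fun x => gradXZ φ 2 x s) x = ((∫ s in Ioc z 0, pz φ x s : ℝ) : ℂ) :=
      integral_complex_ofReal
    rw [e, h2]
    simp [toC]
  have h2 := h1.dx l
  have h3 := (hU (Fin.castSucc l)).ftw z hz
  refine h3.hasFT.unique (h2.hasFT.congr_fun fun x => ?_)
  fin_cases l <;> rfl

end
end WaterWaves

namespace WaterWaves
open Filter Topology FourierTransform
open scoped NNReal
noncomputable section

/-! ### The flattened equation in divergence form -/

/-- The vertical flux `∂_z φ - Q^a`. -/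
def flux (h : E → ℝ) (φ : E → ℝ → ℝ) (x : E) (s : ℝ) : ℝ :=
  pz φ x s * (1 - hTilde h 0 x + (s + 1) ^ 2 * hTilde h 1 x)
    - (s + 1) * (hTilde h 2 x * px 0 φ x s + hTilde h 3 x * px 1 φ x s)

/-- The vertical derivative of the flux. -/
def dflux (h : E → ℝ) (φ : E → ℝ → ℝ) (x : E) (s : ℝ) : ℝ :=
  -(dx 0 (fun y => px 0 φ y s) x + dx 1 (fun y => px 1 φ y s) x)
    - (hTilde h 2 x * px 0 φ x s + hTilde h 3 x * px 1 φ x s)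
    + (s + 1) * (dx 0 (fun y => hTilde h 2 y * pz φ y s) x
      + dx 1 (fun y => hTilde h 3 y * pz φ y s) x)
    + (s + 1) * (hTilde h 1 x * pz φ x s)

lemma dx_mul {f g : E → ℝ} (hf : Differentiable ℝ f) (hg : Differentiable ℝ g) (i : Fin 2) (x : E) :
    dx i (fun y => f y * g y) x = dx i f x * g x + f x * dx i g x := by
  unfold dx
  rw [fderiv_fun_mul (hf x) (hg x)]
  simp
  ring

lemma dx_div_one_add {h : E → ℝ} (hh : MemH 6 h) (h1 : ∀ x, |h x| < 1) (i : Fin 2) (x : E)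
    (hd : Differentiable ℝ fun y => dx i h y / (1 + h y)) :
    dx i (fun y => dx i h y / (1 + h y)) x =
      dx i (dx i h) x / (1 + h x) - dx i h x ^ 2 / (1 + h x) ^ 2 := by
  have hne : ∀ x, 1 + h x ≠ 0 := fun x => (one_add_pos h1 x).ne'
  have e := dx_mul hd (hh.rw.differentiable.const_add 1) i x
  have e1 : (fun y => dx i h y / (1 + h y) * (1 + h y)) = dx i h :=
    funext fun y => div_mul_cancel₀ _ (hne y)
  have e2 : dx i (fun y => 1 + h y) x = dx i h x := by
    unfold dx
    rw [fderiv_const_add]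
  rw [e1, e2] at e
  have := hne x
  rw [e]
  field_simp
  ring

section Flux

variable {h ψ : E → ℝ} {φ : E → ℝ → ℝ}

lemma IsPotential.hasDerivAt_flux (hφ : IsPotential h ψ φ) (hh : MemH 6 h) (h1 : ∀ x, |h x| < 1)
    (x : E) {s : ℝ} (hs : s ∈ Ioo (-1 : ℝ) 0) :
    HasDerivAt (flux h φ x) (dflux h φ x s) s := by
  obtain ⟨d2, d1⟩ := hasDerivAt_interior hφ.contDiffOn x hs
  obtain ⟨U, hU⟩ := hφ.exists_fam 2
  have hdz : Differentiable ℝ fun y => pz φ y s :=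
    ((hU.ftw s (Ioo_subset_Icc_self hs)).mono (by norm_num : 1 ≤ 3)).differentiable
  have hd3 : ∀ j, Differentiable ℝ (hTilde h j) := fun j => (rw_hTilde hh h1 j).differentiable
  have ha : HasDerivAt (fun t : ℝ => t + 1) 1 s := (hasDerivAt_id s).add_const 1
  have key := (d2.mul ((ha.pow 2).mul_const (hTilde h 1 x)|>.const_add (1 - hTilde h 0 x))).sub
    (ha.mul (((d1 0).const_mul (hTilde h 2 x)).add ((d1 1).const_mul (hTilde h 3 x))))
  refine (key.congr_deriv ?_)
  have eq := hφ.equation x s hs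
  rw [dflux, dx_mul (hd3 2) hdz, dx_mul (hd3 3) hdz]
  have m : ∀ i, dx i (fun y => pz φ y s) x = px i (pz φ) x s := fun _ => rfl
  have l : ∀ i, dx i (fun y => px i φ y s) x = px i (px i φ) x s := fun _ => rfl
  have e0 : dx 0 (hTilde h 2) x = _ := dx_div_one_add hh h1 0 x (hd3 2)
  have e1 : dx 1 (hTilde h 3) x = _ := dx_div_one_add hh h1 1 x (hd3 3)
  rw [m, m, l, l, e0, e1]
  have hne : 1 + h x ≠ 0 := (one_add_pos h1 x).ne'
  simp only [coefA, coefB, coefC, gradSq, lap, Fin.sum_univ_two] at eq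
  simp only [hTilde, gradSq, Fin.sum_univ_two, Matrix.cons_val_zero, Matrix.cons_val_one,
    Matrix.cons_val] at *
  generalize px 0 (px 0 φ) x s = A at *
  generalize px 1 (px 1 φ) x s = B at *
  generalize pz (pz φ) x s = C at *
  simp only [Pi.pow_apply, Pi.add_apply, Nat.cast_ofNat]
  have := eq
  field_simp at this ⊢
  linear_combination this

lemma IsPotential.flux_eq (hφ : IsPotential h ψ φ) (hh : MemH 6 h) (h1 : ∀ x, |h x| < 1)
    (x : E) (hi : IntegrableOn (dflux h φ x) (Icc (-1) 0)) {z : ℝ} (hz : z ∈ Icc (-1 : ℝ) 0) :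
    flux h φ x z = ∫ s in Ioc (-1) z, dflux h φ x s := by
  have hc : ∀ b, ContinuousOn (gradXZ φ b x) (Icc (-1) 0) := fun b =>
    (continuousOn_gradXZ hφ.contDiffOn b).comp (f := fun s : ℝ => (x, s)) (by fun_prop)
      fun s hs => ⟨mem_univ x, hs⟩
  have c0 : ContinuousOn (px 0 φ x) (Icc (-1) 0) := hc 0
  have c1 : ContinuousOn (px 1 φ x) (Icc (-1) 0) := hc 1
  have c2 : ContinuousOn (pz φ x) (Icc (-1) 0) := hc 2
  have hcf : ContinuousOn (flux h φ x) (Icc (-1) z) := by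
    refine ContinuousOn.mono ?_ (Icc_subset_Icc_right hz.2)
    unfold flux
    fun_prop
  have h2 := intervalIntegral.integral_eq_sub_of_hasDerivAt_of_le hz.1 hcf
    (fun s hs => hφ.hasDerivAt_flux hh h1 x ⟨hs.1, hs.2.trans_le hz.2⟩)
    ((intervalIntegrable_iff_integrableOn_Icc_of_le hz.1).2
      (hi.mono_set (Icc_subset_Icc_right hz.2)))
  rw [intervalIntegral.integral_of_le hz.1] at h2
  have h3 : flux h φ x (-1) = 0 := by simp [flux, hφ.bottom x]
  rw [h2, h3, sub_zero]

end Flux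

end
end WaterWaves

namespace WaterWaves
open Filter Topology FourierTransform
open scoped NNReal
noncomputable section

/-! ### The fixed point identity on the Fourier side -/

/-- The first order terms `Q^a`, on the Fourier side. -/
def qTerm (H : Fin 4 → E → ℂ) (U : Fin 3 → ℝ → E → ℂ) (s : ℝ) (ξ : E) : ℂ :=
  ∑ j, ∑ b, (alp j b s : ℂ) * cv (H j) (U b s) ξ

/-- The terms in divergence form and of order zero, on the Fourier side. -/
def rTerm (H : Fin 4 → E → ℂ) (U : Fin 3 → ℝ → E → ℂ) (s : ℝ) (ξ : E) : ℂ :=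
  ∑ j, ∑ b, bet j b s ξ * cv (H j) (U b s) ξ

lemma toC_mul (f g : E → ℝ) : toC (fun x => f x * g x) = fun x => toC f x * toC g x :=
  funext fun x => by simp [toC]

section

variable {h ψ : E → ℝ} {φ : E → ℝ → ℝ} {U : Fin 3 → ℝ → E → ℂ} {H : Fin 4 → E → ℂ}

lemma fam_mul_hTilde (hU : ∀ b, Fam 3 (fun s => toC fun x => gradXZ φ b x s) (U b))
    (hH : ∀ j, FTW 1 (toC (hTilde h j)) (H j)) (j : Fin 4) (b : Fin 3) :
    Fam 1 (fun s => toC fun x => hTilde h j x * gradXZ φ b x s) (fun s => cv (H j) (U b s)) :=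
  (((hU b).mono (by norm_num)).mul (hH j)).congr_fun fun s _ x => by simp [toC]

lemma fam_flux (hU : ∀ b, Fam 3 (fun s => toC fun x => gradXZ φ b x s) (U b))
    (hH : ∀ j, FTW 1 (toC (hTilde h j)) (H j)) :
    Fam 1 (fun s => toC fun x => flux h φ x s) (fun s ξ => U 2 s ξ - qTerm H U s ξ) := by
  have hT := fam_mul_hTilde hU hH
  have hc1 : Continuous fun s : ℝ => -((s : ℂ) + 1) ^ 2 := by fun_prop
  have hc2 : Continuous fun s : ℝ => (s : ℂ) + 1 := by fun_prop
  have key := ((hU 2).mono (by norm_num : 1 ≤ 3)).sub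
    (((hT 0 2).add ((hT 1 2).smul hc1)).add (((hT 2 0).smul hc2).add ((hT 3 1).smul hc2)))
  have e : (fun (s : ℝ) ξ => U 2 s ξ - qTerm H U s ξ) = fun (s : ℝ) ξ => U 2 s ξ -
      (cv (H 0) (U 2 s) ξ + -((s : ℂ) + 1) ^ 2 * cv (H 1) (U 2 s) ξ +
        (((s : ℂ) + 1) * cv (H 2) (U 0 s) ξ + ((s : ℂ) + 1) * cv (H 3) (U 1 s) ξ)) := by
    funext s ξ
    simp [qTerm, alp, Fin.sum_univ_succ]
    ring
  rw [e]
  refine key.congr_fun fun s _ x => ?_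
  simp [toC, flux, gradXZ]
  ring

lemma fam_dflux (hU : ∀ b, Fam 3 (fun s => toC fun x => gradXZ φ b x s) (U b))
    (hH : ∀ j, FTW 1 (toC (hTilde h j)) (H j)) :
    Fam 0 (fun s => toC fun x => dflux h φ x s) (fun s ξ =>
      -(Complex.I * ξ 0 * U 0 s ξ + Complex.I * ξ 1 * U 1 s ξ) + rTerm H U s ξ) := by
  have hT := fam_mul_hTilde hU hH
  have hT0 := fun j b => (hT j b).mono (Nat.zero_le 1)
  have hc2 : Continuous fun s : ℝ => (s : ℂ) + 1 := by fun_prop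
  have key := ((((((hU 0).mono (by norm_num : 1 ≤ 3)).dx 0).add
    (((hU 1).mono (by norm_num : 1 ≤ 3)).dx 1)).neg.sub ((hT0 2 0).add (hT0 3 1))).add
    ((((hT 2 2).dx 0).add ((hT 3 2).dx 1)).smul hc2)).add ((hT0 1 2).smul hc2)
  have key' := key.congr_fun (w := fun s => toC fun x => dflux h φ x s) fun s _ x => by
    simp [toC, dflux, gradXZ]
  convert key' using 3 with s ξ
  simp [rTerm, bet, Fin.sum_univ_succ]
  ring

/-- Two measurable functions that agree almost everywhere on every slice. -/
lemma ae_ae_eq_of_slices {A B : ℝ × E → ℂ} (hA : StronglyMeasurable A) (hB : StronglyMeasurable B)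
    (h : ∀ s ∈ Icc (-1 : ℝ) 0, ∀ᵐ ξ, A (s, ξ) = B (s, ξ)) :
    ∀ᵐ ξ, ∀ᵐ s ∂volume.restrict (Icc (-1 : ℝ) 0), A (s, ξ) = B (s, ξ) := by
  refine (Measure.ae_ae_comm (μ := volume.restrict (Icc (-1 : ℝ) 0)) (ν := (volume : Measure E))
    (p := fun s ξ => A (s, ξ) = B (s, ξ)) (measurableSet_eq_fun hA.measurable hB.measurable)).1 ?_
  exact (ae_restrict_iff' measurableSet_Icc).2 (Eventually.of_forall h)

lemma stronglyMeasurable_integral_Ioc {X : ℝ → E → ℂ}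
    (hX : StronglyMeasurable fun q : ℝ × E => X q.1 q.2) :
    StronglyMeasurable (fun q : ℝ × E => ∫ t in Ioc q.1 0, X t q.2) ∧
    StronglyMeasurable (fun q : ℝ × E => ∫ t in Ioc (-1) q.1, X t q.2) := by
  have aux : ∀ S : Set ((ℝ × E) × ℝ), MeasurableSet S → StronglyMeasurable fun q : ℝ × E =>
      ∫ t, S.indicator (fun p => X p.2 p.1.2) (q, t) := fun S hS =>
    ((hX.comp_measurable (by fun_prop : Measurable fun p : (ℝ × E) × ℝ => (p.2, p.1.2))).indicator
      hS).integral_prod_right'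
  constructor
  · convert aux {p | p.1.1 < p.2 ∧ p.2 ≤ 0} (by measurability) using 2 with q
    rw [← integral_indicator measurableSet_Ioc]
    rfl
  · convert aux {p | -1 < p.2 ∧ p.2 ≤ p.1.1} (by measurability) using 2 with q
    rw [← integral_indicator measurableSet_Ioc]
    rfl

lemma IsPotential.fourier_pz (hφ : IsPotential h ψ φ) (hh : MemH 6 h) (h1 : ∀ x, |h x| < 1)
    (hU : ∀ b, Fam 3 (fun s => toC fun x => gradXZ φ b x s) (U b))
    (hH : ∀ j, FTW 1 (toC (hTilde h j)) (H j)) {z : ℝ} (hz : z ∈ Icc (-1 : ℝ) 0) :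
    ∀ᵐ ξ, U 2 z ξ - qTerm H U z ξ = ∫ s in Ioc (-1) z,
      (-(Complex.I * ξ 0 * U 0 s ξ + Complex.I * ξ 1 * U 1 s ξ) + rTerm H U s ξ) := by
  have hsub : Ioc (-1) z ⊆ Icc (-1 : ℝ) 0 := fun s hs => ⟨hs.1.le, hs.2.trans hz.2⟩
  have hd := fam_dflux hU hH
  refine ((fam_flux hU hH).ftw z hz).hasFT.unique
    ((hd.integral hsub measurableSet_Ioc).hasFT.congr_fun fun x => ?_)
  have hi : IntegrableOn (dflux h φ x) (Icc (-1) 0) := by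
    have := (hd.integrableOn x).re
    exact this
  rw [toC_apply, hφ.flux_eq hh h1 x hi hz, ← integral_complex_ofReal]
  rfl

end

/-! ### The operators `T`, on the Fourier side -/

/-- A common bound for the kernels. -/
def kD (z s r : ℝ) : ℝ :=
  if s < z then Real.cosh (r * z) * Real.cosh (r * (s + 1)) / Real.cosh r
  else Real.cosh (r * (z + 1)) * Real.cosh (r * s) / Real.cosh r

lemma abs_sinh_le_cosh (x : ℝ) : |Real.sinh x| ≤ Real.cosh x := by
  rw [abs_le]
  constructor
  · have := Real.exp_pos x
    rw [← Real.cosh_add_sinh] at this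
    linarith
  · exact (Real.sinh_lt_cosh _).le

lemma kD_nonneg (z s r : ℝ) : 0 ≤ kD z s r := by
  have := fun x => (Real.cosh_pos x).le
  unfold kD
  split_ifs <;> exact div_nonneg (mul_nonneg (this _) (this _)) (this _)

lemma cosh_mul_cosh_le {x y r : ℝ} (hx : 0 ≤ x) (hy : 0 ≤ y) (h : x + y ≤ r) :
    Real.cosh x * Real.cosh y ≤ Real.cosh r := by
  have h1 : Real.cosh x * Real.cosh y ≤ Real.cosh (x + y) := by
    rw [Real.cosh_add]
    have := mul_nonneg (Real.sinh_nonneg_iff.2 hx) (Real.sinh_nonneg_iff.2 hy)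
    linarith
  refine h1.trans (Real.cosh_le_cosh.2 ?_)
  rwa [abs_of_nonneg (by linarith), abs_of_nonneg (by linarith)]

lemma kD_le_one {z s r : ℝ} (hz : z ∈ Icc (-1 : ℝ) 0) (hs : s ∈ Icc (-1 : ℝ) 0) (hr : 0 ≤ r) :
    kD z s r ≤ 1 := by
  obtain ⟨hz1, hz2⟩ := hz
  obtain ⟨hs1, hs2⟩ := hs
  unfold kD
  split_ifs with h <;> refine (div_le_one (Real.cosh_pos r)).2 ?_
  · rw [← Real.cosh_neg]
    exact cosh_mul_cosh_le (by nlinarith) (by nlinarith) (by nlinarith)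
  · rw [← Real.cosh_neg (r * s)]
    exact cosh_mul_cosh_le (by nlinarith) (by nlinarith) (by nlinarith)

lemma integral_kD {s : ℝ} (r : ℝ) (hs : s ∈ Icc (-1 : ℝ) 0) :
    IntegrableOn (fun z => r * kD z s r) (Icc (-1) 0) ∧
      ∫ z in Icc (-1 : ℝ) 0, r * kD z s r ≤ 1 := by
  obtain ⟨hs1, hs2⟩ := hs
  have d1 : ∀ t : ℝ, HasDerivAt (fun z => Real.sinh (r * z) * Real.cosh (r * (s + 1)) / Real.cosh r)
      (r * (Real.cosh (r * t) * Real.cosh (r * (s + 1)) / Real.cosh r)) t := fun t => by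
    have := (((((hasDerivAt_id t).const_mul r).sinh).mul_const (Real.cosh (r * (s + 1)))).div_const
      (Real.cosh r))
    refine this.congr_deriv ?_
    simp only [id]
    ring
  have d2 : ∀ t : ℝ, HasDerivAt (fun z => Real.sinh (r * (z + 1)) * Real.cosh (r * s) / Real.cosh r)
      (r * (Real.cosh (r * (t + 1)) * Real.cosh (r * s) / Real.cosh r)) t := fun t => by
    have := ((((((hasDerivAt_id t).add_const (1 : ℝ)).const_mul r).sinh).mul_const
      (Real.cosh (r * s))).div_const (Real.cosh r))
    refine this.congr_deriv ?_
    simp only [id]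
    ring
  have c1 : Continuous fun t : ℝ =>
      r * (Real.cosh (r * t) * Real.cosh (r * (s + 1)) / Real.cosh r) := by
    have := Real.continuous_cosh
    fun_prop
  have c2 : Continuous fun t : ℝ =>
      r * (Real.cosh (r * (t + 1)) * Real.cosh (r * s) / Real.cosh r) := by
    have := Real.continuous_cosh
    fun_prop
  have e2 : EqOn (fun z => r * kD z s r)
      (fun t => r * (Real.cosh (r * (t + 1)) * Real.cosh (r * s) / Real.cosh r)) (Ioc (-1) s) :=
    fun t ht => by simp only [kD, if_neg (not_lt.2 ht.2)]
  have e1 : EqOn (fun z => r * kD z s r)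
      (fun t => r * (Real.cosh (r * t) * Real.cosh (r * (s + 1)) / Real.cosh r)) (Ioc s 0) :=
    fun t ht => by simp only [kD, if_pos ht.1]
  have i2 : IntegrableOn (fun z => r * kD z s r) (Ioc (-1) s) :=
    (c2.integrableOn_Ioc).congr_fun e2.symm measurableSet_Ioc
  have i1 : IntegrableOn (fun z => r * kD z s r) (Ioc s 0) :=
    (c1.integrableOn_Ioc).congr_fun e1.symm measurableSet_Ioc
  rw [integrableOn_Icc_iff_integrableOn_Ioc, integral_Icc_eq_integral_Ioc,
    ← Ioc_union_Ioc_eq_Ioc hs1 hs2]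
  refine ⟨i2.union i1, ?_⟩
  rw [setIntegral_union (Ioc_disjoint_Ioc_of_le le_rfl) measurableSet_Ioc i2 i1,
    setIntegral_congr_fun measurableSet_Ioc e1, setIntegral_congr_fun measurableSet_Ioc e2,
    ← intervalIntegral.integral_of_le hs1, ← intervalIntegral.integral_of_le hs2,
    intervalIntegral.integral_eq_sub_of_hasDerivAt (fun t _ => d1 t) (c1.intervalIntegrable _ _),
    intervalIntegral.integral_eq_sub_of_hasDerivAt (fun t _ => d2 t) (c2.intervalIntegrable _ _)]
  have e3 : Real.sinh r = Real.sinh (r * (s + 1)) * Real.cosh (r * s)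
      - Real.cosh (r * (s + 1)) * Real.sinh (r * s) := by
    rw [← Real.sinh_sub]
    congr 1
    ring
  have e4 := (Real.sinh_lt_cosh r).le
  rw [← div_le_one (Real.cosh_pos r), e3] at e4
  simp only [mul_zero, Real.sinh_zero, neg_add_cancel]
  refine le_trans (le_of_eq ?_) e4
  ring

lemma abs_kernel_le {z s r : ℝ} (hr : 0 ≤ r) : |kPA z s r| ≤ kD z s r ∧
    r * |kPR z s r| ≤ kD z s r ∧ |kVA z s r| ≤ r * kD z s r ∧ |kVR z s r| ≤ kD z s r := by
  have hc := Real.cosh_pos r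
  have h1 := abs_sinh_le_cosh
  have h2 : ∀ x, |Real.cosh x| ≤ Real.cosh x := fun x => (abs_of_pos (Real.cosh_pos x)).le
  have h0 : ∀ x, 0 ≤ Real.cosh x := fun x => (Real.cosh_pos x).le
  have key : ∀ {a b A B : ℝ}, |a| ≤ A → |b| ≤ B → |a * b / Real.cosh r| ≤ A * B / Real.cosh r := by
    intro a b A B ha hb
    rw [abs_div, abs_mul, abs_of_pos hc]
    have := (abs_nonneg a).trans ha
    gcongr
  have keyr : ∀ {a b A B : ℝ}, |a| ≤ A → |b| ≤ B →
      r * |a * b / (r * Real.cosh r)| ≤ A * B / Real.cosh r := by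
    intro a b A B ha hb
    rcases hr.eq_or_lt with rfl | hr'
    · rw [zero_mul]
      exact div_nonneg (mul_nonneg ((abs_nonneg a).trans ha) ((abs_nonneg b).trans hb)) hc.le
    · refine le_trans (le_of_eq ?_) (key ha hb)
      rw [abs_div, abs_div, abs_mul r, abs_of_pos hr']
      field_simp
  have keym : ∀ {a b A B : ℝ}, |a| ≤ A → |b| ≤ B →
      |r * a * b / Real.cosh r| ≤ r * (A * B / Real.cosh r) := by
    intro a b A B ha hb
    rw [mul_assoc, mul_div_assoc, abs_mul, abs_of_nonneg hr]
    exact mul_le_mul_of_nonneg_left (key ha hb) hr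
  unfold kPA kPR kVA kVR kD
  split_ifs with h
  · rw [abs_neg, abs_neg]
    exact ⟨key (h1 _) (h1 _), keyr (h1 _) (h2 _), keym (h2 _) (h1 _), key (h2 _) (h2 _)⟩
  · rw [abs_neg, abs_neg]
    exact ⟨key (h2 _) (h2 _), keyr (h2 _) (h1 _), keym (h1 _) (h2 _), key (h1 _) (h1 _)⟩

lemma norm_bet_le {j : Fin 4} {b : Fin 3} {s : ℝ} (hs : s ∈ Icc (-1 : ℝ) 0) (ξ : E) :
    ‖bet j b s ξ‖ ≤ 1 + ‖ξ‖ := by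
  have h0 := norm_nonneg ξ
  have e2 : ‖(s : ℂ) + 1‖ ≤ 1 := by
    rw [show (s : ℂ) + 1 = ((s + 1 : ℝ) : ℂ) by push_cast; rfl, Complex.norm_real]
    exact abs_le.2 ⟨by linarith [hs.1], by linarith [hs.2]⟩
  have e3 : ∀ i, ‖Complex.I * (ξ i : ℂ) * (s + 1)‖ ≤ 1 + ‖ξ‖ := fun i => by
    rw [norm_mul, norm_mul, Complex.norm_I, one_mul, Complex.norm_real]
    have := mul_le_mul (norm_coord_le ξ i) e2 (norm_nonneg _) h0
    rw [Real.norm_eq_abs]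
    linarith
  fin_cases j <;> fin_cases b <;> simp only [bet] <;>
    first
    | exact e3 0
    | exact e3 1
    | exact e2.trans (by linarith)
    | (simp; linarith)
    | simp

lemma norm_tsym_le {z s : ℝ} (a : Fin 3) (j : Fin 4) (b : Fin 3) (hs : s ∈ Icc (-1 : ℝ) 0) (ξ : E) :
    ‖tsym z a j b s ξ‖ ≤ (1 + 2 * ‖ξ‖) * kD z s ‖ξ‖ := by
  have hr := norm_nonneg ξ
  obtain ⟨h1, h2, h3, h4⟩ := abs_kernel_le (z := z) (s := s) hr
  have hα : |alp j b s| ≤ 1 := abs_alp hs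
  have hβ := norm_bet_le (j := j) (b := b) hs ξ
  have hD := kD_nonneg z s ‖ξ‖
  have n : ∀ x : ℝ, ‖(x : ℂ)‖ = |x| := fun x => Complex.norm_real x
  have hx : ∀ i : Fin 2, ‖Complex.I * (ξ i : ℂ) * (kPA z s ‖ξ‖ * alp j b s
      + kPR z s ‖ξ‖ * bet j b s ξ)‖ ≤ (1 + 2 * ‖ξ‖) * kD z s ‖ξ‖ := fun i => by
    rw [norm_mul, norm_mul, Complex.norm_I, one_mul, n]
    calc _ ≤ ‖ξ‖ * (|kPA z s ‖ξ‖| * 1 + |kPR z s ‖ξ‖| * (1 + ‖ξ‖)) := by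
          refine mul_le_mul (norm_coord_le ξ i) ((norm_add_le _ _).trans ?_) (norm_nonneg _) hr
          rw [norm_mul, norm_mul, n, n, n]
          gcongr
      _ = ‖ξ‖ * |kPA z s ‖ξ‖| + (‖ξ‖ * |kPR z s ‖ξ‖|) * (1 + ‖ξ‖) := by ring
      _ ≤ ‖ξ‖ * kD z s ‖ξ‖ + kD z s ‖ξ‖ * (1 + ‖ξ‖) := by gcongr
      _ = _ := by ring
  fin_cases a
  · exact hx 0
  · exact hx 1
  · refine (norm_add_le _ _).trans ?_
    rw [norm_mul, norm_mul, n, n, n]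
    calc _ ≤ ‖ξ‖ * kD z s ‖ξ‖ * 1 + kD z s ‖ξ‖ * (1 + ‖ξ‖) := by gcongr
      _ = _ := by ring

lemma integrableOn_tsym_mul {z : ℝ} (hz : z ∈ Icc (-1 : ℝ) 0) (a : Fin 3) (j : Fin 4) (b : Fin 3)
    (ξ : E) {f : ℝ → ℂ} (hf : IntegrableOn f (Icc (-1) 0)) :
    IntegrableOn (fun s => tsym z a j b s ξ * f s) (Icc (-1) 0) := by
  refine Integrable.bdd_mul (c := 1 + 2 * ‖ξ‖) hf
    ((measurable_tsym z a j b).comp (by fun_prop : Measurable fun s : ℝ => (s, ξ))).aestronglyMeasurable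
    ((ae_restrict_iff' measurableSet_Icc).2 (Eventually.of_forall fun s hs => ?_))
  exact (norm_tsym_le a j b hs ξ).trans
    (mul_le_of_le_one_right (by positivity) (kD_le_one hz hs (norm_nonneg ξ)))

/-- The operators `T_z^j` at the output frequency `ξ`. -/
def tv (z : ℝ) (a : Fin 3) (j : Fin 4) (ξ : E) (Y : Fin 3 → ℝ → ℂ) : ℂ :=
  ∑ b, (tsym0 z a j b * Y b z + ∫ s in Icc (-1 : ℝ) 0, tsym z a j b s ξ * Y b s)

/-- The operators `T_z^j`, applied to a family on the strip, on the Fourier side. -/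
def TT (z : ℝ) (a : Fin 3) (j : Fin 4) (X : Fin 3 → ℝ → E → ℂ) (ξ : E) : ℂ :=
  tv z a j ξ fun b s => X b s ξ

end
end WaterWaves

namespace WaterWaves
open Filter Topology FourierTransform
open scoped NNReal
noncomputable section

section

variable {z : ℝ} {X : Fin 4 → Fin 3 → ℝ → ℂ}

lemma sum_tv_eq (hz : z ∈ Icc (-1 : ℝ) 0) (a : Fin 3) (ξ : E)
    (hX : ∀ j b, IntegrableOn (X j b) (Icc (-1) 0)) :
    ∑ j, tv z a j ξ (X j) = ∑ j, ∑ b, tsym0 z a j b * X j b z +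
      ∫ s in Icc (-1 : ℝ) 0, ∑ j, ∑ b, tsym z a j b s ξ * X j b s := by
  rw [integral_finsetSum _ fun j _ => integrable_finsetSum _ fun b _ =>
    integrableOn_tsym_mul hz a j b ξ (hX j b), ← Finset.sum_add_distrib]
  refine Finset.sum_congr rfl fun j _ => ?_
  rw [integral_finsetSum _ fun b _ => integrableOn_tsym_mul hz a j b ξ (hX j b),
    ← Finset.sum_add_distrib, tv]

lemma sum_tv_horizontal (hz : z ∈ Icc (-1 : ℝ) 0) (l : Fin 2) (ξ : E)
    (hX : ∀ j b, IntegrableOn (X j b) (Icc (-1) 0)) :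
    ∑ j, tv z l.castSucc j ξ (X j) = Complex.I * ξ l * ∫ s in Icc (-1 : ℝ) 0,
      (kPA z s ‖ξ‖ * (∑ j, ∑ b, (alp j b s : ℂ) * X j b s) +
        kPR z s ‖ξ‖ * ∑ j, ∑ b, bet j b s ξ * X j b s) := by
  rw [sum_tv_eq hz _ ξ hX, ← integral_const_mul]
  have e0 : ∀ j b, tsym0 z l.castSucc j b = 0 := fun j b => by fin_cases l <;> rfl
  simp only [e0, zero_mul, Finset.sum_const_zero, zero_add]
  refine integral_congr_ae (Eventually.of_forall fun s => ?_)
  simp only [Finset.mul_sum, ← Finset.sum_add_distrib]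
  refine Finset.sum_congr rfl fun j _ => Finset.sum_congr rfl fun b _ => ?_
  have e1 : tsym z l.castSucc j b s ξ = Complex.I * ξ l *
      (kPA z s ‖ξ‖ * alp j b s + kPR z s ‖ξ‖ * bet j b s ξ) := by fin_cases l <;> rfl
  rw [e1]
  ring

lemma sum_tv_vertical (hz : z ∈ Icc (-1 : ℝ) 0) (ξ : E)
    (hX : ∀ j b, IntegrableOn (X j b) (Icc (-1) 0)) :
    ∑ j, tv z 2 j ξ (X j) = ∑ j, ∑ b, (alp j b z : ℂ) * X j b z + ∫ s in Icc (-1 : ℝ) 0,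
      (kVA z s ‖ξ‖ * (∑ j, ∑ b, (alp j b s : ℂ) * X j b s) +
        kVR z s ‖ξ‖ * ∑ j, ∑ b, bet j b s ξ * X j b s) := by
  rw [sum_tv_eq hz _ ξ hX]
  congr 1
  refine integral_congr_ae (Eventually.of_forall fun s => ?_)
  simp only [Finset.mul_sum, ← Finset.sum_add_distrib]
  refine Finset.sum_congr rfl fun j _ => Finset.sum_congr rfl fun b _ => ?_
  have e1 : tsym z 2 j b s ξ = kVA z s ‖ξ‖ * alp j b s + kVR z s ‖ξ‖ * bet j b s ξ := rfl
  rw [e1]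
  ring

end

section

variable {h ψ : E → ℝ} {φ : E → ℝ → ℝ} {U : Fin 3 → ℝ → E → ℂ} {H : Fin 4 → E → ℂ}

lemma norm_sq_coord (ξ : E) : (ξ 0 : ℂ) ^ 2 + (ξ 1 : ℂ) ^ 2 = (‖ξ‖ : ℂ) ^ 2 := by
  have := EuclideanSpace.real_norm_sq_eq ξ
  rw [Fin.sum_univ_two] at this
  exact_mod_cast this.symm

/-- The equations for the gradient at a fixed frequency, solved. -/
lemma fixed_point_at {ξ : E} (k0 : ξ ≠ 0) {Ψ : ℂ} {u : Fin 3 → ℝ → ℂ} {Q R : ℝ → ℂ}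
    (ku : IntegrableOn (u 2) (Icc (-1) 0)) (iQ : IntegrableOn Q (Icc (-1) 0))
    (iR : IntegrableOn R (Icc (-1) 0))
    (k1 : ∀ l : Fin 2, ∀ᵐ s ∂volume.restrict (Icc (-1 : ℝ) 0),
      u l.castSucc s = Complex.I * ξ l * (Ψ - ∫ t in Ioc s 0, u 2 t))
    (k2 : ∀ᵐ s ∂volume.restrict (Icc (-1 : ℝ) 0), u 2 s - Q s = ∫ t in Ioc (-1) s,
      (-(Complex.I * ξ 0 * u 0 t + Complex.I * ξ 1 * u 1 t) + R t))
    {z : ℝ} (hz : z ∈ Icc (-1 : ℝ) 0) :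
    Ψ - ∫ t in Ioc z 0, u 2 t = mA z ‖ξ‖ * Ψ +
      ∫ s in Icc (-1 : ℝ) 0, (kPA z s ‖ξ‖ * Q s + kPR z s ‖ξ‖ * R s) ∧
    ∫ t in Ioc (-1) z, (-(Complex.I * ξ 0 * u 0 t + Complex.I * ξ 1 * u 1 t) + R t) =
      mB z ‖ξ‖ * Ψ + ∫ s in Icc (-1 : ℝ) 0, (kVA z s ‖ξ‖ * Q s + kVR z s ‖ξ‖ * R s) := by
  have hr : 0 < ‖ξ‖ := norm_pos_iff.2 k0
  let P : ℝ → ℂ := fun s => Ψ - ∫ t in s..0, u 2 t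
  let V : ℝ → ℂ := fun s => ∫ t in (-1)..s, ((‖ξ‖ : ℂ) ^ 2 * P t + R t)
  have u01 : uIcc (-1 : ℝ) 0 = Icc (-1) 0 := uIcc_of_le (by norm_num)
  have iP : IntegrableOn P (Icc (-1) 0) := by
    refine ContinuousOn.integrableOn_Icc (continuousOn_const.sub ?_)
    rw [← u01]
    exact intervalIntegral.continuousOn_primitive_interval_left (by rw [u01]; exact ku)
  have iPR : IntegrableOn (fun t => (‖ξ‖ : ℂ) ^ 2 * P t + R t) (Icc (-1) 0) := (iP.const_mul _).add iR
  have iV : IntegrableOn V (Icc (-1) 0) := by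
    refine ContinuousOn.integrableOn_Icc ?_
    rw [← u01]
    exact intervalIntegral.continuousOn_primitive_interval (by rw [u01]; exact iPR)
  have hPI : ∀ s ∈ Icc (-1 : ℝ) 0, P s = Ψ - ∫ t in Ioc s 0, u 2 t := fun s hs => by
    rw [← intervalIntegral.integral_of_le hs.2]
  have hVI : ∀ s ∈ Icc (-1 : ℝ) 0, V s = ∫ t in Ioc (-1) s,
      (-(Complex.I * ξ 0 * u 0 t + Complex.I * ξ 1 * u 1 t) + R t) := fun s hs => by
    have hsub : Ioc (-1) s ⊆ Icc (-1 : ℝ) 0 := fun t ht => ⟨ht.1.le, ht.2.trans hs.2⟩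
    rw [show V s = ∫ t in (-1)..s, ((‖ξ‖ : ℂ) ^ 2 * P t + R t) from rfl,
      intervalIntegral.integral_of_le hs.1]
    refine integral_congr_ae ?_
    filter_upwards [ae_restrict_of_ae_restrict_of_subset hsub (k1 0),
      ae_restrict_of_ae_restrict_of_subset hsub (k1 1), ae_restrict_mem measurableSet_Ioc]
      with t e1 e2 ht
    have e1' : u 0 t = _ := e1
    have e2' : u 1 t = _ := e2
    rw [e1', e2', ← hPI t (hsub ht), ← norm_sq_coord]
    linear_combination (((ξ 0 : ℂ) ^ 2 + (ξ 1 : ℂ) ^ 2) * P t) * Complex.I_sq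
  have hPD : ∀ s ∈ Icc (-1 : ℝ) 0, P s = Ψ - ∫ t in s..0, (V t + Q t) := fun s hs => by
    rw [hPI s hs, intervalIntegral.integral_of_le hs.2]
    congr 1
    have hsub : Ioc s 0 ⊆ Icc (-1 : ℝ) 0 := fun t ht => ⟨hs.1.trans ht.1.le, ht.2⟩
    refine integral_congr_ae ?_
    filter_upwards [ae_restrict_of_ae_restrict_of_subset hsub k2, ae_restrict_mem measurableSet_Ioc]
      with t e1 ht
    rw [hVI t (hsub ht), ← e1]
    ring
  rw [← hPI z hz, ← hVI z hz]
  exact duhamel hr iQ iR iP iV hPD (fun s _ => rfl) hz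

/-- The gradient of a velocity potential, as the solution of a fixed point equation. -/
theorem IsPotential.fixed_point (hφ : IsPotential h ψ φ) (hh : MemH 6 h) (h1 : ∀ x, |h x| < 1)
    (hψ : LambdaMemH 6 ψ) (hU : ∀ b, Fam 3 (fun s => toC fun x => gradXZ φ b x s) (U b))
    (hH : ∀ j, FTW 1 (toC (hTilde h j)) (H j)) {z : ℝ} (hz : z ∈ Icc (-1 : ℝ) 0) (a : Fin 3) :
    ∀ᵐ ξ, U a z ξ = symA a z ξ * ft (toC ψ) ξ + ∑ j, TT z a j (fun b s => cv (H j) (U b s)) ξ := by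
  have hΨ : AEStronglyMeasurable (ft (toC ψ)) := hψ.ftw.aesm
  have hd := fam_dflux hU hH
  have hf := fam_flux hU hH
  have g1 : ∀ l : Fin 2, ∀ᵐ ξ, ∀ᵐ s ∂volume.restrict (Icc (-1 : ℝ) 0),
      U l.castSucc s ξ = Complex.I * ξ l * (hΨ.mk _ ξ - ∫ t in Ioc s 0, U 2 t ξ) := fun l => by
    refine ae_ae_eq_of_slices (A := fun q => U l.castSucc q.1 q.2)
      (B := fun q => Complex.I * (q.2 l : ℂ) * (hΨ.mk _ q.2 - ∫ t in Ioc q.1 0, U 2 t q.2))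
      (hU _).sm ?_ fun s hs => ?_
    · exact (Continuous.stronglyMeasurable (by fun_prop)).mul
        ((hΨ.stronglyMeasurable_mk.comp_measurable measurable_snd).sub
          (stronglyMeasurable_integral_Ioc (hU 2).sm).1)
    · filter_upwards [hφ.fourier_px hψ hU hs l, hΨ.ae_eq_mk] with ξ e1 e2
      rw [e1, e2]
  have g2 : ∀ᵐ ξ, ∀ᵐ s ∂volume.restrict (Icc (-1 : ℝ) 0), U 2 s ξ - qTerm H U s ξ =
      ∫ t in Ioc (-1) s,
        (-(Complex.I * ξ 0 * U 0 t ξ + Complex.I * ξ 1 * U 1 t ξ) + rTerm H U t ξ) :=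
    ae_ae_eq_of_slices (A := fun q => U 2 q.1 q.2 - qTerm H U q.1 q.2)
      (B := fun q => ∫ t in Ioc (-1) q.1, (-(Complex.I * q.2 0 * U 0 t q.2 +
        Complex.I * q.2 1 * U 1 t q.2) + rTerm H U t q.2)) hf.sm
      (stronglyMeasurable_integral_Ioc (X := fun t ξ => -(Complex.I * ξ 0 * U 0 t ξ +
        Complex.I * ξ 1 * U 1 t ξ) + rTerm H U t ξ) hd.sm).2 fun s hs => hφ.fourier_pz hh h1 hU hH hs
  have g0 : ∀ᵐ ξ : E, ξ ≠ 0 := by simp [ae_iff]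
  have iX : ∀ᵐ ξ, ∀ j b, IntegrableOn (fun s => cv (H j) (U b s) ξ) (Icc (-1) 0) := by
    simp only [ae_all_iff]
    exact fun j b => (fam_mul_hTilde hU hH j b).ae_integrableOn
  have iU : ∀ᵐ ξ, ∀ b, IntegrableOn (fun s => U b s ξ) (Icc (-1) 0) := by
    simp only [ae_all_iff]
    exact fun b => (hU b).ae_integrableOn
  have hxz : ∀ᵐ ξ, ∀ l : Fin 2, U l.castSucc z ξ =
      Complex.I * ξ l * (ft (toC ψ) ξ - ∫ t in Ioc z 0, U 2 t ξ) :=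
    ae_all_iff.2 fun l => hφ.fourier_px hψ hU hz l
  filter_upwards [g0, ae_all_iff.2 g1, g2, iX, iU, hd.ae_integrableOn, hf.ae_integrableOn,
    hΨ.ae_eq_mk, hxz, hφ.fourier_pz hh h1 hU hH hz] with ξ k0 k1 k3 kX kU kd kf kΨ kx kz
  simp only [← kΨ] at k1
  have iQ : IntegrableOn (fun s => qTerm H U s ξ) (Icc (-1) 0) := ((kU 2).sub kf).congr_fun
    (fun s _ => by simp) measurableSet_Icc
  have iR : IntegrableOn (fun s => rTerm H U s ξ) (Icc (-1) 0) :=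
    (kd.add (((kU 0).const_mul (Complex.I * ξ 0)).add ((kU 1).const_mul (Complex.I * ξ 1)))).congr_fun
      (fun s _ => by simp only [Pi.add_apply]; ring) measurableSet_Icc
  obtain ⟨d1, d2⟩ := fixed_point_at k0 (u := fun b s => U b s ξ) (kU 2) iQ iR k1 k3 hz
  have hx : ∀ l : Fin 2, U l.castSucc z ξ = Complex.I * ξ l * mA z ‖ξ‖ * ft (toC ψ) ξ +
      ∑ j, TT z l.castSucc j (fun b s => cv (H j) (U b s)) ξ := fun l => by
    refine (kx l).trans ?_
    rw [d1, mul_add]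
    exact congrArg₂ _ (by ring) (sum_tv_horizontal hz l ξ kX).symm
  fin_cases a
  · exact hx 0
  · exact hx 1
  · have e3 : U 2 z ξ = mB z ‖ξ‖ * ft (toC ψ) ξ +
        ∑ j, TT z 2 j (fun b s => cv (H j) (U b s)) ξ := by
      have e4 : ∑ j, TT z 2 j (fun b s => cv (H j) (U b s)) ξ = qTerm H U z ξ +
          ∫ s in Icc (-1 : ℝ) 0, (kVA z s ‖ξ‖ * qTerm H U s ξ + kVR z s ‖ξ‖ * rTerm H U s ξ) :=
        sum_tv_vertical hz ξ kX
      rw [e4]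
      linear_combination kz + d2
    exact e3

end

end
end WaterWaves

namespace WaterWaves
open Filter Topology FourierTransform
open scoped NNReal
noncomputable section

/-! ### The symbols of the quadratic terms -/

/-- The symbols of the linear parts of `h̃_j`. -/
def lin (j : Fin 4) (ξ : E) : ℂ :=
  (![2, 0, Complex.I * ξ 0, Complex.I * ξ 1] : Fin 4 → ℂ) j

lemma hasDerivAt_mA (r s : ℝ) : HasDerivAt (fun s => mA s r) (mB s r) s := by
  have := ((((hasDerivAt_id s).add_const (1 : ℝ)).mul_const r).cosh).div_const (Real.cosh r)
  refine this.congr_deriv ?_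
  simp only [id, mB]
  ring

lemma hasDerivAt_mB (r s : ℝ) : HasDerivAt (fun s => mB s r) (r ^ 2 * mA s r) s := by
  have := (((((hasDerivAt_id s).add_const (1 : ℝ)).mul_const r).sinh).const_mul r).div_const
    (Real.cosh r)
  refine this.congr_deriv ?_
  simp only [id, mA]
  ring

@[simp] lemma mA_zero (r : ℝ) : mA 0 r = 1 := by
  rw [mA, zero_add, one_mul, div_self (Real.cosh_pos r).ne']

@[simp] lemma mB_neg_one (r : ℝ) : mB (-1) r = 0 := by simp [mB]

lemma continuous_mA_left (r : ℝ) : Continuous fun s => mA s r :=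
  continuous_iff_continuousAt.2 fun s => (hasDerivAt_mA r s).continuousAt

lemma continuous_mB_left (r : ℝ) : Continuous fun s => mB s r :=
  continuous_iff_continuousAt.2 fun s => (hasDerivAt_mB r s).continuousAt

/-- The flattened Neumann problem solved by the quadratic term of the potential. -/
lemma quadratic_duhamel {r ρ c : ℝ} (hr : 0 < r) {z : ℝ} (hz : z ∈ Icc (-1 : ℝ) 0) (m : ℝ)
    (hrc : r ^ 2 = m + 2 * c + ρ ^ 2) {Q R : ℝ → ℂ}
    (hQ : ∀ s : ℝ, Q s = ((2 * mB s ρ - (s + 1) * (c * mA s ρ) : ℝ) : ℂ))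
    (hR : ∀ s : ℝ, R s = ((c * mA s ρ - (s + 1) * ((m + c) * mB s ρ) : ℝ) : ℂ)) :
    ((1 + z) * mB z ρ - mA z r * mB 0 ρ : ℂ) =
      ∫ s in Icc (-1 : ℝ) 0, (kPA z s r * Q s + kPR z s r * R s) ∧
    (mB z ρ + (1 + z) * (ρ ^ 2 * mA z ρ) - mB z r * mB 0 ρ : ℂ) =
      Q z + ∫ s in Icc (-1 : ℝ) 0, (kVA z s r * Q s + kVR z s r * R s) := by
  have cA := continuous_mA_left ρ
  have cB := continuous_mB_left ρ
  have cA' := continuous_mA_left r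
  have cB' := continuous_mB_left r
  obtain rfl : Q = fun s : ℝ => ((2 * mB s ρ - (s + 1) * (c * mA s ρ) : ℝ) : ℂ) := funext hQ
  obtain rfl : R = fun s : ℝ => ((c * mA s ρ - (s + 1) * ((m + c) * mB s ρ) : ℝ) : ℂ) := funext hR
  let p : ℝ → ℝ := fun s => (1 + s) * mB s ρ - mA s r * mB 0 ρ
  let v : ℝ → ℝ := fun s => mB s ρ + (1 + s) * (ρ ^ 2 * mA s ρ) - mB s r * mB 0 ρ
    - (2 * mB s ρ - (s + 1) * (c * mA s ρ))
  have cp : Continuous p := by fun_prop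
  have cv : Continuous v := by fun_prop
  have dp : ∀ s, HasDerivAt p (v s + (2 * mB s ρ - (s + 1) * (c * mA s ρ))) s := fun s => by
    refine ((((hasDerivAt_id s).const_add 1).mul (hasDerivAt_mB ρ s)).sub
      ((hasDerivAt_mA r s).mul_const _)).congr_deriv ?_
    simp only [v, id]
    ring
  have dv : ∀ s, HasDerivAt v (r ^ 2 * p s + (c * mA s ρ - (s + 1) * ((m + c) * mB s ρ))) s :=
    fun s => by
    refine ((((hasDerivAt_mB ρ s).add (((hasDerivAt_id s).const_add 1).mul
      ((hasDerivAt_mA ρ s).const_mul (ρ ^ 2)))).sub ((hasDerivAt_mB r s).mul_const (mB 0 ρ))).sub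
      (((hasDerivAt_mB ρ s).const_mul 2).sub (((hasDerivAt_id s).add_const 1).mul
      ((hasDerivAt_mA ρ s).const_mul c)))).congr_deriv ?_
    simp only [p, id]
    linear_combination (-(1 + s) * mB s ρ) * hrc
  have key := duhamel hr (P0 := 0) (P := fun s => (p s : ℂ)) (V := fun s => (v s : ℂ))
    (Q := fun s : ℝ => ((2 * mB s ρ - (s + 1) * (c * mA s ρ) : ℝ) : ℂ))
    (R := fun s : ℝ => ((c * mA s ρ - (s + 1) * ((m + c) * mB s ρ) : ℝ) : ℂ))
    (Continuous.integrableOn_Icc (by fun_prop)) (Continuous.integrableOn_Icc (by fun_prop))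
    (Continuous.integrableOn_Icc (by fun_prop)) (Continuous.integrableOn_Icc (by fun_prop))
    (fun s _ => ?_) (fun s _ => ?_) hz
  · refine ⟨?_, ?_⟩
    · have := key.1
      rw [mul_zero, zero_add] at this
      rw [← this]
      push_cast [p]
      rfl
    · have := key.2
      rw [mul_zero, zero_add] at this
      rw [← this]
      push_cast [v]
      ring
  · have h1 := intervalIntegral.integral_eq_sub_of_hasDerivAt (a := s) (b := 0) (fun t _ => dp t)
      (Continuous.intervalIntegrable (by fun_prop) _ _)
    have h2 : p 0 = 0 := by simp [p]
    rw [h2] at h1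
    have h3 := congrArg (fun x : ℝ => (x : ℂ)) h1
    simp only [← intervalIntegral.integral_ofReal] at h3
    push_cast at h3 ⊢
    rw [h3]
    ring
  · have h1 := intervalIntegral.integral_eq_sub_of_hasDerivAt (a := -1) (b := s) (fun t _ => dv t)
      (Continuous.intervalIntegrable (by fun_prop) _ _)
    have h2 : v (-1) = 0 := by simp [v]
    rw [h2] at h1
    have h3 := congrArg (fun x : ℝ => (x : ℂ)) h1
    simp only [← intervalIntegral.integral_ofReal] at h3
    push_cast at h3 ⊢
    rw [h3]
    ring

/-- The quadratic symbols, through the linear ones. -/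
theorem symB_eq {z : ℝ} (hz : z ∈ Icc (-1 : ℝ) 0) (a : Fin 3) {ξ η : E} (hζ : ξ + η ≠ 0) :
    symB a z ξ η = ∑ j, tv z a j (ξ + η) fun b s => lin j ξ * symA b s η := by
  have hX : ∀ (j : Fin 4) (b : Fin 3), IntegrableOn (fun s => lin j ξ * symA b s η) (Icc (-1) 0) :=
    fun j b => Continuous.integrableOn_Icc (continuous_const.mul
      ((continuous_symA b).comp (by fun_prop : Continuous fun s : ℝ => (s, η))))
  have n1 := norm_sq_coord ξ
  have n2 := norm_sq_coord η
  have hr : ‖ξ + η‖ ^ 2 = ‖ξ‖ ^ 2 + 2 * (ξ 0 * η 0 + ξ 1 * η 1) + ‖η‖ ^ 2 := by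
    have n3 := norm_sq_coord (ξ + η)
    have : ((‖ξ + η‖ : ℂ)) ^ 2 = ‖ξ‖ ^ 2 + 2 * (ξ 0 * η 0 + ξ 1 * η 1) + ‖η‖ ^ 2 := by
      rw [← n3, ← n1, ← n2]
      simp only [PiLp.add_apply]
      push_cast
      ring
    exact_mod_cast this
  obtain ⟨d1, d2⟩ := quadratic_duhamel (norm_pos_iff.2 hζ) hz (‖ξ‖ ^ 2) hr
    (Q := fun s => ∑ j, ∑ b, (alp j b s : ℂ) * (lin j ξ * symA b s η))
    (R := fun s => ∑ j, ∑ b, bet j b s (ξ + η) * (lin j ξ * symA b s η))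
    (fun s => by
      simp [lin, symA, alp, Fin.sum_univ_succ]
      linear_combination ((s + 1) * mA s ‖η‖ * (ξ 0 * η 0 + ξ 1 * η 1) : ℂ) * Complex.I_sq)
    (fun s => by
      simp [lin, symA, bet, Fin.sum_univ_succ]
      rw [← n1]
      linear_combination (-mA s ‖η‖ * (ξ 0 * η 0 + ξ 1 * η 1) + (s + 1) * mB s ‖η‖ *
        ((ξ 0 + η 0) * ξ 0 + (ξ 1 + η 1) * ξ 1) : ℂ) * Complex.I_sq)
  have hx : ∀ l : Fin 2, Complex.I * (ξ + η) l *
      ((1 + z) * mB z ‖η‖ - mA z ‖ξ + η‖ * mB 0 ‖η‖) =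
      ∑ j, tv z l.castSucc j (ξ + η) fun b s => lin j ξ * symA b s η := fun l => by
    rw [d1, sum_tv_horizontal hz l _ hX]
  fin_cases a
  · exact hx 0
  · exact hx 1
  · exact d2.trans (sum_tv_vertical hz _ hX).symm

end
end WaterWaves

namespace WaterWaves
open Filter Topology FourierTransform
open scoped NNReal
noncomputable section

/-! ### Integral operators on `L¹` -/

section Kernel

variable {α β : Type*} [MeasurableSpace α] [MeasurableSpace β] {ν : Measure α} {μ : Measure β}
  {m : α → ℂ} {k : α × β → ℂ} {g : α × β → α}

/-- Multiplication by `m` plus the integral operator with kernel `k` along `g`. -/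
def kerOp (μ : Measure β) (m : α → ℂ) (k : α × β → ℂ) (g : α × β → α) (f : α → ℂ) (q : α) : ℂ :=
  m q * f q + ∫ p, k (q, p) * f (g (q, p)) ∂μ

lemma stronglyMeasurable_kerOp [SFinite μ] (hm : Measurable m) (hk : Measurable k) (hg : Measurable g)
    {f : α → ℂ} (hf : StronglyMeasurable f) : StronglyMeasurable (kerOp μ m k g f) :=
  (hm.stronglyMeasurable.mul hf).add
    ((hk.stronglyMeasurable.mul (hf.comp_measurable hg)).integral_prod_right' (ν := μ))

lemma ae_integrable_kernel [SFinite μ] (hk : Measurable k) (hg : Measurable g) {C : ℝ≥0}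
    (hC : ∀ f : α → ℝ≥0∞, Measurable f →
      ∫⁻ q, (‖m q‖ₑ * f q + ∫⁻ p, ‖k (q, p)‖ₑ * f (g (q, p)) ∂μ) ∂ν ≤ C * ∫⁻ q, f q ∂ν)
    {f : α → ℂ} (hf : StronglyMeasurable f) (hi : Integrable f ν) :
    ∀ᵐ q ∂ν, Integrable (fun p => k (q, p) * f (g (q, p))) μ := by
  have hm1 : Measurable fun q => ∫⁻ p, ‖k (q, p)‖ₑ * ‖f (g (q, p))‖ₑ ∂μ :=
    Measurable.lintegral_prod_right' (f := fun r => ‖k r‖ₑ * ‖f (g r)‖ₑ)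
      (hk.enorm.mul (hf.measurable.comp hg).enorm)
  have h1 := hC (fun q => ‖f q‖ₑ) hf.measurable.enorm
  have h2 : ∫⁻ q, ∫⁻ p, ‖k (q, p)‖ₑ * ‖f (g (q, p))‖ₑ ∂μ ∂ν ≠ ⊤ := by
    refine ne_top_of_le_ne_top (ENNReal.mul_ne_top ENNReal.coe_ne_top hi.2.ne)
      ((lintegral_mono fun q => ?_).trans h1)
    exact le_add_self
  filter_upwards [ae_lt_top hm1 h2] with q hq
  refine ⟨((hk.comp measurable_prodMk_left).stronglyMeasurable.mul
    (hf.comp_measurable (hg.comp measurable_prodMk_left))).aestronglyMeasurable, ?_⟩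
  simpa only [HasFiniteIntegral, enorm_mul] using hq

lemma lintegral_kerOp_le {C : ℝ≥0}
    (hC : ∀ f : α → ℝ≥0∞, Measurable f →
      ∫⁻ q, (‖m q‖ₑ * f q + ∫⁻ p, ‖k (q, p)‖ₑ * f (g (q, p)) ∂μ) ∂ν ≤ C * ∫⁻ q, f q ∂ν)
    {f : α → ℂ} (hf : StronglyMeasurable f) :
    ∫⁻ q, ‖kerOp μ m k g f q‖ₑ ∂ν ≤ C * ∫⁻ q, ‖f q‖ₑ ∂ν := by
  refine (lintegral_mono fun q => ?_).trans (hC (fun q => ‖f q‖ₑ) hf.measurable.enorm)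
  refine (enorm_add_le _ _).trans (add_le_add (enorm_mul _ _).le ?_)
  refine (enorm_integral_le_lintegral_enorm _).trans (lintegral_mono fun p => (enorm_mul _ _).le)

/-- Schur's test. -/
theorem exists_clm_kerOp [SFinite μ] (hm : Measurable m) (hk : Measurable k) (hg : Measurable g) {C : ℝ≥0}
    (hC : ∀ f : α → ℝ≥0∞, Measurable f →
      ∫⁻ q, (‖m q‖ₑ * f q + ∫⁻ p, ‖k (q, p)‖ₑ * f (g (q, p)) ∂μ) ∂ν ≤ C * ∫⁻ q, f q ∂ν) :
    ∃ L : (α →₁[ν] ℂ) →L[ℝ] (α →₁[ν] ℂ), ∀ (x : α →₁[ν] ℂ) (f : α → ℂ), StronglyMeasurable f →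
      x =ᵐ[ν] f → L x =ᵐ[ν] kerOp μ m k g f := by
  have hi : ∀ {f : α → ℂ}, StronglyMeasurable f → Integrable f ν → Integrable (kerOp μ m k g f) ν :=
    fun hf hi => ⟨(stronglyMeasurable_kerOp hm hk hg hf).aestronglyMeasurable,
      (lintegral_kerOp_le hC hf).trans_lt (ENNReal.mul_lt_top ENNReal.coe_lt_top hi.2)⟩
  have hadd : ∀ {f f' : α → ℂ}, StronglyMeasurable f → StronglyMeasurable f' → Integrable f ν →
      Integrable f' ν → kerOp μ m k g (fun q => f q + f' q) =ᵐ[ν]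
        fun q => kerOp μ m k g f q + kerOp μ m k g f' q := by
    intro f f' hf hf' i i'
    filter_upwards [ae_integrable_kernel hk hg hC hf i, ae_integrable_kernel hk hg hC hf' i']
      with q h1 h2
    simp only [kerOp, mul_add]
    rw [integral_add h1 h2]
    ring
  have hcongr : ∀ {f f' : α → ℂ}, StronglyMeasurable f → StronglyMeasurable f' → Integrable f ν →
      f =ᵐ[ν] f' → kerOp μ m k g f =ᵐ[ν] kerOp μ m k g f' := by
    intro f f' hf hf' i e
    have hs := hf'.sub hf
    have h1 : ∫⁻ q, ‖kerOp μ m k g (f' - f) q‖ₑ ∂ν = 0 := by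
      refine le_antisymm ((lintegral_kerOp_le hC hs).trans (le_of_eq ?_)) zero_le
      rw [lintegral_congr_ae (g := 0), lintegral_zero_fun, mul_zero]
      filter_upwards [e] with q hq
      simp [hq]
    rw [lintegral_eq_zero_iff (stronglyMeasurable_kerOp hm hk hg hs).measurable.enorm] at h1
    have h2 := hadd hf hs i ((i.congr e).sub i)
    filter_upwards [h1, h2] with q e1 e2
    have e3 : (fun q => f q + (f' - f) q) = f' := funext fun q => by simp
    rw [e3] at e2
    simp only [Pi.zero_apply, enorm_eq_zero] at e1
    rw [e2, e1, add_zero]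
  have sm : ∀ x : α →₁[ν] ℂ, StronglyMeasurable x := fun x => Lp.stronglyMeasurable x
  have it : ∀ x : α →₁[ν] ℂ, Integrable x ν := L1.integrable_coeFn
  let L0 : (α →₁[ν] ℂ) →ₗ[ℝ] (α →₁[ν] ℂ) :=
    { toFun := fun x => (hi (sm x) (it x)).toL1 _
      map_add' := fun x y => by
        rw [← Integrable.toL1_add, Integrable.toL1_eq_toL1_iff]
        refine (hcongr (sm _) ((sm x).add (sm y)) (it _) (Lp.coeFn_add x y)).trans ?_
        exact hadd (sm x) (sm y) (it x) (it y)
      map_smul' := fun c x => by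
        rw [RingHom.id_apply, ← Integrable.toL1_smul, Integrable.toL1_eq_toL1_iff]
        refine (hcongr (sm _) ((sm x).const_smul c) (it _) (Lp.coeFn_smul c x)).trans ?_
        refine Eventually.of_forall fun q => ?_
        simp only [kerOp, Pi.smul_apply, Complex.real_smul, mul_left_comm _ (c : ℂ)]
        rw [integral_const_mul]
        ring }
  have hL0 : ∀ x, ‖L0 x‖ ≤ C * ‖x‖ := fun x => by
    have h1 : ‖L0 x‖ₑ ≤ C * ‖x‖ₑ := by
      have h2 : ‖x‖ₑ = ∫⁻ q, ‖x q‖ₑ ∂ν := by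
        conv_lhs => rw [← Integrable.toL1_coeFn x (it x), Integrable.enorm_toL1]
      rw [h2]
      exact (Integrable.enorm_toL1 (hi (sm x) (it x))).le.trans (lintegral_kerOp_le hC (sm x))
    rw [← enorm_norm, ← enorm_norm x, enorm_eq_nnnorm, enorm_eq_nnnorm] at h1
    have h3 : ‖‖L0 x‖‖₊ ≤ C * ‖‖x‖‖₊ := by exact_mod_cast h1
    simpa using (show ((‖‖L0 x‖‖₊ : ℝ≥0) : ℝ) ≤ _ from NNReal.coe_le_coe.2 h3)
  refine ⟨L0.mkContinuous C hL0, fun x f hf hx => ?_⟩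
  exact (Integrable.coeFn_toL1 (hi (sm x) (it x))).trans (hcongr (sm x) hf (it x) hx)

end Kernel

/-! ### The operators of the fixed point equation on `L¹` -/

/-- The weight `1 + |ξ|`. -/
def wt (ξ : E) : ℝ≥0∞ := ENNReal.ofReal (1 + ‖ξ‖)

@[fun_prop]
lemma measurable_wt : Measurable wt := by
  unfold wt
  fun_prop

lemma wt_le_mul (ξ η : E) : wt ξ ≤ wt η * wt (ξ - η) := by
  rw [wt, wt, wt, ← ENNReal.ofReal_mul (weight_pos η).le]
  exact ENNReal.ofReal_le_ofReal (weight_mul ξ η)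

/-- The measure on the strip that also sees the slice at height `z`. -/
def nu (z : ℝ) : Measure (ℝ × E) :=
  (volume.restrict (Icc (-1 : ℝ) 0)).prod (volume.withDensity wt) + (Measure.dirac z).prod volume

variable {z : ℝ}

lemma lintegral_nu {f : ℝ × E → ℝ≥0∞} (hf : Measurable f) : ∫⁻ q, f q ∂nu z =
    (∫⁻ s in Icc (-1 : ℝ) 0, ∫⁻ ξ, wt ξ * f (s, ξ)) + ∫⁻ ξ, f (z, ξ) := by
  have : SFinite (volume.withDensity wt) := inferInstance
  rw [nu, lintegral_add_measure, lintegral_prod _ hf.aemeasurable, Measure.dirac_prod,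
    lintegral_map hf measurable_prodMk_left]
  congr 1
  refine lintegral_congr fun s => ?_
  exact lintegral_withDensity_eq_lintegral_mul _ measurable_wt (hf.comp measurable_prodMk_left)

lemma ae_nu (hz : z ∈ Icc (-1 : ℝ) 0) {A B : ℝ × E → ℂ} (hA : StronglyMeasurable A)
    (hB : StronglyMeasurable B) (h : ∀ s ∈ Icc (-1 : ℝ) 0, ∀ᵐ ξ, A (s, ξ) = B (s, ξ)) :
    A =ᵐ[nu z] B := by
  have hS : MeasurableSet {q | A q = B q}ᶜ :=
    (measurableSet_eq_fun hA.measurable hB.measurable).compl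
  have hs : ∀ s ∈ Icc (-1 : ℝ) 0, ∀ᵐ ξ, {q | A q = B q}ᶜ.indicator (1 : ℝ × E → ℝ≥0∞) (s, ξ) = 0 :=
    fun s hs => by
    filter_upwards [h s hs] with ξ hξ
    simp [hξ]
  change nu z {q | A q = B q}ᶜ = 0
  rw [← lintegral_indicator_one hS, lintegral_nu (measurable_one.indicator hS),
    lintegral_congr_ae (hs z hz), lintegral_zero, add_zero]
  refine (setLIntegral_congr_fun measurableSet_Icc fun s h' => ?_).trans lintegral_zero
  refine (lintegral_congr_ae ?_).trans lintegral_zero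
  filter_upwards [hs s h'] with ξ hξ
  rw [hξ, mul_zero]

lemma Fam.integrable_nu {v X : ℝ → E → ℂ} (h : Fam 1 v X) (hz : z ∈ Icc (-1 : ℝ) 0) :
    Integrable (fun q : ℝ × E => X q.1 q.2) (nu z) := by
  obtain ⟨M, hM⟩ := h.bd
  refine ⟨h.sm.aestronglyMeasurable, ?_⟩
  rw [HasFiniteIntegral, lintegral_nu h.sm.measurable.enorm]
  refine ENNReal.add_lt_top.2 ⟨?_, (h.ftw z hz).hasFT.1.2⟩
  refine (setLIntegral_mono' (g := fun _ => ENNReal.ofReal M) measurableSet_Icc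
    fun s hs => ?_).trans_lt ?_
  · refine le_trans (le_of_eq ?_) (ENNReal.ofReal_le_ofReal (hM s hs))
    rw [wn, ofReal_integral_eq_lintegral_ofReal (h.ftw s hs).wi
      (Eventually.of_forall fun ξ => by positivity)]
    refine lintegral_congr fun ξ => ?_
    rw [pow_one, ENNReal.ofReal_mul (weight_pos ξ).le, ofReal_norm, wt]
  · rw [setLIntegral_const]
    exact ENNReal.mul_lt_top ENNReal.ofReal_lt_top (by simp)

lemma lintegral_conv_le {W G F : E → ℝ≥0∞} (hW : Measurable W) (hG : Measurable G)
    (hF : Measurable F) (hWm : ∀ ξ η, W ξ ≤ W η * W (ξ - η)) :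
    ∫⁻ ξ, W ξ * ∫⁻ η, G η * F (ξ - η) ≤ (∫⁻ η, W η * G η) * ∫⁻ ξ, W ξ * F ξ := by
  calc ∫⁻ ξ, W ξ * ∫⁻ η, G η * F (ξ - η)
      ≤ ∫⁻ ξ, ∫⁻ η, (W η * G η) * (W (ξ - η) * F (ξ - η)) := by
        refine lintegral_mono fun ξ => ?_
        rw [← lintegral_const_mul _ (by fun_prop)]
        refine lintegral_mono fun η => ?_
        calc W ξ * (G η * F (ξ - η)) ≤ W η * W (ξ - η) * (G η * F (ξ - η)) := by
              gcongr
              exact hWm ξ η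
          _ = _ := by ring
    _ = ∫⁻ η, ∫⁻ ξ, (W η * G η) * (W (ξ - η) * F (ξ - η)) :=
        lintegral_lintegral_swap (by fun_prop)
    _ = ∫⁻ η, (W η * G η) * ∫⁻ ξ, W ξ * F ξ := by
        refine lintegral_congr fun η => ?_
        rw [lintegral_const_mul _ (by fun_prop),
          lintegral_sub_right_eq_self (fun ξ => W ξ * F ξ) η]
    _ = _ := lintegral_mul_const _ (by fun_prop)

/-- Multiplication by a function, on the Fourier side. -/
theorem exists_clm_cv {G : E → ℂ} (hG : StronglyMeasurable G) (hw : WI 1 G) :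
    ∃ L : ((ℝ × E) →₁[nu z] ℂ) →L[ℝ] ((ℝ × E) →₁[nu z] ℂ),
      ∀ (x : (ℝ × E) →₁[nu z] ℂ) (X : ℝ → E → ℂ),
      StronglyMeasurable (fun q : ℝ × E => X q.1 q.2) → x =ᵐ[nu z] (fun q => X q.1 q.2) →
      L x =ᵐ[nu z] fun q => cv G (X q.1) q.2 := by
  have hfin : ∫⁻ η, wt η * ‖G η‖ₑ < ⊤ := by
    have h1 := hw.2
    refine lt_of_eq_of_lt (lintegral_congr fun ξ => ?_) h1
    dsimp only
    rw [pow_one, enorm_mul, enorm_norm, wt, Real.enorm_eq_ofReal (weight_pos ξ).le]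
  refine (exists_clm_kerOp (ν := nu z) (μ := (volume : Measure E)) (m := fun _ => 0)
    (k := fun p : (ℝ × E) × E => c0 * G p.2) (g := fun p => (p.1.1, p.1.2 - p.2))
    (C := (∫⁻ η, wt η * ‖G η‖ₑ).toNNReal) measurable_const
    (hG.measurable.comp measurable_snd |>.const_mul c0) (by fun_prop) fun f hf => ?_).imp fun L hL => ?_
  rotate_left
  · refine fun x X hX hx => (hL x _ hX hx).trans (Eventually.of_forall fun q => ?_)
    simp only [kerOp, zero_mul, zero_add, cv, mul_assoc]
    rw [integral_const_mul]
  · have hGm := hG.measurable.enorm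
    rw [ENNReal.coe_toNNReal hfin.ne]
    have h1 : ∫⁻ η, (1 : ℝ≥0∞) * ‖G η‖ₑ ≤ ∫⁻ η, wt η * ‖G η‖ₑ := lintegral_mono fun η => by
      gcongr
      rw [wt, ← ENNReal.ofReal_one]
      exact ENNReal.ofReal_le_ofReal (by linarith [norm_nonneg η])
    calc _ ≤ ∫⁻ q, (∫⁻ η, ‖G η‖ₑ * f (q.1, q.2 - η)) ∂nu z := by
          refine lintegral_mono fun q => ?_
          simp only [enorm_zero, zero_mul, zero_add, enorm_mul]
          refine lintegral_mono fun η => ?_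
          gcongr
          refine mul_le_of_le_one_left zero_le ?_
          rw [← ofReal_norm, ← ENNReal.ofReal_one]
          exact ENNReal.ofReal_le_ofReal norm_c0_le
      _ ≤ _ := by
          rw [lintegral_nu (Measurable.lintegral_prod_right'
            (f := fun p : (ℝ × E) × E => ‖G p.2‖ₑ * f (p.1.1, p.1.2 - p.2)) (by fun_prop)),
            lintegral_nu hf, mul_add]
          refine add_le_add ?_ ?_
          · rw [← lintegral_const_mul _ (Measurable.lintegral_prod_right'
              (f := fun q : ℝ × E => wt q.2 * f q) (by fun_prop))]
            refine lintegral_mono fun s => ?_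
            exact lintegral_conv_le (F := fun ξ => f (s, ξ)) measurable_wt hGm (by fun_prop) wt_le_mul
          · have h2 := lintegral_conv_le (W := fun _ => 1) (F := fun ξ => f (z, ξ)) measurable_const
              hGm (by fun_prop) (by simp)
            simp only [one_mul] at h2 h1
            exact h2.trans (by gcongr)

lemma lintegral_tsym_le (a : Fin 3) (j : Fin 4) (b : Fin 3) {s' : ℝ} (hs : s' ∈ Icc (-1 : ℝ) 0)
    (ξ : E) : ∫⁻ s in Icc (-1 : ℝ) 0, ‖tsym s a j b s' ξ‖ₑ ≤ 3 := by
  obtain ⟨hi, h1⟩ := integral_kD ‖ξ‖ hs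
  have hc : IntegrableOn (fun _ : ℝ => (1 : ℝ)) (Icc (-1) 0) := integrableOn_const (by simp)
  calc ∫⁻ s in Icc (-1 : ℝ) 0, ‖tsym s a j b s' ξ‖ₑ
      ≤ ∫⁻ s in Icc (-1 : ℝ) 0, ENNReal.ofReal (1 + 2 * (‖ξ‖ * kD s s' ‖ξ‖)) := by
        refine setLIntegral_mono_ae' measurableSet_Icc (Eventually.of_forall fun s h => ?_)
        rw [← ofReal_norm]
        refine ENNReal.ofReal_le_ofReal ((norm_tsym_le a j b hs ξ).trans ?_)
        linarith [kD_le_one h hs (norm_nonneg ξ)]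
    _ = ENNReal.ofReal (∫ s in Icc (-1 : ℝ) 0, (1 + 2 * (‖ξ‖ * kD s s' ‖ξ‖))) := by
        refine (ofReal_integral_eq_lintegral_ofReal (hc.add (hi.const_mul 2))
          (Eventually.of_forall fun s => ?_)).symm
        have h2 := mul_nonneg (norm_nonneg ξ) (kD_nonneg s s' ‖ξ‖)
        show (0 : ℝ) ≤ 1 + 2 * (‖ξ‖ * kD s s' ‖ξ‖)
        linarith
    _ ≤ ENNReal.ofReal 3 := by
        refine ENNReal.ofReal_le_ofReal ?_
        rw [integral_add hc (hi.const_mul 2), integral_const_mul]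
        simp
        linarith
    _ = 3 := by norm_num

lemma enorm_tsym0_le (a : Fin 3) (j : Fin 4) (b : Fin 3) (hz : z ∈ Icc (-1 : ℝ) 0) :
    ‖tsym0 z a j b‖ₑ ≤ 1 := by
  have h1 : ‖(alp j b z : ℂ)‖ₑ ≤ 1 := by
    rw [enorm_eq_nnnorm]
    exact_mod_cast nnnorm_alp hz
  fin_cases a
  · simp [tsym0]
  · simp [tsym0]
  · exact h1

lemma measurable_tsym0 (a : Fin 3) (j : Fin 4) (b : Fin 3) :
    Measurable fun q : ℝ × E => tsym0 q.1 a j b := by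
  fin_cases a
  · exact measurable_const
  · exact measurable_const
  · fin_cases j <;> fin_cases b <;> simp [tsym0, alp] <;> fun_prop

/-- The operators `T^j` on the Fourier side. -/
theorem exists_clm_tsym (hz : z ∈ Icc (-1 : ℝ) 0) (a : Fin 3) (j : Fin 4) (b : Fin 3) :
    ∃ L : ((ℝ × E) →₁[nu z] ℂ) →L[ℝ] ((ℝ × E) →₁[nu z] ℂ),
      ∀ (x : (ℝ × E) →₁[nu z] ℂ) (X : ℝ → E → ℂ),
      StronglyMeasurable (fun q : ℝ × E => X q.1 q.2) → x =ᵐ[nu z] (fun q => X q.1 q.2) →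
      L x =ᵐ[nu z] fun q => tsym0 q.1 a j b * X q.1 q.2 +
        ∫ s in Icc (-1 : ℝ) 0, tsym q.1 a j b s q.2 * X s q.2 := by
  have hk : Measurable fun p : (ℝ × E) × ℝ => tsym p.1.1 a j b p.2 p.1.2 :=
    Measurable.comp (g := fun q : ℝ × ℝ × E => tsym q.1 a j b q.2.1 q.2.2)
      (f := fun p : (ℝ × E) × ℝ => (p.1.1, p.2, p.1.2)) (measurable_tsym_prod a j b) (by fun_prop)
  refine (exists_clm_kerOp (ν := nu z) (μ := volume.restrict (Icc (-1 : ℝ) 0))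
    (m := fun q => tsym0 q.1 a j b) (k := fun p : (ℝ × E) × ℝ => tsym p.1.1 a j b p.2 p.1.2)
    (g := fun p => (p.2, p.1.2)) (C := 6) (measurable_tsym0 a j b) hk (by fun_prop) fun f hf => ?_).imp fun L hL => ?_
  rotate_left
  · exact fun x X hX hx => hL x _ hX hx
  set B := ∫⁻ s in Icc (-1 : ℝ) 0, ∫⁻ ξ, wt ξ * f (s, ξ) with hB
  have hm0 := (measurable_tsym0 a j b).enorm
  have hk' := hk.enorm
  have hI : Measurable fun q : ℝ × E =>
      ∫⁻ s in Icc (-1 : ℝ) 0, ‖tsym q.1 a j b s q.2‖ₑ * f (s, q.2) :=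
    Measurable.lintegral_prod_right'
      (f := fun p : (ℝ × E) × ℝ => ‖tsym p.1.1 a j b p.2 p.1.2‖ₑ * f (p.2, p.1.2)) (by fun_prop)
  have hBs : B = ∫⁻ ξ, wt ξ * ∫⁻ s in Icc (-1 : ℝ) 0, f (s, ξ) := by
    rw [hB, lintegral_lintegral_swap (by fun_prop)]
    exact lintegral_congr fun ξ => lintegral_const_mul _ (by fun_prop)
  have h1 : ∫⁻ s in Icc (-1 : ℝ) 0, ∫⁻ ξ, wt ξ * (‖tsym0 s a j b‖ₑ * f (s, ξ)) ≤ B := by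
    refine setLIntegral_mono_ae' measurableSet_Icc (Eventually.of_forall fun s hs => ?_)
    refine lintegral_mono fun ξ => ?_
    gcongr
    exact mul_le_of_le_one_left zero_le (enorm_tsym0_le a j b hs)
  have h2 : ∫⁻ s in Icc (-1 : ℝ) 0, ∫⁻ ξ,
      wt ξ * ∫⁻ s' in Icc (-1 : ℝ) 0, ‖tsym s a j b s' ξ‖ₑ * f (s', ξ) ≤ 3 * B := by
    have hI2 : Measurable fun q : ℝ × E =>
        wt q.2 * ∫⁻ s in Icc (-1 : ℝ) 0, ‖tsym q.1 a j b s q.2‖ₑ * f (s, q.2) :=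
      (measurable_wt.comp measurable_snd).mul hI
    rw [lintegral_lintegral_swap (f := fun s ξ => wt ξ * ∫⁻ s' in Icc (-1 : ℝ) 0,
      ‖tsym s a j b s' ξ‖ₑ * f (s', ξ)) hI2.aemeasurable, hBs, ← lintegral_const_mul' _ _ (by simp)]
    refine lintegral_mono fun ξ => ?_
    have hk2 : Measurable fun p : ℝ × ℝ => ‖tsym p.1 a j b p.2 ξ‖ₑ * f (p.2, ξ) :=
      Measurable.mul (Measurable.comp (g := fun p : (ℝ × E) × ℝ => ‖tsym p.1.1 a j b p.2 p.1.2‖ₑ)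
        (f := fun p : ℝ × ℝ => ((p.1, ξ), p.2)) hk' (by fun_prop)) (by fun_prop)
    rw [lintegral_const_mul _ (Measurable.lintegral_prod_right' (f := fun p : ℝ × ℝ =>
      ‖tsym p.1 a j b p.2 ξ‖ₑ * f (p.2, ξ)) hk2), mul_left_comm]
    gcongr 1
    rw [lintegral_lintegral_swap hk2.aemeasurable, ← lintegral_const_mul' _ _ (by simp)]
    refine setLIntegral_mono_ae' measurableSet_Icc (Eventually.of_forall fun s' hs => ?_)
    have hk3 : Measurable fun s : ℝ => ‖tsym s a j b s' ξ‖ₑ := Measurable.comp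
      (f := fun s : ℝ => ((s, ξ), s')) (g := fun p : (ℝ × E) × ℝ => ‖tsym p.1.1 a j b p.2 p.1.2‖ₑ)
      hk' (by fun_prop)
    dsimp only
    rw [lintegral_mul_const _ hk3]
    gcongr
    exact lintegral_tsym_le a j b hs ξ
  have h3 : ∫⁻ ξ, ‖tsym0 z a j b‖ₑ * f (z, ξ) ≤ ∫⁻ ξ, f (z, ξ) :=
    lintegral_mono fun ξ => mul_le_of_le_one_left zero_le (enorm_tsym0_le a j b hz)
  have h4 : ∫⁻ ξ, ∫⁻ s' in Icc (-1 : ℝ) 0, ‖tsym z a j b s' ξ‖ₑ * f (s', ξ) ≤ 2 * B := by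
    rw [hBs, ← lintegral_const_mul' _ _ (by simp)]
    refine lintegral_mono fun ξ => ?_
    dsimp only
    rw [← mul_assoc, ← lintegral_const_mul _ (by fun_prop)]
    refine setLIntegral_mono_ae' measurableSet_Icc (Eventually.of_forall fun s hs => ?_)
    gcongr
    have h5 := mul_le_of_le_one_right (by positivity : 0 ≤ 1 + 2 * ‖ξ‖)
      (kD_le_one hz hs (norm_nonneg ξ))
    calc ‖tsym z a j b s ξ‖ₑ ≤ ENNReal.ofReal (2 * (1 + ‖ξ‖)) := by
          rw [← ofReal_norm]
          exact ENNReal.ofReal_le_ofReal (((norm_tsym_le a j b hs ξ).trans h5).trans (by linarith))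
      _ = 2 * wt ξ := by rw [ENNReal.ofReal_mul (by norm_num), ENNReal.ofReal_ofNat, wt]
  refine (lintegral_nu (f := fun q => ‖tsym0 q.1 a j b‖ₑ * f q + ∫⁻ s in Icc (-1 : ℝ) 0,
    ‖tsym q.1 a j b s q.2‖ₑ * f (s, q.2)) ((hm0.mul hf).add hI)).le.trans ?_
  rw [lintegral_nu hf]
  simp only [mul_add]
  have e0 : ∫⁻ ξ, (‖tsym0 z a j b‖ₑ * f (z, ξ) +
      ∫⁻ s' in Icc (-1 : ℝ) 0, ‖tsym z a j b s' ξ‖ₑ * f (s', ξ)) =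
      (∫⁻ ξ, ‖tsym0 z a j b‖ₑ * f (z, ξ)) +
      ∫⁻ ξ, ∫⁻ s' in Icc (-1 : ℝ) 0, ‖tsym z a j b s' ξ‖ₑ * f (s', ξ) :=
    lintegral_add_left (by fun_prop : Measurable fun ξ => ‖tsym0 z a j b‖ₑ * f (z, ξ)) _
  have e1 : ∀ s, ∫⁻ ξ, (wt ξ * (‖tsym0 s a j b‖ₑ * f (s, ξ)) +
      wt ξ * ∫⁻ s' in Icc (-1 : ℝ) 0, ‖tsym s a j b s' ξ‖ₑ * f (s', ξ)) =
      (∫⁻ ξ, wt ξ * (‖tsym0 s a j b‖ₑ * f (s, ξ))) + ∫⁻ ξ,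
        wt ξ * ∫⁻ s' in Icc (-1 : ℝ) 0, ‖tsym s a j b s' ξ‖ₑ * f (s', ξ) := fun s => by
    have hm : Measurable fun ξ => wt ξ * (‖tsym0 s a j b‖ₑ * f (s, ξ)) := by fun_prop
    exact lintegral_add_left hm _
  simp only [e0, e1]
  rw [lintegral_add_left (Measurable.lintegral_prod_right'
    (f := fun q : ℝ × E => wt q.2 * (‖tsym0 q.1 a j b‖ₑ * f q)) (by fun_prop))]
  calc _ ≤ B + 3 * B + ((∫⁻ ξ, f (z, ξ)) + 2 * B) := by gcongr
    _ = 6 * B + 1 * ∫⁻ ξ, f (z, ξ) := by ring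
    _ ≤ 6 * B + 6 * ∫⁻ ξ, f (z, ξ) := by
      gcongr
      norm_num
    _ = _ := by rw [hB]; norm_num

end
end WaterWaves

namespace WaterWaves
open Filter Topology FourierTransform
open scoped NNReal
noncomputable section

/-! ### Families given by their Fourier transforms -/

/-- The inverse Fourier transform of a family. -/
def inv (X : ℝ → E → ℂ) (s : ℝ) (x : E) : ℂ := c0 * ∫ ξ, chr x ξ * X s ξ

lemma fam_of_le {k : ℕ} {X : ℝ → E → ℂ} (hX : StronglyMeasurable fun q : ℝ × E => X q.1 q.2)
    {N : E → ℝ} (hN : Integrable fun ξ => (1 + ‖ξ‖) ^ k * N ξ)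
    (h : ∀ s ∈ Icc (-1 : ℝ) 0, ∀ᵐ ξ, ‖X s ξ‖ ≤ N ξ) : Fam k (inv X) X := by
  have hm : ∀ s, AEStronglyMeasurable (X s) := fun s =>
    (hX.comp_measurable measurable_prodMk_left).aestronglyMeasurable
  have hle : ∀ s ∈ Icc (-1 : ℝ) 0, ∀ᵐ ξ, (1 + ‖ξ‖) ^ k * ‖X s ξ‖ ≤ (1 + ‖ξ‖) ^ k * N ξ :=
    fun s hs => by
    filter_upwards [h s hs] with ξ hξ
    gcongr
  have hw : ∀ s ∈ Icc (-1 : ℝ) 0, WI k (X s) := fun s hs => by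
    refine Integrable.mono' hN ((by fun_prop : AEStronglyMeasurable fun ξ : E =>
      (1 + ‖ξ‖) ^ k).mul (hm s).norm) ?_
    filter_upwards [hle s hs] with ξ hξ
    rwa [Real.norm_of_nonneg (by positivity)]
  exact ⟨hX, fun s hs => ⟨HasFT.mk' ((hw s hs).integrable (hm s)) fun x => rfl, hw s hs⟩,
    ⟨_, fun s hs => integral_mono_ae (hw s hs) hN (hle s hs)⟩⟩

lemma abs_mA_le {s r : ℝ} (hs : s ∈ Icc (-1 : ℝ) 0) (hr : 0 ≤ r) : |mA s r| ≤ 1 := by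
  rw [mA, abs_div, abs_of_pos (Real.cosh_pos _), abs_of_pos (Real.cosh_pos _),
    div_le_one (Real.cosh_pos _), Real.cosh_le_cosh, abs_of_nonneg hr,
    abs_of_nonneg (mul_nonneg (by linarith [hs.1]) hr)]
  nlinarith [hs.2]

lemma abs_mB_le {s r : ℝ} (hs : s ∈ Icc (-1 : ℝ) 0) (hr : 0 ≤ r) : |mB s r| ≤ r := by
  have h1 := abs_mA_le hs hr
  rw [mA, abs_div, abs_of_pos (Real.cosh_pos _)] at h1
  rw [mB, mul_div_assoc, abs_mul, abs_of_nonneg hr, abs_div]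
  refine mul_le_of_le_one_right hr (le_trans ?_ h1)
  rw [abs_of_pos (Real.cosh_pos r)]
  gcongr
  exact abs_sinh_le_cosh _

lemma norm_symA_le (b : Fin 3) {s : ℝ} (hs : s ∈ Icc (-1 : ℝ) 0) (ξ : E) : ‖symA b s ξ‖ ≤ ‖ξ‖ := by
  have hx : ∀ i : Fin 2, ‖Complex.I * ξ i * mA s ‖ξ‖‖ ≤ ‖ξ‖ := fun i => by
    rw [norm_mul, norm_mul, Complex.norm_I, one_mul, Complex.norm_real, Complex.norm_real]
    have := mul_le_mul (norm_coord_le ξ i) (abs_mA_le hs (norm_nonneg ξ)) (abs_nonneg _)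
      (norm_nonneg ξ)
    rwa [mul_one] at this
  fin_cases b
  · exact hx 0
  · exact hx 1
  · refine le_trans (le_of_eq ?_) (abs_mB_le hs (norm_nonneg ξ))
    exact Complex.norm_real _

lemma fam_symA {Ψ : E → ℂ} (hΨ : StronglyMeasurable Ψ) (hw : WI 4 Ψ) (b : Fin 3) :
    Fam 3 (inv fun s ξ => symA b s ξ * Ψ ξ) fun s ξ => symA b s ξ * Ψ ξ := by
  refine fam_of_le (N := fun ξ => (1 + ‖ξ‖) * ‖Ψ ξ‖) ((continuous_symA b).stronglyMeasurable.mul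
    (hΨ.comp_measurable measurable_snd)) (hw.congr (Eventually.of_forall fun ξ => ?_))
    fun s hs => Eventually.of_forall fun ξ => ?_
  · simp only []
    ring
  · rw [norm_mul]
    gcongr
    exact (norm_symA_le b hs ξ).trans (by linarith)

/-! ### Expansions in a real parameter -/

lemma hasDerivAt_of_ofReal {u : ℝ → ℝ} {v' : ℂ} {τ : ℝ}
    (h : HasDerivAt (fun t => (u t : ℂ)) v' τ) : HasDerivAt u v'.re τ ∧ ((v'.re : ℝ) : ℂ) = v' := by
  have h1 : HasDerivAt u v'.re τ := by
    have := (Complex.reCLM.hasFDerivAt (x := (u τ : ℂ))).comp_hasDerivAt τ h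
    exact this
  exact ⟨h1, h1.ofReal_comp.unique h⟩

lemma taylor_of_mul {u : ℝ → ℝ} {g : ℝ → ℂ} (hg : ContDiffAt ℝ 2 g 0)
    (h : ∀ᶠ τ in 𝓝 (0 : ℝ), (u τ : ℂ) = τ * g τ) : ContDiffAt ℝ 2 u 0 ∧ u 0 = 0 ∧
      ((iteratedDeriv 1 u 0 : ℝ) : ℂ) = g 0 ∧ ((iteratedDeriv 2 u 0 : ℝ) : ℂ) = 2 * deriv g 0 := by
  have hd1 : ContDiffAt ℝ 1 (deriv g) 0 := by
    have h1 : ContDiffAt ℝ 1 (fun τ => fderiv ℝ g τ 1) 0 :=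
      (hg.fderiv_right (m := 1) (by norm_num)).clm_apply contDiffAt_const
    exact h1
  have hv : ContDiffAt ℝ 2 (fun τ : ℝ => (τ : ℂ) * g τ) 0 :=
    (Complex.ofRealCLM.contDiff.contDiffAt).mul hg
  have hu : ContDiffAt ℝ 2 u 0 := by
    refine ((Complex.reCLM.contDiff.contDiffAt).comp (0 : ℝ) hv).congr_of_eventuallyEq ?_
    filter_upwards [h] with τ hτ
    simp [← hτ]
  have e1 : ∀ᶠ τ in 𝓝 (0 : ℝ), HasDerivAt u (g τ + τ * deriv g τ).re τ ∧
      (((g τ + τ * deriv g τ).re : ℝ) : ℂ) = g τ + τ * deriv g τ := by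
    filter_upwards [h.eventually_nhds, hg.eventually (by simp)] with τ h1 h2
    refine hasDerivAt_of_ofReal ?_
    have h3 := ((Complex.ofRealCLM.hasDerivAt (x := τ)).mul
      (h2.differentiableAt (by norm_num)).hasDerivAt)
    refine (h3.congr_of_eventuallyEq h1).congr_deriv ?_
    simp
  have e2 : ∀ᶠ τ in 𝓝 (0 : ℝ), ((deriv u τ : ℝ) : ℂ) = g τ + τ * deriv g τ := by
    filter_upwards [e1] with τ hτ
    rw [hτ.1.deriv, hτ.2]
  have e3 : HasDerivAt (fun τ => ((deriv u τ : ℝ) : ℂ)) (2 * deriv g 0) 0 := by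
    have h3 := (hg.differentiableAt (by norm_num)).hasDerivAt.add
      ((Complex.ofRealCLM.hasDerivAt (x := (0 : ℝ))).mul
      (hd1.differentiableAt (by norm_num)).hasDerivAt)
    refine (h3.congr_of_eventuallyEq e2).congr_deriv ?_
    simp
    ring
  refine ⟨hu, ?_, ?_, ?_⟩
  · have := h.self_of_nhds
    simpa using this
  · rw [iteratedDeriv_one]
    simpa using e2.self_of_nhds
  · obtain ⟨h4, h5⟩ := hasDerivAt_of_ofReal e3
    rw [iteratedDeriv_succ, iteratedDeriv_one, h4.deriv, h5]

/-- The expansion of `B(τ) A(τ)⁻¹ ℓ`, when `A(0) = B(0) = 1`. -/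
lemma expansion_ringInverse {X : Type*} [NormedAddCommGroup X] [NormedSpace ℝ X] [CompleteSpace X]
    {A B : ℝ → X →L[ℝ] X} {A' B' : X →L[ℝ] X} (hA : ContDiff ℝ 2 A) (hB : ContDiff ℝ 2 B)
    (hA0 : A 0 = 1) (hB0 : B 0 = 1) (hA' : HasDerivAt A A' 0) (hB' : HasDerivAt B B' 0)
    (Λ : X →L[ℝ] ℂ) (ℓ : X) :
    ContDiffAt ℝ 2 (fun τ => Λ (B τ (Ring.inverse (A τ) ℓ))) 0 ∧
      Λ (B 0 (Ring.inverse (A 0) ℓ)) = Λ ℓ ∧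
      deriv (fun τ => Λ (B τ (Ring.inverse (A τ) ℓ))) 0 = Λ (B' ℓ - A' ℓ) := by
  have hi : ContDiffAt ℝ 2 (fun τ => Ring.inverse (A τ)) 0 := by
    have h1 := contDiffAt_ringInverse (n := 2) ℝ (1 : (X →L[ℝ] X)ˣ)
    rw [Units.val_one, ← hA0] at h1
    exact h1.comp (0 : ℝ) hA.contDiffAt
  have hid : HasDerivAt (fun τ => Ring.inverse (A τ)) (-A') 0 := by
    have h1 := hasFDerivAt_ringInverse (𝕜 := ℝ) (1 : (X →L[ℝ] X)ˣ)
    rw [Units.val_one, ← hA0] at h1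
    refine (h1.comp_hasDerivAt 0 hA').congr_deriv ?_
    simp
  refine ⟨Λ.contDiff.contDiffAt.comp (0 : ℝ) (hB.contDiffAt.clm_apply
    (hi.clm_apply contDiffAt_const)), ?_, ?_⟩
  · simp [hA0, hB0]
  · have h1 := hid.clm_apply (hasDerivAt_const 0 ℓ)
    have h2 := Λ.hasFDerivAt.comp_hasDerivAt 0 (hB'.clm_apply h1)
    refine (HasDerivAt.deriv h2).trans ?_
    simp [hA0, hB0, sub_eq_add_neg]

/-! ### Elements of `L¹` that represent families -/

/-- The Banach space in which the fixed point equation is solved. -/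
abbrev XL (z : ℝ) := Fin 3 → ((ℝ × E) →₁[nu z] ℂ)

/-- `x` is given by the functions `Y`. -/
def Rep (z : ℝ) (x : XL z) (Y : Fin 3 → ℝ → E → ℂ) : Prop :=
  ∀ b, StronglyMeasurable (fun q : ℝ × E => Y b q.1 q.2) ∧ x b =ᵐ[nu z] fun q => Y b q.1 q.2

variable {z : ℝ} {x y : XL z} {Y Y' : Fin 3 → ℝ → E → ℂ}

lemma Rep.add (hx : Rep z x Y) (hy : Rep z y Y') :
    Rep z (x + y) fun b s ξ => Y b s ξ + Y' b s ξ := fun b => by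
  refine ⟨(hx b).1.add (hy b).1, (Lp.coeFn_add (x b) (y b)).trans ?_⟩
  filter_upwards [(hx b).2, (hy b).2] with q h1 h2
  simp [h1, h2]

lemma Rep.smul (hx : Rep z x Y) (c : ℝ) : Rep z (c • x) fun b s ξ => (c : ℂ) * Y b s ξ := fun b => by
  refine ⟨(hx b).1.const_mul _, (Lp.coeFn_smul c (x b)).trans ?_⟩
  filter_upwards [(hx b).2] with q h1
  simp [h1]

lemma Rep.eq (hz : z ∈ Icc (-1 : ℝ) 0) (hx : Rep z x Y) (hy : Rep z y Y')
    (h : ∀ b, ∀ s ∈ Icc (-1 : ℝ) 0, ∀ᵐ ξ, Y b s ξ = Y' b s ξ) : x = y := by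
  funext b
  exact Lp.ext ((hx b).2.trans ((ae_nu hz (hx b).1 (hy b).1 (h b)).trans (hy b).2.symm))

lemma exists_rep (hz : z ∈ Icc (-1 : ℝ) 0) {v : Fin 3 → ℝ → E → ℂ} (h : ∀ b, Fam 1 (v b) (Y b)) :
    ∃ x : XL z, Rep z x Y :=
  ⟨fun b => ((h b).integrable_nu hz).toL1 _, fun b => ⟨(h b).sm, Integrable.coeFn_toL1 _⟩⟩

/-- The value at a point of the slice at height `z`. -/
lemma exists_eval (z : ℝ) (a : Fin 3) (p : E) : ∃ Λ : XL z →L[ℝ] ℂ, ∀ x Y, Rep z x Y →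
    Λ x = inv (Y a) z p := by
  have hle : (Measure.dirac z).prod (volume : Measure E) ≤ nu z := Measure.le_add_left le_rfl
  have hi : ∀ f : (ℝ × E) →₁[nu z] ℂ,
      Integrable (fun q => chr p q.2 * f q) ((Measure.dirac z).prod volume) := fun f =>
    ((L1.integrable_coeFn f).mono_measure hle).bdd_mul (c := 1)
      ((chr_continuous p).comp continuous_snd).aestronglyMeasurable
      (Eventually.of_forall fun q => (norm_chr p q.2).le)
  let L0 : ((ℝ × E) →₁[nu z] ℂ) →ₗ[ℝ] ℂ :=
    { toFun := fun f => ∫ q, chr p q.2 * f q ∂((Measure.dirac z).prod volume)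
      map_add' := fun f g => by
        rw [← integral_add (hi f) (hi g)]
        refine integral_congr_ae ?_
        filter_upwards [ae_mono hle (Lp.coeFn_add f g)] with q hq
        rw [hq, Pi.add_apply, mul_add]
      map_smul' := fun c f => by
        rw [RingHom.id_apply, ← integral_smul]
        refine integral_congr_ae ?_
        filter_upwards [ae_mono hle (Lp.coeFn_smul c f)] with q hq
        rw [hq, Pi.smul_apply, mul_smul_comm] }
  have hL0 : ∀ f, ‖L0 f‖ ≤ 1 * ‖f‖ := fun f => by
    rw [one_mul, L1.norm_eq_integral_norm]
    refine (norm_integral_le_integral_norm _).trans ?_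
    simp only [norm_mul, norm_chr, one_mul]
    exact integral_mono_measure hle (Eventually.of_forall fun q => norm_nonneg _)
      (L1.integrable_coeFn f).norm
  refine ⟨c0 • ((L0.mkContinuous 1 hL0).comp (ContinuousLinearMap.proj a)), fun x Y h => ?_⟩
  have h1 : L0 (x a) = ∫ ξ, chr p ξ * Y a z ξ := by
    have h2 : L0 (x a) = ∫ q, chr p q.2 * Y a q.1 q.2 ∂((Measure.dirac z).prod volume) := by
      refine integral_congr_ae ?_
      filter_upwards [ae_mono hle (h a).2] with q hq
      rw [hq]
    have hsm : StronglyMeasurable fun q : ℝ × E => chr p q.2 * Y a q.1 q.2 :=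
      ((chr_continuous p).comp continuous_snd).stronglyMeasurable.mul (h a).1
    rw [h2, Measure.dirac_prod, integral_map measurable_prodMk_left.aemeasurable
      hsm.aestronglyMeasurable]
  rw [inv, ← h1]
  rfl

lemma exists_mulOp (z : ℝ) {G : E → ℂ} (hG : StronglyMeasurable G) (hw : WI 1 G) :
    ∃ M : XL z →L[ℝ] XL z, ∀ x Y, Rep z x Y → Rep z (M x) fun b s => cv G (Y b s) := by
  obtain ⟨L, hL⟩ := exists_clm_cv (z := z) hG hw
  exact ⟨ContinuousLinearMap.pi fun a => L.comp (ContinuousLinearMap.proj a), fun x Y h b =>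
    ⟨stronglyMeasurable_cv hG (h b).1, hL _ _ (h b).1 (h b).2⟩⟩

lemma stronglyMeasurable_tsym_integral (a : Fin 3) (j : Fin 4) (b : Fin 3) {X : ℝ → E → ℂ}
    (hX : StronglyMeasurable fun q : ℝ × E => X q.1 q.2) :
    StronglyMeasurable fun q : ℝ × E => tsym0 q.1 a j b * X q.1 q.2 +
      ∫ s in Icc (-1 : ℝ) 0, tsym q.1 a j b s q.2 * X s q.2 := by
  refine ((measurable_tsym0 a j b).stronglyMeasurable.mul hX).add ?_
  refine StronglyMeasurable.integral_prod_right'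
    (f := fun p : (ℝ × E) × ℝ => tsym p.1.1 a j b p.2 p.1.2 * X p.2 p.1.2) (StronglyMeasurable.mul ?_
      (hX.comp_measurable (by fun_prop : Measurable fun p : (ℝ × E) × ℝ => (p.2, p.1.2))))
  exact (Measurable.comp (g := fun q : ℝ × ℝ × E => tsym q.1 a j b q.2.1 q.2.2)
    (f := fun p : (ℝ × E) × ℝ => (p.1.1, p.2, p.1.2)) (measurable_tsym_prod a j b)
    (by fun_prop)).stronglyMeasurable

lemma exists_TTOp (hz : z ∈ Icc (-1 : ℝ) 0) (j : Fin 4) :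
    ∃ K : XL z →L[ℝ] XL z, ∀ x Y, Rep z x Y → Rep z (K x) fun a s => TT s a j Y := by
  choose L hL using fun a b => exists_clm_tsym hz a j b
  refine ⟨ContinuousLinearMap.pi fun a => ∑ b, (L a b).comp (ContinuousLinearMap.proj b),
    fun x Y h a => ⟨?_, ?_⟩⟩
  · have h1 := Finset.stronglyMeasurable_fun_sum Finset.univ
      fun b _ => stronglyMeasurable_tsym_integral a j b (h b).1
    exact h1
  · have h1 : ∀ᵐ q ∂nu z, ∀ b, L a b (x b) q = tsym0 q.1 a j b * Y b q.1 q.2 +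
        ∫ s in Icc (-1 : ℝ) 0, tsym q.1 a j b s q.2 * Y b s q.2 :=
      ae_all_iff.2 fun b => hL a b _ _ (h b).1 (h b).2
    have h2 : (ContinuousLinearMap.pi fun a => ∑ b, (L a b).comp (ContinuousLinearMap.proj b) :
        XL z →L[ℝ] XL z) x a = ∑ b, L a b (x b) := by
      simp
    rw [h2, Fin.sum_univ_three]
    filter_upwards [h1, Lp.coeFn_add (L a 0 (x 0) + L a 1 (x 1)) (L a 2 (x 2)),
      Lp.coeFn_add (L a 0 (x 0)) (L a 1 (x 1))] with q e1 e2 e3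
    rw [e2, Pi.add_apply, e3, Pi.add_apply, e1, e1, e1]
    simp only [TT, tv, Fin.sum_univ_three]

end
end WaterWaves

namespace WaterWaves
open Filter Topology FourierTransform
open scoped NNReal
noncomputable section

/-! ### The Taylor expansion of the gradient of the potential -/

lemma eLpNorm_ft_smul_lt_top {f : E → ℝ} (hf : ∃ F, HasFT (toC f) F) (τ : ℝ) {w : E → ℂ}
    (h : eLpNorm (fun ξ => w ξ * ft (toC f) ξ) 2 < ⊤) :
    (∃ F, HasFT (toC fun x => τ * f x) F) ∧
      eLpNorm (fun ξ => w ξ * ft (toC fun x => τ * f x) ξ) 2 < ⊤ := by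
  have h1 : HasFT (toC fun x => τ * f x) fun ξ => (τ : ℂ) * ft (toC f) ξ :=
    ((hasFT_ft hf).smul τ).congr_fun fun x => by simp [toC]
  refine ⟨⟨_, h1⟩, ?_⟩
  have h2 : (fun ξ => w ξ * ft (toC fun x => τ * f x) ξ) =ᵐ[volume]
      (τ : ℂ) • fun ξ => w ξ * ft (toC f) ξ := by
    filter_upwards [h1.ft_ae] with ξ hξ
    rw [hξ, Pi.smul_apply, smul_eq_mul]
    ring
  rw [eLpNorm_congr_ae h2, eLpNorm_const_smul]
  exact ENNReal.mul_lt_top enorm_lt_top h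

lemma MemH.smul {s : ℝ} {f : E → ℝ} (h : MemH s f) (τ : ℝ) : MemH s fun x => τ * f x :=
  eLpNorm_ft_smul_lt_top h.1 τ h.2

lemma LambdaMemH.smul {s : ℝ} {f : E → ℝ} (h : LambdaMemH s f) (τ : ℝ) :
    LambdaMemH s fun x => τ * f x :=
  eLpNorm_ft_smul_lt_top h.1 τ h.2

lemma dx_const_mul {f : E → ℝ} (hf : Differentiable ℝ f) (c : ℝ) (i : Fin 2) (x : E) :
    dx i (fun y => c * f y) x = c * dx i f x := by
  unfold dx
  rw [fderiv_const_mul (hf x)]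
  simp

/-- The Fourier transform of a partial derivative. -/
def dFT (l : Fin 2) (F : E → ℂ) (ξ : E) : ℂ := Complex.I * (ξ l : ℂ) * F ξ

/-- The operators of the fixed point equation: multiplication by `h` and by its derivatives,
and the operators `T^j`. -/
structure StripOps (z : ℝ) (F : E → ℂ) where
  M : XL z →L[ℝ] XL z
  D : Fin 2 → XL z →L[ℝ] XL z
  K : Fin 4 → XL z →L[ℝ] XL z
  hM : ∀ x Y, Rep z x Y → Rep z (M x) fun b s => cv F (Y b s)
  hD : ∀ l x Y, Rep z x Y → Rep z (D l x) fun b s => cv (dFT l F) (Y b s)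
  hK : ∀ j x Y, Rep z x Y → Rep z (K j x) fun a s => TT s a j Y

lemma stronglyMeasurable_dFT {F : E → ℂ} (hF : StronglyMeasurable F) (l : Fin 2) :
    StronglyMeasurable (dFT l F) :=
  (Continuous.stronglyMeasurable (by fun_prop)).mul hF

lemma exists_stripOps {z : ℝ} (hz : z ∈ Icc (-1 : ℝ) 0) {F : E → ℂ} (hF : StronglyMeasurable F)
    {f : E → ℝ} (hw : FTW 4 (toC f) F) : Nonempty (StripOps z F) := by
  obtain ⟨M, hM⟩ := exists_mulOp z hF (hw.mono (by norm_num : 1 ≤ 4)).wi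
  choose D hD using fun l => exists_mulOp z (stronglyMeasurable_dFT hF l)
    ((hw.dx l).mono (by norm_num : 1 ≤ 3)).wi
  choose K hK using fun j => exists_TTOp hz j
  exact ⟨⟨M, D, K, hM, hD, hK⟩⟩

namespace StripOps

variable {z : ℝ} {F : E → ℂ} (O : StripOps z F)

/-- Multiplication by `(1 + τ h)²`. -/
def B (τ : ℝ) : XL z →L[ℝ] XL z := 1 + (2 * τ) • O.M + τ ^ 2 • (O.M * O.M)

/-- The operator of the fixed point equation for `∇φ / (1 + τ h)²`. -/
def A (τ : ℝ) : XL z →L[ℝ] XL z :=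
  O.B τ - (O.K 0 * ((2 * τ) • O.M + τ ^ 2 • (O.M * O.M)) +
    O.K 1 * τ ^ 2 • (O.D 0 * O.D 0 + O.D 1 * O.D 1) +
    O.K 2 * (τ • O.D 0 + τ ^ 2 • (O.D 0 * O.M)) + O.K 3 * (τ • O.D 1 + τ ^ 2 • (O.D 1 * O.M)))

lemma contDiff_B : ContDiff ℝ 2 O.B := by
  unfold B
  fun_prop

lemma contDiff_A : ContDiff ℝ 2 O.A := by
  have := O.contDiff_B
  unfold A
  fun_prop

lemma hasDerivAt_B : HasDerivAt O.B ((2 : ℝ) • O.M) 0 := by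
  have h1 := (((hasDerivAt_id (0 : ℝ)).const_mul 2).smul_const O.M).const_add 1
  have h2 := ((hasDerivAt_id (0 : ℝ)).pow 2).smul_const (O.M * O.M)
  refine (h1.add h2).congr_deriv ?_
  simp

lemma hasDerivAt_A : HasDerivAt O.A ((2 : ℝ) • O.M - (O.K 0 * ((2 : ℝ) • O.M) + O.K 2 * O.D 0 +
    O.K 3 * O.D 1)) 0 := by
  have d1 : ∀ X Y : XL z →L[ℝ] XL z, ∀ c : ℝ,
      HasDerivAt (fun τ : ℝ => (c * τ) • X + τ ^ 2 • Y) (c • X) 0 := fun X Y c => by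
    refine ((((hasDerivAt_id (0 : ℝ)).const_mul c).smul_const X).add
      (((hasDerivAt_id (0 : ℝ)).pow 2).smul_const Y)).congr_deriv ?_
    simp
  have h0 := (d1 O.M (O.M * O.M) 2).const_mul (O.K 0)
  have h1 := (d1 0 (O.D 0 * O.D 0 + O.D 1 * O.D 1) 0).const_mul (O.K 1)
  have h2 := (d1 (O.D 0) (O.D 0 * O.M) 1).const_mul (O.K 2)
  have h3 := (d1 (O.D 1) (O.D 1 * O.M) 1).const_mul (O.K 3)
  have := O.hasDerivAt_B.sub (((h0.add h1).add h2).add h3)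
  simp only [one_mul, one_smul, zero_mul, zero_add, smul_zero, mul_zero, add_zero] at this
  exact this

end StripOps

/-- `x` represents a family of functions with known values. -/
def RF (z : ℝ) (x : XL z) (v : Fin 3 → ℝ → E → ℂ) : Prop :=
  ∃ Y, (∀ b, Fam 1 (v b) (Y b)) ∧ Rep z x Y

section RF

variable {z : ℝ} {x y : XL z} {v w : Fin 3 → ℝ → E → ℂ}

lemma RF.add (hx : RF z x v) (hy : RF z y w) : RF z (x + y) fun b s p => v b s p + w b s p := by
  obtain ⟨Y, h1, h2⟩ := hx
  obtain ⟨Y', h1', h2'⟩ := hy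
  exact ⟨_, fun b => (h1 b).add (h1' b), h2.add h2'⟩

lemma RF.smul (hx : RF z x v) (c : ℝ) : RF z (c • x) fun b s p => (c : ℂ) * v b s p := by
  obtain ⟨Y, h1, h2⟩ := hx
  exact ⟨_, fun b => (h1 b).smul continuous_const, h2.smul c⟩

lemma RF.mul (hx : RF z x v) {g G : E → ℂ} (hg : FTW 1 g G) {M : XL z →L[ℝ] XL z}
    (hM : ∀ x Y, Rep z x Y → Rep z (M x) fun b s => cv G (Y b s)) :
    RF z (M x) fun b s p => g p * v b s p := by
  obtain ⟨Y, h1, h2⟩ := hx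
  exact ⟨_, fun b => (h1 b).mul hg, hM _ _ h2⟩

lemma RF.eq (hz : z ∈ Icc (-1 : ℝ) 0) (hx : RF z x v) (hy : RF z y w)
    (h : ∀ b, ∀ s ∈ Icc (-1 : ℝ) 0, ∀ p, v b s p = w b s p) : x = y := by
  obtain ⟨Y, h1, h2⟩ := hx
  obtain ⟨Y', h1', h2'⟩ := hy
  exact h2.eq hz h2' fun b s hs => ((h1 b).ftw s hs).hasFT.unique
    (((h1' b).ftw s hs).hasFT.congr_fun (h b s hs))

end RF

section Expansion

variable {h ψ : E → ℝ} {φ : E → ℝ → ℝ} {z τ : ℝ} {F Ψ : E → ℂ}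

/-- The fixed point equation in `L¹`. -/
lemma IsPotential.fixed_point_L1 (hh : MemH 6 h) (hψ : LambdaMemH 6 ψ)
    (h1 : ∀ x, |τ * h x| < 1) (hφ : IsPotential (fun x => τ * h x) (fun x => τ * ψ x) φ)
    (hF : FTW 4 (toC h) F) (hΨ : FTW 4 (toC ψ) Ψ) (hz : z ∈ Icc (-1 : ℝ) 0) (O : StripOps z F)
    {ℓ : XL z} (hℓ : Rep z ℓ fun b s ξ => symA b s ξ * Ψ ξ) :
    ∃ x, O.A τ x = τ • ℓ ∧ RF z (O.B τ x) fun b s => toC fun p => gradXZ φ b p s := by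
  have hhτ := hh.smul τ
  choose U hU using hφ.exists_fam
  have hU1 : ∀ b, Fam 1 (fun s => toC fun p => gradXZ φ b p s) (U b) :=
    fun b => (hU b).mono (by norm_num)
  have hG := (rw_inv hhτ h1).ftw
  set G := ft (toC fun x => (1 + τ * h x)⁻¹ - 1) with hGdef
  have hQ : ∀ b, Fam 1 (fun s => toC fun p => gradXZ φ b p s / (1 + τ * h p) ^ 2)
      (fun s ξ => U b s ξ + (2 * cv G (U b s) ξ + cv G (cv G (U b s)) ξ)) := fun b => by
    have h2 := (hU1 b).mul hG
    refine ((hU1 b).add ((h2.smul (c := fun _ => 2) continuous_const).add (h2.mul hG))).congr_fun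
      fun s _ p => ?_
    have := (one_add_pos h1 p).ne'
    simp only [toC]
    push_cast
    have h3 : (1 + (τ : ℂ) * (h p : ℂ)) ≠ 0 := by exact_mod_cast this
    field_simp
    ring
  obtain ⟨x, hx⟩ := exists_rep hz hQ
  have rQ : RF z x fun b s => toC fun p => gradXZ φ b p s / (1 + τ * h p) ^ 2 := ⟨_, hQ, hx⟩
  have fM := hF.mono (by norm_num : 1 ≤ 4)
  have fD : ∀ l, FTW 1 (toC (dx l h)) (dFT l F) := fun l => (hF.dx l).mono (by norm_num : 1 ≤ 3)
  have rM := rQ.mul fM O.hM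
  have rMM := rM.mul fM O.hM
  have hne : ∀ p, (1 + (τ : ℂ) * (h p : ℂ)) ≠ 0 := fun p => by
    exact_mod_cast (one_add_pos h1 p).ne'
  have eB : O.B τ x = x + (2 * τ) • O.M x + τ ^ 2 • O.M (O.M x) := rfl
  have rB : RF z (O.B τ x) fun b s => toC fun p => gradXZ φ b p s := by
    obtain ⟨y, hy⟩ := exists_rep hz hU1
    have rU : RF z y fun b s => toC fun p => gradXZ φ b p s := ⟨_, hU1, hy⟩
    have e : O.B τ x = y := by
      rw [eB]
      refine ((rQ.add (rM.smul _)).add (rMM.smul _)).eq hz rU fun b s _ p => ?_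
      have := hne p
      simp only [toC]
      push_cast
      field_simp
      ring
    rwa [e]
  refine ⟨x, ?_, rB⟩
  have hH : ∀ j, FTW 1 (toC (hTilde (fun x => τ * h x) j)) (ft (toC (hTilde (fun x => τ * h x) j))) :=
    fun j => (rw_hTilde hhτ h1 j).ftw
  set H := fun j => ft (toC (hTilde (fun x => τ * h x) j)) with hHdef
  have hT : ∀ j b, Fam 1 (fun s => toC fun p => hTilde (fun x => τ * h x) j p * gradXZ φ b p s)
      (fun s => cv (H j) (U b s)) := fun j b => fam_mul_hTilde hU hH j b
  choose y hy using fun j => exists_rep hz (hT j)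
  have rT : ∀ j, RF z (y j) fun b s => toC fun p => hTilde (fun x => τ * h x) j p * gradXZ φ b p s :=
    fun j => ⟨_, hT j, hy j⟩
  have hd := hh.rw.differentiable
  have y0 : y 0 = (2 * τ) • O.M x + τ ^ 2 • O.M (O.M x) := by
    refine (rT 0).eq hz ((rM.smul _).add (rMM.smul _)) fun b s _ p => ?_
    have := hne p
    simp only [toC, hTilde, Matrix.cons_val]
    push_cast
    field_simp
  have y1 : y 1 = τ ^ 2 • (O.D 0 (O.D 0 x) + O.D 1 (O.D 1 x)) := by
    refine (rT 1).eq hz ((((rQ.mul (fD 0) (O.hD 0)).mul (fD 0) (O.hD 0)).add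
      ((rQ.mul (fD 1) (O.hD 1)).mul (fD 1) (O.hD 1))).smul _) fun b s _ p => ?_
    have := hne p
    simp only [toC, hTilde, Matrix.cons_val, gradSq, Fin.sum_univ_two, dx_const_mul hd]
    push_cast
    field_simp
  have y2 : y 2 = τ • O.D 0 x + τ ^ 2 • O.D 0 (O.M x) := by
    refine (rT 2).eq hz (((rQ.mul (fD 0) (O.hD 0)).smul _).add
      ((rM.mul (fD 0) (O.hD 0)).smul _)) fun b s _ p => ?_
    have := hne p
    simp only [toC, hTilde, Matrix.cons_val, dx_const_mul hd]
    push_cast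
    field_simp
  have y3 : y 3 = τ • O.D 1 x + τ ^ 2 • O.D 1 (O.M x) := by
    refine (rT 3).eq hz (((rQ.mul (fD 1) (O.hD 1)).smul _).add
      ((rM.mul (fD 1) (O.hD 1)).smul _)) fun b s _ p => ?_
    have := hne p
    simp only [toC, hTilde, Matrix.cons_val, dx_const_mul hd]
    push_cast
    field_simp
  have eU : O.B τ x = τ • ℓ + (O.K 0 (y 0) + O.K 1 (y 1) + O.K 2 (y 2) + O.K 3 (y 3)) := by
    obtain ⟨Y, k1, k2⟩ := rB
    refine k2.eq hz ((hℓ.smul τ).add ((((O.hK 0 _ _ (hy 0)).add (O.hK 1 _ _ (hy 1))).add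
      (O.hK 2 _ _ (hy 2))).add (O.hK 3 _ _ (hy 3)))) fun a s hs => ?_
    have hψτ : ft (toC fun x => τ * ψ x) =ᵐ[volume] fun ξ => (τ : ℂ) * Ψ ξ :=
      ((hΨ.hasFT.smul τ).congr_fun fun x => by simp [toC]).ft_ae
    filter_upwards [hφ.fixed_point hhτ h1 (hψ.smul τ) hU hH hs a, hψτ,
      ((k1 a).ftw s hs).hasFT.unique ((hU1 a).ftw s hs).hasFT] with ξ e1 e2 e3
    rw [e3, e1, e2, Fin.sum_univ_four]
    ring
  have eA : O.A τ x = O.B τ x - (O.K 0 ((2 * τ) • O.M x + τ ^ 2 • O.M (O.M x)) +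
      O.K 1 (τ ^ 2 • (O.D 0 (O.D 0 x) + O.D 1 (O.D 1 x))) +
      O.K 2 (τ • O.D 0 x + τ ^ 2 • O.D 0 (O.M x)) +
      O.K 3 (τ • O.D 1 x + τ ^ 2 • O.D 1 (O.M x))) := rfl
  rw [eA, ← y0, ← y1, ← y2, ← y3, eU, add_sub_cancel_right]

end Expansion

end
end WaterWaves

namespace WaterWaves
open Filter Topology FourierTransform
open scoped NNReal
noncomputable section

/-- The Fourier transforms of the linear terms. -/
def lin1 (Ψ : E → ℂ) (b : Fin 3) (s : ℝ) (ξ : E) : ℂ := symA b s ξ * Ψ ξ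

/-- The Fourier transforms of the quadratic terms. -/
def quad (F Ψ : E → ℂ) (a : Fin 3) (s : ℝ) (ξ : E) : ℂ :=
  ∑ j, TT s a j (fun b t => cv (fun η => lin j η * F η) (lin1 Ψ b t)) ξ

lemma quad_eq (F Ψ : E → ℂ) (a : Fin 3) (s : ℝ) (ξ : E) : quad F Ψ a s ξ =
    TT s a 0 (fun b t ζ => (2 : ℝ) * cv F (lin1 Ψ b t) ζ) ξ
      + TT s a 2 (fun b t => cv (dFT 0 F) (lin1 Ψ b t)) ξ
      + TT s a 3 (fun b t => cv (dFT 1 F) (lin1 Ψ b t)) ξ := by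
  have e0 : ∀ X : E → ℂ, cv (fun η => lin 0 η * F η) X = fun ζ => (2 : ℝ) * cv F X ζ := fun X => by
    funext ζ
    simp only [cv, lin, Matrix.cons_val_zero, mul_assoc]
    rw [integral_const_mul]
    push_cast
    ring
  have e1 : ∀ X : E → ℂ, cv (fun η => lin 1 η * F η) X = fun _ => 0 := fun X => by
    funext ζ
    simp [cv, lin]
  rw [quad, Fin.sum_univ_four]
  simp only [e0, e1]
  have e2 : TT s a 1 (fun _ _ _ => 0) ξ = 0 := by simp [TT, tv]
  rw [e2, add_zero]
  rfl

section

variable {h ψ : E → ℝ} {Φ : ℝ → E → ℝ → ℝ} {z : ℝ} {F Ψ : E → ℂ}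

/-- The Taylor expansion of the gradient of the potential up to order two. -/
theorem taylor_gradXZ (hh : MemH 6 h) (hψ : LambdaMemH 6 ψ) (h1 : ∀ x, |h x| < 1)
    (hΦ : ∀ τ ∈ Icc (-1 : ℝ) 1, IsPotential (fun x => τ * h x) (fun x => τ * ψ x) (Φ τ))
    (hFm : StronglyMeasurable F) (hF : FTW 4 (toC h) F) (hΨm : StronglyMeasurable Ψ)
    (hΨ : FTW 4 (toC ψ) Ψ) (hz : z ∈ Icc (-1 : ℝ) 0) (a : Fin 3) (p : E) :
    ContDiffAt ℝ 2 (fun τ => gradXZ (Φ τ) a p z) 0 ∧ gradTerm Φ 0 a p z = 0 ∧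
      (gradTerm Φ 1 a p z : ℂ) = inv (lin1 Ψ a) z p ∧
      (gradTerm Φ 2 a p z : ℂ) = inv (quad F Ψ a) z p := by
  obtain ⟨O⟩ := exists_stripOps hz hFm hF
  obtain ⟨ℓ, hℓ⟩ := exists_rep hz fun b => (fam_symA hΨm hΨ.wi b).mono (by norm_num : 1 ≤ 3)
  obtain ⟨Λ, hΛ⟩ := exists_eval z a p
  have hA0 : O.A 0 = 1 := by simp [StripOps.A, StripOps.B]
  have hB0 : O.B 0 = 1 := by simp [StripOps.B]
  obtain ⟨g1, g2, g3⟩ := expansion_ringInverse O.contDiff_A O.contDiff_B hA0 hB0 O.hasDerivAt_A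
    O.hasDerivAt_B Λ ℓ
  have hunit : ∀ᶠ τ in 𝓝 (0 : ℝ), IsUnit (O.A τ) := by
    have h2 : IsUnit (O.A 0) := by rw [hA0]; exact isUnit_one
    exact O.contDiff_A.continuous.continuousAt.eventually (Units.isOpen.mem_nhds h2)
  have key : ∀ᶠ τ in 𝓝 (0 : ℝ), ((gradXZ (Φ τ) a p z : ℝ) : ℂ) =
      τ * Λ (O.B τ (Ring.inverse (O.A τ) ℓ)) := by
    filter_upwards [hunit, Icc_mem_nhds (show (-1 : ℝ) < 0 by norm_num) (show (0 : ℝ) < 1 by norm_num)]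
      with τ hu hτ
    have hτh : ∀ x, |τ * h x| < 1 := fun x => by
      rw [abs_mul]
      exact lt_of_le_of_lt (mul_le_of_le_one_left (abs_nonneg _) (abs_le.2 hτ)) (h1 x)
    obtain ⟨x, hx, Y, hY, hr⟩ := (hΦ τ hτ).fixed_point_L1 hh hψ hτh hF hΨ hz O hℓ
    have e1 : x = τ • Ring.inverse (O.A τ) ℓ := by
      rw [← map_smul, ← hx, ← mul_apply_eq_comp, Ring.inverse_mul_cancel _ hu]
      rfl
    have e2 := hΛ _ _ hr
    rw [e1, map_smul, map_smul, Complex.real_smul] at e2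
    rw [e2]
    exact (hY a).eq hz p
  obtain ⟨t1, t2, t3, t4⟩ := taylor_of_mul g1 key
  refine ⟨t1, ?_, ?_, ?_⟩
  · simp [gradTerm, t2]
  · rw [gradTerm, Nat.factorial_one, Nat.cast_one, div_one, t3, g2]
    exact hΛ _ _ hℓ
  · have e1 : ((gradTerm Φ 2 a p z : ℝ) : ℂ) =
        Λ (O.K 0 ((2 : ℝ) • O.M ℓ) + O.K 2 (O.D 0 ℓ) + O.K 3 (O.D 1 ℓ)) := by
      rw [gradTerm]
      push_cast
      rw [t4, g3, Nat.factorial_two, Nat.cast_ofNat, mul_div_cancel_left₀ _ two_ne_zero]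
      congr 1
      simp only [sub_apply, sub_sub_cancel]
      rfl
    have hr := ((O.hK 0 _ _ ((O.hM _ _ hℓ).smul 2)).add (O.hK 2 _ _ (O.hD 0 _ _ hℓ))).add
      (O.hK 3 _ _ (O.hD 1 _ _ hℓ))
    rw [e1, hΛ _ _ hr]
    congr 1
    funext s ξ
    exact (quad_eq F Ψ a s ξ).symm

end

end
end WaterWaves

namespace WaterWaves
open Filter Topology FourierTransform
open scoped NNReal
noncomputable section

/-! ### Bilinear operators with symbols on the strip -/

section tv

variable {z : ℝ}

lemma tv_congr (hz : z ∈ Icc (-1 : ℝ) 0) (a : Fin 3) (j : Fin 4) (ξ : E) {Y Y' : Fin 3 → ℝ → ℂ}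
    (h : ∀ b, ∀ s ∈ Icc (-1 : ℝ) 0, Y b s = Y' b s) : tv z a j ξ Y = tv z a j ξ Y' := by
  unfold tv
  refine Finset.sum_congr rfl fun b _ => ?_
  rw [h b z hz, setIntegral_congr_fun measurableSet_Icc fun s hs => by
    simp only [h b s hs]; rfl]

lemma tv_const_mul (a : Fin 3) (j : Fin 4) (ξ : E) (c : ℂ) (Y : Fin 3 → ℝ → ℂ) :
    tv z a j ξ (fun b s => c * Y b s) = c * tv z a j ξ Y := by
  unfold tv
  rw [Finset.mul_sum]
  refine Finset.sum_congr rfl fun b _ => ?_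
  rw [mul_add, ← integral_const_mul]
  congr 1
  · ring
  · congr 1
    funext s
    ring

lemma norm_tsym_le' (hz : z ∈ Icc (-1 : ℝ) 0) (a : Fin 3) (j : Fin 4) (b : Fin 3) {s : ℝ}
    (hs : s ∈ Icc (-1 : ℝ) 0) (ξ : E) : ‖tsym z a j b s ξ‖ ≤ 1 + 2 * ‖ξ‖ :=
  (norm_tsym_le a j b hs ξ).trans
    (mul_le_of_le_one_right (by positivity) (kD_le_one hz hs (norm_nonneg ξ)))

lemma norm_tsym0_le (hz : z ∈ Icc (-1 : ℝ) 0) (a : Fin 3) (j : Fin 4) (b : Fin 3) :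
    ‖tsym0 z a j b‖ ≤ 1 := by
  have := enorm_tsym0_le a j b hz
  rw [enorm_eq_nnnorm] at this
  exact_mod_cast this

lemma norm_tv_le (hz : z ∈ Icc (-1 : ℝ) 0) (a : Fin 3) (j : Fin 4) (ξ : E) {Y : Fin 3 → ℝ → ℂ}
    {M : ℝ} (h : ∀ b, ∀ s ∈ Icc (-1 : ℝ) 0, ‖Y b s‖ ≤ M) : ‖tv z a j ξ Y‖ ≤ 6 * (1 + ‖ξ‖) * M := by
  have hM : 0 ≤ M := (norm_nonneg _).trans (h 0 z hz)
  have hb : ∀ b, ‖tsym0 z a j b * Y b z + ∫ s in Icc (-1 : ℝ) 0, tsym z a j b s ξ * Y b s‖ ≤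
      1 * M + (1 + 2 * ‖ξ‖) * M := fun b => by
    refine (norm_add_le _ _).trans (add_le_add ?_ ?_)
    · rw [norm_mul]
      exact mul_le_mul (norm_tsym0_le hz a j b) (h b z hz) (norm_nonneg _) zero_le_one
    · have := norm_setIntegral_le_of_norm_le_const (μ := (volume : Measure ℝ)) (s := Icc (-1 : ℝ) 0)
        (f := fun s => tsym z a j b s ξ * Y b s) (C := (1 + 2 * ‖ξ‖) * M) (by simp) fun s hs => by
          rw [norm_mul]
          exact mul_le_mul (norm_tsym_le' hz a j b hs ξ) (h b s hs) (norm_nonneg _) (by positivity)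
      simpa using this
  refine (norm_sum_le _ _).trans ((Finset.sum_le_sum fun b _ => hb b).trans (le_of_eq ?_))
  simp only [Finset.sum_const, Finset.card_univ, Fintype.card_fin, nsmul_eq_mul]
  push_cast
  ring

lemma ae_strip {V : Type*} [MeasurableSpace V] (μ : Measure V) [SFinite μ] :
    ∀ᵐ p : ℝ × V ∂(volume.restrict (Icc (-1 : ℝ) 0)).prod μ, p.1 ∈ Icc (-1 : ℝ) 0 :=
  Measure.quasiMeasurePreserving_fst.ae (ae_restrict_mem measurableSet_Icc)

lemma tv_integral {V : Type*} [MeasurableSpace V] {μ : Measure V} [SFinite μ]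
    (hz : z ∈ Icc (-1 : ℝ) 0) (a : Fin 3) (j : Fin 4) (ξ : E) {D : V → ℂ} {w : V → ℝ}
    {S : Fin 3 → ℝ → V → ℂ} (hD : AEStronglyMeasurable D μ)
    (hS : ∀ b, StronglyMeasurable fun q : ℝ × V => S b q.1 q.2)
    (hw : Integrable (fun q => ‖D q‖ * w q) μ) (hb : ∀ b, ∀ s ∈ Icc (-1 : ℝ) 0, ∀ q, ‖S b s q‖ ≤ w q) :
    Integrable (fun q => D q * tv z a j ξ fun b s => S b s q) μ ∧
      tv z a j ξ (fun b s => ∫ q, D q * S b s q ∂μ) = ∫ q, D q * tv z a j ξ (fun b s => S b s q) ∂μ := by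
  have i1 : ∀ b, Integrable (fun q => tsym0 z a j b * (D q * S b z q)) μ := fun b => by
    refine Integrable.const_mul (hw.mono' (hD.mul
      ((hS b).comp_measurable measurable_prodMk_left).aestronglyMeasurable)
      (Eventually.of_forall fun q => ?_)) _
    refine (norm_mul _ _).trans_le ?_
    exact mul_le_mul_of_nonneg_left (hb b z hz q) (norm_nonneg _)
  have i2 : ∀ b, Integrable (fun p : ℝ × V => tsym z a j b p.1 ξ * (D p.2 * S b p.1 p.2))
      ((volume.restrict (Icc (-1 : ℝ) 0)).prod μ) := fun b => by
    have h1 : Integrable (fun _ : ℝ => 1 + 2 * ‖ξ‖) (volume.restrict (Icc (-1 : ℝ) 0)) := by simp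
    refine (h1.mul_prod hw).mono' ?_ ?_
    · refine AEStronglyMeasurable.mul ?_ (hD.comp_snd.mul (hS b).aestronglyMeasurable)
      exact ((measurable_tsym z a j b).comp
        (by fun_prop : Measurable fun p : ℝ × V => (p.1, ξ))).aestronglyMeasurable
    · filter_upwards [ae_strip μ] with p hp
      rw [norm_mul, norm_mul]
      exact mul_le_mul (norm_tsym_le' hz a j b hp ξ)
        (mul_le_mul_of_nonneg_left (hb b p.1 hp p.2) (norm_nonneg _)) (by positivity) (by positivity)
  have e : ∀ q, (D q * tv z a j ξ fun b s => S b s q) = ∑ b, (tsym0 z a j b * (D q * S b z q) +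
      ∫ s in Icc (-1 : ℝ) 0, tsym z a j b s ξ * (D q * S b s q)) := fun q =>
    (tv_const_mul a j ξ (D q) fun b s => S b s q).symm
  have i3 : ∀ b, Integrable (fun q => tsym0 z a j b * (D q * S b z q) +
      ∫ s in Icc (-1 : ℝ) 0, tsym z a j b s ξ * (D q * S b s q)) μ := fun b =>
    (i1 b).add (i2 b).integral_prod_right
  simp only [e]
  refine ⟨integrable_finsetSum _ fun b _ => i3 b, ?_⟩
  rw [integral_finsetSum _ fun b _ => i3 b, tv]
  refine Finset.sum_congr rfl fun b _ => ?_
  rw [integral_add (i1 b) (i2 b).integral_prod_right, integral_const_mul,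
    ← integral_integral_swap (f := fun s q => tsym z a j b s ξ * (D q * S b s q)) (i2 b)]
  simp only [integral_const_mul]

end tv

lemma measurePreserving_shear {V : Type*} [MeasurableSpace V] (μ : Measure V) [SFinite μ] {L : V → E}
    (hL : Measurable L) : MeasurePreserving (fun p : E × V => (p.1 - L p.2, p.2))
      ((volume : Measure E).prod μ) (volume.prod μ) := by
  have h1 : MeasurePreserving (fun p : V × E => (p.1, p.2 - L p.1)) (μ.prod volume) (μ.prod volume) :=
    (MeasurePreserving.id μ).skew_product (g := fun q ξ => ξ - L q) (by
      exact measurable_snd.sub (hL.comp measurable_fst)) (Eventually.of_forall fun q =>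
        (measurePreserving_sub_right volume (L q)).map_eq)
  exact (Measure.measurePreserving_swap.comp h1).comp Measure.measurePreserving_swap

/-- The integrability and the change of variables `ξ₁ = ξ - L q`. -/
lemma integral_shear {V W : Type*} [MeasurableSpace V] {μ : Measure V} [SFinite μ]
    [NormedAddCommGroup W] [NormedSpace ℝ W] {L : V → E} (hL : Measurable L) {H : E × V → W} (hH : Integrable H (volume.prod μ)) :
    Integrable (fun p : E × V => H (p.1 - L p.2, p.2)) (volume.prod μ) ∧
      ∫ p, H p ∂volume.prod μ = ∫ ξ, ∫ q, H (ξ - L q, q) ∂μ := by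
  have hm := measurePreserving_shear μ hL
  have h1 : Integrable (fun p : E × V => H (p.1 - L p.2, p.2)) (volume.prod μ) :=
    hm.integrable_comp_of_integrable hH
  refine ⟨h1, ?_⟩
  rw [← integral_prod _ h1]
  have := integral_map hm.aemeasurable (f := H) (by rw [hm.map_eq]; exact hH.aestronglyMeasurable)
  rwa [hm.map_eq] at this

/-- Symbols of bilinear operators that depend on the height. -/
structure StripSym (S : ℝ → E → E → ℂ) : Prop where
  cont : Continuous fun q : ℝ × E × E => S q.1 q.2.1 q.2.2
  bd : ∃ C, ∀ s ∈ Icc (-1 : ℝ) 0, ∀ ξ η, ‖S s ξ η‖ ≤ C * ((1 + ‖ξ‖) ^ 2 * (1 + ‖η‖) ^ 2)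

lemma stripSym_A (b : Fin 3) : StripSym fun s _ η => symA b s η where
  cont := (continuous_symA b).comp (by fun_prop : Continuous fun q : ℝ × E × E => (q.1, q.2.2))
  bd := ⟨1, fun s hs ξ η => (norm_symA_le b hs η).trans (by
    have h1 := norm_nonneg η
    have h2 : 1 ≤ (1 + ‖ξ‖) ^ 2 := one_le_pow₀ (by linarith [norm_nonneg ξ])
    nlinarith)⟩

lemma StripSym.add {S S' : ℝ → E → E → ℂ} (h : StripSym S) (h' : StripSym S') :
    StripSym fun s ξ η => S s ξ η + S' s ξ η where
  cont := h.cont.add h'.cont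
  bd := by
    obtain ⟨C, hC⟩ := h.bd
    obtain ⟨C', hC'⟩ := h'.bd
    refine ⟨C + C', fun s hs ξ η => (norm_add_le _ _).trans ?_⟩
    rw [add_mul]
    exact add_le_add (hC s hs ξ η) (hC' s hs ξ η)

lemma StripSym.smul {S : ℝ → E → E → ℂ} (h : StripSym S) (c : ℂ) :
    StripSym fun s ξ η => c * S s ξ η where
  cont := continuous_const.mul h.cont
  bd := by
    obtain ⟨C, hC⟩ := h.bd
    refine ⟨‖c‖ * C, fun s hs ξ η => ?_⟩
    rw [norm_mul, mul_assoc]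
    exact mul_le_mul_of_nonneg_left (hC s hs ξ η) (norm_nonneg _)

lemma stripSym_dA (l : Fin 2) (b : Fin 3) : StripSym fun s ξ η => Complex.I * ξ l * symA b s η where
  cont := Continuous.mul (by fun_prop) (stripSym_A b).cont
  bd := ⟨1, fun s hs ξ η => by
    rw [norm_mul, norm_mul, Complex.norm_I, one_mul, one_mul, Complex.norm_real]
    have h1 := norm_nonneg ξ
    have h2 := norm_nonneg η
    refine mul_le_mul ((norm_coord_le ξ l).trans ?_) ((norm_symA_le b hs η).trans ?_) (norm_nonneg _)
      (by positivity)
    all_goals nlinarith⟩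

lemma stripSym_B (b : Fin 3) : StripSym (symB b) where
  cont := continuous_symB b
  bd := by
    refine ⟨4, fun s hs ξ η => ?_⟩
    have h1 := norm_nonneg ξ
    have h2 := norm_nonneg η
    have h3 := norm_add_le ξ η
    have hs1 : |1 + s| ≤ 1 := abs_le.2 ⟨by linarith [hs.1], by linarith [hs.2]⟩
    have a1 := abs_mB_le hs h2
    have a2 := abs_mA_le hs (norm_nonneg (ξ + η))
    have a3 := abs_mB_le (s := 0) (by simp) h2
    have a4 := abs_mA_le hs h2
    have a5 := abs_mB_le hs (norm_nonneg (ξ + η))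
    have hW : (‖ξ‖ + ‖η‖) * (2 * ‖η‖) + ‖η‖ + ‖η‖ ^ 2 ≤ 4 * ((1 + ‖ξ‖) ^ 2 * (1 + ‖η‖) ^ 2) := by
      have p1 := mul_nonneg h1 h2
      have p2 := mul_nonneg p1 h2
      have p3 := mul_nonneg p1 h1
      have p4 := mul_nonneg p1 p1
      nlinarith [sq_nonneg ‖ξ‖, sq_nonneg ‖η‖]
    have hx : ∀ i : Fin 2, ‖Complex.I * (ξ + η) i *
        ((1 + s) * mB s ‖η‖ - mA s ‖ξ + η‖ * mB 0 ‖η‖)‖ ≤ 4 * ((1 + ‖ξ‖) ^ 2 * (1 + ‖η‖) ^ 2) := fun i => by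
      rw [norm_mul, norm_mul, Complex.norm_I, one_mul, Complex.norm_real]
      have e : ((1 + s) * mB s ‖η‖ - mA s ‖ξ + η‖ * mB 0 ‖η‖ : ℂ) =
        (((1 + s) * mB s ‖η‖ - mA s ‖ξ + η‖ * mB 0 ‖η‖ : ℝ) : ℂ) := by push_cast; ring
      rw [e, Complex.norm_real]
      have b1 : ‖(1 + s) * mB s ‖η‖ - mA s ‖ξ + η‖ * mB 0 ‖η‖‖ ≤ 2 * ‖η‖ := by
        refine (norm_sub_le _ _).trans ?_
        rw [norm_mul, norm_mul]
        have := mul_le_mul hs1 a1 (abs_nonneg _) zero_le_one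
        have := mul_le_mul a2 a3 (abs_nonneg _) zero_le_one
        simp only [Real.norm_eq_abs]
        linarith
      refine (mul_le_mul ((norm_coord_le _ i).trans h3) b1 (norm_nonneg _) (by positivity)).trans ?_
      nlinarith
    fin_cases b
    · exact hx 0
    · exact hx 1
    · have e : symB 2 s ξ η = ((mB s ‖η‖ + (1 + s) * (‖η‖ ^ 2 * mA s ‖η‖)
        - mB s ‖ξ + η‖ * mB 0 ‖η‖ : ℝ) : ℂ) := by simp [symB]
      change ‖symB 2 s ξ η‖ ≤ _
      rw [e, Complex.norm_real]
      refine (norm_sub_le _ _).trans ((add_le_add_left (norm_add_le _ _) _).trans ?_)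
      simp only [norm_mul, Real.norm_eq_abs, abs_pow, abs_norm]
      have b1 : |1 + s| * (‖η‖ ^ 2 * |mA s ‖η‖|) ≤ 1 * (‖η‖ ^ 2 * 1) := by gcongr
      have b2 : |mB s ‖ξ + η‖| * |mB 0 ‖η‖| ≤ (‖ξ‖ + ‖η‖) * ‖η‖ :=
        mul_le_mul (a5.trans h3) a3 (abs_nonneg _) (by positivity)
      nlinarith [mul_nonneg h1 h2]

end
end WaterWaves

namespace WaterWaves
open Filter Topology FourierTransform
open scoped NNReal
noncomputable section

/-- The Fourier transform of the bilinear operator with symbol `S`. -/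
def scv (S : E → E → ℂ) (F G : E → ℂ) (ζ : E) : ℂ :=
  c0 * ∫ η, F (ζ - η) * G η * S (ζ - η) η

lemma cv_eq_scv (m n F G : E → ℂ) : cv (fun η => m η * F η) (fun η => n η * G η) =
    scv (fun ξ η => m ξ * n η) F G := by
  funext ζ
  rw [cv, scv, ← integral_sub_left_eq_self _ volume ζ]
  congr 2
  funext η
  rw [sub_sub_cancel]
  ring

section

variable {F G K : E → ℂ} {S S' : ℝ → E → E → ℂ}

/-- The bound for the integrand of `scv`. -/
def sbd (F G : E → ℂ) (ζ η : E) : ℝ :=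
  (1 + ‖ζ - η‖) ^ 2 * ‖F (ζ - η)‖ * ((1 + ‖η‖) ^ 2 * ‖G η‖)

lemma integrable_sbd (hFm : StronglyMeasurable F) (hF : WI 3 F) (hGm : StronglyMeasurable G)
    (hG : WI 3 G) : Integrable fun p : E × E => (1 + ‖p.1‖) * sbd F G p.1 p.2 := by
  have h1 := Integrable.convolution_integrand (ContinuousLinearMap.mul ℝ ℝ) hG hF
  refine h1.mono' ?_ (Eventually.of_forall fun p => ?_)
  · have e1 : StronglyMeasurable fun p : E × E => F (p.1 - p.2) :=
      hFm.comp_measurable (measurable_fst.sub measurable_snd)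
    have e2 : StronglyMeasurable fun p : E × E => G p.2 := hGm.comp_measurable measurable_snd
    have e3 : StronglyMeasurable fun p : E × E => (1 + ‖p.1 - p.2‖) ^ 2 :=
      Continuous.stronglyMeasurable (by fun_prop)
    have e4 : StronglyMeasurable fun p : E × E => (1 + ‖p.2‖) ^ 2 :=
      Continuous.stronglyMeasurable (by fun_prop)
    have e5 : StronglyMeasurable fun p : E × E => 1 + ‖p.1‖ :=
      Continuous.stronglyMeasurable (by fun_prop)
    exact (e5.mul ((e3.mul e1.norm).mul (e4.mul e2.norm))).aestronglyMeasurable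
  · have h2 := weight_mul p.1 p.2
    rw [sbd, Real.norm_of_nonneg (by positivity)]
    simp only [ContinuousLinearMap.mul_apply']
    calc _ ≤ ((1 + ‖p.2‖) * (1 + ‖p.1 - p.2‖)) * ((1 + ‖p.1 - p.2‖) ^ 2 * ‖F (p.1 - p.2)‖ *
          ((1 + ‖p.2‖) ^ 2 * ‖G p.2‖)) := by gcongr
      _ = _ := by ring

lemma ae_integrable_sbd (hFm : StronglyMeasurable F) (hF : WI 3 F) (hGm : StronglyMeasurable G)
    (hG : WI 3 G) : ∀ᵐ ζ, Integrable (sbd F G ζ) := by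
  filter_upwards [(integrable_sbd hFm hF hGm hG).prod_right_ae] with ζ h
  refine (h.const_mul (1 + ‖ζ‖)⁻¹).congr (Eventually.of_forall fun η => ?_)
  exact inv_mul_cancel_left₀ (weight_pos ζ).ne' _

lemma StripSym.norm_le (hS : StripSym S) : ∃ C, ∀ s ∈ Icc (-1 : ℝ) 0, ∀ ζ η,
    ‖F (ζ - η) * G η * S s (ζ - η) η‖ ≤ C * sbd F G ζ η := by
  obtain ⟨C, hC⟩ := hS.bd
  refine ⟨C, fun s hs ζ η => ?_⟩
  rw [norm_mul, norm_mul, sbd]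
  refine (mul_le_mul_of_nonneg_left (hC s hs (ζ - η) η) (by positivity)).trans (le_of_eq ?_)
  ring

lemma StripSym.stronglyMeasurable (hS : StripSym S) (hFm : StronglyMeasurable F)
    (hGm : StronglyMeasurable G) :
    StronglyMeasurable fun q : (ℝ × E) × E => F (q.1.2 - q.2) * G q.2 * S q.1.1 (q.1.2 - q.2) q.2 := by
  have e1 : StronglyMeasurable fun q : (ℝ × E) × E => F (q.1.2 - q.2) :=
    hFm.comp_measurable (by fun_prop)
  have e3 : StronglyMeasurable fun q : (ℝ × E) × E => S q.1.1 (q.1.2 - q.2) q.2 :=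
    (hS.cont.comp (by fun_prop : Continuous fun q : (ℝ × E) × E =>
      (q.1.1, q.1.2 - q.2, q.2))).stronglyMeasurable
  exact (e1.mul (hGm.comp_measurable measurable_snd)).mul e3

lemma StripSym.ae_integrable (hS : StripSym S) (hFm : StronglyMeasurable F) (hF : WI 3 F)
    (hGm : StronglyMeasurable G) (hG : WI 3 G) {s : ℝ} (hs : s ∈ Icc (-1 : ℝ) 0) :
    ∀ᵐ ζ, Integrable fun η => F (ζ - η) * G η * S s (ζ - η) η := by
  obtain ⟨C, hC⟩ := hS.norm_le (F := F) (G := G)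
  filter_upwards [ae_integrable_sbd hFm hF hGm hG] with ζ h
  exact (h.const_mul C).mono' ((hS.stronglyMeasurable hFm hGm).comp_measurable
    (by fun_prop : Measurable fun η : E => ((s, ζ), η))).aestronglyMeasurable
    (Eventually.of_forall (hC s hs ζ))

lemma fam_scv (hS : StripSym S) (hFm : StronglyMeasurable F) (hF : WI 3 F)
    (hGm : StronglyMeasurable G) (hG : WI 3 G) :
    Fam 1 (inv fun s => scv (S s) F G) fun s => scv (S s) F G := by
  obtain ⟨C, hC⟩ := hS.norm_le (F := F) (G := G)
  have hJ := integrable_sbd hFm hF hGm hG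
  refine fam_of_le (N := fun ζ => ∫ η, C * sbd F G ζ η) ?_ ?_ fun s hs => ?_
  · exact (StronglyMeasurable.integral_prod_right (f := fun (q : ℝ × E) η =>
      F (q.2 - η) * G η * S q.1 (q.2 - η) η) (hS.stronglyMeasurable hFm hGm)).const_mul c0
  · refine (hJ.integral_prod_left.const_mul C).congr (Eventually.of_forall fun ζ => ?_)
    simp only [integral_const_mul, pow_one]
    ring
  · filter_upwards [ae_integrable_sbd hFm hF hGm hG] with ζ h
    rw [scv, norm_mul]
    exact (mul_le_of_le_one_left (norm_nonneg _) norm_c0_le).trans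
      (norm_integral_le_of_norm_le (h.const_mul C) (Eventually.of_forall (hC s hs ζ)))

lemma inv_scv_add_smul (hS : StripSym S) (hS' : StripSym S') (c : ℂ) (hFm : StronglyMeasurable F)
    (hF : WI 3 F) (hGm : StronglyMeasurable G) (hG : WI 3 G) {s : ℝ} (hs : s ∈ Icc (-1 : ℝ) 0) (x : E) :
    inv (fun s => scv (fun ξ η => S s ξ η + c * S' s ξ η) F G) s x =
      inv (fun s => scv (S s) F G) s x + c * inv (fun s => scv (S' s) F G) s x := by
  have h1 := ((fam_scv hS hFm hF hGm hG).ftw s hs).hasFT.add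
    (((fam_scv hS' hFm hF hGm hG).ftw s hs).hasFT.smul c)
  refine Eq.trans (congrArg (c0 * ·) (integral_congr_ae ?_)) (h1.eq x).symm
  filter_upwards [hS.ae_integrable hFm hF hGm hG hs, hS'.ae_integrable hFm hF hGm hG hs] with ζ k k'
  simp only [scv]
  rw [mul_left_comm c, ← integral_const_mul c, ← mul_add, ← integral_add k (k'.const_mul c)]
  congr 3
  funext η
  ring

/-- The quadratic terms have the symbols `symB`. -/
theorem quad_eq_scv (hFm : StronglyMeasurable F) (hF : WI 3 F) (hGm : StronglyMeasurable G)
    (hG : WI 3 G) {z : ℝ} (hz : z ∈ Icc (-1 : ℝ) 0) (a : Fin 3) :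
    quad F G a z =ᵐ[volume] scv (symB a z) F G := by
  have h0 : ∀ᵐ ζ : E, ζ ≠ 0 := by simp [ae_iff]
  filter_upwards [h0, ae_integrable_sbd hFm hF hGm hG] with ζ hζ hi
  have hlin : ∀ (j : Fin 4) (ξ : E), ‖lin j ξ‖ ≤ 2 * (1 + ‖ξ‖) := fun j ξ => by
    have hn := norm_nonneg ξ
    have hx : ∀ i : Fin 2, ‖Complex.I * ξ i‖ ≤ 2 * (1 + ‖ξ‖) := fun i => by
      rw [norm_mul, Complex.norm_I, one_mul, Complex.norm_real]
      exact (norm_coord_le ξ i).trans (by linarith)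
    fin_cases j
    · simp [lin]
    · simp [lin]; positivity
    · exact hx 0
    · exact hx 1
  have hlc : ∀ j : Fin 4, Continuous (lin j) := fun j => by
    have hx : ∀ i : Fin 2, Continuous fun ξ : E => Complex.I * (ξ i : ℂ) := fun i => by fun_prop
    fin_cases j
    · exact continuous_const
    · exact continuous_const
    · exact hx 0
    · exact hx 1
  have key := fun j => tv_integral (μ := (volume : Measure E)) hz a j ζ
    (D := fun η => F (ζ - η) * G η) (w := fun η => 2 * ((1 + ‖ζ - η‖) ^ 2 * (1 + ‖η‖) ^ 2))
    (S := fun b s η => lin j (ζ - η) * symA b s η)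
    ((hFm.comp_measurable (by fun_prop)).mul hGm).aestronglyMeasurable
    (fun b => (Continuous.mul ((hlc j).comp (by fun_prop)) (continuous_symA b)).stronglyMeasurable)
    ((hi.const_mul 2).congr (Eventually.of_forall fun η => by simp only [sbd, norm_mul]; ring))
    fun b s hs η => by
      rw [norm_mul, ← mul_assoc]
      have n1 := norm_nonneg (ζ - η)
      have n2 := norm_nonneg η
      refine mul_le_mul ((hlin j _).trans ?_) ((norm_symA_le b hs η).trans ?_) (norm_nonneg _)
        (by positivity)
      all_goals nlinarith
  have e : ∀ j, TT z a j (fun b t => cv (fun η => lin j η * F η) (lin1 G b t)) ζ =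
      c0 * ∫ η, F (ζ - η) * G η * tv z a j ζ fun b s => lin j (ζ - η) * symA b s η := fun j => by
    rw [← (key j).2, ← tv_const_mul]
    unfold TT lin1
    simp only [cv_eq_scv]
    rfl
  rw [quad, scv]
  simp only [e]
  rw [← Finset.mul_sum, ← integral_finsetSum _ fun j _ => (key j).1]
  congr 2
  funext η
  rw [← Finset.mul_sum, symB_eq hz a (by simpa using hζ)]
  simp only [sub_add_cancel]

/-! ### Trilinear operators -/

variable {z : ℝ} {T T' : Fin 3 → ℝ → E → E → ℂ} {f g k : E → ℝ} {c c' : E → E → E → ℂ}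

/-- The integrand of a trilinear operator. -/
def triInt (c : E → E → E → ℂ) (x : E) (F G K : E → ℂ) (p : E × E × E) : ℂ :=
  chr x (p.1 + p.2.1 + p.2.2) * c p.1 p.2.1 p.2.2 * F p.1 * G p.2.1 * K p.2.2

lemma trilin_eq (hF : HasFT (toC f) F) (hG : HasFT (toC g) G) (hK : HasFT (toC k) K) (x : E) :
    trilin c f g k x = c0 ^ 3 * ∫ p, triInt c x F G K p := by
  rw [trilin, c0, ← pow_mul]
  congr 1
  refine integral_congr_ae ?_
  have q2 : Measure.QuasiMeasurePreserving (fun p : E × E × E => p.2.1) :=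
    Measure.quasiMeasurePreserving_fst.comp Measure.quasiMeasurePreserving_snd
  have q3 : Measure.QuasiMeasurePreserving (fun p : E × E × E => p.2.2) :=
    Measure.quasiMeasurePreserving_snd.comp Measure.quasiMeasurePreserving_snd
  filter_upwards [Measure.quasiMeasurePreserving_fst.ae hF.ft_ae, q2.ae hG.ft_ae, q3.ae hK.ft_ae]
    with p h1 h2 h3
  rw [triInt, h1, h2, h3]

lemma integrable_triInt_csymC (hz : z ∈ Icc (-1 : ℝ) 0) (a : Fin 3) (j : Fin 4)
    (hT : ∀ b, StripSym (T b)) (hFm : StronglyMeasurable F) (hF : WI 3 F)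
    (hGm : StronglyMeasurable G) (hG : WI 3 G) (hKm : StronglyMeasurable K) (hK : WI 1 K) (x : E) :
    Integrable (triInt (csymC z a j fun b s ξ η _ => T b s ξ η) x F G K) := by
  choose C hC using fun b => (hT b).bd
  have hw : Integrable fun p : E × E × E => 6 * (C 0 + C 1 + C 2) * (((1 + ‖p.1‖) ^ 3 * ‖F p.1‖) *
      (((1 + ‖p.2.1‖) ^ 3 * ‖G p.2.1‖) * ((1 + ‖p.2.2‖) ^ 1 * ‖K p.2.2‖))) :=
    (Integrable.mul_prod hF (Integrable.mul_prod hG hK)).const_mul _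
  have hC0 : ∀ b, 0 ≤ C b := fun b => by
    have := (norm_nonneg _).trans (hC b z hz 0 0)
    simpa using this
  refine hw.mono' ?_ (Eventually.of_forall fun p => ?_)
  · have m1 : StronglyMeasurable fun p : E × E × E =>
        csymC z a j (fun b s ξ η _ => T b s ξ η) p.1 p.2.1 p.2.2 := by
      unfold csymC
      refine Finset.stronglyMeasurable_fun_sum Finset.univ fun b _ => StronglyMeasurable.add ?_ ?_
      · exact (((hT b).cont.comp (by fun_prop : Continuous fun p : E × E × E =>
          (z, p.1, p.2.1))).stronglyMeasurable).const_mul _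
      · refine StronglyMeasurable.integral_prod_right (f := fun (p : E × E × E) s =>
          tsym z a j b s (p.1 + p.2.1 + p.2.2) * T b s p.1 p.2.1) (StronglyMeasurable.mul ?_ ?_)
        · exact ((measurable_tsym z a j b).comp (by fun_prop : Measurable fun q : (E × E × E) × ℝ =>
            (q.2, q.1.1 + q.1.2.1 + q.1.2.2))).stronglyMeasurable
        · exact ((hT b).cont.comp (by fun_prop : Continuous fun q : (E × E × E) × ℝ =>
            (q.2, q.1.1, q.1.2.1))).stronglyMeasurable
    have m2 : StronglyMeasurable fun p : E × E × E => chr x (p.1 + p.2.1 + p.2.2) :=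
      ((chr_continuous x).comp (by fun_prop)).stronglyMeasurable
    exact ((((m2.mul m1).mul (hFm.comp_measurable (by fun_prop))).mul
      (hGm.comp_measurable (by fun_prop))).mul (hKm.comp_measurable (by fun_prop))).aestronglyMeasurable
  · have h1 : ‖csymC z a j (fun b s ξ η _ => T b s ξ η) p.1 p.2.1 p.2.2‖ ≤
        6 * (1 + ‖p.1 + p.2.1 + p.2.2‖) * ((C 0 + C 1 + C 2) *
          ((1 + ‖p.1‖) ^ 2 * (1 + ‖p.2.1‖) ^ 2)) :=
      norm_tv_le hz a j _ (Y := fun b s => T b s p.1 p.2.1) fun b s hs =>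
        (hC b s hs _ _).trans (by
          gcongr
          have h0 := hC0 0
          have h1 := hC0 1
          have h2 := hC0 2
          fin_cases b <;> dsimp <;> linarith)
    have h2 : 1 + ‖p.1 + p.2.1 + p.2.2‖ ≤ (1 + ‖p.1‖) * (1 + ‖p.2.1‖) * (1 + ‖p.2.2‖) := by
      have n1 := norm_nonneg p.1
      have n2 := norm_nonneg p.2.1
      have n3 := norm_nonneg p.2.2
      have := norm_add₃_le (a := p.1) (b := p.2.1) (c := p.2.2)
      nlinarith [mul_nonneg n1 n2, mul_nonneg n1 n3, mul_nonneg n2 n3, mul_nonneg (mul_nonneg n1 n2) n3]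
    have hS : 0 ≤ C 0 + C 1 + C 2 := add_nonneg (add_nonneg (hC0 0) (hC0 1)) (hC0 2)
    simp only [triInt, norm_mul, norm_chr, one_mul]
    calc _ ≤ 6 * ((1 + ‖p.1‖) * (1 + ‖p.2.1‖) * (1 + ‖p.2.2‖)) * ((C 0 + C 1 + C 2) *
          ((1 + ‖p.1‖) ^ 2 * (1 + ‖p.2.1‖) ^ 2)) * ‖F p.1‖ * ‖G p.2.1‖ * ‖K p.2.2‖ := by
          gcongr
          exact h1.trans (by gcongr)
      _ = _ := by ring

lemma integral_triInt_csymC (hz : z ∈ Icc (-1 : ℝ) 0) (a : Fin 3) (j : Fin 4)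
    (hT : ∀ b, StripSym (T b)) (hFm : StronglyMeasurable F) (hF : WI 3 F)
    (hGm : StronglyMeasurable G) (hG : WI 3 G) (hKm : StronglyMeasurable K) (hK : WI 1 K) (x : E) :
    c0 ^ 3 * ∫ p, triInt (csymC z a j fun b s ξ η _ => T b s ξ η) x F G K p =
      c0 * ∫ ξ, chr x ξ * TT z a j (fun b s => cv K (scv (T b s) F G)) ξ := by
  have hL : Measurable fun q : E × E => q.1 + q.2 := by fun_prop
  have h1 := (integral_shear (μ := (volume : Measure (E × E))) hL
    (integrable_triInt_csymC hz a j hT hFm hF hGm hG hKm hK x)).2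
  choose C hC using fun b => (hT b).bd
  set M := ∑ b, |C b|
  have hM : ∀ b, C b ≤ M := fun b => (le_abs_self _).trans
    (Finset.single_le_sum (f := fun b => |C b|) (fun _ _ => abs_nonneg _) (Finset.mem_univ b))
  obtain ⟨w, hwe⟩ : ∃ w : E × E × E → ℝ, ∀ p, w p = M * ((1 + ‖p.1‖) ^ 2 * (1 + ‖p.2.1‖) ^ 2) :=
    ⟨_, fun _ => rfl⟩
  have hw : Integrable fun p : E × E × E =>
      ‖F p.1 * G p.2.1 * K p.2.2‖ * w p := by
    have hF2 : WI 2 F := hF.mono (by norm_num) hFm.aestronglyMeasurable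
    have hG2 : WI 2 G := hG.mono (by norm_num) hGm.aestronglyMeasurable
    have hK0 : WI 0 K := hK.mono (by norm_num) hKm.aestronglyMeasurable
    refine ((Integrable.mul_prod hF2 (Integrable.mul_prod hG2 hK0)).const_mul M).congr
      (Eventually.of_forall fun p => ?_)
    simp only [norm_mul, hwe]
    ring
  have h2 := (integral_shear (μ := (volume : Measure (E × E))) hL hw).1.prod_right_ae
  refine Eq.trans (congrArg (c0 ^ 3 * ·) h1) ?_
  rw [show c0 ^ 3 = c0 * c0 ^ 2 by ring, mul_assoc, ← integral_const_mul]
  congr 1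
  refine integral_congr_ae ?_
  filter_upwards [h2] with ξ hξ
  have hD : StronglyMeasurable fun q : E × E => F (ξ - (q.1 + q.2)) * G q.1 * K q.2 :=
    ((hFm.comp_measurable (by fun_prop)).mul (hGm.comp_measurable (by fun_prop))).mul
      (hKm.comp_measurable (by fun_prop))
  have hSm : ∀ b, StronglyMeasurable fun p : ℝ × E × E => T b p.1 (ξ - (p.2.1 + p.2.2)) p.2.1 :=
    fun b => ((hT b).cont.comp (by fun_prop : Continuous fun p : ℝ × E × E =>
      (p.1, ξ - (p.2.1 + p.2.2), p.2.1))).stronglyMeasurable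
  have hr : Integrable fun q : E × E => ‖F (ξ - (q.1 + q.2)) * G q.1 * K q.2‖ *
      w (ξ - (q.1 + q.2), q) := hξ
  have hb : ∀ b, ∀ s ∈ Icc (-1 : ℝ) 0, ∀ q : E × E,
      ‖T b s (ξ - (q.1 + q.2)) q.1‖ ≤ w (ξ - (q.1 + q.2), q) := fun b s hs q => by
    rw [hwe]
    refine (hC b s hs _ _).trans ?_
    gcongr
    exact hM b
  have h3 := (tv_integral (μ := (volume : Measure (E × E))) hz a j ξ hD.aestronglyMeasurable hSm hr hb).2
  have h4 : ∀ q : E × E, triInt (csymC z a j fun b s ξ η _ => T b s ξ η) x F G K (ξ - (q.1 + q.2), q) =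
      chr x ξ * (F (ξ - (q.1 + q.2)) * G q.1 * K q.2 *
        tv z a j ξ fun b s => T b s (ξ - (q.1 + q.2)) q.1) := fun q => by
    have e : ξ - (q.1 + q.2) + q.1 + q.2 = ξ := by abel
    simp only [triInt, csymC, tv, e]
    ring
  simp only [h4]
  rw [integral_const_mul, ← h3, mul_left_comm, ← tv_const_mul]
  congr 1
  refine tv_congr hz a j ξ fun b s hs => ?_
  have hi : Integrable fun q : E × E => F (ξ - (q.1 + q.2)) * G q.1 * K q.2 *
      T b s (ξ - (q.1 + q.2)) q.1 := by
    refine hr.mono' (hD.mul ((hSm b).comp_measurable measurable_prodMk_left)).aestronglyMeasurable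
      (Eventually.of_forall fun q => ?_)
    rw [norm_mul]
    exact mul_le_mul_of_nonneg_left (hb b s hs q) (norm_nonneg _)
  change _ = cv K (scv (T b s) F G) ξ
  rw [Measure.volume_eq_prod, integral_prod_symm _ hi, cv, pow_two, mul_assoc, ← integral_const_mul]
  congr 2
  funext η
  rw [scv, mul_left_comm (K η)]
  congr 1
  rw [← integral_const_mul]
  congr 1
  funext σ
  simp only
  rw [show ξ - (σ + η) = ξ - η - σ by abel]
  ring

end

end
end WaterWaves

namespace WaterWaves
open Filter Topology FourierTransform
open scoped NNReal
noncomputable section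

/-! ### The operators `T_z^j` on functions -/

/-- The operator `T_z^j`, applied to functions on the strip. -/
def SO (z : ℝ) (a : Fin 3) (j : Fin 4) (v : Fin 3 → ℝ → E → ℂ) (x : E) : ℂ :=
  ∑ b, (c0 * (∫ ξ, chr x ξ * (tsym0 z a j b * ft (v b z) ξ)) +
    ∫ s in Icc (-1 : ℝ) 0, c0 * ∫ ξ, chr x ξ * (tsym z a j b s ξ * ft (v b s) ξ))

/-- The functions on the strip to which the operators `T_z^j` apply. -/
def FA (v : Fin 3 → ℝ → E → ℂ) : Prop := ∀ b, ∃ X, Fam 1 (v b) X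

section

variable {z : ℝ} {v : Fin 3 → ℝ → E → ℂ} {X : Fin 3 → ℝ → E → ℂ}

lemma Fam.integrable_tsym {v X : ℝ → E → ℂ} (h : Fam 1 v X) (hz : z ∈ Icc (-1 : ℝ) 0) (a : Fin 3)
    (j : Fin 4) (b : Fin 3) (x : E) :
    Integrable (fun p : ℝ × E => chr x p.2 * (tsym z a j b p.1 p.2 * X p.1 p.2))
      ((volume.restrict (Icc (-1 : ℝ) 0)).prod volume) := by
  refine (h.integrable_prod.const_mul 2).mono' ?_ ?_
  · exact (((chr_continuous x).comp continuous_snd).stronglyMeasurable.mul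
      ((measurable_tsym z a j b).stronglyMeasurable.mul h.sm)).aestronglyMeasurable
  · filter_upwards [ae_strip volume] with p hp
    rw [norm_mul, norm_mul, norm_chr, one_mul, pow_one, ← mul_assoc]
    refine mul_le_mul_of_nonneg_right ((norm_tsym_le' hz a j b hp p.2).trans ?_) (norm_nonneg _)
    linarith [norm_nonneg p.2]

/-- The operators `T_z^j` on the Fourier side. -/
lemma so_eq (hv : ∀ b, Fam 1 (v b) (X b)) (hz : z ∈ Icc (-1 : ℝ) 0) (a : Fin 3) (j : Fin 4) (x : E) :
    Integrable (fun ξ => chr x ξ * TT z a j X ξ) ∧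
      SO z a j v x = c0 * ∫ ξ, chr x ξ * TT z a j X ξ := by
  have hae : ∀ b, ∀ s ∈ Icc (-1 : ℝ) 0, ft (v b s) =ᵐ[volume] X b s := fun b s hs =>
    ((hv b).ftw s hs).hasFT.ft_ae
  have i1 : ∀ b, Integrable fun ξ => chr x ξ * (tsym0 z a j b * X b z ξ) := fun b =>
    chr_integrable (((hv b).ftw z hz).hasFT.integrable.const_mul _) x
  have i2 := fun b => (hv b).integrable_tsym hz a j b x
  have e : ∀ ξ, chr x ξ * TT z a j X ξ = ∑ b, (chr x ξ * (tsym0 z a j b * X b z ξ) +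
      ∫ s in Icc (-1 : ℝ) 0, chr x ξ * (tsym z a j b s ξ * X b s ξ)) := fun ξ => by
    simp only [TT, tv, Finset.mul_sum, mul_add, integral_const_mul]
  have i3 : ∀ b, Integrable fun ξ => chr x ξ * (tsym0 z a j b * X b z ξ) +
      ∫ s in Icc (-1 : ℝ) 0, chr x ξ * (tsym z a j b s ξ * X b s ξ) := fun b =>
    (i1 b).add (i2 b).integral_prod_right
  simp only [e]
  refine ⟨integrable_finsetSum _ fun b _ => i3 b, ?_⟩
  rw [integral_finsetSum _ fun b _ => i3 b, SO, Finset.mul_sum]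
  refine Finset.sum_congr rfl fun b _ => ?_
  rw [integral_add (i1 b) (i2 b).integral_prod_right, mul_add,
    ← integral_integral_swap (f := fun s ξ => chr x ξ * (tsym z a j b s ξ * X b s ξ)) (i2 b)]
  congr 1
  · congr 1
    refine integral_congr_ae ?_
    filter_upwards [hae b z hz] with ξ h
    rw [h]
  · rw [← integral_const_mul]
    refine setIntegral_congr_fun measurableSet_Icc fun s hs => ?_
    refine congrArg (c0 * ·) (integral_congr_ae ?_)
    filter_upwards [hae b s hs] with ξ h
    rw [h]

lemma tv_sum (hz : z ∈ Icc (-1 : ℝ) 0) (a : Fin 3) (j : Fin 4) (ξ : E) {n : ℕ} (c : Fin n → ℂ)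
    {Y : Fin n → Fin 3 → ℝ → ℂ} (hY : ∀ i b, IntegrableOn (Y i b) (Icc (-1) 0)) :
    tv z a j ξ (fun b s => ∑ i, c i * Y i b s) = ∑ i, c i * tv z a j ξ (Y i) := by
  have e : ∀ b s, tsym z a j b s ξ * ∑ i, c i * Y i b s =
      ∑ i, c i * (tsym z a j b s ξ * Y i b s) := fun b s => by
    rw [Finset.mul_sum]
    exact Finset.sum_congr rfl fun i _ => by ring
  simp only [tv, e, Finset.mul_sum]
  rw [Finset.sum_comm]
  refine Finset.sum_congr rfl fun b _ => ?_
  rw [integral_finsetSum _ fun i _ => (integrableOn_tsym_mul hz a j b ξ (hY i b)).const_mul (c i),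
    ← Finset.sum_add_distrib]
  refine Finset.sum_congr rfl fun i _ => ?_
  rw [integral_const_mul]
  ring

lemma so_comb (hz : z ∈ Icc (-1 : ℝ) 0) (a : Fin 3) (j : Fin 4) (x : E) {n : ℕ} (c : Fin n → ℂ)
    {w : Fin n → Fin 3 → ℝ → E → ℂ} (hw : ∀ i, FA (w i))
    (h : ∀ b, ∀ s ∈ Icc (-1 : ℝ) 0, ∀ y, v b s y = ∑ i, c i * w i b s y) :
    SO z a j v x = ∑ i, c i * SO z a j (w i) x := by
  choose Y hY using hw
  have hv : ∀ b, Fam 1 (v b) fun s ξ => ∑ i, c i * Y i b s ξ := fun b =>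
    (fam_sum Finset.univ fun i _ => (hY i b).smul (c := fun _ => c i) continuous_const).congr_fun (h b)
  have hs := fun i => so_eq (hY i) hz a j x
  simp only [(so_eq hv hz a j x).2, (hs _).2]
  have e : ∀ᵐ ξ, chr x ξ * TT z a j (fun b s ξ => ∑ i, c i * Y i b s ξ) ξ =
      ∑ i, c i * (chr x ξ * TT z a j (Y i) ξ) := by
    have hi : ∀ᵐ ξ, ∀ i b, IntegrableOn (fun s => Y i b s ξ) (Icc (-1) 0) := by
      simp only [ae_all_iff]
      exact fun i b => (hY i b).ae_integrableOn
    filter_upwards [hi] with ξ hξ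
    unfold TT
    rw [tv_sum hz a j ξ c hξ, Finset.mul_sum]
    exact Finset.sum_congr rfl fun i _ => by ring
  rw [integral_congr_ae e, integral_finsetSum _ fun i _ => (hs i).1.const_mul (c i), Finset.mul_sum]
  refine Finset.sum_congr rfl fun i _ => ?_
  rw [integral_const_mul]
  ring

lemma bilin_eq {m : E → ℂ} (hm : Measurable m) {C : ℝ} (hC : ∀ ξ, ‖m ξ‖ ≤ C * (1 + ‖ξ‖))
    {f g : E → ℝ} (hf : RW f) (hg : RW g) (x : E) : bilin (fun ξ η => m (ξ + η)) f g x =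
      c0 * ∫ ξ, chr x ξ * (m ξ * ft (toC fun y => f y * g y) ξ) := by
  have hF := hf.ftw
  have hG := hg.ftw
  set F := ft (toC f)
  set G := ft (toC g)
  have hC0 : 0 ≤ C := by simpa using (norm_nonneg _).trans (hC 0)
  have hH : Integrable fun p : E × E => chr x (p.1 + p.2) * m (p.1 + p.2) * F p.1 * G p.2 := by
    refine ((Integrable.mul_prod hF.wi hG.wi).const_mul C).mono' ?_ (Eventually.of_forall fun p => ?_)
    · have e1 : Continuous fun p : E × E => chr x (p.1 + p.2) :=
        (chr_continuous x).comp (by fun_prop)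
      have e2 : Measurable fun p : E × E => m (p.1 + p.2) := hm.comp (by fun_prop)
      exact ((e1.aestronglyMeasurable.mul e2.aestronglyMeasurable).mul hF.aesm.comp_fst).mul
        hG.aesm.comp_snd
    · rw [norm_mul, norm_mul, norm_mul, norm_chr, one_mul]
      have h1 : 1 + ‖p.1 + p.2‖ ≤ (1 + ‖p.1‖) * (1 + ‖p.2‖) := by
        nlinarith [norm_add_le p.1 p.2, mul_nonneg (norm_nonneg p.1) (norm_nonneg p.2)]
      calc _ ≤ C * ((1 + ‖p.1‖) * (1 + ‖p.2‖)) * ‖F p.1‖ * ‖G p.2‖ := by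
            gcongr
            exact (hC _).trans (by gcongr)
        _ = _ := by ring
  have hT : ft (toC fun y => f y * g y) =ᵐ[volume] cv G F :=
    ((hG.mul hF).hasFT.congr_fun fun y => by
      rw [toC_mul]
      exact mul_comm _ _).ft_ae
  rw [bilin, show (((2 * Real.pi : ℝ) : ℂ)⁻¹ ^ 4) = c0 * c0 by rw [c0]; ring, mul_assoc]
  congr 1
  refine Eq.trans (congrArg (c0 * ·) (integral_shear (μ := (volume : Measure E)) measurable_id hH).2) ?_
  simp only [id, sub_add_cancel]
  rw [← integral_const_mul]
  refine integral_congr_ae ?_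
  filter_upwards [hT] with ξ h
  rw [h, cv]
  have e : ∀ η, chr x ξ * m ξ * F (ξ - η) * G η = chr x ξ * m ξ * (G η * F (ξ - η)) := fun η => by ring
  simp only [e, integral_const_mul]
  ring

lemma sum_stripBilin (hz : z ∈ Icc (-1 : ℝ) 0) (a : Fin 3) (j : Fin 4) {f : E → ℝ} (hf : RW f)
    {u : Fin 3 → E → ℝ → ℝ} (hu : ∀ b, ∀ s ∈ Icc (-1 : ℝ) 0, RW fun y => u b y s) (x : E) :
    ∑ b, stripBilin (fun _ _ => tsym0 z a j b) (fun s ξ η => tsym z a j b s (ξ + η)) f (u b) z x =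
      SO z a j (fun b s y => (f y : ℂ) * (u b y s : ℂ)) x := by
  refine Finset.sum_congr rfl fun b _ => ?_
  rw [stripBilin, intervalIntegral.integral_of_le (by norm_num), ← integral_Icc_eq_integral_Ioc]
  have e : ∀ s, (fun y => (f y : ℂ) * (u b y s : ℂ)) = toC fun y => f y * u b y s := fun s =>
    (toC_mul f fun y => u b y s).symm
  simp only [e]
  congr 1
  · refine bilin_eq (m := fun _ => tsym0 z a j b) measurable_const (C := 1) (fun ξ => ?_) hf (hu b z hz) x
    linarith [norm_tsym0_le hz a j b, norm_nonneg ξ]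
  · refine setIntegral_congr_fun measurableSet_Icc fun s hs => ?_
    have hm : Measurable fun ξ => tsym z a j b s ξ :=
      Measurable.comp (g := fun q : ℝ × E => tsym z a j b q.1 q.2) (f := fun ξ => (s, ξ))
        (measurable_tsym z a j b) (by fun_prop)
    refine bilin_eq hm (C := 2) (fun ξ => ?_) hf (hu b s hs) x
    linarith [norm_tsym_le' hz a j b hs ξ, norm_nonneg ξ]

lemma FTW.exists_stronglyMeasurable {k : ℕ} {f F : E → ℂ} (h : FTW k f F) :
    ∃ F', StronglyMeasurable F' ∧ FTW k f F' :=
  ⟨h.aesm.mk F, h.aesm.stronglyMeasurable_mk,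
    ⟨h.hasFT.congr_ae h.aesm.ae_eq_mk, h.wi.congr_ae h.aesm.ae_eq_mk⟩⟩

lemma FA.mul {k : E → ℝ} (hk : RW k) {q : Fin 3 → ℝ → E → ℂ} (hq : FA q) :
    FA fun b s y => (k y : ℂ) * q b s y := fun b => by
  obtain ⟨X, hX⟩ := hq b
  exact ⟨_, hX.mul hk.ftw⟩

variable {f g k : E → ℝ} {F G : E → ℂ} {T T' : Fin 3 → ℝ → E → E → ℂ}

lemma trilin_csymC (hz : z ∈ Icc (-1 : ℝ) 0) (a : Fin 3) (j : Fin 4)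
    (hT : ∀ b, StripSym (T b)) (hFm : StronglyMeasurable F) (hF : FTW 3 (toC f) F)
    (hGm : StronglyMeasurable G) (hG : FTW 3 (toC g) G) (hk : RW k) {q : Fin 3 → ℝ → E → ℂ}
    (hq : ∀ b, ∀ s ∈ Icc (-1 : ℝ) 0, ∀ y, q b s y = inv (fun s => scv (T b s) F G) s y) (x : E) :
    trilin (csymC z a j fun b s ξ η _ => T b s ξ η) f g k x =
      SO z a j (fun b s y => (k y : ℂ) * q b s y) x := by
  obtain ⟨K, hKm, hK⟩ := hk.ftw.exists_stronglyMeasurable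
  rw [trilin_eq hF.hasFT hG.hasFT hK.hasFT,
    integral_triInt_csymC hz a j hT hFm hF.wi hGm hG.wi hKm hK.wi]
  exact (so_eq (fun b => ((fam_scv (hT b) hFm hF.wi hGm hG.wi).congr_fun (hq b)).mul hK) hz a j x).2.symm

lemma trilin_csymC_add (hz : z ∈ Icc (-1 : ℝ) 0) (a : Fin 3) (j j' : Fin 4)
    (hT : ∀ b, StripSym (T b)) (hT' : ∀ b, StripSym (T' b)) (hFm : StronglyMeasurable F)
    (hF : FTW 3 (toC f) F) (hGm : StronglyMeasurable G) (hG : FTW 3 (toC g) G) (hk : RW k) (x : E) :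
    trilin (fun ξ₁ ξ₂ ξ₃ => csymC z a j (fun b s ξ η _ => T b s ξ η) ξ₁ ξ₂ ξ₃ +
        csymC z a j' (fun b s ξ η _ => T' b s ξ η) ξ₁ ξ₂ ξ₃) f g k x =
      trilin (csymC z a j fun b s ξ η _ => T b s ξ η) f g k x +
        trilin (csymC z a j' fun b s ξ η _ => T' b s ξ η) f g k x := by
  obtain ⟨K, hKm, hK⟩ := hk.ftw.exists_stronglyMeasurable
  rw [trilin_eq hF.hasFT hG.hasFT hK.hasFT, trilin_eq hF.hasFT hG.hasFT hK.hasFT,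
    trilin_eq hF.hasFT hG.hasFT hK.hasFT, ← mul_add,
    ← integral_add (integrable_triInt_csymC hz a j hT hFm hF.wi hGm hG.wi hKm hK.wi x)
      (integrable_triInt_csymC hz a j' hT' hFm hF.wi hGm hG.wi hKm hK.wi x)]
  congr 2
  funext p
  simp only [triInt]
  ring

lemma trilin_neg (c : E → E → E → ℂ) (f g k : E → ℝ) (x : E) :
    trilin (fun ξ₁ ξ₂ ξ₃ => -c ξ₁ ξ₂ ξ₃) f g k x = -trilin c f g k x := by
  simp only [trilin, mul_neg, neg_mul, integral_neg]

lemma trilin_zero (f g k : E → ℝ) (x : E) : trilin (fun _ _ _ => 0) f g k x = 0 := by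
  simp [trilin]

end

end
end WaterWaves

namespace WaterWaves
open Filter Topology FourierTransform
open scoped NNReal
noncomputable section

/-! ### The cubic fixed point equation -/

/-- The terms of the coefficients `h̃_j` that are linear in `h`. -/
def linH (h : E → ℝ) : Fin 4 → E → ℝ := ![fun y => 2 * h y, fun _ => 0, dx 0 h, dx 1 h]

lemma ftw_linH {h : E → ℝ} {F : E → ℂ} (hF : FTW 4 (toC h) F) (j : Fin 4) :
    FTW 1 (toC (linH h j)) fun ξ => lin j ξ * F ξ := by
  have h1 := hF.mono (by norm_num : 2 ≤ 4)
  fin_cases j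
  · refine ((hF.mono (by norm_num)).smul 2).congr_fun fun x => ?_
    change ((2 * h x : ℝ) : ℂ) = 2 * (h x : ℂ)
    push_cast
    rfl
  · have e : (fun ξ => lin 1 ξ * F ξ) = fun _ => 0 := by
      funext ξ
      simp [lin]
    change FTW 1 _ fun ξ => lin 1 ξ * F ξ
    rw [e]
    exact (ftw_zero 1).congr_fun fun x => Complex.ofReal_zero
  · exact h1.dx 0
  · exact h1.dx 1

section

variable {h ψ : E → ℝ} {Φ : ℝ → E → ℝ → ℝ} {z : ℝ} {F Ψ : E → ℂ}

lemma inv_scv_mul {m : E → ℂ} {k : E → ℝ} (hk : FTW 1 (toC k) fun ξ => m ξ * F ξ)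
    (hΨm : StronglyMeasurable Ψ) (hΨ : WI 4 Ψ) (b : Fin 3) {s : ℝ} (hs : s ∈ Icc (-1 : ℝ) 0) (y : E) :
    inv (fun s => scv (fun ξ η => m ξ * symA b s η) F Ψ) s y = k y * inv (lin1 Ψ b) s y := by
  have h1 := ((hk.mul (((fam_symA hΨm hΨ b).mono (by norm_num : 1 ≤ 3)).ftw s hs)).hasFT.eq y).symm
  rw [cv_eq_scv] at h1
  exact h1

lemma hTilde_sub (h1 : ∀ x, |h x| < 1) (y : E) :
    hTilde h 0 y - 2 * h y = h y * h y - 2 * h y * hTilde h 0 y - h y * hTilde h 0 y * h y ∧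
      hTilde h 1 y = hTilde h 2 y * dx 0 h y + hTilde h 3 y * dx 1 h y - hTilde h 1 y * h y ∧
      hTilde h 2 y - dx 0 h y = -(hTilde h 2 y * h y) ∧
      hTilde h 3 y - dx 1 h y = -(hTilde h 3 y * h y) := by
  have h0 := (one_add_pos h1 y).ne'
  simp only [hTilde, gradSq, Fin.sum_univ_two, Matrix.cons_val_zero, Matrix.cons_val_one,
    Matrix.cons_val]
  refine ⟨?_, ?_, ?_, ?_⟩ <;> field_simp <;> ring

/-- The cubic and higher order part of the gradient of the potential, in terms of the operators
`T_z^j`. -/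
theorem gradGeThree_eq (hh : MemH 6 h) (hψ : LambdaMemH 6 ψ) (h1 : ∀ x, |h x| < 1)
    (hΦ : ∀ τ ∈ Icc (-1 : ℝ) 1, IsPotential (fun x => τ * h x) (fun x => τ * ψ x) (Φ τ))
    (hFm : StronglyMeasurable F) (hF : FTW 4 (toC h) F) (hΨm : StronglyMeasurable Ψ)
    (hΨ : FTW 4 (toC ψ) Ψ) :
    ∃ u1 u2 : Fin 3 → ℝ → E → ℂ,
      FA u1 ∧ FA u2 ∧ FA (fun b s y => (gradGeThree Φ b y s : ℂ)) ∧
      (∀ b, ∀ s ∈ Icc (-1 : ℝ) 0, RW fun y => gradGeThree Φ b y s) ∧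
      (∀ b, ∀ s ∈ Icc (-1 : ℝ) 0, ∀ y, u1 b s y = inv (lin1 Ψ b) s y) ∧
      (∀ b, ∀ s ∈ Icc (-1 : ℝ) 0, ∀ y, u2 b s y = inv (fun s => scv (symB b s) F Ψ) s y) ∧
      ∀ z ∈ Icc (-1 : ℝ) 0, ∀ a x, (gradGeThree Φ a x z : ℂ) =
        ∑ j, (SO z a j (fun b s y => (hTilde h j y : ℂ) *
            (gradGeThree Φ b y s + u1 b s y + u2 b s y)) x -
          SO z a j (fun b s y => (linH h j y : ℂ) * u1 b s y) x) := by
  have hF3 := hF.mono (by norm_num : 3 ≤ 4)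
  have hΨ3 := hΨ.mono (by norm_num : 3 ≤ 4)
  have hT := fun s (hs : s ∈ Icc (-1 : ℝ) 0) b y => taylor_gradXZ hh hψ h1 hΦ hFm hF hΨm hΨ hs b y
  have hφ : IsPotential h ψ (Φ 1) := by simpa using hΦ 1 (by norm_num)
  choose U hU using fun b => hφ.exists_fam b
  have f1 : ∀ b, Fam 1 (inv (lin1 Ψ b)) (lin1 Ψ b) := fun b => (fam_symA hΨm hΨ.wi b).mono (by norm_num)
  have f2 := fun b => fam_scv (stripSym_B b) hFm hF3.wi hΨm hΨ3.wi
  have eq2 : ∀ b, ∀ s ∈ Icc (-1 : ℝ) 0, ∀ y, inv (quad F Ψ b) s y =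
      inv (fun s => scv (symB b s) F Ψ) s y := fun b s hs y => by
    refine congrArg (c0 * ·) (integral_congr_ae ?_)
    filter_upwards [quad_eq_scv hFm hF3.wi hΨm hΨ3.wi hs b] with ξ e
    rw [e]
  have eW : ∀ b, ∀ s ∈ Icc (-1 : ℝ) 0, ∀ y, (gradGeThree Φ b y s : ℂ) =
      toC (fun x => gradXZ (Φ 1) b x s) y - inv (lin1 Ψ b) s y
        - inv (fun s => scv (symB b s) F Ψ) s y := fun b s hs y => by
    obtain ⟨-, t0, t1, t2⟩ := hT s hs b y
    rw [gradGeThree, ← eq2 b s hs y, ← t1, ← t2]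
    simp only [Finset.sum_range_succ, Finset.sum_range_zero, t0, toC_apply]
    push_cast
    ring
  have fW := fun b => ((((hU b).mono (by norm_num : 1 ≤ 3)).sub (f1 b)).sub (f2 b)).congr_fun
    (w := fun s y => (gradGeThree Φ b y s : ℂ)) (eW b)
  refine ⟨fun b => inv (lin1 Ψ b), fun b => inv fun s => scv (symB b s) F Ψ, fun b => ⟨_, f1 b⟩,
    fun b => ⟨_, f2 b⟩, fun b => ⟨_, fW b⟩, fun b s hs => ⟨_, (fW b).ftw s hs⟩, fun _ _ _ _ => rfl,
    fun _ _ _ _ => rfl, fun z hz a x => ?_⟩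
  have hH := fun j => (rw_hTilde hh h1 j).ftw
  have k1 : ∀ j, Integrable (fun ξ => chr x ξ * TT z a j
        (fun b s => cv (ft (toC (hTilde h j))) (U b s)) ξ) ∧
      SO z a j (fun b s y => (hTilde h j y : ℂ) * (gradGeThree Φ b y s + inv (lin1 Ψ b) s y
        + inv (fun s => scv (symB b s) F Ψ) s y)) x = c0 * ∫ ξ, chr x ξ * TT z a j
        (fun b s => cv (ft (toC (hTilde h j))) (U b s)) ξ := fun j => by
    refine so_eq (fun b => (fam_mul_hTilde hU hH j b).congr_fun fun s hs y => ?_) hz a j x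
    rw [eW b s hs y, toC_mul]
    simp only [toC_apply]
    ring
  have k2 : ∀ j, Integrable (fun ξ => chr x ξ * TT z a j
        (fun b s => cv (fun η => lin j η * F η) (lin1 Ψ b s)) ξ) ∧
      SO z a j (fun b s y => (linH h j y : ℂ) * inv (lin1 Ψ b) s y) x = c0 * ∫ ξ, chr x ξ * TT z a j
        (fun b s => cv (fun η => lin j η * F η) (lin1 Ψ b s)) ξ := fun j =>
    so_eq (fun b => (f1 b).mul (ftw_linH hF j)) hz a j x
  have i1 := ((f1 a).ftw z hz).hasFT
  have e1 : toC (fun y => gradXZ (Φ 1) a y z) x = inv (lin1 Ψ a) z x + ∑ j, c0 * ∫ ξ, chr x ξ *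
      TT z a j (fun b s => cv (ft (toC (hTilde h j))) (U b s)) ξ := by
    rw [← Finset.mul_sum, ← integral_finsetSum _ fun j _ => (k1 j).1, inv, ← mul_add,
      ← integral_add (chr_integrable i1.integrable x) (integrable_finsetSum _ fun j _ => (k1 j).1),
      (hU a).eq hz x]
    congr 1
    refine integral_congr_ae ?_
    filter_upwards [hφ.fixed_point hh h1 hψ hU hH hz a, hΨ.hasFT.ft_ae] with ξ g1 g2
    rw [g1, g2, mul_add, Finset.mul_sum]
    rfl
  have e2 : inv (quad F Ψ a) z x = ∑ j, c0 * ∫ ξ, chr x ξ *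
      TT z a j (fun b s => cv (fun η => lin j η * F η) (lin1 Ψ b s)) ξ := by
    rw [← Finset.mul_sum, ← integral_finsetSum _ fun j _ => (k2 j).1, inv]
    simp only [quad, Finset.mul_sum]
  rw [eW a z hz x, e1, ← eq2 a z hz x, e2]
  simp only [(k1 _).2, (k2 _).2, Finset.sum_sub_distrib]
  ring

end

end
end WaterWaves

namespace WaterWaves
open Filter Topology FourierTransform
open scoped NNReal
noncomputable section

variable {h ψ : E → ℝ} {Φ : ℝ → E → ℝ → ℝ} {z : ℝ}

theorem cubic_fixed_point (hh : MemH 6 h) (hψ : LambdaMemH 6 ψ) (h1 : ∀ x, |h x| < 1)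
    (hΦ : ∀ τ ∈ Icc (-1 : ℝ) 1, IsPotential (fun x => τ * h x) (fun x => τ * ψ x) (Φ τ))
    (hz : z ∈ Icc (-1 : ℝ) 0) (x : E) (a : Fin 3) :
    ContDiffAt ℝ 2 (fun τ => gradXZ (Φ τ) a x z) 0 ∧
      (gradGeThree Φ a x z : ℂ) = trilin (csym0 z a) h ψ h x
        + ∑ j, (trilin (csym z a j) h ψ (hTilde h j) x
            + trilin (csym' z a j) h ψ (fun y => h y * hTilde h j y) x
            + ∑ b, stripBilin (fun _ _ => tsym0 z a j b) (fun s ξ η => tsym z a j b s (ξ + η))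
                (hTilde h j) (gradGeThree Φ b) z x) := by
  obtain ⟨F, hFm, hF⟩ := hh.ftw4.exists_stronglyMeasurable
  obtain ⟨Ψ, hΨm, hΨ⟩ := hψ.ftw.exists_stronglyMeasurable
  refine ⟨(taylor_gradXZ hh hψ h1 hΦ hFm hF hΨm hΨ hz a x).1, ?_⟩
  obtain ⟨u1, u2, f1, f2, fW, rW, e1, e2, key⟩ := gradGeThree_eq hh hψ h1 hΦ hFm hF hΨm hΨ
  have hF3 := hF.mono (by norm_num : 3 ≤ 4)
  have hΨ3 := hΨ.mono (by norm_num : 3 ≤ 4)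
  have rh := hh.rw
  have rd := hh.rw_dx
  have rH := fun j => rw_hTilde hh h1 j
  have qA : ∀ b, ∀ s ∈ Icc (-1 : ℝ) 0, ∀ y, (h y : ℂ) * u1 b s y =
      inv (fun s => scv (fun _ η => symA b s η) F Ψ) s y := fun b s hs y => by
    have := inv_scv_mul (m := fun _ => 1) (k := h) (F := F)
      (by simpa only [one_mul] using hF.mono (by norm_num : 1 ≤ 4)) hΨm hΨ.wi b hs y
    simp only [one_mul] at this
    rw [this, e1 b s hs y]
  have qdA : ∀ (l : Fin 2) b, ∀ s ∈ Icc (-1 : ℝ) 0, ∀ y, (dx l h y : ℂ) * u1 b s y =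
      inv (fun s => scv (fun ξ η => Complex.I * ξ l * symA b s η) F Ψ) s y := fun l b s hs y => by
    rw [inv_scv_mul (k := dx l h) ((hF.mono (by norm_num : 2 ≤ 4)).dx l) hΨm hΨ.wi b hs y, e1 b s hs y]
  have sD : ∀ (m : ℂ) b, StripSym fun s ξ η => symB b s ξ η + -m * symA b s η := fun m b =>
    (stripSym_B b).add ((stripSym_A b).smul (-m))
  have qD : ∀ (m : ℂ) b, ∀ s ∈ Icc (-1 : ℝ) 0, ∀ y, u2 b s y + -m * ((h y : ℂ) * u1 b s y) =
      inv (fun s => scv (fun ξ η => symB b s ξ η + -m * symA b s η) F Ψ) s y := fun m b s hs y => by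
    rw [inv_scv_add_smul (stripSym_B b) (stripSym_A b) (-m) hFm hF3.wi hΨm hΨ3.wi hs y, e2 b s hs y,
      qA b s hs y]
  have eD : ∀ m : ℂ, symD m = fun b s ξ η _ => symB b s ξ η + -m * symA b s η := fun m => by
    funext b s ξ η _
    rw [symD]
    ring
  have fD : ∀ m : ℂ, FA fun b s y => u2 b s y + -m * ((h y : ℂ) * u1 b s y) := fun m b =>
    ⟨_, (fam_scv (sD m b) hFm hF3.wi hΨm hΨ3.wi).congr_fun (qD m b)⟩
  have tA : ∀ {k : E → ℝ}, RW k → trilin (csymC z a 0 symA3) h ψ k x =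
      SO z a 0 (fun b s y => (k y : ℂ) * ((h y : ℂ) * u1 b s y)) x := fun hk =>
    trilin_csymC hz a 0 (fun b => stripSym_A b) hFm hF3 hΨm hΨ3 hk qA x
  have tD : ∀ (m : ℂ) (j : Fin 4), trilin (csymC z a j (symD m)) h ψ (hTilde h j) x =
      SO z a j (fun b s y => (hTilde h j y : ℂ) * (u2 b s y + -m * ((h y : ℂ) * u1 b s y))) x :=
    fun m j => by
      rw [eD]
      exact trilin_csymC hz a j (sD m) hFm hF3 hΨm hΨ3 (rH j) (qD m) x
  have tdA : ∀ (l : Fin 2) (j : Fin 4), trilin (csymC z a 1 (symDA l)) h ψ (hTilde h j) x =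
      SO z a 1 (fun b s y => (hTilde h j y : ℂ) * ((dx l h y : ℂ) * u1 b s y)) x := fun l j =>
    trilin_csymC hz a 1 (fun b => stripSym_dA l b) hFm hF3 hΨm hΨ3 (rH j) (qdA l) x
  have tadd : ∀ (l : Fin 2) (j : Fin 4), trilin (fun ξ₁ ξ₂ ξ₃ => csymC z a j (symD 1) ξ₁ ξ₂ ξ₃ +
      csymC z a 1 (symDA l) ξ₁ ξ₂ ξ₃) h ψ (hTilde h j) x =
      trilin (csymC z a j (symD 1)) h ψ (hTilde h j) x +
        trilin (csymC z a 1 (symDA l)) h ψ (hTilde h j) x := fun l j => by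
    rw [eD]
    exact trilin_csymC_add hz a j 1 (sD 1) (fun b => stripSym_dA l b) hFm hF3 hΨm hΨ3 (rH j) x
  have hW := fun j => sum_stripBilin hz a j (rH j) (u := gradGeThree Φ) rW x
  have alg := hTilde_sub h1
  have fu := fun j => (FA.mul (rH j) fW)
  have fq := fun (m : ℂ) j => FA.mul (rH j) (fD m)
  have fh : FA fun b s y => (h y : ℂ) * u1 b s y := f1.mul rh
  have fd := fun (l : Fin 2) (j : Fin 4) => FA.mul (rH j) (f1.mul (rd l))
  have fl := fun j => FA.mul (k := linH h j) ⟨_, ftw_linH hF j⟩ f1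
  have rhH : RW fun y => h y * hTilde h 0 y := rh.mul (rH 0)
  have k0 := so_comb hz a 0 x ![1, 1, 1, -1, 1] (w := ![_, _, _, _, _])
    (v := fun b s y => (hTilde h 0 y : ℂ) * (gradGeThree Φ b y s + u1 b s y + u2 b s y))
    (Fin.forall_fin_succ.2 ⟨fu 0, Fin.forall_fin_succ.2 ⟨fq 2 0, Fin.forall_fin_succ.2 ⟨fh.mul rh,
      Fin.forall_fin_succ.2 ⟨fh.mul rhH, Fin.forall_fin_one.2 (fl 0)⟩⟩⟩⟩) fun b s hs y => by
      have := congrArg (fun t : ℝ => (t : ℂ)) (alg y).1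
      push_cast at this
      simp [Fin.sum_univ_succ, linH]
      linear_combination u1 b s y * this
  have k1 := so_comb hz a 1 x ![1, 1, 1, 1, 1] (w := ![_, _, _, _, _])
    (v := fun b s y => (hTilde h 1 y : ℂ) * (gradGeThree Φ b y s + u1 b s y + u2 b s y))
    (Fin.forall_fin_succ.2 ⟨fu 1, Fin.forall_fin_succ.2 ⟨fq 1 1, Fin.forall_fin_succ.2 ⟨fd 0 2,
      Fin.forall_fin_succ.2 ⟨fd 1 3, Fin.forall_fin_one.2 (fl 1)⟩⟩⟩⟩) fun b s hs y => by
      have := congrArg (fun t : ℝ => (t : ℂ)) (alg y).2.1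
      push_cast at this
      simp [Fin.sum_univ_succ, linH]
      linear_combination u1 b s y * this
  have k2 := so_comb hz a 2 x ![1, 1, 1] (w := ![_, _, _])
    (v := fun b s y => (hTilde h 2 y : ℂ) * (gradGeThree Φ b y s + u1 b s y + u2 b s y))
    (Fin.forall_fin_succ.2 ⟨fu 2, Fin.forall_fin_succ.2 ⟨fq 1 2, Fin.forall_fin_one.2 (fl 2)⟩⟩)
    fun b s hs y => by
      have := congrArg (fun t : ℝ => (t : ℂ)) (alg y).2.2.1
      push_cast at this
      simp [Fin.sum_univ_succ, linH]
      linear_combination u1 b s y * this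
  have k3 := so_comb hz a 3 x ![1, 1, 1] (w := ![_, _, _])
    (v := fun b s y => (hTilde h 3 y : ℂ) * (gradGeThree Φ b y s + u1 b s y + u2 b s y))
    (Fin.forall_fin_succ.2 ⟨fu 3, Fin.forall_fin_succ.2 ⟨fq 1 3, Fin.forall_fin_one.2 (fl 3)⟩⟩)
    fun b s hs y => by
      have := congrArg (fun t : ℝ => (t : ℂ)) (alg y).2.2.2
      push_cast at this
      simp [Fin.sum_univ_succ, linH]
      linear_combination u1 b s y * this
  have s0 : trilin (csym z a 0) h ψ (hTilde h 0) x = _ := tD 2 0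
  have s1 : trilin (csym z a 1) h ψ (hTilde h 1) x = _ := tD 1 1
  have s2 : trilin (csym z a 2) h ψ (hTilde h 2) x = _ := tadd 0 2
  have s3 : trilin (csym z a 3) h ψ (hTilde h 3) x = _ := tadd 1 3
  have s0' : trilin (csym' z a 0) h ψ (fun y => h y * hTilde h 0 y) x = _ :=
    (trilin_neg _ _ _ _ x).trans (congrArg Neg.neg (tA rhH))
  have s1' : trilin (csym' z a 1) h ψ (fun y => h y * hTilde h 1 y) x = 0 := trilin_zero _ _ _ x
  have s2' : trilin (csym' z a 2) h ψ (fun y => h y * hTilde h 2 y) x = 0 := trilin_zero _ _ _ x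
  have s3' : trilin (csym' z a 3) h ψ (fun y => h y * hTilde h 3 y) x = 0 := trilin_zero _ _ _ x
  rw [key z hz a x, csym0, tA rh]
  simp only [hW, Fin.sum_univ_four, s0, s1, s2, s3, s0', s1', s2', s3', tD, tdA, k0, k1, k2, k3]
  simp only [Fin.sum_univ_succ, Finset.univ_eq_empty, Finset.sum_empty, Matrix.cons_val_zero,
    Matrix.cons_val_succ]
  ring

end
end WaterWaves

theorem mainTheorem6 :
    ∃ (c₀ : ℝ → Fin 3 → WaterWaves.E → WaterWaves.E → WaterWaves.E → ℂ)
      (c c' : ℝ → Fin 3 → Fin 4 → WaterWaves.E → WaterWaves.E → WaterWaves.E → ℂ)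
      (t₀ : ℝ → Fin 3 → Fin 4 → Fin 3 → WaterWaves.E → WaterWaves.E → ℂ)
      (t : ℝ → Fin 3 → Fin 4 → Fin 3 → ℝ → WaterWaves.E → WaterWaves.E → ℂ),
      -- the kernel symbols depend measurably on `s`
      (∀ z ∈ Icc (-1 : ℝ) 0, ∀ a j b,
        Measurable fun p : ℝ × WaterWaves.E × WaterWaves.E => t z a j b p.1 p.2.1 p.2.2) ∧
      -- the symbol bounds
      (∀ χ : ℝ → ℝ, WaterWaves.IsCutoff χ → ∃ K : ℝ,
        (∀ z ∈ Icc (-1 : ℝ) 0, ∀ (a : Fin 3) (k k₁ k₂ k₃ : ℤ),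
          WaterWaves.sNorm3 χ k k₁ k₂ k₃ (c₀ z a)
            + ∑ j, (WaterWaves.sNorm3 χ k k₁ k₂ k₃ (c z a j)
                + WaterWaves.sNorm3 χ k k₁ k₂ k₃ (c' z a j))
            ≤ ENNReal.ofReal (K * 2 ^ (3 * max (max k₁ (max k₂ k₃)) 0))) ∧
        (∀ z ∈ Icc (-1 : ℝ) 0, ∀ s ∈ Icc (-1 : ℝ) 0, ∀ (a : Fin 3) (k k₁ k₂ : ℤ),
          ∑ j, ∑ b, (WaterWaves.sNorm2 χ k k₁ k₂ (t₀ z a j b)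
              + WaterWaves.sNorm2 χ k k₁ k₂ (t z a j b s))
            ≤ ENNReal.ofReal (K * 2 ^ (3 * max (max k₁ k₂) 0)))) ∧
      -- the fixed point identity
      (∀ (h ψ : WaterWaves.E → ℝ), (∀ x, |h x| < 1) →
        WaterWaves.MemH 6 h → WaterWaves.LambdaMemH 6 ψ →
        ∀ Φ : ℝ → WaterWaves.E → ℝ → ℝ,
        (∀ τ ∈ Icc (-1 : ℝ) 1,
          WaterWaves.IsPotential (fun x => τ * h x) (fun x => τ * ψ x) (Φ τ)) →
        ∀ z ∈ Icc (-1 : ℝ) 0, ∀ (x : WaterWaves.E) (a : Fin 3),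
          ContDiffAt ℝ 2 (fun τ => WaterWaves.gradXZ (Φ τ) a x z) 0 ∧
          (WaterWaves.gradGeThree Φ a x z : ℂ) =
            WaterWaves.trilin (c₀ z a) h ψ h x
            + ∑ j, (WaterWaves.trilin (c z a j) h ψ (WaterWaves.hTilde h j) x
                + WaterWaves.trilin (c' z a j) h ψ (fun y => h y * WaterWaves.hTilde h j y) x
                + ∑ b, WaterWaves.stripBilin (t₀ z a j b) (t z a j b) (WaterWaves.hTilde h j)
                    (WaterWaves.gradGeThree Φ b) z x)) := by
  open WaterWaves in
  refine ⟨csym0, csym, csym', fun z a j b _ _ => tsym0 z a j b,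
    fun z a j b s ξ η => tsym z a j b s (ξ + η), fun z _ a j b => ?_, fun χ hχ => ?_,
    fun h ψ h1 hh hψ Φ hΦ z hz x a => cubic_fixed_point hh hψ h1 hΦ hz x a⟩
  · exact Measurable.comp (g := fun q : ℝ × WaterWaves.E => WaterWaves.tsym z a j b q.1 q.2)
      (f := fun p : ℝ × WaterWaves.E × WaterWaves.E => (p.1, p.2.1 + p.2.2))
      (WaterWaves.measurable_tsym z a j b) (by fun_prop)
  · obtain ⟨K, hK⟩ := WaterWaves.symbol_bounds3 hχ
    obtain ⟨K', hK'⟩ := WaterWaves.symbol_bounds2 hχ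
    refine ⟨(max K K' : NNReal), fun z hz a k k₁ k₂ k₃ => ?_, fun z hz s hs a k k₁ k₂ => ?_⟩
    · rw [← WaterWaves.coe_Ysz_pow]
      refine (hK z hz a k k₁ k₂ k₃).trans (ENNReal.coe_le_coe.2 ?_)
      gcongr
      exact le_max_left _ _
    · rw [← WaterWaves.coe_Ysz_pow]
      refine (hK' z hz s hs a k k₁ k₂).trans (ENNReal.coe_le_coe.2 ?_)
      gcongr
      exact le_max_right _ _
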